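/- Let $p\le q\le r$ be positive integers, and let $D$ be the standard diagram of the pretzel link $P(-p,q,r)$: three vertical columns of $p$, $q$, $r$ half twists, in this cyclic order from left to right, where the top right end of each column is joined to the top left end of the next one by a top arc, and likewise at the bottom (cyclically). In the columns of $q$ and $r$ the strand going from bottom left to top right is the upper one at each crossing (so that a crossing there is positive if the two strands of the column are parallel), and in the column of $p$ it is the lower one. Put the basepoint on the top arc between the columns of $q$ and $r$. Fix any orientation of the link, and let $n_+$, $n_-$ be the numbers of positive and negative crossings of $D$. Let $H_\delta$ be the reduced Khovanov homology over $\mathbb Z$ (with the standard, "even" signs) of $P(-p,q,r)$ in grading $\delta=\frac{\mathsf q}{2}-\mathsf h$, where $\mathsf h$ is the homological and $\mathsf q$ the quantum grading, normalized such that the reduced homology of the unknot is $\mathbb Z$ in $\mathsf h=\mathsf q=0$. Put $\delta_1=\frac{-p+n_+}{2}$ and $\delta_0=\frac{-2-p+n_+}{2}$. Then $H_\delta=0$ for $\delta\ne\delta_0,\delta_1$, and: - if $p$ is even and $p+1\le q$, then $H_{\delta_1}\cong\mathbb Z^{p^2}$ and $H_{\delta_0}\cong\mathbb Z^{(q-p)(r-p)}$;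 - if $p$ is odd, $p+1\le q$ and $p+2\le r$, then $H_{\delta_1}\cong\mathbb Z^{p^2-1}$ and $H_{\delta_0}\cong\mathbb Z^{(q-p)(r-p)-1}$; - if $p$ is odd and $q=r=p+1$, then $H_{\delta_1}\cong\mathbb Z^{p^2}$ and $H_{\delta_0}\cong\mathbb Z$; - if $p$ is even, $q=p$ and $r>p$, then $H_{\delta_1}\cong\mathbb Z^{p^2+r-p}$ and $H_{\delta_0}\cong\mathbb Z^{r-p}$; - if $p$ is even and $p=q=r$, then $H_{\delta_1}\cong\mathbb Z^{p^2+1}$ and $H_{\delta_0}\cong\mathbb Z$; - if $p$ is odd and $q=p$, then $H_{\delta_1}\cong\mathbb Z^{p^2}$ and $H_{\delta_0}=0$. In particular the reduced Khovanov homology is free. The numbers $n_\pm$ are as follows. Reverse the orientation of the whole link, if necessary, such that the top arc between the columns of $q$ and $r$ runs from $q$ to $r$. Write $+$ or $-$ in the first place according to whether or not the top arc between the columns of $p$ and $r$ runs from $p$ to $r$, and in the second place according to whether or not the top arc between the columns of $p$ and $q$ runs from $p$ to $q$. Then $(n_+,n_-)$ is $(r,p+q)$ for $++$, $(p+q+r,0)$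 for $+-$, $(p,q+r)$ for $-+$, and $(q,p+r)$ for $--$. -/

import Mathlib

/-!
Reduced Khovanov homology of a link diagram given by a planar diagram code,
with integer coefficients and the standard ("even") signs, and the standard
diagrams of 3-strand pretzel links.
-/

/-- A planar diagram code with crossings `χ` and edges `ε`. The four ends at a crossing are listed
counterclockwise, starting from an end of the lower strand: the ends `0, 2` belong to the lower
strand, the ends `1, 3` to the upper one. In the code of a diagram every edge occurs twice. -/
abbrev PDCode (χ ε : Type) : Type := χ → Fin 4 → ε

namespace PDCode

variable {χ ε : Type}

/-- An orientation of the link: for each end at each crossing, whether the edge points into the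
crossing there. Strands run straight through the crossings, and an edge that points into a crossing
at one of its ends points out of a crossing at the other. -/
structure Orientation (D : PDCode χ ε) where
  inward : χ → Fin 4 → Bool
  lower : ∀ c, inward c 0 ≠ inward c 2
  upper : ∀ c, inward c 1 ≠ inward c 3
  edge : ∀ c i c' i', D c i = D c' i' → (c, i) ≠ (c', i') → inward c i ≠ inward c' i'

/-- A crossing is positive if the upper strand has to be turned counterclockwise (by less than a
half turn) to get the direction of the lower one, that is, if the ends `0, 3` are both incoming or
both outgoing. -/
def Orientation.IsPositive {D : PDCode χ ε} (o : D.Orientation) (c : χ) : Prop :=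
  o.inward c 0 = o.inward c 3

/-- The number `n₊` of positive crossings. -/
noncomputable def Orientation.nPlus {D : PDCode χ ε} (o : D.Orientation) : ℕ :=
  {c | o.IsPositive c}.ncard

/-- The number `n₋` of negative crossings. -/
noncomputable def Orientation.nMinus {D : PDCode χ ε} (o : D.Orientation) : ℕ :=
  {c | ¬ o.IsPositive c}.ncard

/-- Two edges are joined at some crossing in the resolution `v`: the `0`-smoothing joins the ends
`0, 1` and the ends `2, 3`, the `1`-smoothing joins the ends `0, 3` and the ends `1, 2`. -/
def Joined (D : PDCode χ ε) (v : χ → Bool) (e f : ε) : Prop :=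
  ∃ c, (v c = false ∧ (e = D c 0 ∧ f = D c 1 ∨ e = D c 2 ∧ f = D c 3)) ∨
    (v c = true ∧ (e = D c 0 ∧ f = D c 3 ∨ e = D c 1 ∧ f = D c 2))

/-- The circles of the resolution `v`. -/
def Circle (D : PDCode χ ε) (v : χ → Bool) : Type :=
  Quotient (Relation.EqvGen.setoid (D.Joined v))

/-- The circle of the resolution `v` that contains the edge `e`. -/
def circle (D : PDCode χ ε) (v : χ → Bool) (e : ε) : D.Circle v :=
  Quotient.mk (Relation.EqvGen.setoid (D.Joined v)) e

instance (D : PDCode χ ε) (v : χ → Bool) [Finite ε] : Finite (D.Circle v) :=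
  inferInstanceAs (Finite (Quotient _))

/-- Generators of the Khovanov complex: a resolution `v` with an exponent `0` or `1` on each of its
circles. The pair `(v, x)` stands for the basis element `⨂ X ^ (x C)`, over the circles `C`, of the
tensor power of `ℤ[X] / (X ^ 2)` at the vertex `v` of the cube of resolutions. -/
def State (D : PDCode χ ε) : Type := Σ v : χ → Bool, D.Circle v → Fin 2

instance (D : PDCode χ ε) [Finite χ] [Finite ε] : Finite D.State :=
  inferInstanceAs (Finite (Σ v : χ → Bool, D.Circle v → Fin 2))

/-- The state `t` occurs in the value at `s` of the edge map of the cube that switches the crossing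
`c` from the `0`- to the `1`-smoothing. Circles that do not meet `c` keep their exponents. If
two circles merge at `c`, the map is the product `X ^ a ⊗ X ^ b ↦ X ^ (a + b)`; if a circle is split
at `c`, it is the coproduct `1 ↦ X ⊗ 1 + 1 ⊗ X`, `X ↦ X ⊗ X`. -/
def Incident (D : PDCode χ ε) (c : χ) (s t : D.State) : Prop :=
  s.1 c = false ∧ t.1 c = true ∧ (∀ c', c' ≠ c → s.1 c' = t.1 c') ∧
    (∀ e, D.circle s.1 e ≠ D.circle s.1 (D c 0) → D.circle s.1 e ≠ D.circle s.1 (D c 2) →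
      s.2 (D.circle s.1 e) = t.2 (D.circle t.1 e)) ∧
    (D.circle s.1 (D c 0) ≠ D.circle s.1 (D c 2) →
      (t.2 (D.circle t.1 (D c 0)) : ℕ) =
        s.2 (D.circle s.1 (D c 0)) + s.2 (D.circle s.1 (D c 2))) ∧
    (D.circle s.1 (D c 0) = D.circle s.1 (D c 2) →
      (t.2 (D.circle t.1 (D c 0)) : ℕ) + t.2 (D.circle t.1 (D c 2)) =
        s.2 (D.circle s.1 (D c 0)) + 1)

open Classical in
/-- The coefficient of `t` in the differential of `s`: the edge map at the crossing `c` has the sign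
`(-1) ^ k`, where `k` is the number of crossings before `c` with the `1`-smoothing. -/
noncomputable def coeff (D : PDCode χ ε) [Fintype χ] [LinearOrder χ] (s t : D.State) : ℤ :=
  ∑ c, if D.Incident c s t then (-1) ^ {c' | c' < c ∧ s.1 c' = true}.ncard else 0

/-- Homological grading of a generator. -/
noncomputable def hGrading {D : PDCode χ ε} (o : D.Orientation) (s : D.State) : ℤ :=
  {c | s.1 c = true}.ncard - o.nMinus

/-- Quantum grading of a generator of the reduced complex. A circle contributes `1` or `-1`,
according to its exponent being `0` or `1`, except for the circle with the basepoint, which has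
exponent `0` and contributes `0`. -/
noncomputable def qGrading {D : PDCode χ ε} (o : D.Orientation) (s : D.State) : ℤ :=
  ((∑ᶠ C, (1 - 2 * ((s.2 C : ℕ) : ℤ))) - 1) + {c | s.1 c = true}.ncard + o.nPlus - 2 * o.nMinus

/-- The `δ`-grading `q / 2 - h`. -/
noncomputable def deltaGrading {D : PDCode χ ε} (o : D.Orientation) (s : D.State) : ℚ :=
  (qGrading o s : ℚ) / 2 - hGrading o s

/-- Generators in grading `δ` of the reduced complex with basepoint on the edge `b`. The reduced
complex is the quotient of the Khovanov complex by the states with exponent `1` on the circle of the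
basepoint; its basis consists of the states with exponent `0` there. -/
def ReducedState {D : PDCode χ ε} (o : D.Orientation) (b : ε) (δ : ℚ) : Type :=
  {s : D.State // s.2 (D.circle s.1 b) = 0 ∧ deltaGrading o s = δ}

instance {D : PDCode χ ε} (o : D.Orientation) (b : ε) (δ : ℚ) [Finite χ] [Finite ε] :
    Finite (ReducedState o b δ) :=
  inferInstanceAs (Finite {s : D.State // s.2 (D.circle s.1 b) = 0 ∧ deltaGrading o s = δ})

noncomputable instance {D : PDCode χ ε} (o : D.Orientation) (b : ε) (δ : ℚ)
    [Finite χ] [Finite ε] : Fintype (ReducedState o b δ) := Fintype.ofFinite _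

/-- The part of the differential of the reduced complex from grading `δ` to grading `δ'`; a chain is
given by its coefficients. The differential preserves the quantum grading and raises the homological
one by `1`, so this is all of the differential on grading `δ` for `δ' = δ - 1`. -/
noncomputable def differential {D : PDCode χ ε} [Fintype χ] [LinearOrder χ] [Finite ε]
    (o : D.Orientation) (b : ε) (δ δ' : ℚ) :
    (ReducedState o b δ → ℤ) →ₗ[ℤ] (ReducedState o b δ' → ℤ) :=
  Matrix.mulVecLin (Matrix.of fun t s => D.coeff s.1 t.1)

/-- The reduced Khovanov homology over `ℤ` in `δ`-grading `δ`: cycles modulo boundaries. -/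
abbrev ReducedKh {D : PDCode χ ε} [Fintype χ] [LinearOrder χ] [Finite ε]
    (o : D.Orientation) (b : ε) (δ : ℚ) : Type :=
  LinearMap.ker (differential o b δ (δ - 1)) ⧸
    (LinearMap.range (differential o b (δ + 1) δ)).submoduleOf
      (LinearMap.ker (differential o b δ (δ - 1)))

/-- The reduced Khovanov homology is `ℤ ^ m₁` in grading `δ₁`, is `ℤ ^ m₀` in grading `δ₀`,
and is `0` in all other gradings. -/
def ReducedKhIs {D : PDCode χ ε} [Fintype χ] [LinearOrder χ] [Finite ε]
    (o : D.Orientation) (b : ε) (δ₁ : ℚ) (m₁ : ℕ) (δ₀ : ℚ) (m₀ : ℕ) : Prop :=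
  Nonempty (ReducedKh o b δ₁ ≃ₗ[ℤ] (Fin m₁ → ℤ)) ∧
  Nonempty (ReducedKh o b δ₀ ≃ₗ[ℤ] (Fin m₀ → ℤ)) ∧
  ∀ δ : ℚ, δ ≠ δ₁ → δ ≠ δ₀ → Subsingleton (ReducedKh o b δ)

end PDCode

/-- The crossings of a 3-strand pretzel diagram: three columns `0, 1, 2` from left to right,
with `n k` crossings in column `k`, numbered from bottom to top. Columns come first in the order. -/
abbrev PretzelCrossing (n : Fin 3 → ℕ) : Type := Σₗ k : Fin 3, Fin (n k)

/-- The edges of a 3-strand pretzel diagram. The arcs `top k` and `bot k` join the right strand of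
column `k` to the left strand of column `k + 1` (cyclically) at the top and at the bottom. Between
the crossings `i` and `i + 1` of column `k` there are the edges `inner k false i` on the left and
`inner k true i` on the right. -/
inductive PretzelEdge (n : Fin 3 → ℕ) : Type
  | top (k : Fin 3)
  | bot (k : Fin 3)
  | inner (k : Fin 3) (right : Bool) (i : Fin (n k - 1))
  deriving DecidableEq, Fintype

/-- The edge of column `k`, on the left or on the right, below the crossing number `i` (and above
the crossing number `i - 1`). -/
def columnEdge (n : Fin 3 → ℕ) (k : Fin 3) (right : Bool) (i : ℕ) : PretzelEdge n :=
  if h : 0 < i ∧ i < n k then .inner k right ⟨i - 1, by omega⟩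
  else if i = 0 then .bot (if right then k else k - 1)
  else .top (if right then k else k - 1)

/-- The standard diagram of a 3-strand pretzel link with `n k` half twists in column `k`, of
positive sign if `pos k = true` and of negative sign otherwise. In a positive column the
strand from bottom left to top right is the upper one at each crossing. -/
def pretzelDiagram (n : Fin 3 → ℕ) (pos : Fin 3 → Bool) :
    PDCode (PretzelCrossing n) (PretzelEdge n) := fun c =>
  let k := (ofLex c).1
  let i : ℕ := (ofLex c).2
  let sw := columnEdge n k false i
  let se := columnEdge n k true i
  let ne := columnEdge n k true (i + 1)
  let nw := columnEdge n k false (i + 1)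
  if pos k then ![se, ne, nw, sw] else ![sw, se, ne, nw]

/-- The diagram of the pretzel link `P(-p, q, r)`. -/
abbrev pretzelNegPosPos (p q r : ℕ) :
    PDCode (PretzelCrossing ![p, q, r]) (PretzelEdge ![p, q, r]) :=
  pretzelDiagram ![p, q, r] ![false, true, true]

/-- The arc `top k` is oriented from column `k` to column `k + 1` (cyclically), that is, it leaves
the top crossing of column `k` at the top right end. -/
def TopArcRunsRight {n : Fin 3 → ℕ} {pos : Fin 3 → Bool} (o : (pretzelDiagram n pos).Orientation)
    (k : Fin 3) : Prop :=
  ∀ i : Fin (n k), (i : ℕ) + 1 = n k →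
    o.inward (toLex ⟨k, i⟩) (if pos k then 1 else 2) = false

/-- With the orientation of the whole link chosen such that the top arc between columns `1` and `2`
runs from `1` to `2`, the top arc between columns `0` and `2` runs from `0` to `2`. -/
def FirstArrowAgrees {n : Fin 3 → ℕ} {pos : Fin 3 → Bool}
    (o : (pretzelDiagram n pos).Orientation) : Prop :=
  ¬ TopArcRunsRight o 2 ↔ TopArcRunsRight o 1

/-- With the orientation of the whole link chosen such that the top arc between columns `1` and `2`
runs from `1` to `2`, the top arc between columns `0` and `1` runs from `0` to `1`. -/
def SecondArrowAgrees {n : Fin 3 → ℕ} {pos : Fin 3 → Bool}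
    (o : (pretzelDiagram n pos).Orientation) : Prop :=
  TopArcRunsRight o 0 ↔ TopArcRunsRight o 1

set_option linter.unusedVariables false

namespace PretzelKh

open Function (update update_of_ne update_self)
open AddMonoidHom (comp_zero add_comp zero_comp)
open AddMonoidHom renaming id → idHom, ext → hom_ext, comp_apply → hom_comp, add_apply → hom_add,
  sub_apply → hom_sub, neg_apply → hom_neg, smul_apply → hom_smul, zero_apply → hom_zero

local notation "Ab" => AddCommGroup

/-! ### Homology of a graded group with a differential -/

/-- Cycles of degree `i`. -/
def cycles {C : Type} [Ab C] (d : C →+ C) (G : ℤ → AddSubgroup C) (i : ℤ) :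
    AddSubgroup C := d.ker ⊓ G i

/-- Boundaries of degree `i`; the differential has degree `-1`. -/
def boundaries {C : Type} [Ab C] (d : C →+ C) (G : ℤ → AddSubgroup C) (i : ℤ) :
    AddSubgroup C := (G (i + 1)).map d

/-- Homology in degree `i`. -/
abbrev Homology {C : Type} [Ab C] (d : C →+ C) (G : ℤ → AddSubgroup C) (i : ℤ) : Type :=
  cycles d G i ⧸ (boundaries d G i).addSubgroupOf (cycles d G i)

/-- A surjective graded chain map with acyclic kernel. -/
structure QSurj {A B : Type} [Ab A] [Ab B] (d : A →+ A)
    (G : ℤ → AddSubgroup A) (d' : B →+ B) (G' : ℤ → AddSubgroup B) (f : A →+ B) : Prop where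
  comm : ∀ x, f (d x) = d' (f x)
  deg : ∀ i, ∀ x ∈ G i, f x ∈ G' i
  surj : ∀ i, ∀ y ∈ G' i, ∃ x ∈ G i, f x = y
  acyclic : ∀ i, ∀ x ∈ G i, f x = 0 → d x = 0 → ∃ y ∈ G (i + 1), f y = 0 ∧ d y = x

/-- An injective graded chain map with acyclic cokernel. -/
structure QInj {A B : Type} [Ab A] [Ab B] (d : A →+ A)
    (G : ℤ → AddSubgroup A) (d' : B →+ B) (G' : ℤ → AddSubgroup B) (f : A →+ B) : Prop where
  comm : ∀ x, f (d x) = d' (f x)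
  deg : ∀ i, ∀ x ∈ G i, f x ∈ G' i
  inj : ∀ x, f x = 0 → x = 0
  acyclic : ∀ i, ∀ x ∈ G' i, (∃ y, f y = d' x) →
    ∃ z ∈ G' (i + 1), ∃ y ∈ G i, x = d' z + f y

section Homology

variable {A B : Type} [Ab A] [Ab B] {d : A →+ A} {G : ℤ → AddSubgroup A}
  {d' : B →+ B} {G' : ℤ → AddSubgroup B} {f : A →+ B}

/-- The map on cycles induced by a graded chain map. -/
def cyclesMap (f : A →+ B) (comm : ∀ x, f (d x) = d' (f x)) (deg : ∀ i, ∀ x ∈ G i, f x ∈ G' i)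
    (i : ℤ) : cycles d G i →+ cycles d' G' i :=
  (f.comp (cycles d G i).subtype).codRestrict _ fun x => by
    obtain ⟨h1, h2⟩ := x.2
    exact ⟨by simpa [← comm] using congrArg f h1, deg i _ h2⟩

theorem homology_equiv_of_cyclesMap (comm : ∀ x, f (d x) = d' (f x))
    (deg : ∀ i, ∀ x ∈ G i, f x ∈ G' i) (i : ℤ)
    (hinj : ∀ x ∈ G i, d x = 0 → (∃ y ∈ G' (i + 1), d' y = f x) → ∃ z ∈ G (i + 1), d z = x)
    (hsurj : ∀ y ∈ G' i, d' y = 0 → ∃ x ∈ G i, d x = 0 ∧ ∃ z ∈ G' (i + 1), y = f x + d' z) :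
    Nonempty (Homology d G i ≃+ Homology d' G' i) := by
  have hle : (boundaries d G i).addSubgroupOf (cycles d G i) ≤
      ((boundaries d' G' i).addSubgroupOf (cycles d' G' i)).comap (cyclesMap f comm deg i) := by
    rintro ⟨x, hx⟩ ⟨y, hy, hyx⟩
    exact ⟨f y, deg _ _ hy, by rw [← comm]; exact congrArg f hyx⟩
  refine ⟨AddEquiv.ofBijective (QuotientAddGroup.map _ _ (cyclesMap f comm deg i) hle) ⟨?_, ?_⟩⟩
  · rw [injective_iff_map_eq_zero]
    intro a
    induction a using QuotientAddGroup.induction_on with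
    | H a =>
      obtain ⟨x, hx⟩ := a
      intro h
      rw [QuotientAddGroup.map_mk, QuotientAddGroup.eq_zero_iff] at h
      obtain ⟨y, hy, hyx⟩ := h
      rw [QuotientAddGroup.eq_zero_iff]
      obtain ⟨z, hz, hzx⟩ := hinj x hx.2 hx.1 ⟨y, hy, hyx⟩
      exact ⟨z, hz, hzx⟩
  · intro b
    induction b using QuotientAddGroup.induction_on with
    | H b =>
      obtain ⟨y, hy⟩ := b
      obtain ⟨x, hx, hdx, z, hz, e⟩ := hsurj y hy.2 hy.1
      refine ⟨QuotientAddGroup.mk ⟨x, hdx, hx⟩, ?_⟩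
      rw [QuotientAddGroup.map_mk, QuotientAddGroup.eq]
      refine ⟨z, hz, ?_⟩
      change d' z = -f x + y
      rw [e]; abel

theorem QSurj.homology_equiv (h : QSurj d G d' G' f) (hd : ∀ x, d (d x) = 0)
    (hG : ∀ i, ∀ x ∈ G (i + 1), d x ∈ G i) (i : ℤ) :
    Nonempty (Homology d G i ≃+ Homology d' G' i) := by
  refine homology_equiv_of_cyclesMap h.comm h.deg i ?_ ?_
  · rintro x hx hdx ⟨y, hy, e⟩
    obtain ⟨w, hw, rfl⟩ := h.surj _ _ hy
    obtain ⟨z, hz, -, e2⟩ := h.acyclic i (x - d w) (sub_mem hx (hG _ _ hw))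
      (by rw [map_sub, h.comm, e, sub_self]) (by rw [map_sub, hdx, hd, sub_self])
    exact ⟨z + w, add_mem hz hw, by rw [map_add, e2]; abel⟩
  · intro y hy hdy
    obtain ⟨x, hx, rfl⟩ := h.surj _ _ hy
    obtain ⟨z, hz, hfz, e⟩ := h.acyclic (i - 1) (d x) (hG _ _ (by simpa using hx))
      (by rw [h.comm, hdy]) (hd x)
    refine ⟨x - z, sub_mem hx (by simpa using hz), by rw [map_sub, e, sub_self], 0, zero_mem _, ?_⟩
    rw [map_sub, hfz, map_zero, add_zero, sub_zero]

theorem QInj.homology_equiv (h : QInj d G d' G' f) (hd : ∀ x, d' (d' x) = 0) (i : ℤ) :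
    Nonempty (Homology d G i ≃+ Homology d' G' i) := by
  have key : ∀ x, f x = 0 → x = 0 := h.inj
  have inj : ∀ x y, f x = f y → x = y := fun x y e =>
    sub_eq_zero.1 (key _ (by rw [map_sub, e, sub_self]))
  refine homology_equiv_of_cyclesMap h.comm h.deg i ?_ ?_
  · rintro x hx hdx ⟨y, hy, e⟩
    obtain ⟨z, hz, w, hw, rfl⟩ := h.acyclic _ y hy ⟨x, e.symm⟩
    refine ⟨w, hw, inj _ _ ?_⟩
    rw [h.comm, ← e, map_add, hd, zero_add]
  · intro y hy hdy
    obtain ⟨z, hz, w, hw, rfl⟩ := h.acyclic _ y hy ⟨0, by rw [map_zero, hdy]⟩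
    refine ⟨w, hw, inj _ _ ?_, z, hz, add_comm _ _⟩
    rw [h.comm, map_zero]
    simpa [hd] using hdy

end Homology

/-! ### Columns -/

/-- Underlying group of the complex of a column of `n` crossings, resolved from the top. A crossing
resolved vertically is forgotten; below a crossing resolved horizontally, the group `V` for the
vertical tangle becomes `H`, and the group `H` for the horizontal tangle gets a factor for the
additional circle. -/
def Col : ℕ → Type → Type → Type
  | 0, V, _ => V
  | n + 1, V, H => Col n V H × Col n H (H × H)

instance Col.addCommGroup : (n : ℕ) → (V H : Type) → [Ab V] → [Ab H] →
    Ab (Col n V H)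
  | 0, V, _, _, _ => inferInstanceAs (Ab V)
  | n + 1, V, H, _, _ =>
    letI := Col.addCommGroup n V H
    letI := Col.addCommGroup n H (H × H)
    inferInstanceAs (Ab (Col n V H × Col n H (H × H)))

section

variable {n : ℕ} {V H M : Type} [Ab V] [Ab H] [Ab M]

/-- The part with the top crossing resolved vertically. -/
def Col.fst : Col (n + 1) V H →+ Col n V H := AddMonoidHom.fst (Col n V H) (Col n H (H × H))

/-- The part with the top crossing resolved horizontally. -/
def Col.snd : Col (n + 1) V H →+ Col n H (H × H) :=
  AddMonoidHom.snd (Col n V H) (Col n H (H × H))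

/-- A map into a column from its two parts. -/
def Col.pair (f : M →+ Col n V H) (g : M →+ Col n H (H × H)) : M →+ Col (n + 1) V H :=
  AddMonoidHom.prod f g

@[simp] theorem Col.fst_pair (f : M →+ Col n V H) (g : M →+ Col n H (H × H)) (x : M) :
    Col.fst (Col.pair f g x) = f x := rfl

@[simp] theorem Col.snd_pair (f : M →+ Col n V H) (g : M →+ Col n H (H × H)) (x : M) :
    Col.snd (Col.pair f g x) = g x := rfl

theorem Col.ext {x y : Col (n + 1) V H} (h₁ : Col.fst x = Col.fst y)
    (h₂ : Col.snd x = Col.snd y) : x = y := Prod.ext h₁ h₂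

theorem Col.exists_mk (x : Col n V H) (y : Col n H (H × H)) :
    ∃ z : Col (n + 1) V H, Col.fst z = x ∧ Col.snd z = y := ⟨(x, y), rfl, rfl⟩

end

/-- Functoriality of `Col`. -/
def Col.map : (n : ℕ) → {V H V' H' : Type} → [Ab V] → [Ab H] →
    [Ab V'] → [Ab H'] → (V →+ V') → (H →+ H') → (Col n V H →+ Col n V' H')
  | 0, _, _, _, _, _, _, _, _, f, _ => f
  | n + 1, _, _, _, _, _, _, _, _, f, g =>
    Col.pair ((Col.map n f g).comp Col.fst) ((Col.map n g (g.prodMap g)).comp Col.snd)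

section

variable {V H V' H' : Type} [Ab V] [Ab H] [Ab V']
  [Ab H']

@[simp] theorem Col.fst_map (n : ℕ) (f : V →+ V') (g : H →+ H') (x : Col (n + 1) V H) :
    Col.fst (Col.map (n + 1) f g x) = Col.map n f g (Col.fst x) := rfl

@[simp] theorem Col.snd_map (n : ℕ) (f : V →+ V') (g : H →+ H') (x : Col (n + 1) V H) :
    Col.snd (Col.map (n + 1) f g x) = Col.map n g (g.prodMap g) (Col.snd x) := rfl

end

theorem Col.map_map : ∀ (n : ℕ) {V H V' H' V'' H'' : Type} [Ab V] [Ab H] [Ab V'] [Ab H'] [Ab V'']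
    [Ab H''] (f' : V' →+ V'') (g' : H' →+ H'') (f : V →+ V') (g : H →+ H')
    (x : Col n V H),
    Col.map n f' g' (Col.map n f g x) = Col.map n (f'.comp f) (g'.comp g) x
  | 0, _, _, _, _, _, _, _, _, _, _, _, _, _, _, _, _, _ => rfl
  | n + 1, _, _, _, _, _, _, _, _, _, _, _, _, f', g', f, g, x =>
    Col.ext (Col.map_map n _ _ _ _ _) (Col.map_map n _ _ _ _ _)

theorem Col.map_id : ∀ (n : ℕ) {V H : Type} [Ab V] [Ab H] (x : Col n V H),
    Col.map n (idHom V) (idHom H) x = x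
  | 0, _, _, _, _, _ => rfl
  | n + 1, _, _, _, _, _ => Col.ext (Col.map_id n _) (Col.map_id n _)

theorem Col.map_zero : ∀ (n : ℕ) {V H V' H' : Type} [Ab V] [Ab H] [Ab V'] [Ab H']
    (x : Col n V H),
    Col.map n (0 : V →+ V') (0 : H →+ H') x = 0
  | 0, _, _, _, _, _, _, _, _, _ => rfl
  | n + 1, _, _, _, _, _, _, _, _, _ => Col.ext (Col.map_zero n _) (Col.map_zero n _)

/-- The summand of a column with all crossings resolved vertically. -/
def Col.incl : (n : ℕ) → {V H : Type} → [Ab V] → [Ab H] → V →+ Col n V H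
  | 0, _, _, _, _ => idHom _
  | n + 1, _, _, _, _ => Col.pair (Col.incl n) 0

/-- The projection to the summand with all crossings resolved vertically. -/
def Col.proj : (n : ℕ) → {V H : Type} → [Ab V] → [Ab H] → Col n V H →+ V
  | 0, _, _, _, _ => idHom _
  | n + 1, _, _, _, _ => (Col.proj n).comp Col.fst

theorem Col.map_incl : ∀ (n : ℕ) {V H V' H' : Type} [Ab V] [Ab H] [Ab V'] [Ab H'] (f : V →+ V')
    (g : H →+ H') (v : V),
    Col.map n f g (Col.incl n v) = Col.incl n (f v)
  | 0, _, _, _, _, _, _, _, _, _, _, _ => rfl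
  | n + 1, _, _, _, _, _, _, _, _, f, g, v =>
    Col.ext (Col.map_incl n f g v) (_root_.map_zero (Col.map n g (g.prodMap g)))

theorem Col.proj_map : ∀ (n : ℕ) {V H V' H' : Type} [Ab V] [Ab H] [Ab V'] [Ab H'] (f : V →+ V')
    (g : H →+ H') (x : Col n V H),
    Col.proj n (Col.map n f g x) = f (Col.proj n x)
  | 0, _, _, _, _, _, _, _, _, _, _, _ => rfl
  | n + 1, _, _, _, _, _, _, _, _, f, g, x => Col.proj_map n f g (Col.fst x)

theorem Col.proj_incl : ∀ (n : ℕ) {V H : Type} [Ab V] [Ab H] (v : V),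
    Col.proj n (Col.incl n v : Col n V H) = v
  | 0, _, _, _, _, _ => rfl
  | n + 1, _, _, _, _, v => Col.proj_incl n v

theorem Col.map_zero_right : ∀ (n : ℕ) {V H V' H' : Type} [Ab V] [Ab H] [Ab V'] [Ab H']
    (f : V →+ V') (x : Col n V H),
    Col.map n f (0 : H →+ H') x = Col.incl n (f (Col.proj n x))
  | 0, _, _, _, _, _, _, _, _, _, _ => rfl
  | n + 1, _, _, _, _, _, _, _, _, f, x =>
    Col.ext (Col.map_zero_right n f _) (Col.map_zero n _)

theorem Col.map_add : ∀ (n : ℕ) {V H V' H' : Type} [Ab V] [Ab H] [Ab V'] [Ab H'] (f f' : V →+ V')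
    (g g' : H →+ H') (x : Col n V H),
    Col.map n (f + f') (g + g') x = Col.map n f g x + Col.map n f' g' x
  | 0, _, _, _, _, _, _, _, _, _, _, _, _, _ => rfl
  | n + 1, _, _, _, _, _, _, _, _, f, f', g, g', _ =>
    Col.ext (Col.map_add n f f' g g' _) (Col.map_add n g g' (g.prodMap g) (g'.prodMap g') _)

theorem Col.incl_proj_add (n : ℕ) {V H : Type} [Ab V] [Ab H] (x : Col n V H) :
    Col.incl n (Col.proj n x) + Col.map n (0 : V →+ V) (idHom H) x = x := by
  have h := Col.map_add n (idHom V) 0 0 (idHom H) x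
  rw [add_zero, zero_add, Col.map_id, Col.map_zero_right] at h
  exact h.symm

/-- A map that is split injective on the horizontal part is injective there. -/
theorem Col.eq_zero_of_map_eq_zero (n : ℕ) {V H V' H' : Type} [Ab V] [Ab H] [Ab V'] [Ab H']
    (f : V →+ V') (g : H →+ H') (g' : H' →+ H)
    (hg : g'.comp g = idHom H) (x : Col n V H) (hx : Col.proj n x = 0)
    (h : Col.map n f g x = 0) : x = 0 := by
  have h1 := congrArg (Col.map n (0 : V' →+ V) g') h
  rw [Col.map_map, hg, zero_comp, _root_.map_zero] at h1
  rw [← Col.incl_proj_add n x, h1, hx, _root_.map_zero, add_zero]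

/-- The group of the simplified complex of a column of `n` crossings. -/
def Sm : ℕ → Type → Type → Type
  | 0, V, _ => V
  | n + 1, V, H => V × Sm n H H

instance Sm.addCommGroup : (n : ℕ) → (V H : Type) → [Ab V] → [Ab H] →
    Ab (Sm n V H)
  | 0, V, _, _, _ => inferInstanceAs (Ab V)
  | n + 1, V, H, _, _ =>
    letI := Sm.addCommGroup n H H
    inferInstanceAs (Ab (V × Sm n H H))

section

variable {n : ℕ} {V H M : Type} [Ab V] [Ab H] [Ab M]

/-- The vertical summand. -/
def Sm.head : Sm (n + 1) V H →+ V := AddMonoidHom.fst V (Sm n H H)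

/-- The horizontal summands. -/
def Sm.tail : Sm (n + 1) V H →+ Sm n H H := AddMonoidHom.snd V (Sm n H H)

/-- A map into the simplified complex from its two parts. -/
def Sm.pair (f : M →+ V) (g : M →+ Sm n H H) : M →+ Sm (n + 1) V H := AddMonoidHom.prod f g

@[simp] theorem Sm.head_pair (f : M →+ V) (g : M →+ Sm n H H) (x : M) :
    Sm.head (Sm.pair f g x) = f x := rfl

@[simp] theorem Sm.tail_pair (f : M →+ V) (g : M →+ Sm n H H) (x : M) :
    Sm.tail (Sm.pair f g x) = g x := rfl

theorem Sm.ext {x y : Sm (n + 1) V H} (h₁ : Sm.head x = Sm.head y)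
    (h₂ : Sm.tail x = Sm.tail y) : x = y := Prod.ext h₁ h₂

end

/-- Functoriality of `Sm`. -/
def Sm.map : (n : ℕ) → {V H V' H' : Type} → [Ab V] → [Ab H] →
    [Ab V'] → [Ab H'] → (V →+ V') → (H →+ H') → (Sm n V H →+ Sm n V' H')
  | 0, _, _, _, _, _, _, _, _, f, _ => f
  | n + 1, _, _, _, _, _, _, _, _, f, g =>
    Sm.pair (f.comp Sm.head) ((Sm.map n g g).comp Sm.tail)

theorem Sm.map_map : ∀ (n : ℕ) {V H V' H' V'' H'' : Type} [Ab V] [Ab H] [Ab V'] [Ab H'] [Ab V'']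
    [Ab H''] (f' : V' →+ V'') (g' : H' →+ H'') (f : V →+ V') (g : H →+ H')
    (x : Sm n V H),
    Sm.map n f' g' (Sm.map n f g x) = Sm.map n (f'.comp f) (g'.comp g) x
  | 0, _, _, _, _, _, _, _, _, _, _, _, _, _, _, _, _, _ => rfl
  | n + 1, _, _, _, _, _, _, _, _, _, _, _, _, _, _, _, _, _ =>
    Sm.ext rfl (Sm.map_map n _ _ _ _ _)

theorem Sm.map_zero : ∀ (n : ℕ) {V H V' H' : Type} [Ab V] [Ab H] [Ab V'] [Ab H']
    (x : Sm n V H),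
    Sm.map n (0 : V →+ V') (0 : H →+ H') x = 0
  | 0, _, _, _, _, _, _, _, _, _ => rfl
  | n + 1, _, _, _, _, _, _, _, _, _ => Sm.ext rfl (Sm.map_zero n _)

/-- The inclusion of the vertical summand. -/
def Sm.incl : (n : ℕ) → {V H : Type} → [Ab V] → [Ab H] → V →+ Sm n V H
  | 0, _, _, _, _ => idHom _
  | _ + 1, _, _, _, _ => Sm.pair (idHom _) 0

/-- The projection to the vertical summand. -/
def Sm.proj : (n : ℕ) → {V H : Type} → [Ab V] → [Ab H] → Sm n V H →+ V
  | 0, _, _, _, _ => idHom _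
  | _ + 1, _, _, _, _ => Sm.head

theorem Sm.map_incl : ∀ (n : ℕ) {V H V' H' : Type} [Ab V] [Ab H] [Ab V'] [Ab H'] (f : V →+ V')
    (g : H →+ H') (v : V),
    Sm.map n f g (Sm.incl n v) = Sm.incl n (f v)
  | 0, _, _, _, _, _, _, _, _, _, _, _ => rfl
  | n + 1, _, _, _, _, _, _, _, _, _, g, _ => Sm.ext rfl (_root_.map_zero (Sm.map n g g))

theorem Sm.proj_map : ∀ (n : ℕ) {V H V' H' : Type} [Ab V] [Ab H] [Ab V'] [Ab H'] (f : V →+ V')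
    (g : H →+ H') (x : Sm n V H),
    Sm.proj n (Sm.map n f g x) = f (Sm.proj n x)
  | 0, _, _, _, _, _, _, _, _, _, _, _ => rfl
  | _ + 1, _, _, _, _, _, _, _, _, _, _, _ => rfl

/-! ### Columns with the vertical resolution first -/

/-- The operations used to form the complex of a column whose `0`-smoothing is vertical: a graded
group `V` with a differential and a parity for the vertical tangle, a group `H` for the horizontal
one, the saddle `s`, and the actions `T`, `Y` of the upper and the lower arc of the horizontal
tangle. -/
structure Ops (V H : Type) [Ab V] [Ab H] where
  dV : V →+ V
  dH : H →+ H
  eV : V →+ V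
  eH : H →+ H
  s : V →+ H
  T : H →+ H
  Y : H →+ H
  GV : ℤ → AddSubgroup V
  GH : ℤ → AddSubgroup H

namespace Ops

/-- The relations between the operations. -/
structure Good {V H : Type} [Ab V] [Ab H] (O : Ops V H) : Prop where
  ddV : ∀ x, O.dV (O.dV x) = 0
  ddH : ∀ x, O.dH (O.dH x) = 0
  eeV : ∀ x, O.eV (O.eV x) = x
  eeH : ∀ x, O.eH (O.eH x) = x
  deV : ∀ x, O.dV (O.eV x) = -O.eV (O.dV x)
  deH : ∀ x, O.dH (O.eH x) = -O.eH (O.dH x)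
  sd : ∀ x, O.s (O.dV x) = O.dH (O.s x)
  se : ∀ x, O.s (O.eV x) = O.eH (O.s x)
  Td : ∀ x, O.T (O.dH x) = O.dH (O.T x)
  Te : ∀ x, O.T (O.eH x) = O.eH (O.T x)
  Yd : ∀ x, O.Y (O.dH x) = O.dH (O.Y x)
  Ye : ∀ x, O.Y (O.eH x) = O.eH (O.Y x)
  Ts : ∀ x, O.T (O.s x) = O.Y (O.s x)
  TT : ∀ x, O.T (O.T x) = 0
  YY : ∀ x, O.Y (O.Y x) = 0
  TY : ∀ x, O.T (O.Y x) = O.Y (O.T x)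
  gdV : ∀ i, ∀ x ∈ O.GV (i + 1), O.dV x ∈ O.GV i
  gdH : ∀ i, ∀ x ∈ O.GH (i + 1), O.dH x ∈ O.GH i
  geV : ∀ i, ∀ x ∈ O.GV i, O.eV x ∈ O.GV i
  geH : ∀ i, ∀ x ∈ O.GH i, O.eH x ∈ O.GH i
  gs : ∀ i, ∀ x ∈ O.GV (i + 1), O.s x ∈ O.GH i
  gT : ∀ i, ∀ x ∈ O.GH (i + 1), O.T x ∈ O.GH i
  gY : ∀ i, ∀ x ∈ O.GH (i + 1), O.Y x ∈ O.GH i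

/-- A pair of maps that commute with the operations. -/
structure Map {V H V' H' : Type} [Ab V] [Ab H] [Ab V'] [Ab H'] (O : Ops V H) (O' : Ops V' H')
    (f : V →+ V') (g : H →+ H') : Prop where
  dV : ∀ x, f (O.dV x) = O'.dV (f x)
  dH : ∀ x, g (O.dH x) = O'.dH (g x)
  eV : ∀ x, f (O.eV x) = O'.eV (f x)
  eH : ∀ x, g (O.eH x) = O'.eH (g x)
  s : ∀ x, g (O.s x) = O'.s (f x)
  T : ∀ x, g (O.T x) = O'.T (g x)
  Y : ∀ x, g (O.Y x) = O'.Y (g x)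

section

variable {V H V' H' : Type} [Ab V] [Ab H] [Ab V'] [Ab H']

/-- The operations below a crossing that is resolved horizontally. In `H × H` the first factor has
exponent `0` on the additional circle, the second one exponent `1`. -/
def cap (O : Ops V H) : Ops H (H × H) where
  dV := O.dH
  dH := O.dH.prodMap O.dH
  eV := O.eH
  eH := O.eH.prodMap O.eH
  s := O.Y.prod (idHom H)
  T := (0 : H × H →+ H).prod (AddMonoidHom.fst H H)
  Y := O.Y.prodMap O.Y
  GV := O.GH
  GH i := (O.GH i).prod (O.GH (i + 1))

/-- The operations after the top crossing of a column has been simplified. -/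
def peel (O : Ops V H) : Ops H H where
  dV := O.dH
  dH := O.dH
  eV := O.eH
  eH := O.eH
  s := O.Y - O.T
  T := -O.T
  Y := O.Y
  GV := O.GH
  GH := O.GH

/-- The coproduct at the upper arc. -/
def split (O : Ops V H) : H →+ H × H := O.T.prod (idHom H)

/-- Removal of the circle below the top crossing, which acts as minus the upper arc. -/
def uncap (T : H →+ H) : H × H →+ H := AddMonoidHom.fst H H - T.comp (AddMonoidHom.snd H H)

theorem Good.cap {O : Ops V H} (h : O.Good) : O.cap.Good where
  ddV := h.ddH
  ddH x := Prod.ext (h.ddH _) (h.ddH _)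
  eeV := h.eeH
  eeH x := Prod.ext (h.eeH _) (h.eeH _)
  deV := h.deH
  deH x := Prod.ext (h.deH _) (h.deH _)
  sd x := Prod.ext (h.Yd _) rfl
  se x := Prod.ext (h.Ye _) rfl
  Td x := Prod.ext (map_zero O.dH).symm rfl
  Te x := Prod.ext (map_zero O.eH).symm rfl
  Yd x := Prod.ext (h.Yd _) (h.Yd _)
  Ye x := Prod.ext (h.Ye _) (h.Ye _)
  Ts x := Prod.ext (h.YY _).symm rfl
  TT x := rfl
  YY x := Prod.ext (h.YY _) (h.YY _)
  TY x := Prod.ext (map_zero O.Y).symm rfl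
  gdV := h.gdH
  gdH i x hx := ⟨h.gdH _ _ hx.1, h.gdH _ _ hx.2⟩
  geV := h.geH
  geH i x hx := ⟨h.geH _ _ hx.1, h.geH _ _ hx.2⟩
  gs i x hx := ⟨h.gY _ _ hx, hx⟩
  gT i x hx := ⟨zero_mem _, hx.1⟩
  gY i x hx := ⟨h.gY _ _ hx.1, h.gY _ _ hx.2⟩

theorem Good.peel {O : Ops V H} (h : O.Good) : O.peel.Good where
  ddV := h.ddH
  ddH := h.ddH
  eeV := h.eeH
  eeH := h.eeH
  deV := h.deH
  deH := h.deH
  sd x := by simp [Ops.peel, h.Yd, h.Td]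
  se x := by simp [Ops.peel, h.Ye, h.Te]
  Td x := by simp [Ops.peel, h.Td]
  Te x := by simp [Ops.peel, h.Te]
  Yd := h.Yd
  Ye := h.Ye
  Ts x := by simp [Ops.peel, h.TY, h.TT, h.YY]
  TT x := by simp [Ops.peel, h.TT]
  YY := h.YY
  TY x := by simp [Ops.peel, h.TY]
  gdV := h.gdH
  gdH := h.gdH
  geV := h.geH
  geH := h.geH
  gs i x hx := sub_mem (h.gY _ _ hx) (h.gT _ _ hx)
  gT i x hx := neg_mem (h.gT _ _ hx)
  gY := h.gY

theorem Map.cap {O : Ops V H} {O' : Ops V' H'} {f : V →+ V'} {g : H →+ H'} (h : O.Map O' f g) :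
    O.cap.Map O'.cap g (g.prodMap g) where
  dV := h.dH
  dH x := Prod.ext (h.dH _) (h.dH _)
  eV := h.eH
  eH x := Prod.ext (h.eH _) (h.eH _)
  s x := Prod.ext (h.Y _) rfl
  T x := Prod.ext (map_zero g) rfl
  Y x := Prod.ext (h.Y _) (h.Y _)

theorem Map.peel {O : Ops V H} {O' : Ops V' H'} {f : V →+ V'} {g : H →+ H'} (h : O.Map O' f g) :
    O.peel.Map O'.peel g g where
  dV := h.dH
  dH := h.dH
  eV := h.eH
  eH := h.eH
  s x := by simp [Ops.peel, h.Y, h.T]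
  T x := by simp [Ops.peel, h.T]
  Y := h.Y

theorem Good.map_split {O : Ops V H} (h : O.Good) : O.Map O.cap O.s O.split where
  dV := h.sd
  dH x := Prod.ext (h.Td _) rfl
  eV := h.se
  eH x := Prod.ext (h.Te _) rfl
  s x := Prod.ext (h.Ts _) rfl
  T x := Prod.ext (h.TT _) rfl
  Y x := Prod.ext (h.TY _) rfl

theorem Good.map_uncap {O : Ops V H} (h : O.Good) :
    O.cap.Map O.peel (idHom H) (uncap O.T) where
  dV x := rfl
  dH x := by simp [Ops.peel, Ops.cap, uncap, h.Td]
  eV x := rfl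
  eH x := by simp [Ops.peel, Ops.cap, uncap, h.Te]
  s x := by simp [Ops.peel, Ops.cap, uncap]
  T x := by simp [Ops.peel, Ops.cap, uncap, h.TT]
  Y x := by simp [Ops.peel, Ops.cap, uncap, h.TY]

end

end Ops

/-- The parity of a column. -/
def colE : (n : ℕ) → {V H : Type} → [Ab V] → [Ab H] → Ops V H →
    (Col n V H →+ Col n V H)
  | 0, _, _, _, _, O => O.eV
  | n + 1, _, _, _, _, O => Col.pair ((colE n O).comp Col.fst) (-(colE n O.cap).comp Col.snd)

/-- The differential of a column. -/
def colD : (n : ℕ) → {V H : Type} → [Ab V] → [Ab H] → Ops V H →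
    (Col n V H →+ Col n V H)
  | 0, _, _, _, _, O => O.dV
  | n + 1, _, _, _, _, O => Col.pair ((colD n O).comp Col.fst)
      ((colD n O.cap).comp Col.snd + (colE n O.cap).comp ((Col.map n O.s O.split).comp Col.fst))

/-- The grading of a column. -/
def colG : (n : ℕ) → {V H : Type} → [Ab V] → [Ab H] → Ops V H → ℤ →
    AddSubgroup (Col n V H)
  | 0, _, _, _, _, O, i => O.GV i
  | n + 1, _, _, _, _, O, i => (colG n O i).comap Col.fst ⊓ (colG n O.cap i).comap Col.snd

theorem colE_map : ∀ (n : ℕ) {V H V' H' : Type} [Ab V] [Ab H] [Ab V'] [Ab H'] {O : Ops V H}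
    {O' : Ops V' H'} {f : V →+ V'} {g : H →+ H'}
    (_ : O.Map O' f g) (x : Col n V H),
    colE n O' (Col.map n f g x) = Col.map n f g (colE n O x)
  | 0, _, _, _, _, _, _, _, _, _, _, _, _, h, x => (h.eV x).symm
  | n + 1, _, _, _, _, _, _, _, _, O, O', f, g, h, x =>
    Col.ext (colE_map n h _) (by
      have := colE_map n h.cap (Col.snd x)
      simp only [colE, Col.snd_pair, Col.snd_map, hom_neg,
        hom_comp, map_neg, this])

theorem colD_map : ∀ (n : ℕ) {V H V' H' : Type} [Ab V] [Ab H] [Ab V'] [Ab H'] {O : Ops V H}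
    {O' : Ops V' H'} {f : V →+ V'} {g : H →+ H'}
    (_ : O.Map O' f g) (x : Col n V H),
    colD n O' (Col.map n f g x) = Col.map n f g (colD n O x)
  | 0, _, _, _, _, _, _, _, _, _, _, _, _, h, x => (h.dV x).symm
  | n + 1, V, H, V', H', _, _, _, _, O, O', f, g, h, x =>
    Col.ext (colD_map n h _) (by
      have h1 := colD_map n h.cap (Col.snd x)
      have h2 := colE_map n h.cap (Col.map n O.s O.split (Col.fst x))
      have h3 : O'.s.comp f = g.comp O.s := hom_ext fun x => (h.s x).symm
      have h4 : O'.split.comp g = (g.prodMap g).comp O.split :=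
        hom_ext fun x => Prod.ext (h.T x).symm rfl
      simp only [colD, Col.snd_pair, Col.snd_map, Col.fst_map, hom_add,
        hom_comp, map_add, h1, ← h2, Col.map_map, h3, h4])

theorem colE_colE : ∀ (n : ℕ) {V H : Type} [Ab V] [Ab H] {O : Ops V H}
    (_ : O.Good) (x : Col n V H), colE n O (colE n O x) = x
  | 0, _, _, _, _, _, h, x => h.eeV x
  | n + 1, _, _, _, _, O, h, x => Col.ext (colE_colE n h _) (by
      simpa [colE] using colE_colE n h.cap (Col.snd x))

theorem colD_colE : ∀ (n : ℕ) {V H : Type} [Ab V] [Ab H] {O : Ops V H}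
    (_ : O.Good) (x : Col n V H), colD n O (colE n O x) = -colE n O (colD n O x)
  | 0, _, _, _, _, _, h, x => h.deV x
  | n + 1, _, _, _, _, O, h, x => Col.ext (colD_colE n h _) (by
      have h1 := colD_colE n h.cap (Col.snd x)
      have h2 := colE_map n h.map_split (Col.fst x)
      simp [colE, colD, h1, h2])

theorem colD_colD : ∀ (n : ℕ) {V H : Type} [Ab V] [Ab H] {O : Ops V H}
    (_ : O.Good) (x : Col n V H), colD n O (colD n O x) = 0
  | 0, _, _, _, _, _, h, x => h.ddV x
  | n + 1, _, _, _, _, O, h, x => Col.ext (colD_colD n h _) (by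
      have h1 := colD_colD n h.cap (Col.snd x)
      have h2 := colD_colE n h.cap (Col.map n O.s O.split (Col.fst x))
      have h3 := colD_map n h.map_split (Col.fst x)
      simp [colD, h1, h2, h3])

theorem map_mem_colG (k : ℤ) : ∀ (n : ℕ) {V H V' H' : Type} [Ab V] [Ab H] [Ab V'] [Ab H']
    {O : Ops V H} {O' : Ops V' H'} {f : V →+ V'} {g : H →+ H'}
    (_ : ∀ i, ∀ x ∈ O.GV (i + k), f x ∈ O'.GV i) (_ : ∀ i, ∀ x ∈ O.GH (i + k), g x ∈ O'.GH i)
    (i : ℤ) (x : Col n V H), x ∈ colG n O (i + k) → Col.map n f g x ∈ colG n O' i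
  | 0, _, _, _, _, _, _, _, _, _, _, _, _, hf, _, i, x, hx => hf i x hx
  | n + 1, _, _, _, _, _, _, _, _, O, O', f, g, hf, hg, i, x, hx =>
    ⟨map_mem_colG k n hf hg i _ hx.1,
      map_mem_colG k n (O := O.cap) (O' := O'.cap) hg (fun i x hx => ⟨hg _ _ hx.1,
        hg _ _ (by rw [add_right_comm]; exact hx.2)⟩) i _ hx.2⟩

theorem colE_mem : ∀ (n : ℕ) {V H : Type} [Ab V] [Ab H] {O : Ops V H}
    (_ : O.Good) (i : ℤ) (x : Col n V H), x ∈ colG n O i → colE n O x ∈ colG n O i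
  | 0, _, _, _, _, _, h, i, x, hx => h.geV i x hx
  | n + 1, _, _, _, _, O, h, i, x, hx =>
    ⟨colE_mem n h i _ hx.1, neg_mem (colE_mem n h.cap i _ hx.2)⟩

theorem map_split_mem (n : ℕ) {V H : Type} [Ab V] [Ab H] {O : Ops V H}
    (h : O.Good) (i : ℤ) (x : Col n V H) (hx : x ∈ colG n O (i + 1)) :
    Col.map n O.s O.split x ∈ colG n O.cap i :=
  map_mem_colG 1 n (O' := O.cap) h.gs (fun i x hx => ⟨h.gT i x hx, hx⟩) i x hx

theorem colD_mem : ∀ (n : ℕ) {V H : Type} [Ab V] [Ab H] {O : Ops V H}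
    (_ : O.Good) (i : ℤ) (x : Col n V H), x ∈ colG n O (i + 1) → colD n O x ∈ colG n O i
  | 0, _, _, _, _, _, h, i, x, hx => h.gdV i x hx
  | n + 1, _, _, _, _, O, h, i, x, hx =>
    ⟨colD_mem n h i _ hx.1, add_mem (colD_mem n h.cap i _ hx.2)
      (colE_mem n h.cap _ _ (map_split_mem n h i _ hx.1))⟩

theorem proj_colD : ∀ (n : ℕ) {V H : Type} [Ab V] [Ab H] (O : Ops V H)
    (x : Col n V H), Col.proj n (colD n O x) = O.dV (Col.proj n x)
  | 0, _, _, _, _, _, _ => rfl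
  | n + 1, _, _, _, _, O, x => proj_colD n O (Col.fst x)

theorem proj_colE : ∀ (n : ℕ) {V H : Type} [Ab V] [Ab H] (O : Ops V H)
    (x : Col n V H), Col.proj n (colE n O x) = O.eV (Col.proj n x)
  | 0, _, _, _, _, _, _ => rfl
  | n + 1, _, _, _, _, O, x => proj_colE n O (Col.fst x)

theorem colE_incl : ∀ (n : ℕ) {V H : Type} [Ab V] [Ab H] (O : Ops V H)
    (v : V), colE n O (Col.incl n v) = Col.incl n (O.eV v)
  | 0, _, _, _, _, _, _ => rfl
  | n + 1, _, _, _, _, O, v => Col.ext (colE_incl n O v) (by simp [colE, Col.incl])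

theorem incl_mem_colG : ∀ (n : ℕ) {V H : Type} [Ab V] [Ab H] (O : Ops V H)
    (i : ℤ) (v : V), v ∈ O.GV i → (Col.incl n v : Col n V H) ∈ colG n O i
  | 0, _, _, _, _, _, _, _, h => h
  | n + 1, _, _, _, _, O, i, v, h => ⟨incl_mem_colG n O i v h, zero_mem (colG n O.cap i)⟩

theorem proj_mem_colG : ∀ (n : ℕ) {V H : Type} [Ab V] [Ab H] (O : Ops V H)
    (i : ℤ) (x : Col n V H), x ∈ colG n O i → Col.proj n x ∈ O.GV i
  | 0, _, _, _, _, _, _, _, h => h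
  | n + 1, _, _, _, _, O, i, x, h => proj_mem_colG n O i (Col.fst x) h.1

/-! ### The simplified column -/

/-- The parity of a simplified column. -/
def smE : (n : ℕ) → {V H : Type} → [Ab V] → [Ab H] → Ops V H →
    (Sm n V H →+ Sm n V H)
  | 0, _, _, _, _, O => O.eV
  | n + 1, _, _, _, _, O => Sm.pair (O.eV.comp Sm.head) (-(smE n O.peel).comp Sm.tail)

/-- The differential of a simplified column. -/
def smD : (n : ℕ) → {V H : Type} → [Ab V] → [Ab H] → Ops V H →
    (Sm n V H →+ Sm n V H)
  | 0, _, _, _, _, O => O.dV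
  | n + 1, _, _, _, _, O => Sm.pair (O.dV.comp Sm.head)
      ((smD n O.peel).comp Sm.tail + (Sm.incl n).comp (O.eH.comp (O.s.comp Sm.head)))

/-- The grading of a simplified column. -/
def smG : (n : ℕ) → {V H : Type} → [Ab V] → [Ab H] → Ops V H → ℤ →
    AddSubgroup (Sm n V H)
  | 0, _, _, _, _, O, i => O.GV i
  | n + 1, _, _, _, _, O, i => (O.GV i).comap Sm.head ⊓ (smG n O.peel i).comap Sm.tail

theorem smE_map : ∀ (n : ℕ) {V H V' H' : Type} [Ab V] [Ab H] [Ab V'] [Ab H'] {O : Ops V H}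
    {O' : Ops V' H'} {f : V →+ V'} {g : H →+ H'}
    (_ : O.Map O' f g) (x : Sm n V H),
    smE n O' (Sm.map n f g x) = Sm.map n f g (smE n O x)
  | 0, _, _, _, _, _, _, _, _, _, _, _, _, h, x => (h.eV x).symm
  | n + 1, _, _, _, _, _, _, _, _, O, O', f, g, h, x =>
    Sm.ext (h.eV _).symm (by
      have := smE_map n h.peel (Sm.tail x)
      simp [smE, Sm.map, this])

theorem smD_map : ∀ (n : ℕ) {V H V' H' : Type} [Ab V] [Ab H] [Ab V'] [Ab H'] {O : Ops V H}
    {O' : Ops V' H'} {f : V →+ V'} {g : H →+ H'}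
    (_ : O.Map O' f g) (x : Sm n V H),
    smD n O' (Sm.map n f g x) = Sm.map n f g (smD n O x)
  | 0, _, _, _, _, _, _, _, _, _, _, _, _, h, x => (h.dV x).symm
  | n + 1, _, _, _, _, _, _, _, _, O, O', f, g, h, x =>
    Sm.ext (h.dV _).symm (by
      have := smD_map n h.peel (Sm.tail x)
      simp [smD, Sm.map, this, Sm.map_incl, h.s, h.eH])

theorem smE_smE : ∀ (n : ℕ) {V H : Type} [Ab V] [Ab H] {O : Ops V H}
    (_ : O.Good) (x : Sm n V H), smE n O (smE n O x) = x
  | 0, _, _, _, _, _, h, x => h.eeV x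
  | n + 1, _, _, _, _, O, h, x => Sm.ext (h.eeV _) (by
      simpa [smE] using smE_smE n h.peel (Sm.tail x))

theorem smE_incl : ∀ (n : ℕ) {V H : Type} [Ab V] [Ab H] (O : Ops V H)
    (v : V), smE n O (Sm.incl n v) = Sm.incl n (O.eV v)
  | 0, _, _, _, _, _, _ => rfl
  | n + 1, _, _, _, _, O, v => Sm.ext rfl (by simp [smE, Sm.incl])

theorem smD_incl_of_s_eq_zero : ∀ (n : ℕ) {V H : Type} [Ab V] [Ab H] (O : Ops V H)
    (v : V), O.s v = 0 → smD n O (Sm.incl n v) = Sm.incl n (O.dV v)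
  | 0, _, _, _, _, _, _, _ => rfl
  | n + 1, _, _, _, _, O, v, h => Sm.ext rfl (by simp [smD, Sm.incl, h])

theorem Ops.Good.peel_s_s {V H : Type} [Ab V] [Ab H] {O : Ops V H}
    (h : O.Good) (v : V) : O.peel.s (O.eH (O.s v)) = 0 := by
  simp [Ops.peel, h.Ye, h.Te, h.Ts]

theorem smD_smE : ∀ (n : ℕ) {V H : Type} [Ab V] [Ab H] {O : Ops V H}
    (_ : O.Good) (x : Sm n V H), smD n O (smE n O x) = -smE n O (smD n O x)
  | 0, _, _, _, _, _, h, x => h.deV x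
  | n + 1, _, _, _, _, O, h, x => Sm.ext (h.deV _) (by
      have h1 := smD_smE n h.peel (Sm.tail x)
      have h2 := smE_incl n O.peel (O.eH (O.s (Sm.head x)))
      have h3 : O.peel.eV = O.eH := rfl
      simp [smE, smD, h1, h2, h3, h.se])

theorem smD_smD : ∀ (n : ℕ) {V H : Type} [Ab V] [Ab H] {O : Ops V H}
    (_ : O.Good) (x : Sm n V H), smD n O (smD n O x) = 0
  | 0, _, _, _, _, _, h, x => h.ddV x
  | n + 1, _, _, _, _, O, h, x => Sm.ext (h.ddV _) (by
      have h1 := smD_smD n h.peel (Sm.tail x)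
      have h2 := smD_incl_of_s_eq_zero n O.peel _ (h.peel_s_s (Sm.head x))
      have h3 : O.peel.dV = O.dH := rfl
      simp [smD, h1, h2, h3, h.sd, h.deH])

theorem incl_mem_smG : ∀ (n : ℕ) {V H : Type} [Ab V] [Ab H] (O : Ops V H)
    (i : ℤ) (v : V), v ∈ O.GV i → (Sm.incl n v : Sm n V H) ∈ smG n O i
  | 0, _, _, _, _, _, _, _, h => h
  | n + 1, _, _, _, _, O, i, _, h => ⟨h, zero_mem (smG n O.peel i)⟩

theorem map_mem_smG (k : ℤ) : ∀ (n : ℕ) {V H V' H' : Type} [Ab V] [Ab H] [Ab V'] [Ab H']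
    {O : Ops V H} {O' : Ops V' H'} {f : V →+ V'} {g : H →+ H'}
    (_ : ∀ i, ∀ x ∈ O.GV (i + k), f x ∈ O'.GV i) (_ : ∀ i, ∀ x ∈ O.GH (i + k), g x ∈ O'.GH i)
    (i : ℤ) (x : Sm n V H), x ∈ smG n O (i + k) → Sm.map n f g x ∈ smG n O' i
  | 0, _, _, _, _, _, _, _, _, _, _, _, _, hf, _, i, x, hx => hf i x hx
  | n + 1, _, _, _, _, _, _, _, _, O, O', f, g, hf, hg, i, x, hx =>
    ⟨hf i _ hx.1, map_mem_smG k n (O := O.peel) (O' := O'.peel) hg hg i _ hx.2⟩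

theorem smE_mem : ∀ (n : ℕ) {V H : Type} [Ab V] [Ab H] {O : Ops V H}
    (_ : O.Good) (i : ℤ) (x : Sm n V H), x ∈ smG n O i → smE n O x ∈ smG n O i
  | 0, _, _, _, _, _, h, i, x, hx => h.geV i x hx
  | n + 1, _, _, _, _, O, h, i, x, hx => ⟨h.geV i _ hx.1, neg_mem (smE_mem n h.peel i _ hx.2)⟩

theorem smD_mem : ∀ (n : ℕ) {V H : Type} [Ab V] [Ab H] {O : Ops V H}
    (_ : O.Good) (i : ℤ) (x : Sm n V H), x ∈ smG n O (i + 1) → smD n O x ∈ smG n O i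
  | 0, _, _, _, _, _, h, i, x, hx => h.gdV i x hx
  | n + 1, _, _, _, _, O, h, i, x, hx =>
    ⟨h.gdV i _ hx.1, add_mem (smD_mem n h.peel i _ hx.2)
      (incl_mem_smG n O.peel i _ (h.geH _ _ (h.gs i _ hx.1)))⟩

theorem map_uncap_mem (n : ℕ) {V H : Type} [Ab V] [Ab H] {O : Ops V H}
    (h : O.Good) (i : ℤ) (x : Col n H (H × H)) (hx : x ∈ colG n O.cap i) :
    Col.map n (idHom H) (Ops.uncap O.T) x ∈ colG n O.peel i := by
  refine map_mem_colG 0 n (O := O.cap) (O' := O.peel) (fun i x hx => ?_) (fun i x hx => ?_) i _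
    (by rwa [add_zero])
  · rw [add_zero] at hx
    exact hx
  · rw [add_zero] at hx
    exact sub_mem hx.1 (h.gT _ _ hx.2)

theorem map_inl_mem (n : ℕ) {V H : Type} [Ab V] [Ab H] (O : Ops V H) (i : ℤ)
    (x : Col n H H) (hx : x ∈ colG n O.peel i) :
    Col.map n (idHom H) (AddMonoidHom.inl H H) x ∈ colG n O.cap i := by
  refine map_mem_colG 0 n (O := O.peel) (O' := O.cap) (fun i x hx => ?_) (fun i x hx => ?_) i _
    (by rwa [add_zero])
  · rw [add_zero] at hx
    exact hx
  · rw [add_zero] at hx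
    exact ⟨hx, zero_mem _⟩

/-- The simplification of a column. -/
def simplify : (n : ℕ) → {V H : Type} → [Ab V] → [Ab H] → (H →+ H) →
    (Col n V H →+ Sm n V H)
  | 0, _, _, _, _, _ => idHom _
  | n + 1, _, H, _, _, T => Sm.pair ((Col.proj n).comp Col.fst)
      ((simplify n (-T)).comp ((Col.map n (idHom H) (Ops.uncap T)).comp Col.snd))

theorem simplify_incl : ∀ (n : ℕ) {V H : Type} [Ab V] [Ab H] (T : H →+ H)
    (v : V), simplify n T (Col.incl n v : Col n V H) = Sm.incl n v
  | 0, _, _, _, _, _, _ => rfl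
  | n + 1, _, _, _, _, T, v => Sm.ext (Col.proj_incl n v) (by simp [simplify, Col.incl, Sm.incl])

theorem simplify_map : ∀ (n : ℕ) {V H V' H' : Type} [Ab V] [Ab H] [Ab V'] [Ab H'] (T : H →+ H)
    (T' : H' →+ H') (f : V →+ V') (g : H →+ H')
    (_ : ∀ x, g (T x) = T' (g x)) (x : Col n V H),
    simplify n T' (Col.map n f g x) = Sm.map n f g (simplify n T x)
  | 0, _, _, _, _, _, _, _, _, _, _, _, _, _, _ => rfl
  | n + 1, V, H, V', H', _, _, _, _, T, T', f, g, h, x => Sm.ext (Col.proj_map n f g _) (by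
      have h1 := simplify_map n (-T) (-T') g g (fun x => by simp [h])
        (Col.map n (idHom H) (Ops.uncap T) (Col.snd x))
      have h2 : (Ops.uncap T').comp (g.prodMap g) = g.comp (Ops.uncap T) :=
        hom_ext fun x => by simp [Ops.uncap, h]
      simp only [simplify, Sm.map, Sm.tail_pair, hom_comp, ← h1, Col.snd_map,
        Col.map_map, h2]
      rfl)

theorem simplify_mem : ∀ (n : ℕ) {V H : Type} [Ab V] [Ab H] {O : Ops V H}
    (_ : O.Good) (i : ℤ) (x : Col n V H), x ∈ colG n O i → simplify n O.T x ∈ smG n O i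
  | 0, _, _, _, _, _, _, _, _, h => h
  | n + 1, _, _, _, _, O, h, i, x, hx =>
    ⟨proj_mem_colG n O i _ hx.1, simplify_mem n h.peel i _
      (map_uncap_mem n h i _ hx.2)⟩

theorem simplify_colD : ∀ (n : ℕ) {V H : Type} [Ab V] [Ab H] {O : Ops V H}
    (_ : O.Good) (x : Col n V H), simplify n O.T (colD n O x) = smD n O (simplify n O.T x)
  | 0, _, _, _, _, _, _, _ => rfl
  | n + 1, V, H, _, _, O, h, x => Sm.ext (proj_colD n O _) (by
      have h1 := simplify_colD n h.peel
        (Col.map n (idHom H) (Ops.uncap O.T) (Col.snd x))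
      have h2 := colD_map n h.map_uncap (Col.snd x)
      have h3 := colE_map n h.map_uncap (Col.map n O.s O.split (Col.fst x))
      have h4 : (Ops.uncap O.T).comp O.split = 0 :=
        hom_ext fun x => by simp [Ops.uncap, Ops.split]
      have h5 : O.peel.T = -O.T := rfl
      have h6 : O.peel.eV = O.eH := rfl
      rw [Col.map_map, h4, Col.map_zero_right, colE_incl] at h3
      rw [h2, h5] at h1
      simp only [simplify, smD, colD, Sm.tail_pair, Sm.head_pair, Col.snd_pair,
        hom_comp, hom_add, map_add, h1, ← h3, simplify_incl, h6]
      rfl)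

theorem simplify_surj : ∀ (n : ℕ) {V H : Type} [Ab V] [Ab H] {O : Ops V H}
    (_ : O.Good) (i : ℤ) (y : Sm n V H), y ∈ smG n O i → ∃ x ∈ colG n O i, simplify n O.T x = y
  | 0, _, _, _, _, _, _, _, y, hy => ⟨y, hy, rfl⟩
  | n + 1, V, H, _, _, O, h, i, y, hy => by
    obtain ⟨x, hx, e⟩ := simplify_surj n h.peel i (Sm.tail y) hy.2
    obtain ⟨z, hz1, hz2⟩ := Col.exists_mk (Col.incl n (Sm.head y) : Col n V H)
      (Col.map n (idHom H) (AddMonoidHom.inl H H) x)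
    refine ⟨z, ⟨?_, ?_⟩, Sm.ext ?_ ?_⟩
    · change Col.fst z ∈ colG n O i
      rw [hz1]
      exact incl_mem_colG n O i _ hy.1
    · change Col.snd z ∈ colG n O.cap i
      rw [hz2]
      exact map_inl_mem n O i x hx
    · simp [simplify, hz1, Col.proj_incl]
    · have h2 : (Ops.uncap O.T).comp (AddMonoidHom.inl H H) = idHom H :=
        hom_ext fun x => by simp [Ops.uncap]
      simp only [simplify, Sm.tail_pair, hom_comp, hz2, Col.map_map, h2]
      rw [← e]
      exact congrArg _ (Col.map_id n x)

theorem simplify_acyclic : ∀ (n : ℕ) {V H : Type} [Ab V] [Ab H] {O : Ops V H}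
    (_ : O.Good) (i : ℤ) (x : Col n V H), x ∈ colG n O i → simplify n O.T x = 0 →
    colD n O x = 0 → ∃ y ∈ colG n O (i + 1), simplify n O.T y = 0 ∧ colD n O y = x
  | 0, _, _, _, _, _, _, _, x, _, hx, _ => ⟨0, zero_mem _, rfl, by
      rw [map_zero]
      exact Eq.symm hx⟩
  | n + 1, V, H, _, _, O, h, i, x, hG, hx, hd => by
    let P : Col n H (H × H) →+ Col n H H := Col.map n (idHom H) (Ops.uncap O.T)
    have hP0 : simplify n O.peel.T (P (Col.snd x)) = 0 := congrArg Sm.tail hx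
    have hPG : P (Col.snd x) ∈ colG n O.peel i :=
      map_uncap_mem n h i _ hG.2
    have hv : Col.proj n (Col.fst x) = 0 := congrArg Sm.head hx
    have hd1 : colD n O (Col.fst x) = 0 := congrArg Col.fst hd
    have hd2 : colD n O.cap (Col.snd x) + colE n O.cap (Col.map n O.s O.split (Col.fst x)) = 0 :=
      congrArg Col.snd hd
    have h4 : (Ops.uncap O.T).comp O.split = 0 :=
      hom_ext fun x => by simp [Ops.uncap, Ops.split]
    have hPd : colD n O.peel (P (Col.snd x)) = 0 := by
      have := congrArg P hd2
      rw [map_add, ← colD_map n h.map_uncap, ← colE_map n h.map_uncap, Col.map_map, h4,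
        Col.map_zero_right, hom_comp, hv] at this
      simpa using this
    obtain ⟨w, hwG, hw0, hwd⟩ := simplify_acyclic n h.peel i _ hPG hP0 hPd
    let w' : Col n H (H × H) := Col.map n (idHom H) (AddMonoidHom.inl H H) w
    have hw' : w' ∈ colG n O.cap (i + 1) :=
      map_inl_mem n O (i + 1) w hwG
    have h2 : (Ops.uncap O.T).comp (AddMonoidHom.inl H H) = idHom H :=
      hom_ext fun x => by simp [Ops.uncap]
    have hPw : P w' = w := by
      change Col.map n _ _ (Col.map n _ _ w) = w
      rw [Col.map_map, h2]
      exact Col.map_id n w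
    let y := Col.snd x - colD n O.cap w'
    have hPy : P y = 0 := by
      rw [map_sub, ← colD_map n h.map_uncap, hPw, hwd, sub_self]
    have hyG : y ∈ colG n O.cap i := sub_mem hG.2 (colD_mem n h.cap i _ hw')
    let u : Col n V H := Col.map n 0 (AddMonoidHom.snd H H) y
    have hu : u ∈ colG n O (i + 1) :=
      map_mem_colG (-1) n (O := O.cap) (O' := O) (fun i x hx => zero_mem _)
        (fun i x hx => by simpa using hx.2) (i + 1) y (by simpa using hyG)
    have hu0 : Col.proj n u = 0 := Col.proj_map n _ _ y
    have huy : Col.map n O.s O.split u = y := by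
      have e := Col.map_add n (0 : H →+ H) (idHom H)
        (O.split.comp (AddMonoidHom.snd H H)) ((AddMonoidHom.inl H H).comp (Ops.uncap O.T)) y
      have e1 : O.split.comp (AddMonoidHom.snd H H) + (AddMonoidHom.inl H H).comp (Ops.uncap O.T)
          = idHom (H × H) := hom_ext fun x =>
        Prod.ext (by simp [Ops.uncap, Ops.split]) (by simp [Ops.uncap, Ops.split])
      have e2 : Col.map n (idHom H) ((AddMonoidHom.inl H H).comp (Ops.uncap O.T)) y
          = Col.map n (idHom H) (AddMonoidHom.inl H H) (P y) := by
        rw [show P y = Col.map n (idHom H) (Ops.uncap O.T) y from rfl, Col.map_map]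
        rfl
      rw [e1, zero_add, Col.map_id, e2, hPy, map_zero, add_zero] at e
      rw [e, show u = Col.map n (0 : H →+ V) (AddMonoidHom.snd H H) y from rfl, Col.map_map,
        comp_zero]
    have hdu : colD n O u + colE n O (Col.fst x) = 0 := by
      refine Col.eq_zero_of_map_eq_zero n O.s O.split (AddMonoidHom.snd H H) rfl _ ?_ ?_
      · rw [map_add, proj_colD, proj_colE, hu0, hv]
        simp
      · rw [map_add, ← colD_map n h.map_split, ← colE_map n h.map_split, huy, map_sub,
          colD_colD n h.cap, sub_zero, hd2]
    obtain ⟨z, hz1, hz2⟩ := Col.exists_mk (colE n O u) w'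
    refine ⟨z, ⟨?_, ?_⟩, Sm.ext ?_ ?_, Col.ext ?_ ?_⟩
    · change Col.fst z ∈ colG n O (i + 1)
      rw [hz1]
      exact colE_mem n h _ _ hu
    · change Col.snd z ∈ colG n O.cap (i + 1)
      rw [hz2]
      exact hw'
    · change Col.proj n (Col.fst z) = 0
      rw [hz1, proj_colE, hu0, map_zero]
    · change simplify n O.peel.T (P (Col.snd z)) = 0
      rw [hz2, hPw, hw0]
    · change colD n O (Col.fst z) = _
      rw [hz1, colD_colE n h, eq_neg_of_add_eq_zero_left hdu, map_neg, colE_colE n h, neg_neg]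
    · change colD n O.cap (Col.snd z) + colE n O.cap (Col.map n O.s O.split (Col.fst z)) = _
      rw [hz1, hz2, ← colE_map n h.map_split, huy, colE_colE n h.cap]
      exact add_sub_cancel _ _

/-- A column is quasi-isomorphic to its simplification. -/
theorem simplify_qSurj (n : ℕ) {V H : Type} [Ab V] [Ab H] {O : Ops V H}
    (h : O.Good) : QSurj (colD n O) (colG n O) (smD n O) (smG n O) (simplify n O.T) :=
  ⟨simplify_colD n h, simplify_mem n h, simplify_surj n h, simplify_acyclic n h⟩

theorem QSurj.sm_map : ∀ (n : ℕ) {V H V' H' : Type} [Ab V] [Ab H] [Ab V'] [Ab H'] {O : Ops V H}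
    {O' : Ops V' H'} {f : V →+ V'} {g : H →+ H'}
    (_ : O.Good) (_ : O.Map O' f g) (_ : QSurj O.dV O.GV O'.dV O'.GV f)
    (_ : QSurj O.dH O.GH O'.dH O'.GH g),
    QSurj (smD n O) (smG n O) (smD n O') (smG n O') (Sm.map n f g)
  | 0, _, _, _, _, _, _, _, _, _, _, _, _, _, _, hf, _ => hf
  | n + 1, V, H, V', H', _, _, _, _, O, O', f, g, h, hm, hf, hg => by
    have ih := QSurj.sm_map n h.peel hm.peel hg hg
    refine ⟨fun x => (smD_map _ hm x).symm, fun i x hx => ⟨hf.deg _ _ hx.1, ih.deg _ _ hx.2⟩,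
      fun i y hy => ?_, fun i x hx hx0 hdx => ?_⟩
    · obtain ⟨a, ha, e1⟩ := hf.surj _ _ hy.1
      obtain ⟨b, hb, e2⟩ := ih.surj _ _ hy.2
      exact ⟨(a, b), ⟨ha, hb⟩, Sm.ext e1 e2⟩
    · obtain ⟨a, ha, ha0, e1⟩ := hf.acyclic _ _ hx.1 (congrArg Sm.head hx0) (congrArg Sm.head hdx)
      have hd2 : smD n O.peel (Sm.tail x) + Sm.incl n (O.eH (O.s (Sm.head x))) = 0 :=
        congrArg Sm.tail hdx
      have hi : smD n O.peel (Sm.incl n (O.eH (O.s a))) = -Sm.incl n (O.eH (O.s (Sm.head x))) := by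
        rw [smD_incl_of_s_eq_zero n O.peel _ (h.peel_s_s a)]
        change Sm.incl n (O.dH _) = _
        rw [h.deH, ← h.sd, e1, map_neg]
      obtain ⟨b, hb, hb0, e2⟩ := ih.acyclic i (Sm.tail x - Sm.incl n (O.eH (O.s a)))
        (sub_mem hx.2 (incl_mem_smG n O.peel i _ (h.geH _ _ (h.gs _ _ ha))))
        (by
          rw [map_sub, Sm.map_incl, hm.eH, hm.s, ha0, map_zero, map_zero, map_zero, sub_zero]
          exact congrArg Sm.tail hx0)
        (by rw [map_sub, hi, sub_neg_eq_add, hd2])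
      refine ⟨(a, b), ⟨ha, hb⟩, Sm.ext ha0 hb0, Sm.ext e1 ?_⟩
      change smD n O.peel b + Sm.incl n (O.eH (O.s a)) = _
      rw [e2, sub_add_cancel]

theorem QInj.sm_map : ∀ (n : ℕ) {V H V' H' : Type} [Ab V] [Ab H] [Ab V'] [Ab H'] {O : Ops V H}
    {O' : Ops V' H'} {f : V →+ V'} {g : H →+ H'}
    (_ : O.Good) (_ : O'.Good) (_ : O.Map O' f g) (_ : QInj O.dV O.GV O'.dV O'.GV f)
    (_ : QInj O.dH O.GH O'.dH O'.GH g),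
    QInj (smD n O) (smG n O) (smD n O') (smG n O') (Sm.map n f g)
  | 0, _, _, _, _, _, _, _, _, _, _, _, _, _, _, _, hf, _ => hf
  | n + 1, V, H, V', H', _, _, _, _, O, O', f, g, h, h', hm, hf, hg => by
    have ih := QInj.sm_map n h.peel h'.peel hm.peel hg hg
    refine ⟨fun x => (smD_map _ hm x).symm, fun i x hx => ⟨hf.deg _ _ hx.1, ih.deg _ _ hx.2⟩,
      fun x hx => Sm.ext (hf.inj _ (congrArg Sm.head hx)) (ih.inj _ (congrArg Sm.tail hx)),
      fun i x hx ⟨y, hy⟩ => ?_⟩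
    obtain ⟨a, ha, v, hv, e1⟩ := hf.acyclic _ _ hx.1 ⟨Sm.head y, congrArg Sm.head hy⟩
    have hy2 : Sm.map n g g (Sm.tail y) =
        smD n O'.peel (Sm.tail x) + Sm.incl n (O'.eH (O'.s (Sm.head x))) := congrArg Sm.tail hy
    have hi : smD n O'.peel (Sm.incl n (O'.eH (O'.s a))) = -Sm.incl n (O'.eH (O'.s (O'.dV a))) := by
      rw [smD_incl_of_s_eq_zero n O'.peel _ (h'.peel_s_s a)]
      change Sm.incl n (O'.dH _) = _
      rw [h'.deH, ← h'.sd, map_neg]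
    obtain ⟨b, hb, w, hw, e2⟩ := ih.acyclic i (Sm.tail x - Sm.incl n (O'.eH (O'.s a)))
      (sub_mem hx.2 (incl_mem_smG n O'.peel i _ (h'.geH _ _ (h'.gs _ _ ha))))
      ⟨Sm.tail y - Sm.incl n (O.eH (O.s v)), by
        rw [map_sub, hy2, map_sub, hi, e1, Sm.map_incl, hm.eH, hm.s, map_add, map_add, map_add]
        abel⟩
    refine ⟨(a, b), ⟨ha, hb⟩, (v, w), ⟨hv, hw⟩, Sm.ext e1 ?_⟩
    change _ = (smD n O'.peel b + Sm.incl n (O'.eH (O'.s a))) + Sm.map n g g w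
    rw [add_right_comm, ← e2, sub_add_cancel]

/-! ### Columns with the horizontal resolution first -/

/-- The operations used to form the complex of a column whose `0`-smoothing is horizontal. -/
structure MOps (V H : Type) [Ab V] [Ab H] where
  dV : V →+ V
  dH : H →+ H
  eV : V →+ V
  eH : H →+ H
  s : H →+ V
  T : H →+ H
  Y : H →+ H
  GV : ℤ → AddSubgroup V
  GH : ℤ → AddSubgroup H

namespace MOps

/-- The relations between the operations. -/
structure Good {V H : Type} [Ab V] [Ab H] (O : MOps V H) : Prop where
  ddV : ∀ x, O.dV (O.dV x) = 0
  ddH : ∀ x, O.dH (O.dH x) = 0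
  eeV : ∀ x, O.eV (O.eV x) = x
  eeH : ∀ x, O.eH (O.eH x) = x
  deV : ∀ x, O.dV (O.eV x) = -O.eV (O.dV x)
  deH : ∀ x, O.dH (O.eH x) = -O.eH (O.dH x)
  sd : ∀ x, O.s (O.dH x) = O.dV (O.s x)
  se : ∀ x, O.s (O.eH x) = O.eV (O.s x)
  Td : ∀ x, O.T (O.dH x) = O.dH (O.T x)
  Te : ∀ x, O.T (O.eH x) = O.eH (O.T x)
  Yd : ∀ x, O.Y (O.dH x) = O.dH (O.Y x)
  Ye : ∀ x, O.Y (O.eH x) = O.eH (O.Y x)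
  sT : ∀ x, O.s (O.T x) = O.s (O.Y x)
  TT : ∀ x, O.T (O.T x) = 0
  YY : ∀ x, O.Y (O.Y x) = 0
  TY : ∀ x, O.T (O.Y x) = O.Y (O.T x)
  gdV : ∀ i, ∀ x ∈ O.GV (i + 1), O.dV x ∈ O.GV i
  gdH : ∀ i, ∀ x ∈ O.GH (i + 1), O.dH x ∈ O.GH i
  geV : ∀ i, ∀ x ∈ O.GV i, O.eV x ∈ O.GV i
  geH : ∀ i, ∀ x ∈ O.GH i, O.eH x ∈ O.GH i
  gs : ∀ i, ∀ x ∈ O.GH (i + 1), O.s x ∈ O.GV i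
  gT : ∀ i, ∀ x ∈ O.GH (i + 1), O.T x ∈ O.GH i
  gY : ∀ i, ∀ x ∈ O.GH (i + 1), O.Y x ∈ O.GH i

/-- A pair of maps that commute with the operations. -/
structure Map {V H V' H' : Type} [Ab V] [Ab H] [Ab V'] [Ab H'] (O : MOps V H) (O' : MOps V' H')
    (f : V →+ V') (g : H →+ H') : Prop where
  dV : ∀ x, f (O.dV x) = O'.dV (f x)
  dH : ∀ x, g (O.dH x) = O'.dH (g x)
  eV : ∀ x, f (O.eV x) = O'.eV (f x)
  eH : ∀ x, g (O.eH x) = O'.eH (g x)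
  s : ∀ x, f (O.s x) = O'.s (g x)
  T : ∀ x, g (O.T x) = O'.T (g x)
  Y : ∀ x, g (O.Y x) = O'.Y (g x)

section

variable {V H V' H' : Type} [Ab V] [Ab H] [Ab V'] [Ab H']

/-- The operations below a crossing that is resolved horizontally. -/
def cap (O : MOps V H) : MOps H (H × H) where
  dV := O.dH
  dH := O.dH.prodMap O.dH
  eV := O.eH
  eH := O.eH.prodMap O.eH
  s := (idHom H).coprod O.Y
  T := (0 : H × H →+ H).prod (AddMonoidHom.fst H H)
  Y := O.Y.prodMap O.Y
  GV := O.GH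
  GH i := (O.GH (i - 1)).prod (O.GH i)

/-- The operations after the top crossing of a column has been simplified. -/
def peel (O : MOps V H) : MOps H H where
  dV := O.dH
  dH := O.dH
  eV := O.eH
  eH := O.eH
  s := O.Y - O.T
  T := -O.T
  Y := O.Y
  GV := O.GH
  GH := O.GH

/-- The product at the upper arc. -/
def merge (O : MOps V H) : H × H →+ H := (idHom H).coprod O.T

/-- Insertion of a circle below the top crossing, which acts as minus the upper arc. -/
def incap (T : H →+ H) : H →+ H × H := (-T).prod (idHom H)

theorem Good.cap {O : MOps V H} (h : O.Good) : O.cap.Good where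
  ddV := h.ddH
  ddH x := Prod.ext (h.ddH _) (h.ddH _)
  eeV := h.eeH
  eeH x := Prod.ext (h.eeH _) (h.eeH _)
  deV := h.deH
  deH x := Prod.ext (h.deH _) (h.deH _)
  sd x := by simp [MOps.cap, h.Yd]
  se x := by simp [MOps.cap, h.Ye]
  Td x := Prod.ext (map_zero O.dH).symm rfl
  Te x := Prod.ext (map_zero O.eH).symm rfl
  Yd x := Prod.ext (h.Yd _) (h.Yd _)
  Ye x := Prod.ext (h.Ye _) (h.Ye _)
  sT x := by simp [MOps.cap, h.YY]
  TT x := rfl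
  YY x := Prod.ext (h.YY _) (h.YY _)
  TY x := Prod.ext (map_zero O.Y).symm rfl
  gdV := h.gdH
  gdH i x hx := ⟨h.gdH _ _ (by simpa using hx.1), h.gdH _ _ hx.2⟩
  geV := h.geH
  geH i x hx := ⟨h.geH _ _ hx.1, h.geH _ _ hx.2⟩
  gs i x hx := add_mem (add_sub_cancel_right i 1 ▸ hx.1) (h.gY _ _ hx.2)
  gT i x hx := ⟨zero_mem _, add_sub_cancel_right i 1 ▸ hx.1⟩
  gY i x hx := ⟨h.gY _ _ (by simpa using hx.1), h.gY _ _ hx.2⟩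

theorem Good.peel {O : MOps V H} (h : O.Good) : O.peel.Good where
  ddV := h.ddH
  ddH := h.ddH
  eeV := h.eeH
  eeH := h.eeH
  deV := h.deH
  deH := h.deH
  sd x := by simp [MOps.peel, h.Yd, h.Td]
  se x := by simp [MOps.peel, h.Ye, h.Te]
  Td x := by simp [MOps.peel, h.Td]
  Te x := by simp [MOps.peel, h.Te]
  Yd := h.Yd
  Ye := h.Ye
  sT x := by simp [MOps.peel, h.TY, h.TT, h.YY]
  TT x := by simp [MOps.peel, h.TT]
  YY := h.YY
  TY x := by simp [MOps.peel, h.TY]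
  gdV := h.gdH
  gdH := h.gdH
  geV := h.geH
  geH := h.geH
  gs i x hx := sub_mem (h.gY _ _ hx) (h.gT _ _ hx)
  gT i x hx := neg_mem (h.gT _ _ hx)
  gY := h.gY

theorem Map.cap {O : MOps V H} {O' : MOps V' H'} {f : V →+ V'} {g : H →+ H'} (h : O.Map O' f g) :
    O.cap.Map O'.cap g (g.prodMap g) where
  dV := h.dH
  dH x := Prod.ext (h.dH _) (h.dH _)
  eV := h.eH
  eH x := Prod.ext (h.eH _) (h.eH _)
  s x := by simp [MOps.cap, h.Y]
  T x := Prod.ext (map_zero g) rfl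
  Y x := Prod.ext (h.Y _) (h.Y _)

theorem Map.peel {O : MOps V H} {O' : MOps V' H'} {f : V →+ V'} {g : H →+ H'} (h : O.Map O' f g) :
    O.peel.Map O'.peel g g where
  dV := h.dH
  dH := h.dH
  eV := h.eH
  eH := h.eH
  s x := by simp [MOps.peel, h.Y, h.T]
  T x := by simp [MOps.peel, h.T]
  Y := h.Y

theorem Good.map_merge {O : MOps V H} (h : O.Good) : O.cap.Map O O.s O.merge where
  dV := h.sd
  dH x := by simp [MOps.cap, MOps.merge, h.Td]
  eV := h.se
  eH x := by simp [MOps.cap, MOps.merge, h.Te]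
  s x := by simp [MOps.cap, MOps.merge, h.sT]
  T x := by simp [MOps.cap, MOps.merge, h.TT]
  Y x := by simp [MOps.cap, MOps.merge, h.TY]

theorem Good.map_incap {O : MOps V H} (h : O.Good) :
    O.peel.Map O.cap (idHom H) (incap O.T) where
  dV x := rfl
  dH x := Prod.ext (by simp [incap, MOps.peel, MOps.cap, h.Td]) rfl
  eV x := rfl
  eH x := Prod.ext (by simp [incap, MOps.peel, MOps.cap, h.Te]) rfl
  s x := by simp [incap, MOps.peel, MOps.cap, sub_eq_neg_add]
  T x := Prod.ext (by simp [incap, MOps.peel, MOps.cap, h.TT]) rfl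
  Y x := Prod.ext (by simp [incap, MOps.peel, MOps.cap, h.TY]) rfl

end

end MOps

/-- The parity of a column. -/
def mcolE : (n : ℕ) → {V H : Type} → [Ab V] → [Ab H] → MOps V H →
    (Col n V H →+ Col n V H)
  | 0, _, _, _, _, O => O.eV
  | n + 1, _, _, _, _, O => Col.pair (-(mcolE n O).comp Col.fst) ((mcolE n O.cap).comp Col.snd)

/-- The differential of a column. -/
def mcolD : (n : ℕ) → {V H : Type} → [Ab V] → [Ab H] → MOps V H →
    (Col n V H →+ Col n V H)
  | 0, _, _, _, _, O => O.dV
  | n + 1, _, _, _, _, O => Col.pair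
      ((mcolD n O).comp Col.fst + (mcolE n O).comp ((Col.map n O.s O.merge).comp Col.snd))
      ((mcolD n O.cap).comp Col.snd)

/-- The grading of a column. -/
def mcolG : (n : ℕ) → {V H : Type} → [Ab V] → [Ab H] → MOps V H → ℤ →
    AddSubgroup (Col n V H)
  | 0, _, _, _, _, O, i => O.GV i
  | n + 1, _, _, _, _, O, i => (mcolG n O i).comap Col.fst ⊓ (mcolG n O.cap i).comap Col.snd

theorem mcolE_map : ∀ (n : ℕ) {V H V' H' : Type} [Ab V] [Ab H] [Ab V'] [Ab H'] {O : MOps V H}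
    {O' : MOps V' H'} {f : V →+ V'}
    {g : H →+ H'} (_ : ∀ x, f (O.eV x) = O'.eV (f x)) (_ : ∀ x, g (O.eH x) = O'.eH (g x))
    (x : Col n V H), mcolE n O' (Col.map n f g x) = Col.map n f g (mcolE n O x)
  | 0, _, _, _, _, _, _, _, _, _, _, _, _, h, _, x => (h x).symm
  | n + 1, _, _, _, _, _, _, _, _, O, O', f, g, hf, hg, x =>
    Col.ext (by simp [mcolE, mcolE_map n hf hg]) (mcolE_map n (O := O.cap) (O' := O'.cap) hg
      (fun x => Prod.ext (hg _) (hg _)) _)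

theorem mcolD_map : ∀ (n : ℕ) {V H V' H' : Type} [Ab V] [Ab H] [Ab V'] [Ab H'] {O : MOps V H}
    {O' : MOps V' H'} {f : V →+ V'} {g : H →+ H'}
    (_ : O.Map O' f g) (x : Col n V H),
    mcolD n O' (Col.map n f g x) = Col.map n f g (mcolD n O x)
  | 0, _, _, _, _, _, _, _, _, _, _, _, _, h, x => (h.dV x).symm
  | n + 1, V, H, V', H', _, _, _, _, O, O', f, g, h, x =>
    Col.ext (by
      have h1 := mcolD_map n h (Col.fst x)
      have h2 := mcolE_map n h.eV h.eH (Col.map n O.s O.merge (Col.snd x))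
      have h3 : O'.s.comp g = f.comp O.s := hom_ext fun x => (h.s x).symm
      have h4 : O'.merge.comp (g.prodMap g) = g.comp O.merge :=
        hom_ext fun x => by simp [MOps.merge, h.T]
      simp only [mcolD, Col.fst_pair, Col.snd_map, Col.fst_map, hom_add,
        hom_comp, map_add, h1, ← h2, Col.map_map, h3, h4]) (mcolD_map n h.cap _)

theorem mcolE_mcolE : ∀ (n : ℕ) {V H : Type} [Ab V] [Ab H] {O : MOps V H}
    (_ : O.Good) (x : Col n V H), mcolE n O (mcolE n O x) = x
  | 0, _, _, _, _, _, h, x => h.eeV x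
  | n + 1, _, _, _, _, O, h, x => Col.ext (by
      simpa [mcolE] using mcolE_mcolE n h (Col.fst x)) (mcolE_mcolE n h.cap _)

theorem mcolD_mcolE : ∀ (n : ℕ) {V H : Type} [Ab V] [Ab H] {O : MOps V H}
    (_ : O.Good) (x : Col n V H), mcolD n O (mcolE n O x) = -mcolE n O (mcolD n O x)
  | 0, _, _, _, _, _, h, x => h.deV x
  | n + 1, _, _, _, _, O, h, x => Col.ext (by
      have h1 := mcolD_mcolE n h (Col.fst x)
      have h2 := mcolE_map n h.map_merge.eV h.map_merge.eH (Col.snd x)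
      simp [mcolE, mcolD, h1, h2]) (mcolD_mcolE n h.cap _)

theorem mcolD_mcolD : ∀ (n : ℕ) {V H : Type} [Ab V] [Ab H] {O : MOps V H}
    (_ : O.Good) (x : Col n V H), mcolD n O (mcolD n O x) = 0
  | 0, _, _, _, _, _, h, x => h.ddV x
  | n + 1, _, _, _, _, O, h, x => Col.ext (by
      have h1 := mcolD_mcolD n h (Col.fst x)
      have h2 := mcolD_mcolE n h (Col.map n O.s O.merge (Col.snd x))
      have h3 := mcolD_map n h.map_merge (Col.snd x)
      simp [mcolD, h1, h2, h3]) (mcolD_mcolD n h.cap _)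

theorem map_mem_mcolG (k : ℤ) : ∀ (n : ℕ) {V H V' H' : Type} [Ab V] [Ab H] [Ab V'] [Ab H']
    {O : MOps V H} {O' : MOps V' H'} {f : V →+ V'} {g : H →+ H'}
    (_ : ∀ i, ∀ x ∈ O.GV (i + k), f x ∈ O'.GV i) (_ : ∀ i, ∀ x ∈ O.GH (i + k), g x ∈ O'.GH i)
    (i : ℤ) (x : Col n V H), x ∈ mcolG n O (i + k) → Col.map n f g x ∈ mcolG n O' i
  | 0, _, _, _, _, _, _, _, _, _, _, _, _, hf, _, i, x, hx => hf i x hx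
  | n + 1, _, _, _, _, _, _, _, _, O, O', f, g, hf, hg, i, x, hx =>
    ⟨map_mem_mcolG k n hf hg i _ hx.1,
      map_mem_mcolG k n (O := O.cap) (O' := O'.cap) hg (fun i x hx =>
        ⟨hg _ _ (by rw [← add_sub_right_comm]; exact hx.1), hg _ _ hx.2⟩) i _ hx.2⟩

theorem mcolE_mem : ∀ (n : ℕ) {V H : Type} [Ab V] [Ab H] {O : MOps V H}
    (_ : O.Good) (i : ℤ) (x : Col n V H), x ∈ mcolG n O i → mcolE n O x ∈ mcolG n O i
  | 0, _, _, _, _, _, h, i, x, hx => h.geV i x hx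
  | n + 1, _, _, _, _, O, h, i, x, hx =>
    ⟨neg_mem (mcolE_mem n h i _ hx.1), mcolE_mem n h.cap i _ hx.2⟩

theorem map_merge_mem (n : ℕ) {V H : Type} [Ab V] [Ab H] {O : MOps V H}
    (h : O.Good) (i : ℤ) (x : Col n H (H × H)) (hx : x ∈ mcolG n O.cap (i + 1)) :
    Col.map n O.s O.merge x ∈ mcolG n O i :=
  map_mem_mcolG 1 n (O := O.cap) h.gs (fun i x hx =>
    add_mem (by simpa using hx.1) (h.gT i _ hx.2)) i x hx

theorem mcolD_mem : ∀ (n : ℕ) {V H : Type} [Ab V] [Ab H] {O : MOps V H}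
    (_ : O.Good) (i : ℤ) (x : Col n V H), x ∈ mcolG n O (i + 1) → mcolD n O x ∈ mcolG n O i
  | 0, _, _, _, _, _, h, i, x, hx => h.gdV i x hx
  | n + 1, _, _, _, _, O, h, i, x, hx =>
    ⟨add_mem (mcolD_mem n h i _ hx.1) (mcolE_mem n h _ _ (map_merge_mem n h i _ hx.2)),
      mcolD_mem n h.cap i _ hx.2⟩

theorem mcolE_incl : ∀ (n : ℕ) {V H : Type} [Ab V] [Ab H] (O : MOps V H)
    (v : V), mcolE n O (Col.incl n v) = Col.incl n ((-1 : ℤ) ^ n • O.eV v)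
  | 0, _, _, _, _, _, _ => (by rw [pow_zero, one_smul]; rfl)
  | n + 1, _, _, _, _, O, v => Col.ext (by simp [mcolE, Col.incl, mcolE_incl n, pow_succ])
      (by simp [mcolE, Col.incl])

theorem mcolD_incl : ∀ (n : ℕ) {V H : Type} [Ab V] [Ab H] (O : MOps V H)
    (v : V), mcolD n O (Col.incl n v) = Col.incl n (O.dV v)
  | 0, _, _, _, _, _, _ => rfl
  | n + 1, _, _, _, _, O, v => Col.ext (by simp [mcolD, Col.incl, mcolD_incl n])
      (by simp [mcolD, Col.incl])

theorem incl_mem_mcolG : ∀ (n : ℕ) {V H : Type} [Ab V] [Ab H] (O : MOps V H)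
    (i : ℤ) (v : V), v ∈ O.GV i → (Col.incl n v : Col n V H) ∈ mcolG n O i
  | 0, _, _, _, _, _, _, _, h => h
  | n + 1, _, _, _, _, O, i, v, h => ⟨incl_mem_mcolG n O i v h, zero_mem (mcolG n O.cap i)⟩

theorem proj_mem_mcolG : ∀ (n : ℕ) {V H : Type} [Ab V] [Ab H] (O : MOps V H)
    (i : ℤ) (x : Col n V H), x ∈ mcolG n O i → Col.proj n x ∈ O.GV i
  | 0, _, _, _, _, _, _, _, h => h
  | n + 1, _, _, _, _, O, i, x, h => proj_mem_mcolG n O i (Col.fst x) h.1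

/-! ### The simplified column -/

/-- The parity of a simplified column. -/
def msmE : (n : ℕ) → {V H : Type} → [Ab V] → [Ab H] → MOps V H →
    (Sm n V H →+ Sm n V H)
  | 0, _, _, _, _, O => O.eV
  | n + 1, _, _, _, _, O =>
    Sm.pair ((-1 : ℤ) ^ (n + 1) • O.eV.comp Sm.head) ((msmE n O.peel).comp Sm.tail)

/-- The differential of a simplified column. -/
def msmD : (n : ℕ) → {V H : Type} → [Ab V] → [Ab H] → MOps V H →
    (Sm n V H →+ Sm n V H)
  | 0, _, _, _, _, O => O.dV
  | n + 1, _, _, _, _, O => Sm.pair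
      (O.dV.comp Sm.head + (-1 : ℤ) ^ n • O.eV.comp (O.s.comp ((Sm.proj n).comp Sm.tail)))
      ((msmD n O.peel).comp Sm.tail)

/-- The grading of a simplified column. -/
def msmG : (n : ℕ) → {V H : Type} → [Ab V] → [Ab H] → MOps V H → ℤ →
    AddSubgroup (Sm n V H)
  | 0, _, _, _, _, O, i => O.GV i
  | n + 1, _, _, _, _, O, i => (O.GV i).comap Sm.head ⊓ (msmG n O.peel i).comap Sm.tail

theorem msmG_eq_smG : ∀ (n : ℕ) {V H : Type} [Ab V] [Ab H] {O : MOps V H} {O' : Ops V H}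
    (_ : O.GV = O'.GV) (_ : O.GH = O'.GH) (i : ℤ), msmG n O i = smG n O' i
  | 0, _, _, _, _, _, _, hV, _, i => congrFun hV i
  | n + 1, _, _, _, _, O, O', hV, hH, i => by
    rw [msmG, smG, hV, msmG_eq_smG n (O := O.peel) (O' := O'.peel) hH hH]

/-- The gradings, without the operations. -/
def MOps.toOps {V H : Type} [Ab V] [Ab H] (O : MOps V H) : Ops V H :=
  ⟨0, 0, 0, 0, 0, 0, 0, O.GV, O.GH⟩

theorem msmG_eq (n : ℕ) {V H : Type} [Ab V] [Ab H] (O : MOps V H) (i : ℤ) :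
    msmG n O i = smG n O.toOps i := msmG_eq_smG n rfl rfl i

theorem msmE_map : ∀ (n : ℕ) {V H V' H' : Type} [Ab V] [Ab H] [Ab V'] [Ab H'] {O : MOps V H}
    {O' : MOps V' H'} {f : V →+ V'} {g : H →+ H'}
    (_ : O.Map O' f g) (x : Sm n V H),
    msmE n O' (Sm.map n f g x) = Sm.map n f g (msmE n O x)
  | 0, _, _, _, _, _, _, _, _, _, _, _, _, h, x => (h.eV x).symm
  | n + 1, _, _, _, _, _, _, _, _, O, O', f, g, h, x =>
    Sm.ext (by simp [msmE, Sm.map, h.eV]) (msmE_map n h.peel _)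

theorem msmD_map : ∀ (n : ℕ) {V H V' H' : Type} [Ab V] [Ab H] [Ab V'] [Ab H'] {O : MOps V H}
    {O' : MOps V' H'} {f : V →+ V'} {g : H →+ H'}
    (_ : O.Map O' f g) (x : Sm n V H),
    msmD n O' (Sm.map n f g x) = Sm.map n f g (msmD n O x)
  | 0, _, _, _, _, _, _, _, _, _, _, _, _, h, x => (h.dV x).symm
  | n + 1, _, _, _, _, _, _, _, _, O, O', f, g, h, x =>
    Sm.ext (by simp [msmD, Sm.map, Sm.proj_map, h.dV, h.eV, h.s]) (msmD_map n h.peel _)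

theorem msmE_msmE : ∀ (n : ℕ) {V H : Type} [Ab V] [Ab H] {O : MOps V H}
    (_ : O.Good) (x : Sm n V H), msmE n O (msmE n O x) = x
  | 0, _, _, _, _, _, h, x => h.eeV x
  | n + 1, _, _, _, _, O, h, x => Sm.ext (by
      simp [msmE, h.eeV, smul_smul, ← mul_pow]) (msmE_msmE n h.peel _)

theorem proj_msmE : ∀ (n : ℕ) {V H : Type} [Ab V] [Ab H] (O : MOps V H)
    (x : Sm n V H), Sm.proj n (msmE n O x) = (-1 : ℤ) ^ n • O.eV (Sm.proj n x)
  | 0, _, _, _, _, _, _ => (by rw [pow_zero, one_smul]; rfl)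
  | n + 1, _, _, _, _, O, x => by simp [msmE, Sm.proj]

theorem MOps.Good.s_proj_msmD : ∀ (n : ℕ) {V H : Type} [Ab V] [Ab H] {O : MOps V H} (_ : O.Good)
    (x : Sm n H H),
    O.s (Sm.proj n (msmD n O.peel x)) = O.dV (O.s (Sm.proj n x))
  | 0, _, _, _, _, _, h, x => h.sd x
  | n + 1, _, _, _, _, O, h, x => by
    simp [msmD, Sm.proj, MOps.peel, h.sd, h.se, h.sT]

theorem msmD_msmE : ∀ (n : ℕ) {V H : Type} [Ab V] [Ab H] {O : MOps V H}
    (_ : O.Good) (x : Sm n V H), msmD n O (msmE n O x) = -msmE n O (msmD n O x)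
  | 0, _, _, _, _, _, h, x => h.deV x
  | n + 1, _, _, _, _, O, h, x => Sm.ext (by
      have h3 : O.peel.eV = O.eH := rfl
      simp [msmE, msmD, h.deV, proj_msmE, h3, h.se, pow_succ, add_comm]) (msmD_msmE n h.peel _)

theorem msmD_msmD : ∀ (n : ℕ) {V H : Type} [Ab V] [Ab H] {O : MOps V H}
    (_ : O.Good) (x : Sm n V H), msmD n O (msmD n O x) = 0
  | 0, _, _, _, _, _, h, x => h.ddV x
  | n + 1, _, _, _, _, O, h, x => Sm.ext (by
      simp [msmD, h.ddV, h.deV, h.s_proj_msmD]) (msmD_msmD n h.peel _)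

theorem proj_mem_msmG : ∀ (n : ℕ) {V H : Type} [Ab V] [Ab H] (O : MOps V H)
    (i : ℤ) (x : Sm n V H), x ∈ msmG n O i → Sm.proj n x ∈ O.GV i
  | 0, _, _, _, _, _, _, _, h => h
  | n + 1, _, _, _, _, O, i, x, h => h.1

theorem map_mem_msmG (k : ℤ) (n : ℕ) {V H V' H' : Type} [Ab V] [Ab H] [Ab V'] [Ab H'] {O : MOps V H}
    {O' : MOps V' H'} {f : V →+ V'} {g : H →+ H'}
    (hf : ∀ i, ∀ x ∈ O.GV (i + k), f x ∈ O'.GV i) (hg : ∀ i, ∀ x ∈ O.GH (i + k), g x ∈ O'.GH i)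
    (i : ℤ) (x : Sm n V H) (hx : x ∈ msmG n O (i + k)) :
    Sm.map n f g x ∈ msmG n O' i := by
  rw [msmG_eq] at hx ⊢
  exact map_mem_smG k n (O := O.toOps) (O' := O'.toOps) hf hg i x hx

theorem msmE_mem : ∀ (n : ℕ) {V H : Type} [Ab V] [Ab H] {O : MOps V H}
    (_ : O.Good) (i : ℤ) (x : Sm n V H), x ∈ msmG n O i → msmE n O x ∈ msmG n O i
  | 0, _, _, _, _, _, h, i, x, hx => h.geV i x hx
  | n + 1, _, _, _, _, O, h, i, x, hx =>
    ⟨zsmul_mem (h.geV i _ hx.1) _, msmE_mem n h.peel i _ hx.2⟩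

theorem msmD_mem : ∀ (n : ℕ) {V H : Type} [Ab V] [Ab H] {O : MOps V H}
    (_ : O.Good) (i : ℤ) (x : Sm n V H), x ∈ msmG n O (i + 1) → msmD n O x ∈ msmG n O i
  | 0, _, _, _, _, _, h, i, x, hx => h.gdV i x hx
  | n + 1, _, _, _, _, O, h, i, x, hx =>
    ⟨add_mem (h.gdV i _ hx.1) (zsmul_mem (h.geV _ _ (h.gs _ _ (proj_mem_msmG n O.peel _ _ hx.2)))
        _),
      msmD_mem n h.peel i _ hx.2⟩

/-- The inclusion of the simplified column into a column. -/
def unsimplify : (n : ℕ) → {V H : Type} → [Ab V] → [Ab H] → (H →+ H) →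
    (Sm n V H →+ Col n V H)
  | 0, _, _, _, _, _ => idHom _
  | n + 1, _, H, _, _, T => Col.pair ((Col.incl n).comp Sm.head)
      ((Col.map n (idHom H) (MOps.incap T)).comp ((unsimplify n (-T)).comp Sm.tail))

theorem proj_unsimplify : ∀ (n : ℕ) {V H : Type} [Ab V] [Ab H] (T : H →+ H)
    (x : Sm n V H), Col.proj n (unsimplify n T x) = Sm.proj n x
  | 0, _, _, _, _, _, _ => rfl
  | n + 1, _, _, _, _, T, x => Col.proj_incl n (Sm.head x)

theorem unsimplify_map : ∀ (n : ℕ) {V H V' H' : Type} [Ab V] [Ab H] [Ab V'] [Ab H'] (T : H →+ H)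
    (T' : H' →+ H') (f : V →+ V') (g : H →+ H')
    (_ : ∀ x, g (T x) = T' (g x)) (x : Sm n V H),
    unsimplify n T' (Sm.map n f g x) = Col.map n f g (unsimplify n T x)
  | 0, _, _, _, _, _, _, _, _, _, _, _, _, _, _ => rfl
  | n + 1, V, H, V', H', _, _, _, _, T, T', f, g, h, x =>
    Col.ext (Col.map_incl n f g _).symm (by
      have h1 := unsimplify_map n (-T) (-T') g g (fun x => by simp [h]) (Sm.tail x)
      have h2 : (MOps.incap T').comp g = (g.prodMap g).comp (MOps.incap T) :=
        hom_ext fun x => Prod.ext (by simp [MOps.incap, h]) rfl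
      simp only [unsimplify, Sm.map, Col.snd_pair, Sm.tail_pair, hom_comp, h1,
        Col.snd_map, Col.map_map, h2]
      rfl)

theorem map_incap_mem (n : ℕ) {V H : Type} [Ab V] [Ab H] {O : MOps V H}
    (h : O.Good) (i : ℤ) (x : Col n H H) (hx : x ∈ mcolG n O.peel i) :
    Col.map n (idHom H) (MOps.incap O.T) x ∈ mcolG n O.cap i := by
  refine map_mem_mcolG 0 n (O := O.peel) (O' := O.cap) (fun i x hx => ?_) (fun i x hx => ?_) i _
    (by rwa [add_zero])
  · rw [add_zero] at hx
    exact hx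
  · rw [add_zero] at hx
    exact ⟨neg_mem (S := AddSubgroup H) (h.gT _ _ (by rw [sub_add_cancel]; exact hx)), hx⟩

theorem unsimplify_mem : ∀ (n : ℕ) {V H : Type} [Ab V] [Ab H] {O : MOps V H}
    (_ : O.Good) (i : ℤ) (x : Sm n V H), x ∈ msmG n O i → unsimplify n O.T x ∈ mcolG n O i
  | 0, _, _, _, _, _, _, _, _, h => h
  | n + 1, _, _, _, _, O, h, i, x, hx =>
    ⟨incl_mem_mcolG n O i _ hx.1, map_incap_mem n h i _ (unsimplify_mem n h.peel i _ hx.2)⟩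

theorem MOps.merge_comp_incap {V H : Type} [Ab V] [Ab H] (O : MOps V H) :
    O.merge.comp (MOps.incap O.T) = 0 :=
  hom_ext fun x => by simp [MOps.incap, MOps.merge]

theorem unsimplify_msmD : ∀ (n : ℕ) {V H : Type} [Ab V] [Ab H] {O : MOps V H}
    (_ : O.Good) (x : Sm n V H), unsimplify n O.T (msmD n O x) = mcolD n O (unsimplify n O.T x)
  | 0, _, _, _, _, _, _, _ => rfl
  | n + 1, V, H, _, _, O, h, x => Col.ext (by
      have h1 := Col.map_map n O.s O.merge (idHom H) (MOps.incap O.T)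
        (unsimplify n (-O.T) (Sm.tail x))
      rw [O.merge_comp_incap, Col.map_zero_right, proj_unsimplify] at h1
      simp only [unsimplify, msmD, mcolD, Col.fst_pair, Col.snd_pair, Sm.head_pair,
        hom_comp, hom_add, hom_smul, map_add, h1,
        mcolD_incl, mcolE_incl]
      rfl) (by
      have h1 := unsimplify_msmD n h.peel (Sm.tail x)
      have h2 := mcolD_map n h.map_incap (unsimplify n O.peel.T (Sm.tail x))
      have h5 : O.peel.T = -O.T := rfl
      rw [h5] at h1 h2
      simp only [unsimplify, msmD, mcolD, Col.snd_pair, Sm.tail_pair, hom_comp, h1,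
        h2])

theorem unsimplify_inj : ∀ (n : ℕ) {V H : Type} [Ab V] [Ab H] (T : H →+ H)
    (x : Sm n V H), unsimplify n T x = 0 → x = 0
  | 0, _, _, _, _, _, _, h => h
  | n + 1, V, H, _, _, T, x, h => by
    have h1 : Col.incl n (Sm.head x) = (0 : Col n V H) := congrArg Col.fst h
    have h2 : Col.map n (idHom H) (MOps.incap T) (unsimplify n (-T) (Sm.tail x)) = 0 :=
      congrArg Col.snd h
    refine Sm.ext ?_ (unsimplify_inj n (-T) _ ?_)
    · have := congrArg (Col.proj n) h1
      rw [Col.proj_incl] at this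
      rw [this, map_zero, map_zero]
    · have := congrArg (Col.map n (idHom H) (AddMonoidHom.snd H H)) h2
      rw [Col.map_map, map_zero] at this
      exact (Col.map_id n _).symm.trans this

theorem unsimplify_acyclic : ∀ (n : ℕ) {V H : Type} [Ab V] [Ab H] {O : MOps V H} (_ : O.Good)
    (i : ℤ) (x : Col n V H), x ∈ mcolG n O i →
    (∃ y, unsimplify n O.T y = mcolD n O x) →
    ∃ z ∈ mcolG n O (i + 1), ∃ y ∈ msmG n O i, x = mcolD n O z + unsimplify n O.T y
  | 0, _, _, _, _, _, _, _, x, hx, _ => ⟨0, zero_mem _, x, hx, by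
      rw [map_zero, zero_add]
      rfl⟩
  | n + 1, V, H, _, _, O, h, i, x, hx, ⟨t, ht⟩ => by
    let K : Col n H H →+ Col n H (H × H) := Col.map n (idHom H) (MOps.incap O.T)
    let P : Col n H (H × H) →+ Col n H H := Col.map n (idHom H) (AddMonoidHom.snd H H)
    let c : Col n H (H × H) →+ Col n V H := Col.map n O.s O.merge
    have hPK : ∀ w, P (K w) = w := fun w => by
      have e : P (K w) = Col.map n (idHom H) (idHom H) w :=
        Col.map_map n _ _ _ _ w
      rw [e, Col.map_id]
    have ht1 : Col.incl n (Sm.head t) = mcolD n O (Col.fst x) + mcolE n O (c (Col.snd x)) :=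
      congrArg Col.fst ht
    have ht2 : K (unsimplify n O.peel.T (Sm.tail t)) = mcolD n O.cap (Col.snd x) :=
      congrArg Col.snd ht
    let z : Col n H (H × H) :=
      Col.map n (0 : V →+ H) (AddMonoidHom.inl H H) (mcolE n O (Col.fst x))
    have hz : z ∈ mcolG n O.cap (i + 1) :=
      map_mem_mcolG (-1) n (O := O) (O' := O.cap) (fun i x hx => zero_mem _)
        (fun i x hx => ⟨by rw [sub_eq_add_neg]; exact hx, zero_mem (O.GH i)⟩) (i + 1) _
        (by rw [add_neg_cancel_right]; exact mcolE_mem n h _ _ hx.1)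
    have hcz : mcolE n O (c z) = Col.map n (0 : V →+ V) (idHom H) (Col.fst x) := by
      have e : c z = Col.map n (0 : V →+ V) (idHom H) (mcolE n O (Col.fst x)) := by
        have e1 := Col.map_map n O.s O.merge (0 : V →+ H) (AddMonoidHom.inl H H)
          (mcolE n O (Col.fst x))
        have e2 : O.merge.comp (AddMonoidHom.inl H H) = idHom H :=
          hom_ext fun x => by simp [MOps.merge]
        rwa [e2, comp_zero] at e1
      rw [e, mcolE_map n (O := O) (O' := O) (f := 0) (g := idHom H)
        (fun x => (map_zero O.eV).symm) (fun x => rfl),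
        mcolE_mcolE n h]
    let y := Col.snd x - mcolD n O.cap z
    have hy : y ∈ mcolG n O.cap i := sub_mem hx.2 (mcolD_mem n h.cap i _ hz)
    have hdy : mcolD n O.cap y = K (unsimplify n O.peel.T (Sm.tail t)) := by
      rw [map_sub, mcolD_mcolD n h.cap, sub_zero, ht2]
    have hcy : mcolE n O (c y) = Col.incl n (Sm.head t - O.dV (Col.proj n (Col.fst x))) := by
      have e1 : c (mcolD n O.cap z) = mcolD n O (c z) := (mcolD_map n h.map_merge z).symm
      have e2 := mcolD_mcolE n h (c z)
      rw [hcz] at e2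
      have e3 := congrArg (mcolD n O) (Col.incl_proj_add n (Col.fst x))
      rw [map_add, mcolD_incl, e2] at e3
      rw [map_sub, map_sub, e1, map_sub, ht1, ← e3]
      abel
    have hy0 : Col.map n (0 : H →+ V) O.merge y = 0 := by
      have e1 : Col.map n (0 : V →+ V) (idHom H) (c y) = Col.map n (0 : H →+ V) O.merge y :=
        Col.map_map n _ _ _ _ y
      have e2 : c y = mcolE n O (Col.incl n (Sm.head t - O.dV (Col.proj n (Col.fst x)))) := by
        rw [← hcy, mcolE_mcolE n h]
      rw [← e1, e2, mcolE_incl, Col.map_incl, hom_zero, map_zero]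
    have hyK : y = K (P y) := by
      have e := Col.map_add n (idHom H) (0 : H →+ H)
        ((MOps.incap O.T).comp (AddMonoidHom.snd H H)) ((AddMonoidHom.inl H H).comp O.merge) y
      have e1 : (MOps.incap O.T).comp (AddMonoidHom.snd H H) + (AddMonoidHom.inl H H).comp O.merge
          = idHom (H × H) := hom_ext fun x =>
        Prod.ext (by simp [MOps.incap, MOps.merge]) (by simp [MOps.incap, MOps.merge])
      have e2 : K (P y) = Col.map n (idHom H)
          ((MOps.incap O.T).comp (AddMonoidHom.snd H H)) y := Col.map_map n _ _ _ _ y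
      have e3 := Col.map_map n (0 : V →+ H) (AddMonoidHom.inl H H) (0 : H →+ V) O.merge y
      rw [hy0, map_zero, comp_zero] at e3
      rw [e1, add_zero, Col.map_id, ← e2, ← e3, add_zero] at e
      exact e
    have hPy : P y ∈ mcolG n O.peel i := by
      refine map_mem_mcolG 0 n (O := O.cap) (O' := O.peel) (fun i x hx => ?_) (fun i x hx => ?_) i _
        (by rwa [add_zero])
      · rw [add_zero] at hx
        exact hx
      · rw [add_zero] at hx
        exact hx.2
    have hdP : unsimplify n O.peel.T (Sm.tail t) = mcolD n O.peel (P y) := by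
      have e : K (mcolD n O.peel (P y)) = mcolD n O.cap (K (P y)) :=
        (mcolD_map n h.map_incap (P y)).symm
      rw [← hyK, hdy] at e
      rw [← hPK (unsimplify n O.peel.T (Sm.tail t)), ← e, hPK]
    obtain ⟨w, hw, u, hu, e⟩ := unsimplify_acyclic n h.peel i (P y) hPy ⟨_, hdP⟩
    have hcK : mcolE n O (c (K w)) = Col.incl n ((-1 : ℤ) ^ n • O.eV (O.s (Col.proj n w))) := by
      have e1 : c (K w) = Col.map n (O.s.comp (idHom H))
        (O.merge.comp (MOps.incap O.T)) w := Col.map_map n _ _ _ _ w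
      rw [e1, O.merge_comp_incap, Col.map_zero_right, mcolE_incl]
      rfl
    refine ⟨(0, z + K w), ⟨zero_mem (mcolG n O (i + 1)), add_mem hz (map_incap_mem n h _ _ hw)⟩,
      (Col.proj n (Col.fst x) - (-1 : ℤ) ^ n • O.eV (O.s (Col.proj n w)), u),
      ⟨sub_mem (proj_mem_mcolG n O i _ hx.1) (zsmul_mem (h.geV _ _ (h.gs _ _
        (proj_mem_mcolG n O.peel _ _ hw))) _), hu⟩, Col.ext ?_ ?_⟩
    · change _ = (mcolD n O 0 + mcolE n O (c (z + K w))) +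
        Col.incl n (Col.proj n (Col.fst x) - (-1 : ℤ) ^ n • O.eV (O.s (Col.proj n w)))
      rw [map_zero, zero_add, map_add, map_add, hcz, hcK, map_sub]
      rw [add_assoc, add_sub_cancel]
      exact ((add_comm _ _).trans (Col.incl_proj_add n _)).symm
    · change _ = mcolD n O.cap (z + K w) + K (unsimplify n O.peel.T u)
      have e1 : mcolD n O.cap (K w) = K (mcolD n O.peel w) := mcolD_map n h.map_incap w
      rw [map_add, e1, add_assoc, ← map_add, ← e, ← hyK]
      exact (add_sub_cancel _ _).symm

/-- A simplified column is quasi-isomorphic to the column. -/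
theorem unsimplify_qInj (n : ℕ) {V H : Type} [Ab V] [Ab H] {O : MOps V H}
    (h : O.Good) : QInj (msmD n O) (msmG n O) (mcolD n O) (mcolG n O) (unsimplify n O.T) :=
  ⟨unsimplify_msmD n h, unsimplify_mem n h, unsimplify_inj n O.T, unsimplify_acyclic n h⟩

theorem simplify_colE : ∀ (n : ℕ) {V H : Type} [Ab V] [Ab H] {O : Ops V H}
    (_ : O.Good) (x : Col n V H), simplify n O.T (colE n O x) = smE n O (simplify n O.T x)
  | 0, _, _, _, _, _, _, _ => rfl
  | n + 1, V, H, _, _, O, h, x => Sm.ext (proj_colE n O _) (by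
      have h1 := simplify_colE n h.peel
        (Col.map n (idHom H) (Ops.uncap O.T) (Col.snd x))
      have h2 := colE_map n h.map_uncap (Col.snd x)
      have h5 : O.peel.T = -O.T := rfl
      rw [h2, h5] at h1
      simp only [simplify, smE, colE, Sm.tail_pair, Col.snd_pair,
        hom_comp, hom_neg, map_neg, h1])

theorem unsimplify_msmE : ∀ (n : ℕ) {V H : Type} [Ab V] [Ab H] {O : MOps V H}
    (_ : O.Good) (x : Sm n V H), unsimplify n O.T (msmE n O x) = mcolE n O (unsimplify n O.T x)
  | 0, _, _, _, _, _, _, _ => rfl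
  | n + 1, V, H, _, _, O, h, x => Col.ext (by
      simp only [unsimplify, msmE, mcolE, Col.fst_pair, Sm.head_pair, hom_comp,
        hom_smul, hom_neg, mcolE_incl, pow_succ, mul_neg, mul_one,
        neg_smul, map_neg]) (by
      have h1 := unsimplify_msmE n h.peel (Sm.tail x)
      have h2 := mcolE_map n h.map_incap.eV h.map_incap.eH (unsimplify n O.peel.T (Sm.tail x))
      have h5 : O.peel.T = -O.T := rfl
      rw [h5] at h1 h2
      simp only [unsimplify, msmE, mcolE, Col.snd_pair, Sm.tail_pair, hom_comp, h1,
        h2])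

/-! ### Iterated columns -/

/-- Two pairs of maps, `s` from `V, H` to `V', H'` and `y` on `V', H'`, of degree `-1`, with
`y ∘ s = 0` and `y ∘ y = 0`. -/
structure Step {V H V' H' : Type} [Ab V] [Ab H] [Ab V'] [Ab H'] (GV : ℤ → AddSubgroup V)
    (GH : ℤ → AddSubgroup H) (GV' : ℤ → AddSubgroup V') (GH' : ℤ → AddSubgroup H') (sV : V →+ V')
    (sH : H →+ H') (yV : V' →+ V') (yH : H' →+ H') : Prop where
  ysV : yV.comp sV = 0
  ysH : yH.comp sH = 0
  yyV : yV.comp yV = 0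
  yyH : yH.comp yH = 0
  gsV : ∀ i, ∀ x ∈ GV (i + 1), sV x ∈ GV' i
  gsH : ∀ i, ∀ x ∈ GH (i + 1), sH x ∈ GH' i
  gyV : ∀ i, ∀ x ∈ GV' (i + 1), yV x ∈ GV' i
  gyH : ∀ i, ∀ x ∈ GH' (i + 1), yH x ∈ GH' i

section

variable {V H V' H' : Type} [Ab V] [Ab H] [Ab V'] [Ab H']

/-- Two pairs of maps with the properties of a saddle and of the lower arc of another column. -/
structure MStep (O : MOps V H) (O' : MOps V' H') (sV : V →+ V') (sH : H →+ H') (yV : V' →+ V')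
    (yH : H' →+ H') : Prop extends Step O.GV O.GH O'.GV O'.GH sV sH yV yH where
  good : O.Good
  good' : O'.Good
  map : O.Map O' sV sH
  map' : O'.Map O' yV yH

/-- The same for columns of the other kind. -/
structure OStep (O : Ops V H) (O' : Ops V' H') (sV : V →+ V') (sH : H →+ H') (yV : V' →+ V')
    (yH : H' →+ H') : Prop extends Step O.GV O.GH O'.GV O'.GH sV sH yV yH where
  good : O.Good
  good' : O'.Good
  map : O.Map O' sV sH
  map' : O'.Map O' yV yH

/-- The operations on columns given by operations commuting with those of the columns. -/
def mcolOps (n : ℕ) (O : MOps V H) (O' : MOps V' H') (sV : V →+ V') (sH : H →+ H')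
    (yV : V' →+ V') (yH : H' →+ H') : Ops (Col n V H) (Col n V' H') :=
  ⟨mcolD n O, mcolD n O', mcolE n O, mcolE n O', Col.map n sV sH, 0, Col.map n yV yH,
    mcolG n O, mcolG n O'⟩

/-- The operations on simplified columns given by operations commuting with those of the columns. -/
def msmOps (n : ℕ) (O : MOps V H) (O' : MOps V' H') (sV : V →+ V') (sH : H →+ H')
    (yV : V' →+ V') (yH : H' →+ H') : Ops (Sm n V H) (Sm n V' H') :=
  ⟨msmD n O, msmD n O', msmE n O, msmE n O', Sm.map n sV sH, 0, Sm.map n yV yH,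
    msmG n O, msmG n O'⟩

/-- The operations on columns given by operations commuting with those of the columns. -/
def colOps (n : ℕ) (O : Ops V H) (O' : Ops V' H') (sV : V →+ V') (sH : H →+ H')
    (yV : V' →+ V') (yH : H' →+ H') : Ops (Col n V H) (Col n V' H') :=
  ⟨colD n O, colD n O', colE n O, colE n O', Col.map n sV sH, 0, Col.map n yV yH,
    colG n O, colG n O'⟩

/-- The operations on simplified columns given by operations commuting with those of the columns. -/
def smOps (n : ℕ) (O : Ops V H) (O' : Ops V' H') (sV : V →+ V') (sH : H →+ H')
    (yV : V' →+ V') (yH : H' →+ H') : Ops (Sm n V H) (Sm n V' H') :=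
  ⟨smD n O, smD n O', smE n O, smE n O', Sm.map n sV sH, 0, Sm.map n yV yH,
    smG n O, smG n O'⟩

variable {sV : V →+ V'} {sH : H →+ H'} {yV : V' →+ V'} {yH : H' →+ H'}

theorem MStep.col_good {O : MOps V H} {O' : MOps V' H'} (n : ℕ)
    (h : MStep O O' sV sH yV yH) : (mcolOps n O O' sV sH yV yH).Good :=
  ⟨mcolD_mcolD n h.good, mcolD_mcolD n h.good', mcolE_mcolE n h.good, mcolE_mcolE n h.good',
    mcolD_mcolE n h.good, mcolD_mcolE n h.good', fun x => (mcolD_map n h.map x).symm,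
    fun x => (mcolE_map n h.map.eV h.map.eH x).symm, fun _ => (map_zero (mcolD n O')).symm,
    fun _ => (map_zero (mcolE n O')).symm, fun x => (mcolD_map n h.map' x).symm,
    fun x => (mcolE_map n h.map'.eV h.map'.eH x).symm,
    fun x => by simp only [mcolOps, Col.map_map, h.ysV, h.ysH, Col.map_zero]; rfl, fun _ => rfl,
    fun x => by simp only [mcolOps, Col.map_map, h.yyV, h.yyH, Col.map_zero],
    fun _ => (map_zero (Col.map n yV yH)).symm, mcolD_mem n h.good, mcolD_mem n h.good',
    mcolE_mem n h.good, mcolE_mem n h.good', map_mem_mcolG 1 n h.gsV h.gsH,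
    fun _ _ _ => zero_mem _, map_mem_mcolG 1 n h.gyV h.gyH⟩

theorem MStep.sm_good {O : MOps V H} {O' : MOps V' H'} (n : ℕ)
    (h : MStep O O' sV sH yV yH) : (msmOps n O O' sV sH yV yH).Good :=
  ⟨msmD_msmD n h.good, msmD_msmD n h.good', msmE_msmE n h.good, msmE_msmE n h.good',
    msmD_msmE n h.good, msmD_msmE n h.good', fun x => (msmD_map n h.map x).symm,
    fun x => (msmE_map n h.map x).symm, fun _ => (map_zero (msmD n O')).symm,
    fun _ => (map_zero (msmE n O')).symm, fun x => (msmD_map n h.map' x).symm,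
    fun x => (msmE_map n h.map' x).symm,
    fun x => by simp only [msmOps, Sm.map_map, h.ysV, h.ysH, Sm.map_zero]; rfl, fun _ => rfl,
    fun x => by simp only [msmOps, Sm.map_map, h.yyV, h.yyH, Sm.map_zero],
    fun _ => (map_zero (Sm.map n yV yH)).symm, msmD_mem n h.good, msmD_mem n h.good',
    msmE_mem n h.good, msmE_mem n h.good', map_mem_msmG 1 n h.gsV h.gsH,
    fun _ _ _ => zero_mem _, map_mem_msmG 1 n h.gyV h.gyH⟩

theorem OStep.col_good {O : Ops V H} {O' : Ops V' H'} (n : ℕ)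
    (h : OStep O O' sV sH yV yH) : (colOps n O O' sV sH yV yH).Good :=
  ⟨colD_colD n h.good, colD_colD n h.good', colE_colE n h.good, colE_colE n h.good',
    colD_colE n h.good, colD_colE n h.good', fun x => (colD_map n h.map x).symm,
    fun x => (colE_map n h.map x).symm, fun _ => (map_zero (colD n O')).symm,
    fun _ => (map_zero (colE n O')).symm, fun x => (colD_map n h.map' x).symm,
    fun x => (colE_map n h.map' x).symm,
    fun x => by simp only [colOps, Col.map_map, h.ysV, h.ysH, Col.map_zero]; rfl, fun _ => rfl,
    fun x => by simp only [colOps, Col.map_map, h.yyV, h.yyH, Col.map_zero],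
    fun _ => (map_zero (Col.map n yV yH)).symm, colD_mem n h.good, colD_mem n h.good',
    colE_mem n h.good, colE_mem n h.good', map_mem_colG 1 n h.gsV h.gsH,
    fun _ _ _ => zero_mem _, map_mem_colG 1 n h.gyV h.gyH⟩

theorem OStep.sm_good {O : Ops V H} {O' : Ops V' H'} (n : ℕ)
    (h : OStep O O' sV sH yV yH) : (smOps n O O' sV sH yV yH).Good :=
  ⟨smD_smD n h.good, smD_smD n h.good', smE_smE n h.good, smE_smE n h.good',
    smD_smE n h.good, smD_smE n h.good', fun x => (smD_map n h.map x).symm,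
    fun x => (smE_map n h.map x).symm, fun _ => (map_zero (smD n O')).symm,
    fun _ => (map_zero (smE n O')).symm, fun x => (smD_map n h.map' x).symm,
    fun x => (smE_map n h.map' x).symm,
    fun x => by simp only [smOps, Sm.map_map, h.ysV, h.ysH, Sm.map_zero]; rfl, fun _ => rfl,
    fun x => by simp only [smOps, Sm.map_map, h.yyV, h.yyH, Sm.map_zero],
    fun _ => (map_zero (Sm.map n yV yH)).symm, smD_mem n h.good, smD_mem n h.good',
    smE_mem n h.good, smE_mem n h.good', map_mem_smG 1 n h.gsV h.gsH,
    fun _ _ _ => zero_mem _, map_mem_smG 1 n h.gyV h.gyH⟩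

end

/-! ### The outer circles -/

/-- The integers in degree `k`. -/
def pureDeg (k i : ℤ) : AddSubgroup ℤ where
  carrier := {x | i ≠ k → x = 0}
  zero_mem' _ := rfl
  add_mem' ha hb h := by rw [ha h, hb h, add_zero]
  neg_mem' ha h := by rw [ha h, neg_zero]

/-- `ℤ[X] / (X ^ 2)`, with the unit in degree `k` and `X` in degree `k - 1`. -/
def circleDeg (k i : ℤ) : AddSubgroup (ℤ × ℤ) := (pureDeg k i).prod (pureDeg (k - 1) i)

/-- Multiplication by `X` on `ℤ[X] / (X ^ 2)`. -/
def mulX : ℤ × ℤ →+ ℤ × ℤ := (0 : ℤ × ℤ →+ ℤ).prod (AddMonoidHom.fst ℤ ℤ)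

/-- The constant term of an element of `ℤ[X] / (X ^ 2)`. -/
def cst : ℤ × ℤ →+ ℤ := AddMonoidHom.fst ℤ ℤ

/-- The inclusion of the multiples of `X`. -/
def inX : ℤ →+ ℤ × ℤ := AddMonoidHom.inr ℤ ℤ

/-- The constant terms in the inner variable. -/
def cstInner : (ℤ × ℤ) × (ℤ × ℤ) →+ ℤ × ℤ := cst.prodMap cst

/-- The constant term in the outer variable. -/
def cstOuter : (ℤ × ℤ) × (ℤ × ℤ) →+ ℤ × ℤ := AddMonoidHom.fst _ _

/-- The coproduct of `ℤ[X] / (X ^ 2)`. -/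
def coprodX : ℤ × ℤ →+ (ℤ × ℤ) × (ℤ × ℤ) := mulX.prod (idHom _)

/-- The left column, with the other columns vertical. -/
def opsVV : MOps ((ℤ × ℤ) × (ℤ × ℤ)) (ℤ × ℤ) where
  dV := 0
  dH := 0
  eV := idHom _
  eH := idHom _
  s := coprodX
  T := mulX
  Y := mulX
  GV i := (circleDeg 1 i).prod (circleDeg 0 i)
  GH := circleDeg 1

/-- The left column, with one of the other columns horizontal. -/
def opsHV : MOps (ℤ × ℤ) ℤ where
  dV := 0
  dH := 0
  eV := idHom _
  eH := idHom _
  s := inX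
  T := 0
  Y := 0
  GV := circleDeg 0
  GH := pureDeg 0

/-- The left column, with the other columns horizontal. -/
def opsHH : MOps ℤ (ℤ × ℤ) where
  dV := 0
  dH := 0
  eV := idHom _
  eH := idHom _
  s := cst
  T := 0
  Y := mulX
  GV := pureDeg (-1)
  GH := circleDeg 0

theorem mem_circleDeg {k i : ℤ} {x : ℤ × ℤ} :
    x ∈ circleDeg k i ↔ (i ≠ k → x.1 = 0) ∧ (i ≠ k - 1 → x.2 = 0) := Iff.rfl

theorem mulX_mem {k i : ℤ} {x : ℤ × ℤ} (hx : x ∈ circleDeg k (i + 1)) :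
    mulX x ∈ circleDeg k i :=
  ⟨fun _ => rfl, fun h => hx.1 (by omega)⟩

theorem opsVV_good : opsVV.Good := by
  constructor
  case gs =>
    rintro i ⟨a, b⟩ hx
    have h := mem_circleDeg.1 hx
    exact ⟨⟨fun _ => rfl, fun h' => h.1 (by omega)⟩, ⟨fun h' => h.1 (by omega), fun h' => h.2 (by
        omega)⟩⟩
  case gT => exact fun i x hx => mulX_mem hx
  case gY => exact fun i x hx => mulX_mem hx
  all_goals first
    | (intro i x hx; exact zero_mem _)
    | (intro i x hx; exact hx)
    | (intro x; rfl)

theorem opsHV_good : opsHV.Good := by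
  constructor
  case gs =>
    intro i x hx
    exact ⟨fun _ => rfl, fun h => hx (by omega)⟩
  all_goals first
    | (intro i x hx; exact zero_mem _)
    | (intro i x hx; exact hx)
    | (intro x; rfl)

theorem opsHH_good : opsHH.Good := by
  constructor
  case gs =>
    rintro i ⟨a, b⟩ hx h
    exact (mem_circleDeg.1 hx).1 (by omega)
  case gY => exact fun i x hx => mulX_mem hx
  all_goals first
    | (intro i x hx; exact zero_mem _)
    | (intro i x hx; exact hx)
    | (intro x; rfl)

theorem step_VV_outer : MStep opsVV opsHV cstOuter cst 0 0 where
  good := opsVV_good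
  good' := opsHV_good
  map := by constructor <;> exact fun _ => rfl
  map' := by constructor <;> exact fun _ => rfl
  ysV := rfl
  ysH := rfl
  yyV := rfl
  yyH := rfl
  gsV i x hx := ⟨fun h => hx.1.1 (by omega), fun h => hx.1.2 (by omega)⟩
  gsH i x hx h := hx.1 (by omega)
  gyV i x hx := zero_mem _
  gyH i x hx := zero_mem _

theorem step_VV_inner : MStep opsVV opsHV cstInner cst 0 0 where
  good := opsVV_good
  good' := opsHV_good
  map := by constructor <;> exact fun _ => rfl
  map' := by constructor <;> exact fun _ => rfl
  ysV := rfl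
  ysH := rfl
  yyV := rfl
  yyH := rfl
  gsV i x hx := ⟨fun h => hx.1.1 (by omega), fun h => hx.2.1 (by omega)⟩
  gsH i x hx h := hx.1 (by omega)
  gyV i x hx := zero_mem _
  gyH i x hx := zero_mem _

theorem step_HV : MStep opsHV opsHH cst inX 0 mulX where
  good := opsHV_good
  good' := opsHH_good
  map := by constructor <;> exact fun _ => rfl
  map' := by constructor <;> exact fun _ => rfl
  ysV := rfl
  ysH := rfl
  yyV := rfl
  yyH := rfl
  gsV i x hx h := hx.1 (by omega)
  gsH i x hx := ⟨fun _ => rfl, fun h => hx (by omega)⟩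
  gyV i x hx := zero_mem _
  gyH i x hx := mulX_mem hx

/-! ### The complex of the three columns -/

section

variable (p q r : ℕ)

/-- The middle column, with the right one vertical. -/
def midV := mcolOps p opsVV opsHV cstOuter cst 0 0

/-- The middle column, with the right one horizontal. -/
def midH := mcolOps p opsHV opsHH cst inX 0 mulX

/-- The right column. -/
def right := colOps q (midV p) (midH p) (Col.map p cstInner cst) (Col.map p cst inX)
  (Col.map p 0 0) (Col.map p 0 mulX)

/-- The middle column after simplification of the left one, with the right one vertical. -/
def smidV := msmOps p opsVV opsHV cstOuter cst 0 0

/-- The middle column after simplification of the left one, with the right one horizontal. -/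
def smidH := msmOps p opsHV opsHH cst inX 0 mulX

/-- The right column after simplification of the middle one. -/
def halfRight := smOps q (midV p) (midH p) (Col.map p cstInner cst) (Col.map p cst inX)
  (Col.map p 0 0) (Col.map p 0 mulX)

/-- The right column after simplification of the others. -/
def sright := smOps q (smidV p) (smidH p) (Sm.map p cstInner cst) (Sm.map p cst inX)
  (Sm.map p 0 0) (Sm.map p 0 mulX)

theorem step_mid : OStep (midV p) (midH p) (Col.map p cstInner cst) (Col.map p cst inX)
    (Col.map p 0 0) (Col.map p 0 mulX) where
  good := step_VV_outer.col_good p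
  good' := step_HV.col_good p
  map :=
    { dV := fun x => (mcolD_map p step_VV_inner.map x).symm
      dH := fun x => (mcolD_map p step_HV.map x).symm
      eV := fun x => (mcolE_map p step_VV_inner.map.eV step_VV_inner.map.eH x).symm
      eH := fun x => (mcolE_map p step_HV.map.eV step_HV.map.eH x).symm
      s := fun x => by
        simp only [midV, midH, mcolOps, Col.map_map]
        rfl
      T := fun x => map_zero _
      Y := fun x => by
        simp only [midV, midH, mcolOps, Col.map_map]
        exact (Col.map_zero p x).trans (Col.map_zero p x).symm }
  map' :=
    { dV := fun x => (mcolD_map p step_VV_inner.map' x).symm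
      dH := fun x => (mcolD_map p step_HV.map' x).symm
      eV := fun x => (mcolE_map p step_VV_inner.map'.eV step_VV_inner.map'.eH x).symm
      eH := fun x => (mcolE_map p step_HV.map'.eV step_HV.map'.eH x).symm
      s := fun x => by
        simp only [midH, mcolOps, Col.map_map]
        rfl
      T := fun x => map_zero _
      Y := fun x => rfl }
  ysV := hom_ext fun x => Col.map_zero p _
  ysH := hom_ext fun x => (Col.map_map p _ _ _ _ x).trans (Col.map_zero p x)
  yyV := hom_ext fun x => Col.map_zero p _
  yyH := hom_ext fun x => (Col.map_map p _ _ _ _ x).trans (Col.map_zero p x)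
  gsV := map_mem_mcolG 1 p step_VV_inner.gsV step_VV_inner.gsH
  gsH := map_mem_mcolG 1 p step_HV.gsV step_HV.gsH
  gyV := map_mem_mcolG 1 p step_VV_inner.gyV step_VV_inner.gyH
  gyH := map_mem_mcolG 1 p step_HV.gyV step_HV.gyH

theorem step_smid : OStep (smidV p) (smidH p) (Sm.map p cstInner cst) (Sm.map p cst inX)
    (Sm.map p 0 0) (Sm.map p 0 mulX) where
  good := step_VV_outer.sm_good p
  good' := step_HV.sm_good p
  map :=
    { dV := fun x => (msmD_map p step_VV_inner.map x).symm
      dH := fun x => (msmD_map p step_HV.map x).symm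
      eV := fun x => (msmE_map p step_VV_inner.map x).symm
      eH := fun x => (msmE_map p step_HV.map x).symm
      s := fun x => by
        simp only [smidV, smidH, msmOps, Sm.map_map]
        rfl
      T := fun x => map_zero _
      Y := fun x => by
        simp only [smidV, smidH, msmOps, Sm.map_map]
        exact (Sm.map_zero p x).trans (Sm.map_zero p x).symm }
  map' :=
    { dV := fun x => (msmD_map p step_VV_inner.map' x).symm
      dH := fun x => (msmD_map p step_HV.map' x).symm
      eV := fun x => (msmE_map p step_VV_inner.map' x).symm
      eH := fun x => (msmE_map p step_HV.map' x).symm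
      s := fun x => by
        simp only [smidH, msmOps, Sm.map_map]
        rfl
      T := fun x => map_zero _
      Y := fun x => rfl }
  ysV := hom_ext fun x => Sm.map_zero p _
  ysH := hom_ext fun x => (Sm.map_map p _ _ _ _ x).trans (Sm.map_zero p x)
  yyV := hom_ext fun x => Sm.map_zero p _
  yyH := hom_ext fun x => (Sm.map_map p _ _ _ _ x).trans (Sm.map_zero p x)
  gsV := map_mem_msmG 1 p step_VV_inner.gsV step_VV_inner.gsH
  gsH := map_mem_msmG 1 p step_HV.gsV step_HV.gsH
  gyV := map_mem_msmG 1 p step_VV_inner.gyV step_VV_inner.gyH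
  gyH := map_mem_msmG 1 p step_HV.gyV step_HV.gyH

theorem halfRight_map : (right p q).Map (halfRight p q) (simplify q (midV p).T)
    (simplify q (midH p).T) where
  dV := simplify_colD q (step_mid p).good
  dH := simplify_colD q (step_mid p).good'
  eV := simplify_colE q (step_mid p).good
  eH := simplify_colE q (step_mid p).good'
  s x := simplify_map q _ _ _ _ (step_mid p).map.T x
  T x := map_zero _
  Y x := simplify_map q _ _ _ _ (step_mid p).map'.T x

theorem smidV_map : (smidV p).Map (midV p) (unsimplify p opsVV.T) (unsimplify p opsHV.T) where
  dV := unsimplify_msmD p opsVV_good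
  dH := unsimplify_msmD p opsHV_good
  eV := unsimplify_msmE p opsVV_good
  eH := unsimplify_msmE p opsHV_good
  s x := unsimplify_map p _ _ _ _ step_VV_outer.map.T x
  T x := map_zero _
  Y x := unsimplify_map p _ _ _ _ step_VV_outer.map'.T x

theorem smidH_map : (smidH p).Map (midH p) (unsimplify p opsHV.T) (unsimplify p opsHH.T) where
  dV := unsimplify_msmD p opsHV_good
  dH := unsimplify_msmD p opsHH_good
  eV := unsimplify_msmE p opsHV_good
  eH := unsimplify_msmE p opsHH_good
  s x := unsimplify_map p _ _ _ _ step_HV.map.T x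
  T x := map_zero _
  Y x := unsimplify_map p _ _ _ _ step_HV.map'.T x

theorem sright_map : (sright p q).Map (halfRight p q)
    (Sm.map q (unsimplify p opsVV.T) (unsimplify p opsHV.T))
    (Sm.map q (unsimplify p opsHV.T) (unsimplify p opsHH.T)) where
  dV x := (smD_map q (smidV_map p) x).symm
  dH x := (smD_map q (smidH_map p) x).symm
  eV x := (smE_map q (smidV_map p) x).symm
  eH x := (smE_map q (smidH_map p) x).symm
  s x := by
    simp only [sright, halfRight, smOps, Sm.map_map]
    congr 2
    · exact hom_ext fun x => unsimplify_map p _ _ _ _ step_VV_inner.map.T x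
    · exact hom_ext fun x => unsimplify_map p _ _ _ _ step_HV.map.T x
  T x := map_zero _
  Y x := by
    simp only [sright, halfRight, smOps, Sm.map_map]
    congr 2
    · exact hom_ext fun x => unsimplify_map p _ _ _ _ step_VV_inner.map'.T x
    · exact hom_ext fun x => unsimplify_map p _ _ _ _ step_HV.map'.T x

/-- The complex of the three columns has the homology of its simplification. -/
theorem homology_simplify (i : ℤ) :
    Nonempty (Homology (colD r (right p q)) (colG r (right p q)) i ≃+
      Homology (smD r (sright p q)) (smG r (sright p q)) i) := by
  have g1 : (right p q).Good := (step_mid p).col_good q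
  have g2 : (halfRight p q).Good := (step_mid p).sm_good q
  have g3 : (sright p q).Good := (step_smid p).sm_good q
  obtain ⟨e1⟩ := (simplify_qSurj r g1).homology_equiv (colD_colD r g1) (colD_mem r g1) i
  obtain ⟨e2⟩ := (QSurj.sm_map r g1 (halfRight_map p q) (simplify_qSurj q (step_mid p).good)
    (simplify_qSurj q (step_mid p).good')).homology_equiv (smD_smD r g1) (smD_mem r g1) i
  obtain ⟨e3⟩ := (QInj.sm_map r g3 g2 (sright_map p q)
    (QInj.sm_map q (step_smid p).good (step_mid p).good (smidV_map p)
      (unsimplify_qInj p opsVV_good) (unsimplify_qInj p opsHV_good))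
    (QInj.sm_map q (step_smid p).good' (step_mid p).good' (smidH_map p)
      (unsimplify_qInj p opsHV_good) (unsimplify_qInj p opsHH_good))).homology_equiv
      (smD_smD r g2) i
  exact ⟨(e1.trans e2).trans e3.symm⟩

end

/-! ### Coordinates on columns -/

/-- The coefficient of `X ^ a` in the additional variable. -/
def coef {H : Type} [Ab H] (a : Fin 2) : H × H →+ H :=
  if a = 0 then AddMonoidHom.fst H H else AddMonoidHom.snd H H

@[simp] theorem coef_zero {H : Type} [Ab H] :
    coef (H := H) 0 = AddMonoidHom.fst H H := rfl

@[simp] theorem coef_one {H : Type} [Ab H] :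
    coef (H := H) 1 = AddMonoidHom.snd H H := rfl

theorem coef_prodMap {H H' : Type} [Ab H] [Ab H'] (a : Fin 2) (g : H →+ H')
    (x : H × H) : coef a (g.prodMap g x) = g (coef a x) := by
  unfold coef
  split_ifs <;> rfl

/-- The coordinate of a column with crossing `m` resolved horizontally if `sm m`, with exponent
`lab m` on the circle below this crossing unless it is the lowest horizontal one, and with
coordinates `φV`, `φH` on the outer circles. -/
def ev : (n : ℕ) → {V H : Type} → [Ab V] → [Ab H] → (ℕ → Bool) →
    (ℕ → Fin 2) → (V →+ ℤ) → (H →+ ℤ) → (Col n V H →+ ℤ)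
  | 0, _, _, _, _, _, _, φV, _ => φV
  | n + 1, _, _, _, _, sm, lab, φV, φH =>
    if sm n then (ev n sm lab φH (φH.comp (coef (lab n)))).comp Col.snd
    else (ev n sm lab φV φH).comp Col.fst

section

variable {V H V' H' : Type} [Ab V] [Ab H] [Ab V'] [Ab H']

theorem ev_succ_true {n : ℕ} {sm : ℕ → Bool} (h : sm n = true) (lab : ℕ → Fin 2) (φV : V →+ ℤ)
    (φH : H →+ ℤ) : ev (n + 1) sm lab φV φH =
      (ev n sm lab φH (φH.comp (coef (lab n)))).comp Col.snd := by
  rw [ev, if_pos h]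

theorem ev_succ_false {n : ℕ} {sm : ℕ → Bool} (h : sm n = false) (lab : ℕ → Fin 2) (φV : V →+ ℤ)
    (φH : H →+ ℤ) : ev (n + 1) sm lab φV φH = (ev n sm lab φV φH).comp Col.fst := by
  rw [ev, if_neg (by simp [h])]

end

theorem ev_map : ∀ (n : ℕ) {V H V' H' : Type} [Ab V] [Ab H] [Ab V'] [Ab H'] (sm : ℕ → Bool)
    (lab : ℕ → Fin 2) (φV : V' →+ ℤ)
    (φH : H' →+ ℤ) (f : V →+ V') (g : H →+ H'),
    (ev n sm lab φV φH).comp (Col.map n f g) = ev n sm lab (φV.comp f) (φH.comp g)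
  | 0, _, _, _, _, _, _, _, _, _, _, _, _, _, _ => rfl
  | n + 1, _, H, _, H', _, _, _, _, sm, lab, φV, φH, f, g => by
    cases h : sm n
    · rw [ev_succ_false h, ev_succ_false h, ← ev_map n]
      rfl
    · have e : (φH.comp g).comp (coef (lab n)) =
          (φH.comp (coef (lab n))).comp (g.prodMap g) :=
        hom_ext fun x => congrArg φH (coef_prodMap _ g x).symm
      rw [ev_succ_true h, ev_succ_true h, e, ← ev_map n]
      rfl

theorem ev_zero_zero : ∀ (n : ℕ) {V H : Type} [Ab V] [Ab H] (sm : ℕ → Bool)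
    (lab : ℕ → Fin 2), ev n sm lab (0 : V →+ ℤ) (0 : H →+ ℤ) = 0
  | 0, _, _, _, _, _, _ => rfl
  | n + 1, _, _, _, _, sm, lab => by
    cases h : sm n
    · rw [ev_succ_false h, ev_zero_zero n]; rfl
    · rw [ev_succ_true h, zero_comp, ev_zero_zero n]; rfl

theorem ev_add : ∀ (n : ℕ) {V H : Type} [Ab V] [Ab H] (sm : ℕ → Bool)
    (lab : ℕ → Fin 2) (φV φV' : V →+ ℤ) (φH φH' : H →+ ℤ),
    ev n sm lab (φV + φV') (φH + φH') = ev n sm lab φV φH + ev n sm lab φV' φH'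
  | 0, _, _, _, _, _, _, _, _, _, _ => rfl
  | n + 1, _, _, _, _, sm, lab, φV, φV', φH, φH' => by
    cases h : sm n
    · simp only [ev_succ_false h, ev_add n, add_comp]
    · simp only [ev_succ_true h, add_comp, ev_add n]

theorem ev_smul (a : ℤ) : ∀ (n : ℕ) {V H : Type} [Ab V] [Ab H] (sm : ℕ → Bool)
    (lab : ℕ → Fin 2) (φV : V →+ ℤ) (φH : H →+ ℤ),
    ev n sm lab (a • φV) (a • φH) = a • ev n sm lab φV φH
  | 0, _, _, _, _, _, _, _, _ => rfl
  | n + 1, _, _, _, _, sm, lab, φV, φH => by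
    cases h : sm n
    · simp only [ev_succ_false h, ev_smul a n]; rfl
    · have : (a • φH).comp (coef (lab n)) = a • φH.comp (coef (lab n)) := rfl
      simp only [ev_succ_true h, this, ev_smul a n]; rfl

theorem ev_sum {ι : Type} (s : Finset ι) (n : ℕ) {V H : Type} [Ab V] [Ab H] (sm : ℕ → Bool)
    (lab : ℕ → Fin 2) (φV : ι → V →+ ℤ) (φH : ι → H →+ ℤ) :
    ev n sm lab (∑ i ∈ s, φV i) (∑ i ∈ s, φH i) = ∑ i ∈ s, ev n sm lab (φV i) (φH i) := by
  classical
  induction s using Finset.induction_on with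
  | empty => simp [ev_zero_zero]
  | insert a s h ih => rw [Finset.sum_insert h, Finset.sum_insert h, Finset.sum_insert h, ev_add,
      ih]

/-- A coordinate depends only on the relevant exponents and outer coordinates. -/
theorem ev_congr : ∀ (n : ℕ) {V H : Type} [Ab V] [Ab H] {sm sm' : ℕ → Bool}
    {lab lab' : ℕ → Fin 2} {φV φV' : V →+ ℤ} {φH φH' : H →+ ℤ} (_ : ∀ m < n, sm m = sm' m)
    (_ : ∀ m < n, sm m = true → (∃ l < m, sm l = true) → lab m = lab' m)
    (_ : (∀ m < n, sm m = false) → φV = φV') (_ : (∃ m < n, sm m = true) → φH = φH'),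
    ev n sm lab φV φH = ev n sm' lab' φV' φH'
  | 0, _, _, _, _, _, _, _, _, _, _, _, _, _, _, hV, _ => hV (by simp)
  | n + 1, _, _, _, _, sm, sm', lab, lab', φV, φV', φH, φH', hs, hl, hV, hH => by
    have hsn := hs n n.lt_succ_self
    cases h : sm n
    · rw [ev_succ_false h, ev_succ_false (hsn ▸ h), ev_congr n (fun m hm => hs m (by omega))
        (fun m hm => hl m (by omega)) (fun h0 => hV fun m hm => ?_)
        (fun ⟨m, hm, h1⟩ => hH ⟨m, by omega, h1⟩)]
      rcases Nat.lt_succ_iff_lt_or_eq.1 hm with hm | rfl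
      · exact h0 m hm
      · exact h
    · have e := hH ⟨n, n.lt_succ_self, h⟩
      rw [ev_succ_true h, ev_succ_true (hsn ▸ h), ev_congr n (fun m hm => hs m (by omega))
        (fun m hm => hl m (by omega)) (fun _ => e) (fun h1 => ?_)]
      rw [e, hl n n.lt_succ_self h h1]

/-! ### The differential in coordinates -/

theorem ev_colE (ε : ℤ) : ∀ (n : ℕ) {V H : Type} [Ab V] [Ab H] (O : Ops V H)
    (sm : ℕ → Bool) (lab : ℕ → Fin 2) (φV : V →+ ℤ) (φH : H →+ ℤ)
    (_ : φV.comp O.eV = ε • φV) (_ : φH.comp O.eH = ε • φH),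
    (ev n sm lab φV φH).comp (colE n O) =
      ((-1) ^ Nat.count (fun m => sm m = true) n * ε) • ev n sm lab φV φH
  | 0, _, _, _, _, O, _, _, _, _, hV, _ => by
    rw [Nat.count_zero, pow_zero, one_mul]
    exact hV
  | n + 1, V, H, _, _, O, sm, lab, φV, φH, hV, hH => by
    cases h : sm n
    · have ih := ev_colE ε n O sm lab φV φH hV hH
      rw [ev_succ_false h, Nat.count_succ, if_neg (by simp [h]), add_zero]
      ext x
      exact DFunLike.congr_fun ih (Col.fst x)
    · have ih := ev_colE ε n O.cap sm lab φH (φH.comp (coef (lab n))) hH (hom_ext fun x =>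
        (congrArg φH (coef_prodMap _ _ _)).trans (DFunLike.congr_fun hH _))
      rw [ev_succ_true h, Nat.count_succ, if_pos h, pow_succ]
      ext x
      have := DFunLike.congr_fun ih (Col.snd x)
      simp only [hom_comp, hom_smul, smul_eq_mul, colE, Col.snd_pair,
        hom_neg, map_neg] at this ⊢
      rw [this]
      ring

/-- The coordinate of the edge map at crossing `i`, where `φs`, `φT`, `φY` are the compositions of
`φH` with the operations. -/
def evT : (n i : ℕ) → {V H : Type} → [Ab V] → [Ab H] → (ℕ → Bool) →
    (ℕ → Fin 2) → (H →+ ℤ) → (V →+ ℤ) → (H →+ ℤ) → (H →+ ℤ) → (Col n V H →+ ℤ)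
  | 0, _, _, _, _, _, _, _, _, _, _, _ => 0
  | n + 1, i, _, H, _, _, sm, lab, φH, φs, φT, φY =>
    if i = n then (ev n sm lab φs (if lab n = 0 then φT else φH)).comp Col.fst
    else if sm n then (evT n i sm lab (φH.comp (coef (lab n))) (if lab n = 0 then φY else φH)
      (if lab n = 0 then 0 else φH.comp (AddMonoidHom.fst H H))
      (φY.comp (coef (lab n)))).comp Col.snd
    else (evT n i sm lab φH φs φT φY).comp Col.fst

theorem ev_colD (ε : ℤ) : ∀ (n : ℕ) {V H : Type} [Ab V] [Ab H] (O : Ops V H)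
    (sm : ℕ → Bool) (lab : ℕ → Fin 2) (φV : V →+ ℤ) (φH : H →+ ℤ)
    (_ : φH.comp O.eH = ε • φH),
    (ev n sm lab φV φH).comp (colD n O) = ev n sm lab (φV.comp O.dV) (φH.comp O.dH) +
      ∑ i ∈ Finset.range n, if sm i = true then
        (ε * (-1) ^ Nat.count (fun m => sm m = true) i) •
          evT n i sm lab φH (φH.comp O.s) (φH.comp O.T) (φH.comp O.Y) else 0
  | 0, _, _, _, _, O, _, _, _, _, _ => by
    rw [Finset.range_zero, Finset.sum_empty, add_zero]
    rfl
  | n + 1, V, H, _, _, O, sm, lab, φV, φH, hH => by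
    cases h : sm n
    · have ih := ev_colD ε n O sm lab φV φH hH
      rw [Finset.sum_range_succ, if_neg (by simp [h]), add_zero, ev_succ_false h, ev_succ_false h]
      ext x
      have := DFunLike.congr_fun ih (Col.fst x)
      simp only [hom_comp, hom_add, colD, Col.fst_pair,
        AddMonoidHom.finsetSum_apply] at this ⊢
      rw [this]
      refine congrArg _ (Finset.sum_congr rfl fun i hi => ?_)
      rw [evT, if_neg (Finset.mem_range.1 hi).ne, if_neg (c := sm n = true) (by simp [h])]
      split_ifs <;> rfl
    · have hH' : (φH.comp (coef (lab n))).comp O.cap.eH = ε • φH.comp (coef (lab n)) :=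
        hom_ext fun x =>
        (congrArg φH (coef_prodMap _ _ _)).trans (DFunLike.congr_fun hH _)
      have ih := ev_colD ε n O.cap sm lab φH (φH.comp (coef (lab n))) hH'
      have hE := ev_colE ε n O.cap sm lab φH (φH.comp (coef (lab n))) hH hH'
      have hM := ev_map n sm lab φH (φH.comp (coef (lab n))) O.s O.split
      rw [Finset.sum_range_succ, if_pos h, ev_succ_true h, ev_succ_true h]
      have e4 : (φH.comp (coef (lab n))).comp O.split = if lab n = 0 then φH.comp O.T else φH := by
        unfold coef; split_ifs <;> rfl
      rw [evT, if_pos rfl, ← e4]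
      ext x
      have i1 := DFunLike.congr_fun ih (Col.snd x)
      have i2 := DFunLike.congr_fun hE (Col.map n O.s O.split (Col.fst x))
      have i3 := DFunLike.congr_fun hM (Col.fst x)
      have e5 : φH.comp O.cap.dV = φH.comp O.dH := rfl
      have e6 : (φH.comp (coef (lab n))).comp O.cap.dH = (φH.comp O.dH).comp (coef (lab n)) :=
        hom_ext fun x => congrArg φH (coef_prodMap _ _ _)
      rw [e5, e6] at i1
      simp only [hom_comp, hom_add, colD, Col.snd_pair,
        AddMonoidHom.finsetSum_apply, hom_smul, smul_eq_mul, map_add] at i1 i2 i3 ⊢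
      rw [i1, i2, i3, add_assoc]
      refine congrArg₂ (· + ·) rfl (congrArg₂ (· + ·) (Finset.sum_congr rfl fun i hi => ?_) (by
          ring))
      rw [evT, if_neg (Finset.mem_range.1 hi).ne, if_pos (c := sm n = true) h]
      have e1 : (φH.comp (coef (lab n))).comp O.cap.s = if lab n = 0 then φH.comp O.Y else φH := by
        unfold coef; split_ifs <;> rfl
      have e2 : (φH.comp (coef (lab n))).comp O.cap.T =
          if lab n = 0 then 0 else φH.comp (AddMonoidHom.fst H H) := by
        unfold coef; split_ifs
        · exact hom_ext fun x => map_zero φH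
        · rfl
      have e3 : (φH.comp (coef (lab n))).comp O.cap.Y = (φH.comp O.Y).comp (coef (lab n)) :=
        hom_ext fun x => congrArg φH (coef_prodMap _ _ _)
      rw [e1, e2, e3]
      split_ifs <;> rfl

/-! ### The edge maps of a column -/

section

variable (n : ℕ) {i : ℕ}

theorem evT_top {V H : Type} [Ab V] [Ab H] {sm : ℕ → Bool} (lab : ℕ → Fin 2)
    (φH : H →+ ℤ) (φs : V →+ ℤ) (φT φY : H →+ ℤ) (hi : i < n)
    (ha : ∀ m, i < m → m < n → sm m = false) :
    evT n i sm lab φH φs φT φY =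
      ev n (update sm i false) lab φs (if lab i = 0 then φT else φH) := by
  induction n with
  | zero => omega
  | succ n ih =>
    rw [evT]
    by_cases h : i = n
    · subst h
      rw [if_pos rfl, ev_succ_false (by simp)]
      congr 1
      exact ev_congr i (fun m hm => by rw [update_of_ne hm.ne]) (fun _ _ _ _ => rfl)
        (fun _ => rfl) (fun _ => rfl)
    · have hn := ha n (by omega) (by omega)
      rw [if_neg h, if_neg (by simp [hn]), ih (by omega) (fun m h1 h2 => ha m h1 (by omega)),
        ev_succ_false (by rw [update_of_ne (Ne.symm h), hn])]

end

/-- The edge map at a crossing with a horizontal crossing `j` next above. -/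
theorem evT_below : ∀ (n : ℕ) {i j : ℕ} {V H : Type} [Ab V] [Ab H] {sm : ℕ → Bool} (lab : ℕ → Fin 2)
    (φH : H →+ ℤ) (φs ψ : V →+ ℤ) (φT φY : H →+ ℤ)
    (_ : i < j) (_ : j < n) (_ : sm j = true) (_ : ∀ m, i < m → m < j → sm m = false),
    ((∀ m < i, sm m = false) → evT n i sm lab φH φs φT φY =
      ev n (update sm i false) lab ψ (if lab j = 0 then φY else φH)) ∧
    ((∃ m < i, sm m = true) → evT n i sm lab φH φs φT φY =
      if lab i = 0 ∧ lab j = 0 then 0 else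
      ev n (update sm i false) (update lab j (lab i * lab j)) ψ φH)
  | 0, _, _, _, _, _, _, _, _, _, _, _, _, _, _, _, _, _ => by omega
  | n + 1, i, j, V, H, _, _, sm, lab, φH, φs, ψ, φT, φY, hij, hj, hsj, hb => by
    have hin : i ≠ n := by omega
    by_cases hjn : j = n
    · subst hjn
      rw [evT, if_neg hin, if_pos hsj, evT_top j _ _ _ _ _ hij hb,
        ev_succ_true (by rw [update_of_ne hij.ne', hsj]),
        ev_succ_true (by rw [update_of_ne hij.ne', hsj])]
      refine ⟨fun h0 => ?_, fun h1 => ?_⟩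
      · congr 1
        refine ev_congr j (fun _ _ => rfl) (fun _ _ _ _ => rfl) (fun _ => rfl) ?_
        rintro ⟨m, hm, e⟩
        rcases lt_trichotomy m i with h | rfl | h
        · rw [update_of_ne h.ne, h0 m h] at e
          cases e
        · simp at e
        · rw [update_of_ne h.ne', hb m h hm] at e
          cases e
      · by_cases hl : lab i = 0 ∧ lab j = 0
        · obtain ⟨m, hm, e⟩ := h1
          have : ev j (update sm i false) lab (if lab j = 0 then φY else φH)
              (0 : H × H →+ ℤ) = 0 := by
            rw [← ev_zero_zero j (update sm i false) lab]
            refine ev_congr j (fun _ _ => rfl) (fun _ _ _ _ => rfl) (fun h => ?_) (fun _ => rfl)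
            have := h m (by omega)
            rw [update_of_ne hm.ne, e] at this
            cases this
          rw [if_pos hl, if_pos hl.1, if_pos hl.2] at *
          rw [if_pos hl.2, this]
          rfl
        · rw [if_neg hl]
          congr 1
          refine ev_congr j (fun _ _ => rfl) (fun m hm _ _ => by rw [update_of_ne hm.ne])
            (fun h => ?_) (fun _ => ?_)
          · obtain ⟨m, hm, e⟩ := h1
            have := h m (by omega)
            rw [update_of_ne hm.ne, e] at this
            cases this
          · rw [update_self]
            rcases Fin.exists_fin_two.1 ⟨lab i, rfl⟩ with e1 | e1 <;>
            rcases Fin.exists_fin_two.1 ⟨lab j, rfl⟩ with e2 | e2 <;>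
            simp_all
    · rw [evT, if_neg hin]
      cases hn : sm n
      · obtain ⟨h0, h1⟩ := evT_below n lab φH φs ψ φT φY hij (by omega) hsj hb
        have e : update sm i false n = false := by
          rw [update_of_ne (Ne.symm hin), hn]
        rw [if_neg (by simp), ev_succ_false e, ev_succ_false e]
        refine ⟨fun h => by rw [h0 h], fun h => ?_⟩
        rw [h1 h]
        split_ifs <;> rfl
      · obtain ⟨h0, h1⟩ := evT_below n lab (φH.comp (coef (lab n)))
          (if lab n = 0 then φY else φH) φH (if lab n = 0 then 0 else φH.comp (AddMonoidHom.fst H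
              H))
          (φY.comp (coef (lab n))) hij (by omega) hsj hb
        have e : update sm i false n = true := by
          rw [update_of_ne (Ne.symm hin), hn]
        rw [if_pos rfl, ev_succ_true e, ev_succ_true e]
        refine ⟨fun h => ?_, fun h => ?_⟩
        · rw [h0 h]
          congr 1
          refine ev_congr n (fun _ _ => rfl) (fun _ _ _ _ => rfl) (fun h => ?_) (fun _ => ?_)
          · have := h j (by omega)
            rw [update_of_ne hij.ne', hsj] at this
            cases this
          · split_ifs <;> rfl
        · rw [h1 h, update_of_ne (Ne.symm hjn)]
          split_ifs <;> rfl

theorem ev_mcolE : ∀ (n : ℕ) {V H : Type} [Ab V] [Ab H] (O : MOps V H)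
    (sm : ℕ → Bool) (lab : ℕ → Fin 2) (φV : V →+ ℤ) (φH : H →+ ℤ)
    (_ : φV.comp O.eV = φV) (_ : φH.comp O.eH = φH),
    (ev n sm lab φV φH).comp (mcolE n O) =
      ((-1 : ℤ) ^ Nat.count (fun m => sm m = false) n) • ev n sm lab φV φH
  | 0, _, _, _, _, O, _, _, _, _, hV, _ => by
    rw [Nat.count_zero, pow_zero, one_smul]
    exact hV
  | n + 1, V, H, _, _, O, sm, lab, φV, φH, hV, hH => by
    cases h : sm n
    · have ih := ev_mcolE n O sm lab φV φH hV hH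
      rw [ev_succ_false h, Nat.count_succ, if_pos h, pow_succ]
      ext x
      have := DFunLike.congr_fun ih (Col.fst x)
      simp only [hom_comp, hom_smul, smul_eq_mul, mcolE, Col.fst_pair,
        hom_neg, map_neg] at this ⊢
      rw [this]
      ring
    · have ih := ev_mcolE n O.cap sm lab φH (φH.comp (coef (lab n))) hH (hom_ext fun x =>
        (congrArg φH (coef_prodMap _ _ _)).trans (DFunLike.congr_fun hH _))
      rw [ev_succ_true h, Nat.count_succ, if_neg (by simp [h]), add_zero]
      ext x
      exact DFunLike.congr_fun ih (Col.snd x)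

/-- The coordinate of the edge map at crossing `i`, where `φs`, `φT`, `φY` are the compositions of
`φV` and `φH` with the operations. -/
def mevT : (n i : ℕ) → {V H : Type} → [Ab V] → [Ab H] → (ℕ → Bool) →
    (ℕ → Fin 2) → (H →+ ℤ) → (H →+ ℤ) → (H →+ ℤ) → (H →+ ℤ) → (Col n V H →+ ℤ)
  | 0, _, _, _, _, _, _, _, _, _, _, _ => 0
  | n + 1, i, _, H, _, _, sm, lab, φH, φs, φT, φY =>
    if i = n then (ev n sm lab φs (φH.coprod φT)).comp Col.snd
    else if sm n then (mevT n i sm lab (φH.comp (coef (lab n))) (φH.coprod φY)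
      (if lab n = 0 then 0 else φH.comp (AddMonoidHom.fst H H))
      (φY.comp (coef (lab n)))).comp Col.snd
    else (mevT n i sm lab φH φs φT φY).comp Col.fst

theorem ev_mcolD : ∀ (n : ℕ) {V H : Type} [Ab V] [Ab H] (O : MOps V H)
    (sm : ℕ → Bool) (lab : ℕ → Fin 2) (φV : V →+ ℤ) (φH : H →+ ℤ)
    (_ : φV.comp O.eV = φV) (_ : φH.comp O.eH = φH),
    (ev n sm lab φV φH).comp (mcolD n O) = ev n sm lab (φV.comp O.dV) (φH.comp O.dH) +
      ∑ i ∈ Finset.range n, if sm i = false then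
        ((-1 : ℤ) ^ Nat.count (fun m => sm m = false) i) •
          mevT n i sm lab φH (φV.comp O.s) (φH.comp O.T) (φH.comp O.Y) else 0
  | 0, _, _, _, _, O, _, _, _, _, _, _ => by
    rw [Finset.range_zero, Finset.sum_empty, add_zero]
    rfl
  | n + 1, V, H, _, _, O, sm, lab, φV, φH, hV, hH => by
    cases h : sm n
    · have ih := ev_mcolD n O sm lab φV φH hV hH
      have hE := ev_mcolE n O sm lab φV φH hV hH
      have hM := ev_map n sm lab φV φH O.s O.merge
      rw [Finset.sum_range_succ, if_pos h, ev_succ_false h, ev_succ_false h]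
      have e4 : φH.comp O.merge = φH.coprod (φH.comp O.T) := hom_ext fun x => by
        simp [MOps.merge]
      rw [mevT, if_pos rfl, ← e4]
      ext x
      have i1 := DFunLike.congr_fun ih (Col.fst x)
      have i2 := DFunLike.congr_fun hE (Col.map n O.s O.merge (Col.snd x))
      have i3 := DFunLike.congr_fun hM (Col.snd x)
      simp only [hom_comp, hom_add, mcolD, Col.fst_pair,
        AddMonoidHom.finsetSum_apply, hom_smul, smul_eq_mul, map_add] at i1 i2 i3 ⊢
      rw [i1, i2, i3, add_assoc]
      refine congrArg₂ (· + ·) rfl (congrArg₂ (· + ·) (Finset.sum_congr rfl fun i hi => ?_) rfl)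
      rw [mevT, if_neg (Finset.mem_range.1 hi).ne, if_neg (c := sm n = true) (by simp [h])]
      split_ifs <;> rfl
    · have hH' : (φH.comp (coef (lab n))).comp O.cap.eH = φH.comp (coef (lab n)) :=
        hom_ext fun x =>
        (congrArg φH (coef_prodMap _ _ _)).trans (DFunLike.congr_fun hH _)
      have ih := ev_mcolD n O.cap sm lab φH (φH.comp (coef (lab n))) hH hH'
      rw [Finset.sum_range_succ, if_neg (by simp [h]), add_zero, ev_succ_true h, ev_succ_true h]
      ext x
      have i1 := DFunLike.congr_fun ih (Col.snd x)
      have e5 : φH.comp O.cap.dV = φH.comp O.dH := rfl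
      have e6 : (φH.comp (coef (lab n))).comp O.cap.dH = (φH.comp O.dH).comp (coef (lab n)) :=
        hom_ext fun x => congrArg φH (coef_prodMap _ _ _)
      rw [e5, e6] at i1
      simp only [hom_comp, hom_add, mcolD, Col.snd_pair,
        AddMonoidHom.finsetSum_apply] at i1 ⊢
      rw [i1]
      refine congrArg _ (Finset.sum_congr rfl fun i hi => ?_)
      rw [mevT, if_neg (Finset.mem_range.1 hi).ne, if_pos (c := sm n = true) h]
      have e1 : φH.comp O.cap.s = φH.coprod (φH.comp O.Y) := hom_ext fun x => by
        simp [MOps.cap]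
      have e2 : (φH.comp (coef (lab n))).comp O.cap.T =
          if lab n = 0 then 0 else φH.comp (AddMonoidHom.fst H H) := by
        unfold coef; split_ifs
        · exact hom_ext fun x => map_zero φH
        · rfl
      have e3 : (φH.comp (coef (lab n))).comp O.cap.Y = (φH.comp O.Y).comp (coef (lab n)) :=
        hom_ext fun x => congrArg φH (coef_prodMap _ _ _)
      rw [e1, e2, e3]
      split_ifs <;> rfl

theorem coprod_eq {H : Type} [Ab H] (φ ψ : H →+ ℤ) :
    φ.coprod ψ = φ.comp (coef 0) + ψ.comp (coef 1) := rfl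

/-- The edge map at a crossing with no horizontal crossing above. -/
theorem mevT_top (n : ℕ) {i : ℕ} {V H : Type} [Ab V] [Ab H] {sm : ℕ → Bool}
    (lab : ℕ → Fin 2) (ψ : V →+ ℤ) (φH φs φT φY : H →+ ℤ) (hi : i < n)
    (ha : ∀ m, i < m → m < n → sm m = false) :
    ((∀ m < i, sm m = false) → mevT n i sm lab φH φs φT φY =
      ev n (update sm i true) lab ψ φs) ∧
    ((∃ m < i, sm m = true) → mevT n i sm lab φH φs φT φY =
      ev n (update sm i true) (update lab i 0) ψ φH +
      ev n (update sm i true) (update lab i 1) ψ φT) := by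
  induction n with
  | zero => omega
  | succ n ih =>
    rw [mevT]
    by_cases h : i = n
    · subst h
      have hs : ∀ m < i, update sm i true m = sm m := fun m hm => by
        rw [update_of_ne hm.ne]
      rw [if_pos rfl, ev_succ_true (by simp), ev_succ_true (by simp), ev_succ_true (by simp)]
      refine ⟨fun h0 => ?_, fun ⟨m, hm, e⟩ => ?_⟩
      · congr 1
        refine ev_congr i (fun m hm => (hs m hm).symm) (fun _ _ _ _ => rfl) (fun _ => rfl) ?_
        rintro ⟨m, hm, e⟩
        rw [h0 m hm] at e
        cases e
      · rw [← add_comp]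
        congr 1
        rw [update_self, update_self]
        have e1 : ∀ (a : Fin 2) (φ : H →+ ℤ), ev i (update sm i true)
            (update lab i a) φ (φ.comp (coef a)) = ev i sm lab 0 (φ.comp (coef a)) := by
          intro a φ
          refine ev_congr i hs (fun m hm _ _ => by rw [update_of_ne hm.ne]) (fun h => ?_)
            (fun _ => rfl)
          have := h m hm
          rw [hs m hm, e] at this
          cases this
        rw [e1, e1, ← ev_add, add_zero, ← coprod_eq]
        refine ev_congr i (fun _ _ => rfl) (fun _ _ _ _ => rfl) (fun h => ?_) (fun _ => rfl)
        rw [h m hm] at e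
        cases e
    · have hn := ha n (by omega) (by omega)
      have e : update sm i true n = false := by
        rw [update_of_ne (Ne.symm h), hn]
      obtain ⟨h0, h1⟩ := ih (by omega) (fun m h1 h2 => ha m h1 (by omega))
      rw [if_neg h, if_neg (by simp [hn]), ev_succ_false e, ev_succ_false e, ev_succ_false e]
      exact ⟨fun h => by rw [h0 h], fun h => by rw [h1 h]; rfl⟩

/-- The edge map at a crossing with a horizontal crossing `j` next above. -/
theorem mevT_below : ∀ (n : ℕ) {i j : ℕ} {V H : Type} [Ab V] [Ab H] {sm : ℕ → Bool}
    (lab : ℕ → Fin 2) (ψ : V →+ ℤ) (φH φs φT φY : H →+ ℤ)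
    (_ : i < j) (_ : j < n) (_ : sm j = true) (_ : ∀ m, i < m → m < j → sm m = false),
    ((∀ m < i, sm m = false) → mevT n i sm lab φH φs φT φY =
      ev n (update sm i true) (update lab j 0) ψ φH +
      ev n (update sm i true) (update lab j 1) ψ φY) ∧
    ((∃ m < i, sm m = true) → mevT n i sm lab φH φs φT φY =
      ev n (update sm i true) (update lab i 0) ψ φH +
      if lab j = 0 then 0 else
      ev n (update sm i true) (update (update lab i 1) j 0) ψ φH)
  | 0, _, _, _, _, _, _, _, _, _, _, _, _, _, _, _, _, _ => by omega
  | n + 1, i, j, V, H, _, _, sm, lab, ψ, φH, φs, φT, φY, hij, hj, hsj, hb => by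
    have hin : i ≠ n := by omega
    by_cases hjn : j = n
    · subst hjn
      have e : update sm i true j = true := by rw [update_of_ne hij.ne', hsj]
      obtain ⟨h0, h1⟩ := mevT_top j lab (0 : H →+ ℤ) (φH.comp (coef (lab j))) (φH.coprod φY)
        (if lab j = 0 then 0 else φH.comp (AddMonoidHom.fst H H)) (φY.comp (coef (lab j))) hij hb
      rw [mevT, if_neg hin, if_pos hsj]
      simp only [ev_succ_true e]
      have hX : ∀ (lab lab' : ℕ → Fin 2) (ψ ψ' : H →+ ℤ) (φ : H × H →+ ℤ),
          (∀ m < j, m ≠ i → lab m = lab' m) → ((∃ m < i, sm m = true) → lab i = lab' i) →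
          ev j (update sm i true) lab ψ φ = ev j (update sm i true) lab' ψ' φ := by
        intro lab lab' ψ ψ' φ hl hl'
        refine ev_congr j (fun _ _ => rfl) (fun m hm _ hm' => ?_) (fun h => ?_) (fun _ => rfl)
        · by_cases hmi : m = i
          · subst hmi
            obtain ⟨l, hl, e⟩ := hm'
            rw [update_of_ne hl.ne] at e
            exact hl' ⟨l, hl, e⟩
          · exact hl m hm hmi
        · have := h i hij
          simp at this
      refine ⟨fun h => ?_, fun h => ?_⟩
      · rw [h0 h, ← add_comp, coprod_eq]
        congr 1
        rw [update_self, update_self, ← add_zero (0 : H →+ ℤ), ev_add]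
        congr 1 <;>
        · refine hX _ _ _ _ _ (fun m hm _ => by rw [update_of_ne hm.ne]) fun ⟨m, hm, e⟩ => ?_
          rw [h m hm] at e
          cases e
      · rw [h1 h, add_comp]
        congr 1
        · rw [update_of_ne hij.ne']
          congr 1
          exact hX _ _ _ _ _ (fun _ _ _ => rfl) fun _ => rfl
        · by_cases hl : lab j = 0
          · rw [if_pos hl, if_pos hl, ev_zero_zero]
            rfl
          · rw [if_neg hl, if_neg hl, update_self]
            congr 1
            refine hX _ _ _ _ _ (fun m hm _ => by rw [update_of_ne (a := m) (a' := j) hm.ne]) fun _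
                => ?_
            rw [update_of_ne hij.ne]
    · rw [mevT, if_neg hin]
      cases hn : sm n
      · obtain ⟨h0, h1⟩ := mevT_below n lab ψ φH φs φT φY hij (by omega) hsj hb
        have e : update sm i true n = false := by
          rw [update_of_ne (Ne.symm hin), hn]
        rw [if_neg (by simp)]
        simp only [ev_succ_false e]
        refine ⟨fun h => by rw [h0 h]; rfl, fun h => ?_⟩
        rw [h1 h]
        split_ifs <;> rfl
      · obtain ⟨h0, h1⟩ := mevT_below n lab φH (φH.comp (coef (lab n))) (φH.coprod φY)
          (if lab n = 0 then 0 else φH.comp (AddMonoidHom.fst H H))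
          (φY.comp (coef (lab n))) hij (by omega) hsj hb
        have e : update sm i true n = true := by
          rw [update_of_ne (Ne.symm hin), hn]
        rw [if_pos rfl]
        simp only [ev_succ_true e, update_of_ne (Ne.symm hjn),
          update_of_ne (Ne.symm hin)]
        refine ⟨fun h => ?_, fun h => ?_⟩
        · rw [h0 h, add_comp]
          congr 2
          refine ev_congr n (fun _ _ => rfl) (fun _ _ _ _ => rfl) (fun h => ?_) (fun _ => rfl)
          have := h j (by omega)
          rw [update_of_ne hij.ne', hsj] at this
          cases this
        · rw [h1 h]
          split_ifs <;> rfl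

/-! ### Dual bases -/

/-- The sets `E j` of coordinates of degree `j` form the dual of a homogeneous basis. -/
structure Dual {C : Type} [Ab C] (G : ℤ → AddSubgroup C) (E : ℤ → Set (C →+ ℤ)) :
    Prop where
  inj : ∀ x, (∀ j, ∀ e ∈ E j, e x = 0) → x = 0
  surj : ∀ g : (C →+ ℤ) → ℤ, ∃ x, ∀ j, ∀ e ∈ E j, e x = g e
  mem : ∀ i x, x ∈ G i ↔ ∀ j, j ≠ i → ∀ e ∈ E j, e x = 0
  disj : ∀ i j, i ≠ j → ∀ e ∈ E i, e ∉ E j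

theorem Dual.ne_zero {C : Type} [Ab C] {G : ℤ → AddSubgroup C} {E : ℤ → Set (C →+ ℤ)}
    (h : Dual G E) {j : ℤ} {e : C →+ ℤ} (he : e ∈ E j) : e ≠ 0 := by
  rintro rfl
  obtain ⟨x, hx⟩ := h.surj fun _ => 1
  simpa using hx j 0 he

/-- Coordinates on a product. -/
def prodCoords {A B : Type} [Ab A] [Ab B] (E : ℤ → Set (A →+ ℤ))
    (F : ℤ → Set (B →+ ℤ)) (j : ℤ) : Set (A × B →+ ℤ) :=
  (fun e => e.comp (AddMonoidHom.fst A B)) '' E j ∪ (fun e => e.comp (AddMonoidHom.snd A B)) '' F j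

theorem Dual.prod {A B : Type} [Ab A] [Ab B] {G : ℤ → AddSubgroup A}
    {G' : ℤ → AddSubgroup B} {E : ℤ → Set (A →+ ℤ)} {F : ℤ → Set (B →+ ℤ)} (h : Dual G E)
    (h' : Dual G' F) : Dual (fun i => (G i).prod (G' i)) (prodCoords E F) where
  inj x hx := Prod.ext (h.inj _ fun j e he => hx j _ (Or.inl ⟨e, he, rfl⟩))
    (h'.inj _ fun j e he => hx j _ (Or.inr ⟨e, he, rfl⟩))
  surj g := by
    obtain ⟨x, hx⟩ := h.surj fun e => g (e.comp (AddMonoidHom.fst A B))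
    obtain ⟨y, hy⟩ := h'.surj fun e => g (e.comp (AddMonoidHom.snd A B))
    refine ⟨(x, y), ?_⟩
    rintro j _ (⟨e, he, rfl⟩ | ⟨e, he, rfl⟩)
    · exact hx j e he
    · exact hy j e he
  mem i x := by
    constructor
    · rintro ⟨h1, h2⟩ j hj _ (⟨e, he, rfl⟩ | ⟨e, he, rfl⟩)
      · exact (h.mem i _).1 h1 j hj e he
      · exact (h'.mem i _).1 h2 j hj e he
    · intro hx
      exact ⟨(h.mem i _).2 fun j hj e he => hx j hj _ (Or.inl ⟨e, he, rfl⟩),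
        (h'.mem i _).2 fun j hj e he => hx j hj _ (Or.inr ⟨e, he, rfl⟩)⟩
  disj i j hij := by
    have key : ∀ {f : A →+ ℤ} {g : B →+ ℤ},
        f.comp (AddMonoidHom.fst A B) = g.comp (AddMonoidHom.snd A B) → f = 0 := fun {f g} e => by
      ext a
      simpa using DFunLike.congr_fun e (a, 0)
    rintro _ (⟨e, he, rfl⟩ | ⟨e, he, rfl⟩) (⟨f, hf, ef⟩ | ⟨f, hf, ef⟩)
    · obtain rfl : f = e := by
        ext a
        exact DFunLike.congr_fun ef (a, 0)
      exact h.disj i j hij _ he hf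
    · exact h.ne_zero he (key ef.symm)
    · exact h.ne_zero hf (key ef)
    · obtain rfl : f = e := by
        ext a
        exact DFunLike.congr_fun ef (0, a)
      exact h'.disj i j hij _ he hf

theorem Dual.shift {C : Type} [Ab C] {G : ℤ → AddSubgroup C} {E : ℤ → Set (C →+ ℤ)}
    (h : Dual G E) (a : ℤ) : Dual (fun i => G (i + a)) (fun i => E (i + a)) where
  inj x hx := h.inj x fun j e he => hx (j - a) e (by simpa using he)
  surj g := by
    obtain ⟨x, hx⟩ := h.surj g
    exact ⟨x, fun j => hx (j + a)⟩
  mem i x := by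
    rw [h.mem]
    exact ⟨fun hx j hj => hx (j + a) (by simpa using hj),
      fun hx j hj e he => hx (j - a) (by omega) e (by simpa using he)⟩
  disj i j hij := h.disj _ _ (by omega)

/-- The grading of a column, where the exponents `0`, `1` on a circle lower the degree by `a`, `b`.
    -/
def gr (a b : ℤ) : (n : ℕ) → {V H : Type} → [Ab V] → [Ab H] →
    (ℤ → AddSubgroup V) → (ℤ → AddSubgroup H) → ℤ → AddSubgroup (Col n V H)
  | 0, _, _, _, _, GV, _ => GV
  | n + 1, _, _, _, _, GV, GH => fun i => (gr a b n GV GH i).comap Col.fst ⊓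
      (gr a b n GH (fun i => (GH (i + a)).prod (GH (i + b))) i).comap Col.snd

/-- The coordinates on a column. -/
def coords (a b : ℤ) : (n : ℕ) → {V H : Type} → [Ab V] → [Ab H] →
    (ℤ → Set (V →+ ℤ)) → (ℤ → Set (H →+ ℤ)) → ℤ → Set (Col n V H →+ ℤ)
  | 0, _, _, _, _, EV, _ => EV
  | n + 1, V, H, _, _, EV, EH => prodCoords (A := Col n V H) (B := Col n H (H × H))
      (coords a b n EV EH)
      (coords a b n EH (prodCoords (fun i => EH (i + a)) (fun i => EH (i + b))))

theorem Dual.col (a b : ℤ) : ∀ (n : ℕ) {V H : Type} [Ab V] [Ab H] {GV : ℤ → AddSubgroup V}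
    {GH : ℤ → AddSubgroup H} {EV : ℤ → Set (V →+ ℤ)}
    {EH : ℤ → Set (H →+ ℤ)} (_ : Dual GV EV) (_ : Dual GH EH),
    Dual (gr a b n GV GH) (coords a b n EV EH)
  | 0, _, _, _, _, _, _, _, _, h, _ => h
  | n + 1, _, _, _, _, _, _, _, _, h, h' =>
    (Dual.col a b n h h').prod (Dual.col a b n h' ((h'.shift a).prod (h'.shift b)))

theorem colG_eq : ∀ (n : ℕ) {V H : Type} [Ab V] [Ab H] (O : Ops V H),
    colG n O = gr 0 1 n O.GV O.GH
  | 0, _, _, _, _, _ => rfl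
  | n + 1, _, _, _, _, O => by
    funext i
    rw [colG, gr, colG_eq n, colG_eq n]
    simp only [add_zero]
    rfl

theorem mcolG_eq : ∀ (n : ℕ) {V H : Type} [Ab V] [Ab H] (O : MOps V H),
    mcolG n O = gr (-1) 0 n O.GV O.GH
  | 0, _, _, _, _, _ => rfl
  | n + 1, _, _, _, _, O => by
    funext i
    rw [mcolG, gr, mcolG_eq n, mcolG_eq n]
    simp only [add_zero]
    rfl

/-- Crossing `m` is resolved horizontally, and not the lowest such crossing. -/
def IsUpper (sm : ℕ → Bool) (m : ℕ) : Prop := sm m = true ∧ ∃ l < m, sm l = true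

open Classical in
/-- The contribution of the circles of a column to the degree. -/
noncomputable def weight (a b : ℤ) (n : ℕ) (sm : ℕ → Bool) (lab : ℕ → Fin 2) : ℤ :=
  ∑ m ∈ Finset.range n, if IsUpper sm m then (if lab m = 0 then a else b) else 0

theorem weight_of_vertical (a b : ℤ) {n : ℕ} {sm : ℕ → Bool} (lab : ℕ → Fin 2)
    (h : ∀ m < n, sm m = false) : weight a b n sm lab = 0 :=
  Finset.sum_eq_zero fun m hm => if_neg fun h' => by
    have := h'.1
    rw [h m (Finset.mem_range.1 hm)] at this
    cases this

theorem weight_congr (a b : ℤ) {n : ℕ} {sm sm' : ℕ → Bool} {lab lab' : ℕ → Fin 2}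
    (h : ∀ m < n, sm m = sm' m) (hl : ∀ m < n, lab m = lab' m) :
    weight a b n sm lab = weight a b n sm' lab' := by
  refine Finset.sum_congr rfl fun m hm => ?_
  rw [Finset.mem_range] at hm
  have : IsUpper sm m ↔ IsUpper sm' m := by
    unfold IsUpper
    rw [h m hm]
    exact and_congr_right fun _ => exists_congr fun l => and_congr_right fun hl => by
      rw [h l (by omega)]
  rw [hl m hm, propext this]

theorem ev_mem_of_vertical (a b : ℤ) : ∀ (n : ℕ) {V H : Type} [Ab V] [Ab H] {EV : ℤ → Set (V →+ ℤ)}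
    {EH : ℤ → Set (H →+ ℤ)} {sm : ℕ → Bool} {lab : ℕ → Fin 2}
    {φV : V →+ ℤ} (φH : H →+ ℤ) {d : ℤ} (_ : ∀ m < n, sm m = false) (_ : φV ∈ EV d),
    ev n sm lab φV φH ∈ coords a b n EV EH d
  | 0, _, _, _, _, _, _, _, _, _, _, _, _, h => h
  | n + 1, _, _, _, _, EV, EH, sm, lab, φV, φH, d, hs, h => by
    rw [ev_succ_false (hs n n.lt_succ_self)]
    exact Or.inl ⟨_, ev_mem_of_vertical a b n φH (fun m hm => hs m (by omega)) h, rfl⟩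

theorem ev_mem_of_horizontal (a b : ℤ) : ∀ (n : ℕ) {V H : Type} [Ab V] [Ab H]
    {EV : ℤ → Set (V →+ ℤ)} {EH : ℤ → Set (H →+ ℤ)} {sm : ℕ → Bool} {lab : ℕ → Fin 2}
    (φV : V →+ ℤ) {φH : H →+ ℤ} {d c : ℤ} (_ : ∃ m < n, sm m = true) (_ : φH ∈ EH c)
    (_ : d = c - weight a b n sm lab),
    ev n sm lab φV φH ∈ coords a b n EV EH d
  | 0, _, _, _, _, _, _, _, _, _, _, _, _, ⟨m, hm, _⟩, h, _ => by omega
  | n + 1, _, _, _, _, EV, EH, sm, lab, φV, φH, d, c, hs, h, hd => by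
    rw [weight, Finset.sum_range_succ] at hd
    change d = c - (weight a b n sm lab + _) at hd
    cases hn : sm n
    · rw [ev_succ_false hn]
      have h0 : ¬ IsUpper sm n := fun h => by rw [h.1] at hn; cases hn
      rw [if_neg h0, add_zero] at hd
      obtain ⟨m, hm, e⟩ := hs
      have hmn : m ≠ n := by rintro rfl; rw [e] at hn; cases hn
      exact Or.inl ⟨_, ev_mem_of_horizontal a b n φV ⟨m, by omega, e⟩ h hd, rfl⟩
    · rw [ev_succ_true hn]
      refine Or.inr ⟨_, ?_, rfl⟩
      by_cases h1 : ∃ l < n, sm l = true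
      · have h0 : IsUpper sm n := ⟨hn, h1⟩
        rw [if_pos h0] at hd
        refine ev_mem_of_horizontal a b n φH (c := c - if lab n = 0 then a else b) h1 ?_
          (by rw [hd]; ring)
        unfold coef
        split_ifs
        · exact Or.inl ⟨φH, by simpa using h, rfl⟩
        · exact Or.inr ⟨φH, by simpa using h, rfl⟩
      · have h0 : ¬ IsUpper sm n := fun h => h1 h.2
        have h2 : ∀ m < n, sm m = false := fun m hm => by
          cases hm' : sm m
          · rfl
          · exact absurd ⟨m, hm, hm'⟩ h1
        rw [if_neg h0, add_zero, weight_of_vertical a b lab h2, sub_zero] at hd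
        exact ev_mem_of_vertical a b n _ h2 (hd ▸ h)

theorem exists_ev (a b : ℤ) : ∀ (n : ℕ) {V H : Type} [Ab V] [Ab H] {EV : ℤ → Set (V →+ ℤ)}
    {EH : ℤ → Set (H →+ ℤ)} {d : ℤ} {e : Col n V H →+ ℤ}
    (_ : e ∈ coords a b n EV EH d), ∃ (sm : ℕ → Bool) (lab : ℕ → Fin 2),
    ((∀ m < n, sm m = false) ∧ ∃ φV ∈ EV d, ∀ φH, e = ev n sm lab φV φH) ∨
    ((∃ m < n, sm m = true) ∧ ∃ φH ∈ EH (d + weight a b n sm lab), ∀ φV, e = ev n sm lab φV φH)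
  | 0, _, _, _, _, EV, EH, d, e, h => ⟨fun _ => false, fun _ => 0, Or.inl ⟨by simp, e, h, fun _ =>
      rfl⟩⟩
  | n + 1, V, H, _, _, EV, EH, d, _, Or.inl ⟨e, he, rfl⟩ => by
    obtain ⟨sm, lab, h⟩ := exists_ev a b n he
    have hs : ∀ m < n, sm m = update sm n false m := fun m hm => by
      rw [update_of_ne hm.ne]
    have h0 : update sm n false n = false := update_self ..
    have hev : ∀ (φV : V →+ ℤ) (φH : H →+ ℤ), ev n sm lab φV φH =
        ev n (update sm n false) lab φV φH := fun φV φH =>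
      ev_congr n hs (fun _ _ _ _ => rfl) (fun _ => rfl) (fun _ => rfl)
    refine ⟨update sm n false, lab, ?_⟩
    simp only [ev_succ_false h0, ← hev]
    rcases h with ⟨h1, φV, hφ, h2⟩ | ⟨⟨m, hm, e1⟩, φH, hφ, h2⟩
    · refine Or.inl ⟨fun m hm => ?_, φV, hφ, fun φH => ?_⟩
      · rcases Nat.lt_succ_iff_lt_or_eq.1 hm with hm | rfl
        · rw [← hs m hm, h1 m hm]
        · exact h0
      · rw [← h2]
        rfl
    · refine Or.inr ⟨⟨m, by omega, by rw [← hs m hm, e1]⟩, φH, ?_, fun φV => ?_⟩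
      · have h3 : ¬ IsUpper (update sm n false) n := fun h => by
          rw [h.1] at h0
          cases h0
        rw [weight, Finset.sum_range_succ, if_neg h3, add_zero]
        change φH ∈ EH (d + weight a b n (update sm n false) lab)
        rw [← weight_congr a b hs fun _ _ => rfl]
        exact hφ
      · rw [← h2]
        rfl
  | n + 1, V, H, _, _, EV, EH, d, _, Or.inr ⟨e, he, rfl⟩ => by
    obtain ⟨sm, lab, h⟩ := exists_ev a b n he
    have hs : ∀ m < n, sm m = update sm n true m := fun m hm => by
      rw [update_of_ne hm.ne]
    have h0 : update sm n true n = true := update_self ..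
    rcases h with ⟨h1, φH, hφ, h2⟩ | ⟨⟨m, hm, e1⟩, ψ, hψ, h2⟩
    · refine ⟨update sm n true, lab, Or.inr ⟨⟨n, n.lt_succ_self, h0⟩, φH, ?_,
        fun φV => ?_⟩⟩
      · have h3 : ¬ IsUpper (update sm n true) n := by
          rintro ⟨_, m, hm, e⟩
          rw [← hs m hm, h1 m hm] at e
          cases e
        rw [weight, Finset.sum_range_succ, if_neg h3, add_zero]
        change φH ∈ EH (d + weight a b n (update sm n true) lab)
        rw [weight_of_vertical a b lab fun m hm => (hs m hm) ▸ h1 m hm, add_zero]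
        exact hφ
      · rw [ev_succ_true h0, h2 (φH.comp (coef (lab n)))]
        congr 1
        exact ev_congr n hs (fun _ _ _ _ => rfl) (fun _ => rfl) (fun _ => rfl)
    · have key : ∃ (c : Fin 2) (φH : H →+ ℤ), ψ = φH.comp (coef c) ∧
          φH ∈ EH (d + weight a b n sm lab + if c = 0 then a else b) := by
        rcases hψ with ⟨φ, hφ, rfl⟩ | ⟨φ, hφ, rfl⟩
        · exact ⟨0, φ, rfl, hφ⟩
        · exact ⟨1, φ, rfl, hφ⟩
      obtain ⟨c, φH, rfl, hφ⟩ := key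
      have hl : ∀ m < n, lab m = update lab n c m := fun m hm => by
        rw [update_of_ne hm.ne]
      refine ⟨update sm n true, update lab n c, Or.inr ⟨⟨n, n.lt_succ_self, h0⟩,
        φH, ?_, fun φV => ?_⟩⟩
      · have h3 : IsUpper (update sm n true) n := ⟨h0, m, hm, by rw [← hs m hm, e1]⟩
        rw [weight, Finset.sum_range_succ, if_pos h3, update_self, ← add_assoc]
        change φH ∈ EH (d + weight a b n (update sm n true) (update lab n c) + _)
        rw [← weight_congr a b hs hl]
        exact hφ
      · rw [ev_succ_true h0, h2 φH, update_self]
        congr 1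
        exact ev_congr n hs (fun m hm _ _ => hl m hm) (fun _ => rfl) (fun _ => rfl)

theorem comp_coef_ne_zero {H : Type} [Ab H] {φ : H →+ ℤ} (h : φ ≠ 0) (c : Fin 2) :
    φ.comp (coef c) ≠ 0 := by
  intro h'
  apply h
  ext x
  have := DFunLike.congr_fun h' (x, x)
  unfold coef at this
  split_ifs at this <;> exact this

theorem comp_coef_injective {H : Type} [Ab H] {φ φ' : H →+ ℤ} (h : φ ≠ 0)
    {c c' : Fin 2} (e : φ.comp (coef c) = φ'.comp (coef c')) : φ = φ' ∧ c = c' := by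
  have h1 : φ = φ' := by
    ext x
    have := DFunLike.congr_fun e (x, x)
    unfold coef at this
    split_ifs at this <;> exact this
  refine ⟨h1, ?_⟩
  subst h1
  by_contra hc
  apply h
  ext x
  have := DFunLike.congr_fun e (x, 0)
  have h0 : c = 0 ∧ c' = 1 ∨ c = 1 ∧ c' = 0 := by omega
  rcases h0 with ⟨rfl, rfl⟩ | ⟨rfl, rfl⟩
  · simpa using this
  · simpa using this.symm

theorem ev_ne_zero : ∀ (n : ℕ) {V H : Type} [Ab V] [Ab H] {sm : ℕ → Bool}
    {lab : ℕ → Fin 2} {φV : V →+ ℤ} {φH : H →+ ℤ} (_ : φV ≠ 0) (_ : φH ≠ 0),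
    ev n sm lab φV φH ≠ 0
  | 0, _, _, _, _, _, _, _, _, h, _ => h
  | n + 1, V, H, _, _, sm, lab, φV, φH, h, h' => by
    cases hn : sm n
    · rw [ev_succ_false hn]
      exact fun e => ev_ne_zero n h h' (hom_ext fun x =>
        DFunLike.congr_fun e ((x, 0) : Col n V H × Col n H (H × H)))
    · rw [ev_succ_true hn]
      exact fun e => ev_ne_zero n h' (comp_coef_ne_zero h' (lab n)) (hom_ext fun x =>
        DFunLike.congr_fun e ((0, x) : Col n V H × Col n H (H × H)))

theorem ev_injective : ∀ (n : ℕ) {V H : Type} [Ab V] [Ab H] {sm sm' : ℕ → Bool}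
    {lab lab' : ℕ → Fin 2} {φV φV' : V →+ ℤ} {φH φH' : H →+ ℤ}
    (_ : φV ≠ 0) (_ : φH ≠ 0) (_ : φV' ≠ 0) (_ : φH' ≠ 0)
    (_ : ev n sm lab φV φH = ev n sm' lab' φV' φH'),
    (∀ m < n, sm m = sm' m) ∧ (∀ m < n, IsUpper sm m → lab m = lab' m) ∧
    ((∀ m < n, sm m = false) → φV = φV') ∧ ((∃ m < n, sm m = true) → φH = φH')
  | 0, _, _, _, _, _, _, _, _, _, _, _, _, _, _, _, _, h => ⟨by simp, by simp, fun _ => h, by simp⟩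
  | n + 1, V, H, _, _, sm, sm', lab, lab', φV, φV', φH, φH', h1, h2, h3, h4, h => by
    cases hn : sm n
    · rw [ev_succ_false hn] at h
      cases hn' : sm' n
      · rw [ev_succ_false hn'] at h
        obtain ⟨k1, k2, k3, k4⟩ := ev_injective n h1 h2 h3 h4 (hom_ext fun x =>
          DFunLike.congr_fun h ((x, 0) : Col n V H × Col n H (H × H)))
        refine ⟨fun m hm => ?_, fun m hm hu => ?_, fun h => k3 fun m hm => h m (by omega),
          fun ⟨m, hm, e⟩ => ?_⟩
        · rcases Nat.lt_succ_iff_lt_or_eq.1 hm with hm | rfl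
          · exact k1 m hm
          · rw [hn, hn']
        · rcases Nat.lt_succ_iff_lt_or_eq.1 hm with hm | rfl
          · exact k2 m hm hu
          · rw [hu.1] at hn
            cases hn
        · rcases Nat.lt_succ_iff_lt_or_eq.1 hm with hm | rfl
          · exact k4 ⟨m, hm, e⟩
          · rw [e] at hn
            cases hn
      · rw [ev_succ_true hn'] at h
        exact absurd (hom_ext fun x => (DFunLike.congr_fun h
          ((x, 0) : Col n V H × Col n H (H × H))).trans (map_zero (ev n sm' lab' _ _)))
          (ev_ne_zero n (sm := sm) (lab := lab) h1 h2)
    · rw [ev_succ_true hn] at h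
      cases hn' : sm' n
      · rw [ev_succ_false hn'] at h
        exact absurd (hom_ext fun x => (DFunLike.congr_fun h
          ((0, x) : Col n V H × Col n H (H × H))).trans (map_zero (ev n sm' lab' _ _)))
          (ev_ne_zero n (sm := sm) (lab := lab) h2 (comp_coef_ne_zero h2 (lab n)))
      · rw [ev_succ_true hn'] at h
        obtain ⟨k1, k2, k3, k4⟩ := ev_injective n h2 (comp_coef_ne_zero h2 _) h4
          (comp_coef_ne_zero h4 _) (hom_ext fun x =>
          DFunLike.congr_fun h ((0, x) : Col n V H × Col n H (H × H)))
        have e : φH = φH' := by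
          by_cases h0 : ∃ m < n, sm m = true
          · exact (comp_coef_injective h2 (k4 h0)).1
          · refine k3 fun m hm => ?_
            cases hm' : sm m
            · rfl
            · exact absurd ⟨m, hm, hm'⟩ h0
        refine ⟨fun m hm => ?_, fun m hm hu => ?_, fun h => ?_, fun _ => e⟩
        · rcases Nat.lt_succ_iff_lt_or_eq.1 hm with hm | rfl
          · exact k1 m hm
          · rw [hn, hn']
        · rcases Nat.lt_succ_iff_lt_or_eq.1 hm with hm | rfl
          · exact k2 m hm hu
          · exact (comp_coef_injective h2 (k4 hu.2)).2
        · rw [h n n.lt_succ_self] at hn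
          cases hn

open PDCode

/-! ### The circles of a resolution of a pretzel diagram -/

section

variable {n : Fin 3 → ℕ} {pos : Fin 3 → Bool}

/-- Crossing `i` of column `k` is resolved horizontally. -/
def hs (pos : Fin 3 → Bool) (v : PretzelCrossing n → Bool) (k : Fin 3) (i : ℕ) : Bool :=
  if h : i < n k then v (toLex ⟨k, ⟨i, h⟩⟩) == pos k else false

theorem lt_of_hs {v : PretzelCrossing n → Bool} {k : Fin 3} {i : ℕ} (h : hs pos v k i = true) :
    i < n k := by
  by_contra h'
  simp [hs, h'] at h

theorem circle_eq_of_joined {χ ε : Type} {D : PDCode χ ε} {v : χ → Bool} {e f : ε}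
    (h : D.Joined v e f) : D.circle v e = D.circle v f :=
  Quotient.sound (Relation.EqvGen.rel _ _ h)

theorem circle_false_eq {v : PretzelCrossing n → Bool} {k : Fin 3} {i : ℕ}
    (h : hs pos v k i = true) :
    (pretzelDiagram n pos).circle v (columnEdge n k false i) =
      (pretzelDiagram n pos).circle v (columnEdge n k true i) ∧
    (pretzelDiagram n pos).circle v (columnEdge n k false (i + 1)) =
      (pretzelDiagram n pos).circle v (columnEdge n k true (i + 1)) := by
  have hi := lt_of_hs h
  cases hp : pos k
  · have hv : v (toLex ⟨k, ⟨i, hi⟩⟩) = false := by simpa [hs, hi, hp] using h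
    exact ⟨circle_eq_of_joined ⟨toLex ⟨k, ⟨i, hi⟩⟩, Or.inl ⟨hv, Or.inl (by simp [pretzelDiagram,
        hp])⟩⟩,
      (circle_eq_of_joined ⟨toLex ⟨k, ⟨i, hi⟩⟩, Or.inl ⟨hv, Or.inr (by simp [pretzelDiagram,
          hp])⟩⟩).symm⟩
  · have hv : v (toLex ⟨k, ⟨i, hi⟩⟩) = true := by simpa [hs, hi, hp] using h
    exact ⟨(circle_eq_of_joined ⟨toLex ⟨k, ⟨i, hi⟩⟩, Or.inr ⟨hv, Or.inl (by simp [pretzelDiagram,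
        hp])⟩⟩).symm,
      (circle_eq_of_joined ⟨toLex ⟨k, ⟨i, hi⟩⟩, Or.inr ⟨hv, Or.inr (by simp [pretzelDiagram,
          hp])⟩⟩).symm⟩

theorem circle_succ_eq {v : PretzelCrossing n → Bool} {k : Fin 3} {i : ℕ} (hi : i < n k)
    (h : hs pos v k i = false) (b : Bool) :
    (pretzelDiagram n pos).circle v (columnEdge n k b i) =
      (pretzelDiagram n pos).circle v (columnEdge n k b (i + 1)) := by
  cases hp : pos k
  · have hv : v (toLex ⟨k, ⟨i, hi⟩⟩) = true := by simpa [hs, hi, hp] using h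
    cases b
    · exact circle_eq_of_joined ⟨toLex ⟨k, ⟨i, hi⟩⟩, Or.inr ⟨hv, Or.inl (by simp [pretzelDiagram,
          hp])⟩⟩
    · exact circle_eq_of_joined ⟨toLex ⟨k, ⟨i, hi⟩⟩, Or.inr ⟨hv, Or.inr (by simp [pretzelDiagram,
          hp])⟩⟩
  · have hv : v (toLex ⟨k, ⟨i, hi⟩⟩) = false := by simpa [hs, hi, hp] using h
    cases b
    · exact (circle_eq_of_joined ⟨toLex ⟨k, ⟨i, hi⟩⟩, Or.inl ⟨hv, Or.inr (by simp [pretzelDiagram,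
          hp])⟩⟩).symm
    · exact circle_eq_of_joined ⟨toLex ⟨k, ⟨i, hi⟩⟩, Or.inl ⟨hv, Or.inl (by simp [pretzelDiagram,
          hp])⟩⟩

theorem eq_of_joined {v : PretzelCrossing n → Bool} {α : Type} (F : PretzelEdge n → α)
    (hH : ∀ k i, hs pos v k i = true → F (columnEdge n k false i) = F (columnEdge n k true i) ∧
      F (columnEdge n k false (i + 1)) = F (columnEdge n k true (i + 1)))
    (hV : ∀ k i, i < n k → hs pos v k i = false → ∀ b,
      F (columnEdge n k b i) = F (columnEdge n k b (i + 1)))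
    {e f : PretzelEdge n} (h : (pretzelDiagram n pos).Joined v e f) : F e = F f := by
  obtain ⟨c, h⟩ := h
  obtain ⟨⟨k, ⟨i, hi⟩⟩, rfl⟩ := toLex.surjective c
  cases hp : pos k
  · rcases h with ⟨hv, ⟨rfl, rfl⟩ | ⟨rfl, rfl⟩⟩ | ⟨hv, ⟨rfl, rfl⟩ | ⟨rfl, rfl⟩⟩
    · simpa [pretzelDiagram, hp] using (hH k i (by simp [hs, hi, hp, hv])).1
    · simpa [pretzelDiagram, hp] using (hH k i (by simp [hs, hi, hp, hv])).2.symm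
    · simpa [pretzelDiagram, hp] using hV k i hi (by simp [hs, hi, hp, hv]) false
    · simpa [pretzelDiagram, hp] using hV k i hi (by simp [hs, hi, hp, hv]) true
  · rcases h with ⟨hv, ⟨rfl, rfl⟩ | ⟨rfl, rfl⟩⟩ | ⟨hv, ⟨rfl, rfl⟩ | ⟨rfl, rfl⟩⟩
    · simpa [pretzelDiagram, hp] using hV k i hi (by simp [hs, hi, hp, hv]) true
    · simpa [pretzelDiagram, hp] using (hV k i hi (by simp [hs, hi, hp, hv]) false).symm
    · simpa [pretzelDiagram, hp] using (hH k i (by simp [hs, hi, hp, hv])).1.symm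
    · simpa [pretzelDiagram, hp] using (hH k i (by simp [hs, hi, hp, hv])).2.symm

/-- The arc at the left or at the right end of column `k`. -/
abbrev arc (k : Fin 3) (b : Bool) : Fin 3 := if b then k else k - 1

theorem columnEdge_zero (k : Fin 3) (b : Bool) : columnEdge n k b 0 = .bot (arc k b) := rfl

theorem columnEdge_last (hn : ∀ k, 0 < n k) (k : Fin 3) (b : Bool) :
    columnEdge n k b (n k) = .top (arc k b) := by
  simp [columnEdge, (hn k).ne']

theorem columnEdge_inner {k : Fin 3} (b : Bool) {l : ℕ} (h : 0 < l ∧ l < n k) :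
    columnEdge n k b l = .inner k b ⟨l - 1, by omega⟩ := by
  simp [columnEdge, h]

open Classical in
/-- Column `k` has a crossing that is resolved horizontally. -/
noncomputable def pattern (pos : Fin 3 → Bool) (v : PretzelCrossing n → Bool) (k : Fin 3) : Bool :=
  decide (∃ i, hs pos v k i = true)

theorem pattern_eq_true {v : PretzelCrossing n → Bool} {k : Fin 3} :
    pattern pos v k = true ↔ ∃ i, hs pos v k i = true := by simp [pattern]

theorem pattern_eq_false {v : PretzelCrossing n → Bool} {k : Fin 3} :
    pattern pos v k = false ↔ ∀ i, hs pos v k i = false := by simp [pattern]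

/-- The arc that represents the outer circle of the arc `top k`, where `P` tells which columns have
a horizontal crossing. -/
def topRep (P : Fin 3 → Bool) (k : Fin 3) : Fin 3 :=
  if k = 0 then (if P 1 || P 0 && P 2 then 1 else 0)
  else if k = 1 then 1
  else (if P 2 || P 0 && P 1 then 1 else if P 0 then 0 else 2)

/-- The edge that represents the circle of the arc `top k`. -/
def topEdge (n : Fin 3 → ℕ) (P : Fin 3 → Bool) (k : Fin 3) : PretzelEdge n := .top (topRep P k)

/-- The edge that represents the circle of the arc `bot k`. -/
def botEdge (n : Fin 3 → ℕ) (P : Fin 3 → Bool) (k : Fin 3) : PretzelEdge n :=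
  if P 0 && P 1 && P 2 then .bot 0 else .top (topRep P k)

theorem topEdge_eq {P : Fin 3 → Bool} {k : Fin 3} (h : P k = true) :
    topEdge n P (k - 1) = topEdge n P k := by
  have : ∀ (a b c : Bool) (k : Fin 3), ![a, b, c] k = true →
      topRep ![a, b, c] (k - 1) = topRep ![a, b, c] k := by decide
  have e : ![P 0, P 1, P 2] = P := by ext k; fin_cases k <;> rfl
  have := this (P 0) (P 1) (P 2) k
  rw [e] at this
  rw [topEdge, this h, topEdge]

theorem botEdge_eq {P : Fin 3 → Bool} {k : Fin 3} (h : P k = true) :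
    botEdge n P (k - 1) = botEdge n P k := by
  have := topEdge_eq (n := n) h
  rw [topEdge, topEdge] at this
  rw [botEdge, this, botEdge]

theorem botEdge_eq_topEdge {P : Fin 3 → Bool} {k : Fin 3} (h : P k = false) (j : Fin 3) :
    botEdge n P j = topEdge n P j := by
  rw [botEdge, if_neg, topEdge]
  fin_cases k <;> simp_all

open Classical in
/-- The edge that represents the circle of the edge at level `l` of column `k`. -/
noncomputable def levelRep (pos : Fin 3 → Bool) (v : PretzelCrossing n → Bool) (k : Fin 3)
    (b : Bool) (l : ℕ) : PretzelEdge n :=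
  if ∃ m, l ≤ m ∧ hs pos v k m = true then
    if ∃ m < l, hs pos v k m = true then columnEdge n k false (sInf {m | l ≤ m ∧ hs pos v k m =
        true})
    else botEdge n (pattern pos v) (arc k b)
  else topEdge n (pattern pos v) (arc k b)

/-- The edge that represents the circle of an edge. -/
noncomputable def rep (pos : Fin 3 → Bool) (v : PretzelCrossing n → Bool) :
    PretzelEdge n → PretzelEdge n
  | .top k => topEdge n (pattern pos v) k
  | .bot k => botEdge n (pattern pos v) k
  | .inner k b i => levelRep pos v k b (i + 1)

theorem rep_columnEdge (hn : ∀ k, 0 < n k) (v : PretzelCrossing n → Bool) (k : Fin 3) (b : Bool)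
    {l : ℕ} (hl : l ≤ n k) : rep pos v (columnEdge n k b l) = levelRep pos v k b l := by
  rcases Nat.eq_zero_or_pos l with rfl | h0
  · rw [columnEdge_zero, rep, levelRep]
    by_cases h : ∃ m, 0 ≤ m ∧ hs pos v k m = true
    · rw [if_pos h, if_neg (by simp)]
    · rw [if_neg h, botEdge_eq_topEdge (k := k)]
      rw [pattern_eq_false]
      intro i
      by_contra h'
      exact h ⟨i, i.zero_le, by simpa using h'⟩
  · rcases hl.eq_or_lt with rfl | hl
    · rw [columnEdge_last hn, rep, levelRep, if_neg]
      rintro ⟨m, h1, h2⟩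
      exact absurd (lt_of_hs h2) (by omega)
    · rw [columnEdge_inner b ⟨h0, hl⟩, rep, Nat.sub_add_cancel h0]

theorem levelRep_of_upper {v : PretzelCrossing n → Bool} {k : Fin 3} {l j : ℕ} (hlj : l ≤ j)
    (hj : hs pos v k j = true) (hb : ∀ m, l ≤ m → m < j → hs pos v k m = false)
    (h : ∃ m < l, hs pos v k m = true) (b : Bool) :
    levelRep pos v k b l = columnEdge n k false j := by
  rw [levelRep, if_pos ⟨j, hlj, hj⟩, if_pos h]
  congr 1
  refine le_antisymm (Nat.sInf_le ⟨hlj, hj⟩) ?_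
  by_contra h'
  obtain ⟨h1, h2⟩ := Nat.sInf_mem (s := {m | l ≤ m ∧ hs pos v k m = true}) ⟨j, hlj, hj⟩
  rw [hb _ h1 (by omega)] at h2
  cases h2

theorem levelRep_of_bot {v : PretzelCrossing n → Bool} {k : Fin 3} {l : ℕ}
    (h : ∀ m < l, hs pos v k m = false) (h' : ∃ m, l ≤ m ∧ hs pos v k m = true) (b : Bool) :
    levelRep pos v k b l = botEdge n (pattern pos v) (arc k b) := by
  rw [levelRep, if_pos h', if_neg]
  rintro ⟨m, hm, e⟩
  rw [h m hm] at e
  cases e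

theorem levelRep_of_top {v : PretzelCrossing n → Bool} {k : Fin 3} {l : ℕ}
    (h : ∀ m, l ≤ m → hs pos v k m = false) (b : Bool) :
    levelRep pos v k b l = topEdge n (pattern pos v) (arc k b) := by
  rw [levelRep, if_neg]
  rintro ⟨m, hm, e⟩
  rw [h m hm] at e
  cases e

theorem levelRep_false_eq {v : PretzelCrossing n → Bool} {k : Fin 3} (h : pattern pos v k = true)
    (l : ℕ) : levelRep pos v k false l = levelRep pos v k true l := by
  unfold levelRep
  split_ifs
  · rfl
  · exact botEdge_eq h
  · exact topEdge_eq h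

theorem levelRep_succ_eq {v : PretzelCrossing n → Bool} {k : Fin 3} {i : ℕ}
    (h : hs pos v k i = false) (b : Bool) :
    levelRep pos v k b i = levelRep pos v k b (i + 1) := by
  have h1 : ∀ m, (i ≤ m ∧ hs pos v k m = true) ↔ (i + 1 ≤ m ∧ hs pos v k m = true) := fun m =>
    ⟨fun ⟨h1, h2⟩ => ⟨by
      rcases h1.eq_or_lt with rfl | h1
      · rw [h] at h2
        cases h2
      · exact h1, h2⟩, fun ⟨h1, h2⟩ => ⟨by omega, h2⟩⟩
  have h2 : (∃ m < i, hs pos v k m = true) ↔ ∃ m < i + 1, hs pos v k m = true :=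
    ⟨fun ⟨m, h1, h2⟩ => ⟨m, by omega, h2⟩, fun ⟨m, h1, h2⟩ => ⟨m, by
      rcases (Nat.lt_succ_iff.1 h1).eq_or_lt with rfl | h1
      · rw [h] at h2
        cases h2
      · exact h1, h2⟩⟩
  have h3 : {m | i ≤ m ∧ hs pos v k m = true} = {m | i + 1 ≤ m ∧ hs pos v k m = true} := Set.ext h1
  rw [levelRep, levelRep, propext (exists_congr h1), h3]
  simp only [h2]

theorem rep_eq_of_circle_eq (hn : ∀ k, 0 < n k) {v : PretzelCrossing n → Bool}
    {e f : PretzelEdge n} (h : (pretzelDiagram n pos).circle v e = (pretzelDiagram n pos).circle v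
        f) :
    rep pos v e = rep pos v f := by
  have h' : Relation.EqvGen ((pretzelDiagram n pos).Joined v) e f := Quotient.exact h
  clear h
  induction h' with
  | rel e f h =>
    refine eq_of_joined (pos := pos) (v := v) (rep pos v) (fun k i hi => ?_) (fun k i hi hv b =>
        ?_) h
    · have := lt_of_hs hi
      rw [rep_columnEdge hn _ _ _ this.le, rep_columnEdge hn _ _ _ this.le,
        rep_columnEdge hn _ _ _ this, rep_columnEdge hn _ _ _ this]
      have := pattern_eq_true.2 ⟨i, hi⟩
      exact ⟨levelRep_false_eq this _, levelRep_false_eq this _⟩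
    · rw [rep_columnEdge hn _ _ _ hi.le, rep_columnEdge hn _ _ _ hi]
      exact levelRep_succ_eq hv b
  | refl e => rfl
  | symm e f _ ih => exact ih.symm
  | trans e f g h1 h2 ih1 ih2 => exact ih1.trans ih2

theorem circle_level_eq {v : PretzelCrossing n → Bool} {k : Fin 3} {l m : ℕ} (h : l ≤ m)
    (hm : m ≤ n k) (hv : ∀ i, l ≤ i → i < m → hs pos v k i = false) (b : Bool) :
    (pretzelDiagram n pos).circle v (columnEdge n k b l) =
      (pretzelDiagram n pos).circle v (columnEdge n k b m) := by
  induction m, h using Nat.le_induction with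
  | base => rfl
  | succ m hlm ih =>
    rw [ih (by omega) fun i h1 h2 => hv i h1 (by omega)]
    exact circle_succ_eq (by omega) (hv m hlm (by omega)) b

theorem circle_bot_eq {v : PretzelCrossing n → Bool} {k : Fin 3} (h : pattern pos v k = true) :
    (pretzelDiagram n pos).circle v (.bot (k - 1)) = (pretzelDiagram n pos).circle v (.bot k) := by
  classical
  have h' := pattern_eq_true.1 h
  have h1 := Nat.find_spec h'
  have h2 : ∀ b, (pretzelDiagram n pos).circle v (columnEdge n k b 0) =
      (pretzelDiagram n pos).circle v (columnEdge n k b (Nat.find h')) := fun b =>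
    circle_level_eq (Nat.zero_le _) (lt_of_hs h1).le
      (fun i _ hi => by simpa using Nat.find_min h' hi) b
  exact (h2 false).trans ((circle_false_eq h1).1.trans (h2 true).symm)

theorem exists_last {f : ℕ → Bool} {N : ℕ} (hN : ∀ i, f i = true → i < N) (h : ∃ i, f i = true) :
    ∃ i, f i = true ∧ ∀ j, i < j → f j = false := by
  classical
  obtain ⟨i, hi⟩ := h
  refine ⟨Nat.findGreatest (fun i => f i = true) N, Nat.findGreatest_spec (P := fun i => f i =
      true) (hN i hi).le hi, ?_⟩
  intro j hj
  by_contra h'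
  have h' : f j = true := by simpa using h'
  exact absurd (Nat.le_findGreatest (P := fun i => f i = true) (hN j h').le h') (by omega)

theorem circle_top_eq (hn : ∀ k, 0 < n k) {v : PretzelCrossing n → Bool} {k : Fin 3}
    (h : pattern pos v k = true) :
    (pretzelDiagram n pos).circle v (.top (k - 1)) = (pretzelDiagram n pos).circle v (.top k) := by
  obtain ⟨i, hi, h1⟩ := exists_last (fun i hi => lt_of_hs hi) (pattern_eq_true.1 h)
  have h2 : ∀ b, (pretzelDiagram n pos).circle v (columnEdge n k b (i + 1)) =
      (pretzelDiagram n pos).circle v (columnEdge n k b (n k)) := fun b =>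
    circle_level_eq (lt_of_hs hi) le_rfl (fun j hj _ => h1 j (by omega)) b
  simp only [columnEdge_last hn] at h2
  exact (h2 false).symm.trans ((circle_false_eq hi).2.trans (h2 true))

theorem circle_bot_eq_top (hn : ∀ k, 0 < n k) {v : PretzelCrossing n → Bool} {k : Fin 3}
    (h : pattern pos v k = false) (b : Bool) :
    (pretzelDiagram n pos).circle v (.bot (arc k b)) =
      (pretzelDiagram n pos).circle v (.top (arc k b)) := by
  rw [← columnEdge_zero, ← columnEdge_last hn]
  exact circle_level_eq (Nat.zero_le _) le_rfl (fun i _ _ => pattern_eq_false.1 h i) b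

theorem circle_rep_top (hn : ∀ k, 0 < n k) (v : PretzelCrossing n → Bool) (k : Fin 3) :
    (pretzelDiagram n pos).circle v (topEdge n (pattern pos v) k) =
      (pretzelDiagram n pos).circle v (.top k) := by
  have h := fun k => circle_top_eq (pos := pos) hn (v := v) (k := k)
  have h0 := h 0
  have h1 := h 1
  have h2 := h 2
  simp only [show (0 : Fin 3) - 1 = 2 from rfl, show (1 : Fin 3) - 1 = 0 from rfl,
    show (2 : Fin 3) - 1 = 1 from rfl] at h0 h1 h2
  fin_cases k <;> cases p0 : pattern pos v 0 <;> cases p1 : pattern pos v 1 <;>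
    cases p2 : pattern pos v 2 <;> simp_all [topEdge, topRep]

theorem circle_rep_bot (hn : ∀ k, 0 < n k) (v : PretzelCrossing n → Bool) (k : Fin 3) :
    (pretzelDiagram n pos).circle v (botEdge n (pattern pos v) k) =
      (pretzelDiagram n pos).circle v (.bot k) := by
  have hb := fun k => circle_bot_eq (pos := pos) (v := v) (k := k)
  have b0 := hb 0
  have b1 := hb 1
  have b2 := hb 2
  have ht := fun k => circle_bot_eq_top (pos := pos) hn (v := v) (k := k)
  have f0 := ht 0
  have f1 := ht 1
  have f2 := ht 2
  have e := circle_rep_top (pos := pos) hn v k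
  have h := fun k => circle_top_eq (pos := pos) hn (v := v) (k := k)
  have h0 := h 0
  have h1 := h 1
  have h2 := h 2
  simp only [topEdge, arc, Bool.forall_bool, show (0 : Fin 3) - 1 = 2 from rfl,
    show (1 : Fin 3) - 1 = 0 from rfl, show (2 : Fin 3) - 1 = 1 from rfl, if_true, if_false,
    Bool.false_eq_true] at h0 h1 h2 b0 b1 b2 f0 f1 f2 e
  unfold botEdge
  split_ifs with hP
  · simp only [Bool.and_eq_true] at hP
    obtain ⟨⟨p0, p1⟩, p2⟩ := hP
    fin_cases k
    · rfl
    · exact b1 p1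
    · exact (b0 p0).symm
  · rw [e]
    fin_cases k <;> cases p0 : pattern pos v 0 <;> cases p1 : pattern pos v 1 <;>
      cases p2 : pattern pos v 2 <;> simp_all

theorem circle_rep (hn : ∀ k, 0 < n k) (v : PretzelCrossing n → Bool) (e : PretzelEdge n) :
    (pretzelDiagram n pos).circle v (rep pos v e) = (pretzelDiagram n pos).circle v e := by
  classical
  rcases e with k | k | ⟨k, b, i, hi⟩
  · exact circle_rep_top hn v k
  · exact circle_rep_bot hn v k
  · have e : (PretzelEdge.inner k b ⟨i, hi⟩ : PretzelEdge n) = columnEdge n k b (i + 1) :=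
      (columnEdge_inner b (l := i + 1) ⟨by omega, by omega⟩).symm
    rw [e, rep_columnEdge hn _ _ _ (by omega)]
    by_cases h1 : ∃ m, i + 1 ≤ m ∧ hs pos v k m = true
    · have h3 := Nat.find_spec h1
      have h4 : ∀ m, i + 1 ≤ m → m < Nat.find h1 → hs pos v k m = false := fun m hm hm' => by
        simpa [hm] using Nat.find_min h1 hm'
      by_cases h2 : ∃ m < i + 1, hs pos v k m = true
      · rw [levelRep_of_upper h3.1 h3.2 h4 h2, circle_level_eq h3.1 (lt_of_hs h3.2).le h4 b]
        cases b
        · rfl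
        · exact (circle_false_eq h3.2).1
      · have h2 : ∀ m < i + 1, hs pos v k m = false := by simpa using h2
        rw [levelRep_of_bot h2 h1, circle_rep_bot hn, ← columnEdge_zero]
        exact circle_level_eq (Nat.zero_le _) (by omega) (fun i _ hi => h2 i hi) b
    · have h1 : ∀ m, i + 1 ≤ m → hs pos v k m = false := by simpa using h1
      rw [levelRep_of_top h1, circle_rep_top hn, ← columnEdge_last hn]
      exact (circle_level_eq (by omega) le_rfl (fun i hi _ => h1 i hi) b).symm

theorem circle_eq_iff (hn : ∀ k, 0 < n k) {v : PretzelCrossing n → Bool} {e f : PretzelEdge n} :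
    (pretzelDiagram n pos).circle v e = (pretzelDiagram n pos).circle v f ↔
      rep pos v e = rep pos v f :=
  ⟨rep_eq_of_circle_eq hn, fun h => by rw [← circle_rep hn v e, h, circle_rep hn]⟩

end

open PDCode

/-! ### Edge maps of the cube of resolutions -/

section

variable {χ ε : Type} {D : PDCode χ ε}

/-- The exponents of a state, as a function on edges. -/
def expo (s : D.State) (e : ε) : Fin 2 := s.2 (D.circle s.1 e)

theorem expo_eq_of_circle_eq (s : D.State) {e f : ε} (h : D.circle s.1 e = D.circle s.1 f) :
    expo s e = expo s f := congrArg s.2 h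

theorem state_ext {s t : D.State} (h : s.1 = t.1) (h' : ∀ e, expo s e = expo t e) : s = t := by
  obtain ⟨v, x⟩ := s
  obtain ⟨w, y⟩ := t
  obtain rfl : v = w := h
  have : x = y := by
    funext C
    obtain ⟨e, rfl⟩ := Quotient.exists_rep C
    exact h' e
  rw [this]

/-- The state with given exponents. -/
def mkState (v : χ → Bool) (z : ε → Fin 2)
    (h : ∀ e f, D.circle v e = D.circle v f → z e = z f) : D.State :=
  ⟨v, Quotient.lift z fun e f hef => h e f (Quotient.sound hef)⟩

theorem expo_mkState (v : χ → Bool) (z : ε → Fin 2)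
    (h : ∀ e f, D.circle v e = D.circle v f → z e = z f) (e : ε) :
    expo (mkState (D := D) v z h) e = z e := rfl

/-- If the four ends at a crossing lie on one circle, the circles are those of the other resolution
of the crossing, with at most two of them merged. -/
theorem circle_eq_iff_of_eq {c : χ} {v w : χ → Bool} (hvw : ∀ c', c' ≠ c → v c' = w c')
    (h : D.circle v (D c 0) = D.circle v (D c 2)) (e f : ε) :
    D.circle v e = D.circle v f ↔ D.circle w e = D.circle w f ∨
      (D.circle w e = D.circle w (D c 0) ∨ D.circle w e = D.circle w (D c 2)) ∧
      (D.circle w f = D.circle w (D c 0) ∨ D.circle w f = D.circle w (D c 2)) := by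
  let U : ε → Prop := fun e => D.circle w e = D.circle w (D c 0) ∨ D.circle w e = D.circle w (D c 2)
  have ends : ∀ u : χ → Bool,
      (D.circle u (D c 1) = D.circle u (D c 0) ∨ D.circle u (D c 1) = D.circle u (D c 2)) ∧
      (D.circle u (D c 3) = D.circle u (D c 0) ∨ D.circle u (D c 3) = D.circle u (D c 2)) := by
    intro u
    cases hu : u c
    · exact ⟨Or.inl (circle_eq_of_joined ⟨c, Or.inl ⟨hu, Or.inl ⟨rfl, rfl⟩⟩⟩).symm,
        Or.inr (circle_eq_of_joined ⟨c, Or.inl ⟨hu, Or.inr ⟨rfl, rfl⟩⟩⟩).symm⟩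
    · exact ⟨Or.inr (circle_eq_of_joined ⟨c, Or.inr ⟨hu, Or.inr ⟨rfl, rfl⟩⟩⟩),
        Or.inl (circle_eq_of_joined ⟨c, Or.inr ⟨hu, Or.inl ⟨rfl, rfl⟩⟩⟩).symm⟩
  have hU1 : U (D c 1) := (ends w).1
  have hU3 : U (D c 3) := (ends w).2
  have hU0 : U (D c 0) := Or.inl rfl
  have hU2 : U (D c 2) := Or.inr rfl
  have hV1 : D.circle v (D c 1) = D.circle v (D c 0) := (ends v).1.elim id fun e => e.trans h.symm
  have hV3 : D.circle v (D c 3) = D.circle v (D c 0) := (ends v).2.elim id fun e => e.trans h.symm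
  constructor
  · intro h'
    replace h' : Relation.EqvGen (D.Joined v) e f := Quotient.exact h'
    change _ ∨ U e ∧ U f
    induction h' with
    | rel e f h2 =>
      obtain ⟨c', h2⟩ := h2
      by_cases hc : c' = c
      · subst hc
        right
        rcases h2 with ⟨_, ⟨rfl, rfl⟩ | ⟨rfl, rfl⟩⟩ | ⟨_, ⟨rfl, rfl⟩ | ⟨rfl, rfl⟩⟩
        exacts [⟨hU0, hU1⟩, ⟨hU2, hU3⟩, ⟨hU0, hU3⟩, ⟨hU1, hU2⟩]
      · left
        rw [hvw c' hc] at h2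
        exact circle_eq_of_joined ⟨c', h2⟩
    | refl e => exact Or.inl rfl
    | symm e f _ ih => exact ih.imp Eq.symm And.symm
    | trans e f g _ _ ih1 ih2 =>
      rcases ih1 with h1 | h1
      · rcases ih2 with h2 | h2
        · exact Or.inl (h1.trans h2)
        · exact Or.inr ⟨h2.1.imp h1.trans h1.trans, h2.2⟩
      · rcases ih2 with h2 | h2
        · exact Or.inr ⟨h1.1, h1.2.imp h2.symm.trans h2.symm.trans⟩
        · exact Or.inr ⟨h1.1, h2.2⟩
  · have key : ∀ {e f}, D.circle w e = D.circle w f → D.circle v e = D.circle v f := by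
      intro e f h'
      replace h' : Relation.EqvGen (D.Joined w) e f := Quotient.exact h'
      induction h' with
      | rel e f h2 =>
        obtain ⟨c', h2⟩ := h2
        by_cases hc : c' = c
        · subst hc
          rcases h2 with ⟨_, ⟨rfl, rfl⟩ | ⟨rfl, rfl⟩⟩ | ⟨_, ⟨rfl, rfl⟩ | ⟨rfl, rfl⟩⟩
          exacts [hV1.symm, h.symm.trans hV3.symm, hV3.symm, hV1.trans h]
        · rw [← hvw c' hc] at h2
          exact circle_eq_of_joined ⟨c', h2⟩
      | refl e => rfl
      | symm e f _ ih => exact ih.symm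
      | trans e f g _ _ ih1 ih2 => exact ih1.trans ih2
    have hU : ∀ e, U e → D.circle v e = D.circle v (D c 0) := fun e he =>
      he.elim key fun h' => (key h').trans h.symm
    rintro (h' | ⟨h1, h2⟩)
    · exact key h'
    · exact (hU e h1).trans (hU f h2).symm

theorem fin_two_eq_zero_or_one (a : Fin 2) : a = 0 ∨ a = 1 := by omega

open Classical in
/-- The states incident to `t` at a crossing where a circle is split. -/
theorem sum_incident_of_split [Fintype D.State] {c : χ} {t : D.State} {v : χ → Bool}
    (ht : t.1 c = true) (hv : v = update t.1 c false)
    (h : D.circle v (D c 0) = D.circle v (D c 2)) (F : (χ → Bool) → (ε → Fin 2) → ℤ) :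
    (∑ s, if D.Incident c s t then F s.1 (expo s) else 0) =
      if expo t (D c 0) = 0 ∧ expo t (D c 2) = 0 then 0 else
      F v fun e => if D.circle v e = D.circle v (D c 0) then expo t (D c 0) * expo t (D c 2)
        else expo t e := by
  have hvc : v c = false := by simp [hv]
  have hvt : ∀ c', c' ≠ c → v c' = t.1 c' := fun c' h => by simp [hv, update_of_ne h]
  have hs1 : ∀ {s : D.State}, D.Incident c s t → s.1 = v := fun {s} hi => by
    funext c'
    by_cases hc : c' = c
    · subst hc
      rw [hi.1, hvc]
    · rw [hi.2.2.1 c' hc, hvt c' hc]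
  split_ifs with h0
  · refine Finset.sum_eq_zero fun s _ => if_neg fun hi => ?_
    have e := hs1 hi
    have h1 := hi.2.2.2.2.2 (by rw [e, h])
    have h2 : t.2 (D.circle t.1 (D c 0)) = 0 := h0.1
    have h3 : t.2 (D.circle t.1 (D c 2)) = 0 := h0.2
    rw [h2, h3] at h1
    simp at h1
  · have hz : ∀ e f, D.circle v e = D.circle v f →
        (if D.circle v e = D.circle v (D c 0) then expo t (D c 0) * expo t (D c 2)
        else expo t e) = (if D.circle v f = D.circle v (D c 0) then expo t (D c 0) * expo t (D c 2)
        else expo t f) := fun e f hef => by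
      rw [← hef]
      split_ifs with h1
      · rfl
      · rcases (circle_eq_iff_of_eq hvt h e f).1 hef with h2 | ⟨h2, -⟩
        · exact expo_eq_of_circle_eq t h2
        · exact absurd ((circle_eq_iff_of_eq hvt h e (D c 0)).2 (Or.inr ⟨h2, Or.inl rfl⟩)) h1
    rw [Finset.sum_eq_single (mkState v _ hz)]
    · rw [if_pos]
      · rfl
      · refine ⟨hvc, ht, hvt, fun e h1 _ => if_neg h1, fun h1 => absurd h h1, fun _ => ?_⟩
        change ((expo t (D c 0) : ℕ) + expo t (D c 2) : ℕ) =
          (if D.circle v (D c 0) = D.circle v (D c 0) then expo t (D c 0) * expo t (D c 2)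
            else expo t (D c 0) : Fin 2) + 1
        rw [if_pos rfl]
        rcases fin_two_eq_zero_or_one (expo t (D c 0)) with e1 | e1 <;>
        rcases fin_two_eq_zero_or_one (expo t (D c 2)) with e2 | e2 <;> simp_all
    · intro s _ hs
      refine if_neg fun hi => hs (state_ext (hs1 hi) fun e => ?_)
      have e1 := hs1 hi
      rw [expo_mkState]
      obtain ⟨w, x⟩ := s
      obtain rfl : w = v := e1
      split_ifs with h1
      · have h2 := hi.2.2.2.2.2 h
        have h3 : expo (⟨w, x⟩ : D.State) e = expo (⟨w, x⟩ : D.State) (D c 0) :=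
          expo_eq_of_circle_eq (⟨w, x⟩ : D.State) h1
        rw [h3]
        change ((expo t (D c 0) : ℕ) + expo t (D c 2) : ℕ) =
          expo (⟨w, x⟩ : D.State) (D c 0) + 1 at h2
        generalize expo (⟨w, x⟩ : D.State) (D c 0) = a at *
        rcases fin_two_eq_zero_or_one (expo t (D c 0)) with e1 | e1 <;>
        rcases fin_two_eq_zero_or_one (expo t (D c 2)) with e2 | e2 <;>
        rcases fin_two_eq_zero_or_one a with rfl | rfl <;> simp_all
      · exact hi.2.2.2.1 e h1 (by rw [← h]; exact h1)
    · simp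

open Classical in
/-- The states incident to `t` at a crossing where two circles are merged. -/
theorem sum_incident_of_merge [Fintype D.State] {c : χ} {t : D.State} {v : χ → Bool}
    (ht : t.1 c = true) (hv : v = update t.1 c false)
    (h : D.circle v (D c 0) ≠ D.circle v (D c 2))
    (h' : D.circle t.1 (D c 0) = D.circle t.1 (D c 2)) (F : (χ → Bool) → (ε → Fin 2) → ℤ) :
    (∑ s, if D.Incident c s t then F s.1 (expo s) else 0) =
      if expo t (D c 0) = 0 then F v (expo t) else
      F v (fun e => if D.circle v e = D.circle v (D c 0) then 0 else expo t e) +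
      F v (fun e => if D.circle v e = D.circle v (D c 2) then 0 else expo t e) := by
  have hvc : v c = false := by simp [hv]
  have hvt : ∀ c', c' ≠ c → v c' = t.1 c' := fun c' h => by simp [hv, update_of_ne h]
  have hs1 : ∀ {s : D.State}, D.Incident c s t → s.1 = v := fun {s} hi => by
    funext c'
    by_cases hc : c' = c
    · subst hc
      rw [hi.1, hvc]
    · rw [hi.2.2.1 c' hc, hvt c' hc]
  have hiff := circle_eq_iff_of_eq (fun c' h => (hvt c' h).symm) h'
  have ht02 : expo t (D c 2) = expo t (D c 0) := expo_eq_of_circle_eq t h'.symm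
  have hU : ∀ e, D.circle v e = D.circle v (D c 0) ∨ D.circle v e = D.circle v (D c 2) →
      expo t e = expo t (D c 0) := fun e he =>
    expo_eq_of_circle_eq t ((hiff e (D c 0)).2 (Or.inr ⟨he, Or.inl rfl⟩))
  have hz : ∀ e f, D.circle v e = D.circle v f → expo t e = expo t f := fun e f hef =>
    expo_eq_of_circle_eq t ((hiff e f).2 (Or.inl hef))
  have hz' : ∀ g e f, D.circle v e = D.circle v f →
      (if D.circle v e = D.circle v g then 0 else expo t e) =
      (if D.circle v f = D.circle v g then 0 else expo t f) := fun g e f hef => by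
    rw [hef, hz e f hef]
  -- a state is incident if and only if its exponents are right
  have hinc : ∀ s : D.State, D.Incident c s t ↔ s.1 = v ∧
      (∀ e, ¬ (D.circle v e = D.circle v (D c 0) ∨ D.circle v e = D.circle v (D c 2)) →
        expo s e = expo t e) ∧
      (expo t (D c 0) : ℕ) = expo s (D c 0) + expo s (D c 2) := by
    intro s
    constructor
    · intro hi
      have e1 := hs1 hi
      obtain ⟨w, x⟩ := s
      obtain rfl : w = v := e1
      exact ⟨rfl, fun e he => hi.2.2.2.1 e (fun h => he (Or.inl h)) (fun h => he (Or.inr h)),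
        hi.2.2.2.2.1 h⟩
    · rintro ⟨e1, h1, h2⟩
      obtain ⟨w, x⟩ := s
      obtain rfl : w = v := e1
      exact ⟨hvc, ht, hvt, fun e h3 h4 => h1 e (fun h => h.elim h3 h4), fun _ => h2,
        fun h3 => absurd h3 h⟩
  have hcases : ∀ s : D.State, s.1 = v → ∀ e, D.circle v e = D.circle v (D c 0) →
      expo s e = expo s (D c 0) := fun s hs e he => by
    subst hs
    exact expo_eq_of_circle_eq s he
  have hcases' : ∀ s : D.State, s.1 = v → ∀ e, D.circle v e = D.circle v (D c 2) →
      expo s e = expo s (D c 2) := fun s hs e he => by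
    subst hs
    exact expo_eq_of_circle_eq s he
  split_ifs with h0
  · rw [Finset.sum_eq_single (mkState v _ hz)]
    · rw [if_pos]
      · rfl
      · rw [hinc]
        refine ⟨rfl, fun e _ => rfl, ?_⟩
        rw [expo_mkState, expo_mkState, ht02, h0]
        rfl
    · intro s _ hs
      refine if_neg fun hi => hs ?_
      obtain ⟨e1, h1, h2⟩ := (hinc s).1 hi
      refine state_ext e1 fun e => ?_
      rw [expo_mkState]
      rw [h0] at h2
      have h3 : expo s (D c 0) = 0 ∧ expo s (D c 2) = 0 := by
        simp only [Fin.val_zero] at h2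
        omega
      by_cases h4 : D.circle v e = D.circle v (D c 0)
      · rw [hcases s e1 e h4, hU e (Or.inl h4), h0, h3.1]
      · by_cases h5 : D.circle v e = D.circle v (D c 2)
        · rw [hcases' s e1 e h5, hU e (Or.inr h5), h0, h3.2]
        · exact h1 e fun h => h.elim h4 h5
    · simp
  · have h1 : expo t (D c 0) = 1 := (fin_two_eq_zero_or_one _).resolve_left h0
    have hne : mkState (D := D) v _ (hz' (D c 0)) ≠ mkState v _ (hz' (D c 2)) := by
      intro h2
      have h3 := congrArg (fun s => expo s (D c 0)) h2
      simp only [expo_mkState, if_neg h, if_true] at h3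
      exact h0 h3.symm
    rw [Finset.sum_eq_add (mkState v _ (hz' (D c 0))) (mkState v _ (hz' (D c 2))) hne]
    · rw [if_pos, if_pos]
      · rfl
      · rw [hinc]
        refine ⟨rfl, fun e he => if_neg fun h => he (Or.inr h), ?_⟩
        rw [expo_mkState, expo_mkState, if_pos rfl, if_neg h]
        rfl
      · rw [hinc]
        refine ⟨rfl, fun e he => if_neg fun h => he (Or.inl h), ?_⟩
        rw [expo_mkState, expo_mkState, if_pos rfl, if_neg (Ne.symm h), ht02, h1]
        rfl
    · rintro s _ ⟨hs0, hs2⟩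
      refine if_neg fun hi => ?_
      obtain ⟨e1, h3, h2⟩ := (hinc s).1 hi
      rw [h1] at h2
      have h6 : expo s (D c 0) = 0 ∧ expo s (D c 2) = 1 ∨ expo s (D c 0) = 1 ∧ expo s (D c 2) = 0
          := by
        simp only [Fin.val_one] at h2
        omega
      rcases h6 with ⟨h6, h7⟩ | ⟨h6, h7⟩
      · refine hs0 (state_ext e1 fun e => ?_)
        rw [expo_mkState]
        by_cases h4 : D.circle v e = D.circle v (D c 0)
        · rw [hcases s e1 e h4, if_pos h4, h6]
        · rw [if_neg h4]
          by_cases h5 : D.circle v e = D.circle v (D c 2)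
          · rw [hcases' s e1 e h5, hU e (Or.inr h5), h7, h1]
          · exact h3 e fun h => h.elim h4 h5
      · refine hs2 (state_ext e1 fun e => ?_)
        rw [expo_mkState]
        by_cases h5 : D.circle v e = D.circle v (D c 2)
        · rw [hcases' s e1 e h5, if_pos h5, h7]
        · rw [if_neg h5]
          by_cases h4 : D.circle v e = D.circle v (D c 0)
          · rw [hcases s e1 e h4, hU e (Or.inl h4), h6, h1]
          · exact h3 e fun h => h.elim h4 h5
    · simp
    · simp

end

/-! ### Coordinates on the complex of the three columns -/

/-- Coordinates on the groups of the outer circles, for each set of columns with horizontal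
crossings. -/
structure Outer where
  f000 : (ℤ × ℤ) × (ℤ × ℤ) →+ ℤ
  f100 : ℤ × ℤ →+ ℤ
  f010 : ℤ × ℤ →+ ℤ
  f110 : ℤ →+ ℤ
  f001 : ℤ × ℤ →+ ℤ
  f101 : ℤ →+ ℤ
  f011 : ℤ →+ ℤ
  f111 : ℤ × ℤ →+ ℤ

namespace Outer

/-- Composition with the saddle of column `0`. -/
def s0 (f : Outer) : Outer :=
  { f with
    f100 := f.f000.comp coprodX
    f110 := f.f010.comp inX
    f101 := f.f001.comp inX
    f111 := f.f011.comp cst }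

/-- Composition with the upper arc of column `0`. -/
def t0 (f : Outer) : Outer :=
  { f with f100 := f.f100.comp mulX, f110 := 0, f101 := 0, f111 := 0 }

/-- Composition with the lower arc of column `0`. -/
def y0 (f : Outer) : Outer :=
  { f with f100 := f.f100.comp mulX, f110 := 0, f101 := 0, f111 := f.f111.comp mulX }

/-- Composition with the saddle of column `1`. -/
def s1 (f : Outer) : Outer :=
  { f with
    f000 := f.f010.comp cstOuter
    f100 := f.f110.comp cst
    f001 := f.f011.comp cst
    f101 := f.f111.comp inX }

/-- Composition with the lower arc of column `1`. -/
def y1 (f : Outer) : Outer :=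
  { f with f010 := 0, f110 := 0, f011 := 0, f111 := f.f111.comp mulX }

/-- Composition with the saddle of column `2`. -/
def s2 (f : Outer) : Outer :=
  { f with
    f000 := f.f001.comp cstInner
    f100 := f.f101.comp cst
    f010 := f.f011.comp cst
    f110 := f.f111.comp inX }

/-- Composition with the lower arc of column `2`. -/
def y2 (f : Outer) : Outer :=
  { f with f001 := 0, f101 := 0, f011 := 0, f111 := f.f111.comp mulX }

/-- Two families of coordinates agree for the columns `P`. -/
structure AgreeAt (P : Fin 3 → Bool) (f g : Outer) : Prop where
  h000 : P 0 = false → P 1 = false → P 2 = false → f.f000 = g.f000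
  h100 : P 0 = true → P 1 = false → P 2 = false → f.f100 = g.f100
  h010 : P 0 = false → P 1 = true → P 2 = false → f.f010 = g.f010
  h110 : P 0 = true → P 1 = true → P 2 = false → f.f110 = g.f110
  h001 : P 0 = false → P 1 = false → P 2 = true → f.f001 = g.f001
  h101 : P 0 = true → P 1 = false → P 2 = true → f.f101 = g.f101
  h011 : P 0 = false → P 1 = true → P 2 = true → f.f011 = g.f011
  h111 : P 0 = true → P 1 = true → P 2 = true → f.f111 = g.f111

theorem AgreeAt.refl (P : Fin 3 → Bool) (f : Outer) : AgreeAt P f f := by constructor <;> simp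

end Outer

section

variable (p q r : ℕ)

/-- The group of the complex of the three columns. -/
abbrev Cpx : Type := Col r (Col q (Col p ((ℤ × ℤ) × (ℤ × ℤ)) (ℤ × ℤ)) (Col p (ℤ × ℤ) ℤ))
  (Col q (Col p (ℤ × ℤ) ℤ) (Col p ℤ (ℤ × ℤ)))

/-- Coordinates on the complex of two columns. -/
def ev2 {A B C D : Type} [Ab A] [Ab B] [Ab C] [Ab D] (sm : Fin 3 → ℕ → Bool)
    (lab : Fin 3 → ℕ → Fin 2) (a : A →+ ℤ) (b : B →+ ℤ) (c : C →+ ℤ)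
    (d : D →+ ℤ) : Col q (Col p A B) (Col p C D) →+ ℤ :=
  ev q (sm 1) (lab 1) (ev p (sm 0) (lab 0) a b) (ev p (sm 0) (lab 0) c d)

/-- Coordinates on the complex of the three columns. -/
def ev3 (sm : Fin 3 → ℕ → Bool) (lab : Fin 3 → ℕ → Fin 2) (f : Outer) : Cpx p q r →+ ℤ :=
  ev r (sm 2) (lab 2) (ev2 p q sm lab f.f000 f.f100 f.f010 f.f110)
    (ev2 p q sm lab f.f001 f.f101 f.f011 f.f111)

/-- The edge map at crossing `i` of column `2`. -/
def term2 (sm : Fin 3 → ℕ → Bool) (lab : Fin 3 → ℕ → Fin 2) (f : Outer) (i : ℕ) :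
    Cpx p q r →+ ℤ :=
  evT r i (sm 2) (lab 2) (ev2 p q sm lab f.f001 f.f101 f.f011 f.f111)
    (ev2 p q sm lab f.s2.f000 f.s2.f100 f.s2.f010 f.s2.f110) 0
    (ev2 p q sm lab f.y2.f001 f.y2.f101 f.y2.f011 f.y2.f111)

/-- The edge map at crossing `i` of column `1`. -/
def term1 (sm : Fin 3 → ℕ → Bool) (lab : Fin 3 → ℕ → Fin 2) (f : Outer) (i : ℕ) :
    Cpx p q r →+ ℤ :=
  ev r (sm 2) (lab 2)
    (evT q i (sm 1) (lab 1) (ev p (sm 0) (lab 0) f.f010 f.f110)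
      (ev p (sm 0) (lab 0) f.s1.f000 f.s1.f100) 0 (ev p (sm 0) (lab 0) f.y1.f010 f.y1.f110))
    (evT q i (sm 1) (lab 1) (ev p (sm 0) (lab 0) f.f011 f.f111)
      (ev p (sm 0) (lab 0) f.s1.f001 f.s1.f101) 0 (ev p (sm 0) (lab 0) f.y1.f011 f.y1.f111))

/-- The edge map at crossing `i` of column `0`. -/
def term0 (sm : Fin 3 → ℕ → Bool) (lab : Fin 3 → ℕ → Fin 2) (f : Outer) (i : ℕ) :
    Cpx p q r →+ ℤ :=
  ev r (sm 2) (lab 2)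
    (ev q (sm 1) (lab 1)
      (mevT p i (sm 0) (lab 0) f.f100 f.s0.f100 f.t0.f100 f.y0.f100)
      (mevT p i (sm 0) (lab 0) f.f110 f.s0.f110 f.t0.f110 f.y0.f110))
    (ev q (sm 1) (lab 1)
      (mevT p i (sm 0) (lab 0) f.f101 f.s0.f101 f.t0.f101 f.y0.f101)
      (mevT p i (sm 0) (lab 0) f.f111 f.s0.f111 f.t0.f111 f.y0.f111))

theorem ev_ite (n : ℕ) {V H : Type} [Ab V] [Ab H] (c : Prop) [Decidable c]
    (sm : ℕ → Bool) (lab : ℕ → Fin 2) (a : ℤ) (φV : V →+ ℤ) (φH : H →+ ℤ) :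
    ev n sm lab (if c then a • φV else 0) (if c then a • φH else 0) =
      if c then a • ev n sm lab φV φH else 0 := by
  split_ifs
  · exact ev_smul a n sm lab φV φH
  · exact ev_zero_zero n sm lab

theorem mcolE_sign {V H : Type} [Ab V] [Ab H] (O : MOps V H)
    (hV : O.eV = idHom V) (hH : O.eH = idHom H) (sm : Fin 3 → ℕ → Bool)
    (lab : Fin 3 → ℕ → Fin 2) (a : V →+ ℤ) (b : H →+ ℤ) :
    (ev p (sm 0) (lab 0) a b).comp (mcolE p O) =
      ((-1 : ℤ) ^ Nat.count (fun m => sm 0 m = false) p) • ev p (sm 0) (lab 0) a b :=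
  ev_mcolE p O _ _ _ _ (by rw [hV]; rfl) (by rw [hH]; rfl)

theorem ev_mcolD_of_zero {V H : Type} [Ab V] [Ab H] (O : MOps V H)
    (hV : O.eV = idHom V) (hH : O.eH = idHom H) (hdV : O.dV = 0)
    (hdH : O.dH = 0) (sm : Fin 3 → ℕ → Bool) (lab : Fin 3 → ℕ → Fin 2) (a : V →+ ℤ)
    (b : H →+ ℤ) :
    (ev p (sm 0) (lab 0) a b).comp (mcolD p O) =
      ∑ i ∈ Finset.range p, if sm 0 i = false then
        ((-1 : ℤ) ^ Nat.count (fun m => sm 0 m = false) i) •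
          mevT p i (sm 0) (lab 0) b (a.comp O.s) (b.comp O.T) (b.comp O.Y) else 0 := by
  rw [ev_mcolD p O _ _ _ _ (by rw [hV]; rfl) (by rw [hH]; rfl), hdV, hdH, comp_zero,
    comp_zero, ev_zero_zero, zero_add]

/-- The differential in coordinates. -/
theorem ev3_colD (sm : Fin 3 → ℕ → Bool) (lab : Fin 3 → ℕ → Fin 2) (f : Outer) :
    (ev3 p q r sm lab f).comp (colD r (right p q)) =
      (∑ i ∈ Finset.range p, if sm 0 i = false then
        ((-1 : ℤ) ^ Nat.count (fun m => sm 0 m = false) i) • term0 p q r sm lab f i else 0) +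
      (∑ i ∈ Finset.range q, if sm 1 i = true then
        ((-1 : ℤ) ^ Nat.count (fun m => sm 0 m = false) p *
          (-1) ^ Nat.count (fun m => sm 1 m = true) i) • term1 p q r sm lab f i else 0) +
      ∑ i ∈ Finset.range r, if sm 2 i = true then
        ((-1 : ℤ) ^ Nat.count (fun m => sm 1 m = true) q *
          (-1) ^ Nat.count (fun m => sm 0 m = false) p *
          (-1) ^ Nat.count (fun m => sm 2 m = true) i) • term2 p q r sm lab f i else 0 := by
  have E1 := ev_colE ((-1 : ℤ) ^ Nat.count (fun m => sm 0 m = false) p) q (midH p) (sm 1) (lab 1)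
    (ev p (sm 0) (lab 0) f.f001 f.f101) (ev p (sm 0) (lab 0) f.f011 f.f111)
    (mcolE_sign p opsHV rfl rfl sm lab _ _) (mcolE_sign p opsHH rfl rfl sm lab _ _)
  have D2 := ev_colD _ r (right p q) (sm 2) (lab 2)
    (ev2 p q sm lab f.f000 f.f100 f.f010 f.f110) (ev2 p q sm lab f.f001 f.f101 f.f011 f.f111) E1
  have hs2 : (ev2 p q sm lab f.f001 f.f101 f.f011 f.f111).comp (right p q).s =
      ev2 p q sm lab f.s2.f000 f.s2.f100 f.s2.f010 f.s2.f110 := by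
    refine (ev_map q _ _ _ _ _ _).trans ?_
    rw [ev_map, ev_map]
    rfl
  have hy2 : (ev2 p q sm lab f.f001 f.f101 f.f011 f.f111).comp (right p q).Y =
      ev2 p q sm lab f.y2.f001 f.y2.f101 f.y2.f011 f.y2.f111 := by
    refine (ev_map q _ _ _ _ _ _).trans ?_
    rw [ev_map, ev_map, comp_zero, comp_zero, comp_zero]
    rfl
  have ht2 : (ev2 p q sm lab f.f001 f.f101 f.f011 f.f111).comp (right p q).T = 0 :=
    comp_zero _
  rw [hs2, hy2, ht2] at D2
  have hV := ev_colD ((-1 : ℤ) ^ Nat.count (fun m => sm 0 m = false) p) q (midV p) (sm 1) (lab 1)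
    (ev p (sm 0) (lab 0) f.f000 f.f100) (ev p (sm 0) (lab 0) f.f010 f.f110)
    (mcolE_sign p opsHV rfl rfl sm lab _ _)
  have hH := ev_colD ((-1 : ℤ) ^ Nat.count (fun m => sm 0 m = false) p) q (midH p) (sm 1) (lab 1)
    (ev p (sm 0) (lab 0) f.f001 f.f101) (ev p (sm 0) (lab 0) f.f011 f.f111)
    (mcolE_sign p opsHH rfl rfl sm lab _ _)
  have a1 : (ev p (sm 0) (lab 0) f.f010 f.f110).comp (midV p).s =
      ev p (sm 0) (lab 0) f.s1.f000 f.s1.f100 := ev_map p _ _ _ _ _ _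
  have a2 : (ev p (sm 0) (lab 0) f.f010 f.f110).comp (midV p).T = 0 := comp_zero _
  have a3 : (ev p (sm 0) (lab 0) f.f010 f.f110).comp (midV p).Y =
      ev p (sm 0) (lab 0) f.y1.f010 f.y1.f110 := by
    refine (ev_map p _ _ _ _ _ _).trans ?_
    rw [comp_zero, comp_zero]
    rfl
  have b1 : (ev p (sm 0) (lab 0) f.f011 f.f111).comp (midH p).s =
      ev p (sm 0) (lab 0) f.s1.f001 f.s1.f101 := ev_map p _ _ _ _ _ _
  have b2 : (ev p (sm 0) (lab 0) f.f011 f.f111).comp (midH p).T = 0 := comp_zero _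
  have b3 : (ev p (sm 0) (lab 0) f.f011 f.f111).comp (midH p).Y =
      ev p (sm 0) (lab 0) f.y1.f011 f.y1.f111 := by
    refine (ev_map p _ _ _ _ _ _).trans ?_
    rw [comp_zero]
    rfl
  rw [a1, a2, a3] at hV
  rw [b1, b2, b3] at hH
  have c1 : (ev p (sm 0) (lab 0) f.f000 f.f100).comp (midV p).dV = _ :=
    ev_mcolD_of_zero p opsVV rfl rfl rfl rfl sm lab _ _
  have c2 : (ev p (sm 0) (lab 0) f.f010 f.f110).comp (midV p).dH = _ :=
    ev_mcolD_of_zero p opsHV rfl rfl rfl rfl sm lab _ _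
  have c3 : (ev p (sm 0) (lab 0) f.f001 f.f101).comp (midH p).dV = _ :=
    ev_mcolD_of_zero p opsHV rfl rfl rfl rfl sm lab _ _
  have c4 : (ev p (sm 0) (lab 0) f.f011 f.f111).comp (midH p).dH = _ :=
    ev_mcolD_of_zero p opsHH rfl rfl rfl rfl sm lab _ _
  rw [c1, c2, ev_sum] at hV
  rw [c3, c4, ev_sum] at hH
  simp only [ev_ite] at hV hH
  have hV' : (ev2 p q sm lab f.f000 f.f100 f.f010 f.f110).comp (right p q).dV = _ := hV
  have hH' : (ev2 p q sm lab f.f001 f.f101 f.f011 f.f111).comp (right p q).dH = _ := hH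
  rw [hV', hH', ev_add, ev_sum, ev_sum] at D2
  simp only [ev_ite] at D2
  refine D2.trans ?_
  congr 2
  · refine Finset.sum_congr rfl fun i _ => ?_
    have z1 : f.f110.comp opsHV.T = 0 := comp_zero _
    have z2 : f.f110.comp opsHV.Y = 0 := comp_zero _
    have z3 : f.f101.comp opsHV.T = 0 := comp_zero _
    have z4 : f.f101.comp opsHV.Y = 0 := comp_zero _
    have z5 : f.f111.comp opsHH.T = 0 := comp_zero _
    rw [z1, z2, z3, z4, z5]
    rfl

/-- A coordinate depends only on the relevant exponents and outer coordinates. -/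
theorem ev3_congr {sm sm' : Fin 3 → ℕ → Bool} {lab lab' : Fin 3 → ℕ → Fin 2} {f f' : Outer}
    (hsm : sm = sm') (hlab : ∀ k m, IsUpper (sm k) m → lab k m = lab' k m) {P : Fin 3 → Bool}
    (h0 : ∀ k, P k = false → ∀ m, sm k m = false)
    (hP : ∀ k, P k = true → ∃ m < ![p, q, r] k, sm k m = true)
    (hf : Outer.AgreeAt P f f') : ev3 p q r sm lab f = ev3 p q r sm' lab' f' := by
  subst hsm
  have hT : ∀ k, (∃ m < ![p, q, r] k, sm k m = true) → P k = true := by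
    rintro k ⟨m, hm, h⟩
    by_contra hk
    rw [h0 k (by simpa using hk) m] at h
    cases h
  have hF : ∀ k, (∀ m < ![p, q, r] k, sm k m = false) → P k = false := by
    intro k h
    by_contra hk
    obtain ⟨m, hm, e⟩ := hP k (by simpa using hk)
    rw [h m hm] at e
    cases e
  have c0 : ∀ {A B : Type} [Ab A] [Ab B] {a a' : A →+ ℤ} {b b' : B →+ ℤ},
      (P 0 = false → a = a') → (P 0 = true → b = b') →
      ev p (sm 0) (lab 0) a b = ev p (sm 0) (lab' 0) a' b' := fun ha hb =>
    ev_congr p (fun _ _ => rfl) (fun m _ h h' => hlab 0 m ⟨h, h'⟩) (fun h => ha (hF 0 h))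
      (fun h => hb (hT 0 h))
  have c1 : ∀ {A B : Type} [Ab A] [Ab B] {a a' : A →+ ℤ} {b b' : B →+ ℤ},
      (P 1 = false → a = a') → (P 1 = true → b = b') →
      ev q (sm 1) (lab 1) a b = ev q (sm 1) (lab' 1) a' b' := fun ha hb =>
    ev_congr q (fun _ _ => rfl) (fun m _ h h' => hlab 1 m ⟨h, h'⟩) (fun h => ha (hF 1 h))
      (fun h => hb (hT 1 h))
  refine ev_congr r (fun _ _ => rfl) (fun m _ h h' => hlab 2 m ⟨h, h'⟩) (fun h2 => ?_) (fun h2 =>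
      ?_)
  · replace h2 := hF 2 h2
    exact c1 (fun h1 => c0 (fun h0 => hf.h000 h0 h1 h2) (fun h0 => hf.h100 h0 h1 h2))
      (fun h1 => c0 (fun h0 => hf.h010 h0 h1 h2) (fun h0 => hf.h110 h0 h1 h2))
  · replace h2 := hT 2 h2
    exact c1 (fun h1 => c0 (fun h0 => hf.h001 h0 h1 h2) (fun h0 => hf.h101 h0 h1 h2))
      (fun h1 => c0 (fun h0 => hf.h011 h0 h1 h2) (fun h0 => hf.h111 h0 h1 h2))

section

variable {p q r} {sm sm' : Fin 3 → ℕ → Bool} (lab : Fin 3 → ℕ → Fin 2) (f : Outer) {i j : ℕ}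

theorem term2_of_no_other (h0 : sm' 0 = sm 0) (h1 : sm' 1 = sm 1)
    (h2 : sm' 2 = update (sm 2) i false) (hi : i < r)
    (h : ∀ m, m ≠ i → sm 2 m = false) : term2 p q r sm lab f i = ev3 p q r sm' lab f.s2 := by
  rw [term2, evT_top r _ _ _ _ _ hi fun m hm _ => h m hm.ne', ev3, ev2, ev2, ev2, h0, h1, h2]
  refine ev_congr r (fun _ _ => rfl) (fun _ _ _ _ => rfl) (fun _ => rfl) ?_
  rintro ⟨m, hm, e⟩
  by_cases hmi : m = i
  · subst hmi; simp at e
  · rw [update_of_ne hmi, h m hmi] at e; cases e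

theorem term2_of_top (h0 : sm' 0 = sm 0) (h1 : sm' 1 = sm 1)
    (h2 : sm' 2 = update (sm 2) i false) (hi : i < r)
    (ha : ∀ m, i < m → sm 2 m = false) (hb : ∃ m < i, sm 2 m = true) :
    term2 p q r sm lab f i = if lab 2 i = 0 then 0 else ev3 p q r sm' lab f := by
  obtain ⟨m, hm, e⟩ := hb
  rw [term2, evT_top r _ _ _ _ _ hi fun m hm _ => ha m hm, ev3, ev2, ev2, ev2, ev2, h0, h1, h2]
  have key : ∀ (ψ ψ' φ), ev r (update (sm 2) i false) (lab 2) ψ φ =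
      (ev r (update (sm 2) i false) (lab 2) ψ' φ : Cpx p q r →+ ℤ) := fun ψ ψ' φ =>
    ev_congr r (fun _ _ => rfl) (fun _ _ _ _ => rfl) (fun h => by
      have := h m (by omega)
      rw [update_of_ne hm.ne, e] at this
      cases this) fun _ => rfl
  split_ifs
  · rw [key _ 0, ev_zero_zero]
  · exact key _ _ _

theorem term2_of_bottom (h0 : sm' 0 = sm 0) (h1 : sm' 1 = sm 1)
    (h2 : sm' 2 = update (sm 2) i false) (hij : i < j) (hj : j < r) (hsj : sm 2 j = true)
    (hb : ∀ m, i < m → m < j → sm 2 m = false) (hc : ∀ m < i, sm 2 m = false) :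
    term2 p q r sm lab f i =
      if lab 2 j = 0 then ev3 p q r sm' lab f.y2 else ev3 p q r sm' lab f := by
  rw [term2, (evT_below r _ _ _ (ev2 p q sm lab f.f000 f.f100 f.f010 f.f110) _ _ hij hj hsj hb).1
      hc]
  simp only [ev3, ev2, h0, h1, h2]
  split_ifs <;> rfl

theorem term2_of_middle (h0 : sm' 0 = sm 0) (h1 : sm' 1 = sm 1)
    (h2 : sm' 2 = update (sm 2) i false) (hij : i < j) (hj : j < r) (hsj : sm 2 j = true)
    (hb : ∀ m, i < m → m < j → sm 2 m = false) (hc : ∃ m < i, sm 2 m = true) :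
    term2 p q r sm lab f i = if lab 2 i = 0 ∧ lab 2 j = 0 then 0 else
      ev3 p q r sm' (update lab 2 (update (lab 2) j (lab 2 i * lab 2 j))) f := by
  rw [term2, (evT_below r _ _ _ (ev2 p q sm lab f.f000 f.f100 f.f010 f.f110) _ _ hij hj hsj hb).2
      hc,
    ev3, ev2, ev2, ev2, ev2, h0, h1, h2]
  rfl

theorem term1_of_no_other (h0 : sm' 0 = sm 0) (h2 : sm' 2 = sm 2)
    (h1 : sm' 1 = update (sm 1) i false) (hi : i < q)
    (h : ∀ m, m ≠ i → sm 1 m = false) : term1 p q r sm lab f i = ev3 p q r sm' lab f.s1 := by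
  have key : ∀ {A B : Type} [Ab A] [Ab B] (ψ : A →+ ℤ) (φ φ' : B →+ ℤ),
      ev q (update (sm 1) i false) (lab 1) ψ φ =
      ev q (update (sm 1) i false) (lab 1) ψ φ' := fun ψ φ φ' =>
    ev_congr q (fun _ _ => rfl) (fun _ _ _ _ => rfl) (fun _ => rfl) (by
      rintro ⟨m, hm, e⟩
      by_cases hmi : m = i
      · subst hmi; simp at e
      · rw [update_of_ne hmi, h m hmi] at e; cases e)
  rw [term1, evT_top q _ _ _ _ _ hi fun m hm _ => h m hm.ne',
    evT_top q _ _ _ _ _ hi fun m hm _ => h m hm.ne', ev3, ev2, ev2, h0, h1, h2]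
  congr 1 <;> exact key _ _ _

theorem term1_of_top (h0 : sm' 0 = sm 0) (h2 : sm' 2 = sm 2)
    (h1 : sm' 1 = update (sm 1) i false) (hi : i < q)
    (ha : ∀ m, i < m → sm 1 m = false) (hb : ∃ m < i, sm 1 m = true) :
    term1 p q r sm lab f i = if lab 1 i = 0 then 0 else ev3 p q r sm' lab f := by
  obtain ⟨m, hm, e⟩ := hb
  have key : ∀ {A B : Type} [Ab A] [Ab B] (ψ ψ' : A →+ ℤ) (φ : B →+ ℤ),
      ev q (update (sm 1) i false) (lab 1) ψ φ =
      ev q (update (sm 1) i false) (lab 1) ψ' φ := fun ψ ψ' φ =>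
    ev_congr q (fun _ _ => rfl) (fun _ _ _ _ => rfl) (fun h => by
      have := h m (by omega)
      rw [update_of_ne hm.ne, e] at this
      cases this) fun _ => rfl
  rw [term1, evT_top q _ _ _ _ _ hi fun m hm _ => ha m hm,
    evT_top q _ _ _ _ _ hi fun m hm _ => ha m hm, ev3, ev2, ev2, h0, h1, h2]
  split_ifs
  · have z : ∀ {A B : Type} [Ab A] [Ab B] (ψ : A →+ ℤ),
        ev q (update (sm 1) i false) (lab 1) ψ (0 : B →+ ℤ) = 0 := fun ψ =>
      (key ψ 0 0).trans (ev_zero_zero q _ _)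
    rw [z, z, ev_zero_zero]
  · congr 1 <;> exact key _ _ _

theorem term1_of_bottom (h0 : sm' 0 = sm 0) (h2 : sm' 2 = sm 2)
    (h1 : sm' 1 = update (sm 1) i false) (hij : i < j) (hj : j < q) (hsj : sm 1 j = true)
    (hb : ∀ m, i < m → m < j → sm 1 m = false) (hc : ∀ m < i, sm 1 m = false) :
    term1 p q r sm lab f i =
      if lab 1 j = 0 then ev3 p q r sm' lab f.y1 else ev3 p q r sm' lab f := by
  rw [term1, (evT_below q _ _ _ (ev p (sm 0) (lab 0) f.f000 f.f100) _ _ hij hj hsj hb).1 hc,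
    (evT_below q _ _ _ (ev p (sm 0) (lab 0) f.f001 f.f101) _ _ hij hj hsj hb).1 hc,
    ev3, ev3, ev2, ev2, ev2, ev2, h0, h1, h2]
  split_ifs <;> rfl

theorem term1_of_middle (h0 : sm' 0 = sm 0) (h2 : sm' 2 = sm 2)
    (h1 : sm' 1 = update (sm 1) i false) (hij : i < j) (hj : j < q) (hsj : sm 1 j = true)
    (hb : ∀ m, i < m → m < j → sm 1 m = false) (hc : ∃ m < i, sm 1 m = true) :
    term1 p q r sm lab f i = if lab 1 i = 0 ∧ lab 1 j = 0 then 0 else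
      ev3 p q r sm' (update lab 1 (update (lab 1) j (lab 1 i * lab 1 j))) f := by
  rw [term1, (evT_below q _ _ _ (ev p (sm 0) (lab 0) f.f000 f.f100) _ _ hij hj hsj hb).2 hc,
    (evT_below q _ _ _ (ev p (sm 0) (lab 0) f.f001 f.f101) _ _ hij hj hsj hb).2 hc,
    ev3, ev2, ev2, h0, h1, h2]
  split_ifs
  · exact ev_zero_zero r _ _
  · rfl

theorem term0_of_no_other (h1 : sm' 1 = sm 1) (h2 : sm' 2 = sm 2)
    (h0 : sm' 0 = update (sm 0) i true) (hi : i < p)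
    (h : ∀ m, m ≠ i → sm 0 m = false) : term0 p q r sm lab f i = ev3 p q r sm' lab f.s0 := by
  have ha : ∀ m, i < m → m < p → sm 0 m = false := fun m hm _ => h m hm.ne'
  have hb : ∀ m < i, sm 0 m = false := fun m hm => h m hm.ne
  rw [term0, (mevT_top p _ f.s0.f000 _ _ _ _ hi ha).1 hb, (mevT_top p _ f.s0.f010 _ _ _ _ hi ha).1
      hb,
    (mevT_top p _ f.s0.f001 _ _ _ _ hi ha).1 hb, (mevT_top p _ f.s0.f011 _ _ _ _ hi ha).1 hb,
    ev3, ev2, ev2, h0, h1, h2]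

theorem term0_of_top (h1 : sm' 1 = sm 1) (h2 : sm' 2 = sm 2)
    (h0 : sm' 0 = update (sm 0) i true) (hi : i < p)
    (ha : ∀ m, i < m → sm 0 m = false) (hb : ∃ m < i, sm 0 m = true) :
    term0 p q r sm lab f i =
      ev3 p q r sm' (update lab 0 (update (lab 0) i 0)) f +
      ev3 p q r sm' (update lab 0 (update (lab 0) i 1)) f.t0 := by
  have ha' : ∀ m, i < m → m < p → sm 0 m = false := fun m hm _ => ha m hm
  rw [term0, (mevT_top p _ f.f000 _ _ _ _ hi ha').2 hb, (mevT_top p _ f.f010 _ _ _ _ hi ha').2 hb,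
    (mevT_top p _ f.f001 _ _ _ _ hi ha').2 hb, (mevT_top p _ f.f011 _ _ _ _ hi ha').2 hb,
    ev_add, ev_add, ev_add, ev3, ev3, ev2, ev2, ev2, ev2, h0, h1, h2]
  rfl

theorem term0_of_bottom (h1 : sm' 1 = sm 1) (h2 : sm' 2 = sm 2)
    (h0 : sm' 0 = update (sm 0) i true) (hij : i < j) (hj : j < p) (hsj : sm 0 j = true)
    (hb : ∀ m, i < m → m < j → sm 0 m = false) (hc : ∀ m < i, sm 0 m = false) :
    term0 p q r sm lab f i =
      ev3 p q r sm' (update lab 0 (update (lab 0) j 0)) f +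
      ev3 p q r sm' (update lab 0 (update (lab 0) j 1)) f.y0 := by
  rw [term0, (mevT_below p _ f.f000 _ _ _ _ hij hj hsj hb).1 hc,
    (mevT_below p _ f.f010 _ _ _ _ hij hj hsj hb).1 hc,
    (mevT_below p _ f.f001 _ _ _ _ hij hj hsj hb).1 hc,
    (mevT_below p _ f.f011 _ _ _ _ hij hj hsj hb).1 hc,
    ev_add, ev_add, ev_add, ev3, ev3, ev2, ev2, ev2, ev2, h0, h1, h2]
  rfl

theorem term0_of_middle (h1 : sm' 1 = sm 1) (h2 : sm' 2 = sm 2)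
    (h0 : sm' 0 = update (sm 0) i true) (hij : i < j) (hj : j < p) (hsj : sm 0 j = true)
    (hb : ∀ m, i < m → m < j → sm 0 m = false) (hc : ∃ m < i, sm 0 m = true) :
    term0 p q r sm lab f i =
      ev3 p q r sm' (update lab 0 (update (lab 0) i 0)) f +
      if lab 0 j = 0 then 0 else ev3 p q r sm'
        (update lab 0 (update (update (lab 0) i 1) j 0)) f := by
  rw [term0, (mevT_below p _ f.f000 _ _ _ _ hij hj hsj hb).2 hc,
    (mevT_below p _ f.f010 _ _ _ _ hij hj hsj hb).2 hc,
    (mevT_below p _ f.f001 _ _ _ _ hij hj hsj hb).2 hc,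
    (mevT_below p _ f.f011 _ _ _ _ hij hj hsj hb).2 hc,
    ev_add, ev_add, ev_add, ev3, ev3, ev2, ev2, ev2, ev2, h0, h1, h2]
  split_ifs
  · rw [ev_zero_zero, ev_zero_zero, ev_zero_zero]
    rfl
  · rfl

end

end

open PDCode

/-! ### The coordinate of a state -/

/-- The signs of the columns. -/
abbrev sg : Fin 3 → Bool := ![false, true, true]

local notation "PD" n:max => pretzelDiagram n sg

variable {n : Fin 3 → ℕ}

/-- The exponents on the circles between the crossings of the columns. -/
def labs (z : PretzelEdge n → Fin 2) (k : Fin 3) (i : ℕ) : Fin 2 := z (columnEdge n k false i)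

/-- The coordinates on the outer circles. -/
def outer (z : PretzelEdge n → Fin 2) : Outer where
  f000 := (coef (z (.top 2))).comp (coef (z (.top 0)))
  f100 := coef (z (.top 0))
  f010 := coef (z (.top 2))
  f110 := idHom ℤ
  f001 := coef (z (.top 0))
  f101 := idHom ℤ
  f011 := idHom ℤ
  f111 := coef (z (.bot 0))

/-- The coordinate of a state. -/
def stEv (v : PretzelCrossing n → Bool) (z : PretzelEdge n → Fin 2) :
    Cpx (n 0) (n 1) (n 2) →+ ℤ :=
  ev3 (n 0) (n 1) (n 2) (hs sg v) (labs z) (outer z)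

/-- The coordinate of a state of the reduced complex. -/
def redEv (v : PretzelCrossing n → Bool) (z : PretzelEdge n → Fin 2) (x : Cpx (n 0) (n 1) (n 2)) :
    ℤ := if z (.top 1) = 0 then stEv v z x else 0

theorem ev3_hs_congr {v : PretzelCrossing n → Bool} {lab lab' : Fin 3 → ℕ → Fin 2} {f f' : Outer}
    (hlab : ∀ k m, IsUpper (hs sg v k) m → lab k m = lab' k m)
    (hf : Outer.AgreeAt (pattern sg v) f f') :
    ev3 (n 0) (n 1) (n 2) (hs sg v) lab f = ev3 (n 0) (n 1) (n 2) (hs sg v) lab' f' := by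
  have e : ![n 0, n 1, n 2] = n := by ext k; fin_cases k <;> rfl
  refine ev3_congr _ _ _ rfl hlab (fun k h m => pattern_eq_false.1 h m) (fun k h => ?_) hf
  obtain ⟨m, hm⟩ := pattern_eq_true.1 h
  exact ⟨m, by rw [e]; exact lt_of_hs hm, hm⟩

theorem ev3_zero (p q r : ℕ) (sm : Fin 3 → ℕ → Bool) (lab : Fin 3 → ℕ → Fin 2) :
    ev3 p q r sm lab ⟨0, 0, 0, 0, 0, 0, 0, 0⟩ = 0 := by
  simp only [ev3, ev2, ev_zero_zero]

theorem ev3_hs_eq_zero {v : PretzelCrossing n → Bool} {lab : Fin 3 → ℕ → Fin 2} {f : Outer}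
    (hf : Outer.AgreeAt (pattern sg v) f ⟨0, 0, 0, 0, 0, 0, 0, 0⟩) :
    ev3 (n 0) (n 1) (n 2) (hs sg v) lab f = 0 := by
  rw [ev3_hs_congr (lab' := lab) (fun _ _ _ => rfl) hf, ev3_zero]

theorem hs_update_of_ne (pos : Fin 3 → Bool) (v : PretzelCrossing n → Bool) {k k' : Fin 3}
    (h : k' ≠ k) (i : Fin (n k)) (b : Bool) :
    hs pos (update v (toLex ⟨k, i⟩) b) k' = hs pos v k' := by
  funext m
  unfold hs
  split_ifs with hm
  · rw [update_of_ne]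
    intro e
    exact h (congrArg (fun c : PretzelCrossing n => (ofLex c).1) e)
  · rfl

theorem hs_update (pos : Fin 3 → Bool) (v : PretzelCrossing n → Bool) (k : Fin 3) (i : Fin (n k))
    (b : Bool) : hs pos (update v (toLex ⟨k, i⟩) b) k =
      update (hs pos v k) i (b == pos k) := by
  funext m
  by_cases hm : m = i
  · subst hm
    simp [hs, i.2]
  · rw [update_of_ne hm]
    unfold hs
    split_ifs with h
    · rw [update_of_ne]
      intro e
      have e' := toLex.injective e
      rw [Sigma.mk.injEq] at e'
      exact hm (congrArg Fin.val (eq_of_heq e'.2))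
    · rfl

theorem columnEdge_of_isUpper {pos : Fin 3 → Bool} {v : PretzelCrossing n → Bool} {k : Fin 3}
    {m : ℕ} (h : IsUpper (hs pos v k) m) : ∃ h' : m - 1 < n k - 1, 0 < m ∧
      columnEdge n k false m = .inner k false ⟨m - 1, h'⟩ := by
  obtain ⟨h1, l, hl, -⟩ := h
  have := lt_of_hs h1
  exact ⟨by omega, by omega, columnEdge_inner false ⟨by omega, this⟩⟩

theorem columnEdge_ne_top {pos : Fin 3 → Bool} {v : PretzelCrossing n → Bool} {k : Fin 3} {m : ℕ}
    (h : IsUpper (hs pos v k) m) (P : Fin 3 → Bool) (j : Fin 3) :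
    columnEdge n k false m ≠ topEdge n P j := by
  obtain ⟨h', -, e⟩ := columnEdge_of_isUpper h
  rw [e, topEdge]
  simp

theorem columnEdge_ne_bot {pos : Fin 3 → Bool} {v : PretzelCrossing n → Bool} {k : Fin 3} {m : ℕ}
    (h : IsUpper (hs pos v k) m) (P : Fin 3 → Bool) (j : Fin 3) :
    columnEdge n k false m ≠ botEdge n P j := by
  obtain ⟨h', -, e⟩ := columnEdge_of_isUpper h
  rw [e, botEdge]
  split_ifs <;> simp

theorem columnEdge_injective {pos : Fin 3 → Bool} {v w : PretzelCrossing n → Bool}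
    {k k' : Fin 3} {m m' : ℕ} (h : IsUpper (hs pos v k) m) (h' : IsUpper (hs pos w k') m')
    (e : columnEdge n k false m = columnEdge n k' false m') : k = k' ∧ m = m' := by
  obtain ⟨h1, h2, e1⟩ := columnEdge_of_isUpper h
  obtain ⟨h3, h4, e2⟩ := columnEdge_of_isUpper h'
  rw [e1, e2] at e
  simp only [PretzelEdge.inner.injEq, true_and] at e
  obtain ⟨rfl, e⟩ := e
  have := congrArg Fin.val (eq_of_heq e)
  simp only at this
  exact ⟨rfl, by omega⟩

theorem rep_of_isUpper (hn : ∀ k, 0 < n k) {pos : Fin 3 → Bool} {v : PretzelCrossing n → Bool}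
    {k : Fin 3} {m : ℕ} (h : IsUpper (hs pos v k) m) :
    rep pos v (columnEdge n k false m) = columnEdge n k false m := by
  rw [rep_columnEdge hn _ _ _ (lt_of_hs h.1).le]
  exact levelRep_of_upper le_rfl h.1 (fun l h1 h2 => by omega) h.2 _

theorem expo_rep (hn : ∀ k, 0 < n k) {pos : Fin 3 → Bool} (t : (pretzelDiagram n pos).State)
    (e : PretzelEdge n) : expo t (rep pos t.1 e) = expo t e :=
  expo_eq_of_circle_eq t (circle_rep hn t.1 e)

theorem pattern_congr {pos : Fin 3 → Bool} {v w : PretzelCrossing n → Bool} {k : Fin 3}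
    (h : hs pos v k = hs pos w k) : pattern pos v k = pattern pos w k := by
  unfold pattern
  rw [h]

/-- The edge map of a column on the right or in the middle. -/
def termk (k : Fin 3) (v : PretzelCrossing n → Bool) (z : PretzelEdge n → Fin 2) (i : ℕ) :
    Cpx (n 0) (n 1) (n 2) →+ ℤ :=
  if k = 0 then term0 (n 0) (n 1) (n 2) (hs sg v) (labs z) (outer z) i
  else if k = 1 then term1 (n 0) (n 1) (n 2) (hs sg v) (labs z) (outer z) i
  else term2 (n 0) (n 1) (n 2) (hs sg v) (labs z) (outer z) i

/-- A crossing of a column with vertical `0`-smoothing, between two resolutions. -/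
structure Saddle (k : Fin 3) (i : Fin (n k)) (t : (PD n).State)
    (v : PretzelCrossing n → Bool) : Prop where
  pos : ∀ k, 0 < n k
  base : expo t (.top 1) = 0
  one : t.1 (toLex ⟨k, i⟩) = true
  eq : v = update t.1 (toLex ⟨k, i⟩) false

namespace Saddle

variable {k : Fin 3} {i : Fin (n k)} {t : (PD n).State}
  {v : PretzelCrossing n → Bool}

theorem hs_other (h : Saddle k i t v) {k' : Fin 3} (hk : k' ≠ k) : hs sg v k' = hs sg t.1 k' := by
  rw [h.eq, hs_update_of_ne sg _ hk]

theorem hs_self (h : Saddle k i t v) (hk : k ≠ 0) :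
    hs sg v k = update (hs sg t.1 k) i false := by
  rw [h.eq, hs_update]
  fin_cases k <;> simp_all

theorem hs_self_zero {i : Fin (n 0)} (h : Saddle 0 i t v) :
    hs sg v 0 = update (hs sg t.1 0) i true := by
  rw [h.eq, hs_update]
  rfl

theorem hs_i (h : Saddle k i t v) (hk : k ≠ 0) : hs sg t.1 k i = true := by
  have := h.one
  fin_cases k <;> simp_all [hs]

theorem hs_i_zero {i : Fin (n 0)} (h : Saddle 0 i t v) : hs sg t.1 0 i = false := by
  have := h.one
  simp_all [hs]

theorem end0 (hk : k ≠ 0) :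
    (PD n) (toLex ⟨k, i⟩) 0 = columnEdge n k true i := by
  fin_cases k <;> simp_all [pretzelDiagram]

theorem end2 (hk : k ≠ 0) :
    (PD n) (toLex ⟨k, i⟩) 2 = columnEdge n k false (i + 1) := by
  fin_cases k <;> simp_all [pretzelDiagram]

theorem end0_zero {i : Fin (n 0)} :
    (PD n) (toLex ⟨0, i⟩) 0 = columnEdge n 0 false i := by
  simp [pretzelDiagram]

theorem end2_zero {i : Fin (n 0)} :
    (PD n) (toLex ⟨0, i⟩) 2 = columnEdge n 0 true (i + 1) := by
  simp [pretzelDiagram]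

end Saddle

theorem topEdge_base {P : Fin 3 → Bool} {k : Fin 3} (hk : k ≠ 0) (h : P k = true) :
    topEdge n P k = .top 1 := by
  fin_cases k <;> simp_all [topEdge, topRep]

theorem botEdge_base {P : Fin 3 → Bool} {k : Fin 3} (hk : k ≠ 0) (h : P k = true)
    (h' : ¬ (P 0 = true ∧ P 1 = true ∧ P 2 = true)) : botEdge n P k = .top 1 := by
  rw [botEdge, if_neg, ← topEdge, topEdge_base hk h]
  simpa [and_assoc] using h'

/-- Agreement on the outer edges implies agreement of the outer coordinates. -/
theorem outer_congr {z z' : PretzelEdge n → Fin 2} (h0 : z (.top 0) = z' (.top 0))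
    (h2 : z (.top 2) = z' (.top 2)) (hb : z (.bot 0) = z' (.bot 0)) : outer z = outer z' := by
  simp only [outer, h0, h2, hb]

open PDCode

/-! ### The edge maps in coordinates: the columns on the right -/

/-- The coordinate of a state depends only on the exponents at the representatives of circles. -/
theorem stEv_congr {n : Fin 3 → ℕ} (hn : ∀ k, 0 < n k) {v : PretzelCrossing n → Bool}
    {z z' : PretzelEdge n → Fin 2} (h : ∀ e, rep sg v e = e → e ≠ .top 1 → z e = z' e) :
    stEv v z = stEv v z' := by
  refine ev3_hs_congr (fun k m hm => ?_) ?_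
  · refine h _ (rep_of_isUpper hn hm) ?_
    obtain ⟨_, -, e⟩ := columnEdge_of_isUpper hm
    rw [e]
    simp
  · have t0 := h (.top 0)
    have t2 := h (.top 2)
    have b0 := h (.bot 0)
    simp only [rep, topEdge, topRep, botEdge] at t0 t2 b0
    constructor <;> intro h0 h1 h2 <;> simp_all [outer]

namespace Outer

/-- Composition with the saddle of a column on the right. -/
def sAt (k : Fin 3) (f : Outer) : Outer := if k = 1 then f.s1 else f.s2

/-- Composition with the lower arc of a column on the right. -/
def yAt (k : Fin 3) (f : Outer) : Outer := if k = 1 then f.y1 else f.y2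

end Outer

namespace Saddle

variable {n : Fin 3 → ℕ} {k : Fin 3} {i : Fin (n k)} {t : (PD n).State}
  {v : PretzelCrossing n → Bool} {j : ℕ}

theorem eq_one_or_two (hk : k ≠ 0) : k = 1 ∨ k = 2 := by omega

theorem termk_of_no_other (h : Saddle k i t v) (hk : k ≠ 0) (z : PretzelEdge n → Fin 2)
    (ho : ∀ m, m ≠ (i : ℕ) → hs sg t.1 k m = false) :
    termk k t.1 z i = ev3 (n 0) (n 1) (n 2) (hs sg v) (labs z) ((outer z).sAt k) := by
  obtain rfl | rfl := eq_one_or_two hk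
  · exact term1_of_no_other _ _ (h.hs_other (by decide)) (h.hs_other (by decide)) (h.hs_self hk)
        i.2 ho
  · exact term2_of_no_other _ _ (h.hs_other (by decide)) (h.hs_other (by decide)) (h.hs_self hk)
        i.2 ho

theorem termk_of_top (h : Saddle k i t v) (hk : k ≠ 0) (z : PretzelEdge n → Fin 2)
    (ha : ∀ m, (i : ℕ) < m → hs sg t.1 k m = false) (hb : ∃ m < (i : ℕ), hs sg t.1 k m = true) :
    termk k t.1 z i = if labs z k i = 0 then 0 else stEv v z := by
  obtain rfl | rfl := eq_one_or_two hk
  · exact term1_of_top _ _ (h.hs_other (by decide)) (h.hs_other (by decide)) (h.hs_self hk) i.2 ha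
        hb
  · exact term2_of_top _ _ (h.hs_other (by decide)) (h.hs_other (by decide)) (h.hs_self hk) i.2 ha
        hb

theorem termk_of_bottom (h : Saddle k i t v) (hk : k ≠ 0) (z : PretzelEdge n → Fin 2)
    (hij : (i : ℕ) < j) (hsj : hs sg t.1 k j = true)
    (hb : ∀ m, (i : ℕ) < m → m < j → hs sg t.1 k m = false)
    (hc : ∀ m < (i : ℕ), hs sg t.1 k m = false) :
    termk k t.1 z i = if labs z k j = 0 then
      ev3 (n 0) (n 1) (n 2) (hs sg v) (labs z) ((outer z).yAt k) else stEv v z := by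
  obtain rfl | rfl := eq_one_or_two hk
  · exact term1_of_bottom _ _ (h.hs_other (by decide)) (h.hs_other (by decide)) (h.hs_self hk) hij
      (lt_of_hs hsj) hsj hb hc
  · exact term2_of_bottom _ _ (h.hs_other (by decide)) (h.hs_other (by decide)) (h.hs_self hk) hij
      (lt_of_hs hsj) hsj hb hc

theorem termk_of_middle (h : Saddle k i t v) (hk : k ≠ 0) (z : PretzelEdge n → Fin 2)
    (hij : (i : ℕ) < j) (hsj : hs sg t.1 k j = true)
    (hb : ∀ m, (i : ℕ) < m → m < j → hs sg t.1 k m = false)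
    (hc : ∃ m < (i : ℕ), hs sg t.1 k m = true) :
    termk k t.1 z i = if labs z k i = 0 ∧ labs z k j = 0 then 0 else
      ev3 (n 0) (n 1) (n 2) (hs sg v) (update (labs z) k
        (update (labs z k) j (labs z k i * labs z k j))) (outer z) := by
  obtain rfl | rfl := eq_one_or_two hk
  · exact term1_of_middle _ _ (h.hs_other (by decide)) (h.hs_other (by decide)) (h.hs_self hk) hij
      (lt_of_hs hsj) hsj hb hc
  · exact term2_of_middle _ _ (h.hs_other (by decide)) (h.hs_other (by decide)) (h.hs_self hk) hij
      (lt_of_hs hsj) hsj hb hc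

theorem expo_eq (h : Saddle k i t v) {e f : PretzelEdge n} (he : rep sg t.1 e = f) :
    expo t e = expo t f := by rw [← expo_rep h.pos t e, he]

open Classical in
/-- The edge map into the state `t`, in coordinates. -/
noncomputable def edgeSum [Fintype (PD n).State] (i : Fin (n k)) (t : (PD n).State)
    (x : Cpx (n 0) (n 1) (n 2)) : ℤ :=
  ∑ s, if (PD n).Incident (toLex ⟨k, i⟩) s t then redEv s.1 (expo s) x else 0

open Classical in
theorem sum_of_split [Fintype (PD n).State] (h : Saddle k i t v)
    {a b r : PretzelEdge n} (ha : (PD n) (toLex ⟨k, i⟩) 0 = a)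
    (hb : (PD n) (toLex ⟨k, i⟩) 2 = b) (ra : rep sg v a = r) (rb : rep sg v b = r)
    (x : Cpx (n 0) (n 1) (n 2)) :
    edgeSum i t x =
      if expo t a = 0 ∧ expo t b = 0 then 0 else
        stEv v (fun e => if rep sg v e = r then expo t a * expo t b else expo t e) x := by
  subst ha hb
  have hv : (PD n).circle v ((PD n) (toLex ⟨k, i⟩) 0) =
      (PD n).circle v ((PD n) (toLex ⟨k, i⟩) 2) :=
    (circle_eq_iff h.pos).2 (ra.trans rb.symm)
  refine (sum_incident_of_split h.one (h.eq.trans (by congr!)) hv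
    (fun v z => redEv v z x)).trans ?_
  simp only [circle_eq_iff h.pos, ra]
  congr 1
  refine if_pos ?_
  beta_reduce
  split_ifs with h1
  · have h2 := (circle_eq_iff_of_eq (w := t.1) (fun c' hc => by
      rw [h.eq, update_of_ne hc]) hv (.top 1) _).1 ((circle_eq_iff h.pos).2 (h1.trans ra.symm))
    rcases h2.elim Or.inl And.left with h3 | h3
    · rw [← expo_eq_of_circle_eq t h3, h.base, zero_mul]
    · rw [← expo_eq_of_circle_eq t h3, h.base, mul_zero]
  · exact h.base

open Classical in
theorem sum_of_merge [Fintype (PD n).State] (h : Saddle k i t v)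
    {a b r r' u : PretzelEdge n} (ha : (PD n) (toLex ⟨k, i⟩) 0 = a)
    (hb : (PD n) (toLex ⟨k, i⟩) 2 = b) (ra : rep sg v a = r) (rb : rep sg v b = r')
    (hr : r ≠ r') (ua : rep sg t.1 a = u) (ub : rep sg t.1 b = u) (x : Cpx (n 0) (n 1) (n 2)) :
    edgeSum i t x =
      if expo t u = 0 then stEv v (expo t) x else
        stEv v (fun e => if rep sg v e = r then 0 else expo t e) x +
        stEv v (fun e => if rep sg v e = r' then 0 else expo t e) x := by
  rw [← h.expo_eq ua]
  subst ha hb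
  refine (sum_incident_of_merge h.one (h.eq.trans (by congr!))
    (fun e => hr (ra.symm.trans (((circle_eq_iff h.pos).1 e).trans rb)))
    ((circle_eq_iff h.pos).2 (ua.trans ub.symm)) (fun v z => redEv v z x)).trans ?_
  simp only [circle_eq_iff h.pos, ra, rb, redEv, h.base, ite_self, if_true]

theorem hs_v_of_ne (h : Saddle k i t v) (hk : k ≠ 0) {m : ℕ} (hm : m ≠ i) :
    hs sg v k m = hs sg t.1 k m := by rw [h.hs_self hk, update_of_ne hm]

theorem hs_v_self (h : Saddle k i t v) (hk : k ≠ 0) : hs sg v k i = false := by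
  rw [h.hs_self hk, update_self]

theorem pattern_other (h : Saddle k i t v) {k' : Fin 3} (hk : k' ≠ k) :
    pattern sg v k' = pattern sg t.1 k' := pattern_congr (h.hs_other hk)

theorem pattern_t (h : Saddle k i t v) (hk : k ≠ 0) : pattern sg t.1 k = true :=
  pattern_eq_true.2 ⟨i, h.hs_i hk⟩

theorem pattern_eq (h : Saddle k i t v) (hk : k ≠ 0) {m : ℕ} (hm : m ≠ i)
    (h' : hs sg t.1 k m = true) : pattern sg v = pattern sg t.1 := by
  funext k'
  by_cases hk' : k' = k
  · subst hk'
    rw [h.pattern_t hk, pattern_eq_true]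
    exact ⟨m, by rw [h.hs_v_of_ne hk hm, h']⟩
  · exact h.pattern_other hk'

section

variable [Fintype (PD n).State]

theorem sum_of_top (h : Saddle k i t v) (hk : k ≠ 0)
    (ha : ∀ m, (i : ℕ) < m → hs sg t.1 k m = false) (hb : ∃ m < (i : ℕ), hs sg t.1 k m = true)
    (x : Cpx (n 0) (n 1) (n 2)) :
    edgeSum i t x = termk k t.1 (expo t) i x := by
  obtain ⟨m, hm, hm'⟩ := hb
  have hP := h.pattern_eq hk hm.ne hm'
  have hv : ∀ l, (i : ℕ) ≤ l → hs sg v k l = false := fun l hl => by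
    rcases hl.eq_or_lt with rfl | hl
    · exact h.hs_v_self hk
    · rw [h.hs_v_of_ne hk hl.ne', ha l hl]
  have ra : rep sg v (columnEdge n k true i) = .top 1 := by
    rw [rep_columnEdge h.pos _ _ _ i.2.le, levelRep_of_top hv, hP]
    exact topEdge_base hk (h.pattern_t hk)
  have rb : rep sg v (columnEdge n k false (i + 1)) = .top 1 := by
    rw [rep_columnEdge h.pos _ _ _ i.2, levelRep_of_top fun l hl => hv l (by omega), hP]
    refine (topEdge_eq (h.pattern_t hk)).trans (topEdge_base hk (h.pattern_t hk))
  have ta : rep sg t.1 (columnEdge n k true i) = columnEdge n k false i := by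
    rw [rep_columnEdge h.pos _ _ _ i.2.le]
    exact levelRep_of_upper le_rfl (h.hs_i hk) (fun l h1 h2 => by omega) ⟨m, hm, hm'⟩ _
  have tb : rep sg t.1 (columnEdge n k false (i + 1)) = .top 1 := by
    rw [rep_columnEdge h.pos _ _ _ i.2, levelRep_of_top fun l hl => ha l (by omega)]
    refine (topEdge_eq (h.pattern_t hk)).trans (topEdge_base hk (h.pattern_t hk))
  rw [h.sum_of_split (end0 hk) (end2 hk) ra rb, h.expo_eq ta, h.expo_eq tb, h.base,
    h.termk_of_top hk _ ha ⟨m, hm, hm'⟩]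
  simp only [and_true]
  by_cases h1 : expo t (columnEdge n k false i) = 0
  · rw [if_pos h1, if_pos (show labs (expo t) k i = 0 from h1)]
    rfl
  · rw [if_neg h1, if_neg (show ¬ labs (expo t) k i = 0 from h1), stEv_congr h.pos fun e he he' =>
        if_neg (by rw [he]; exact he')]

theorem sum_of_bottom (h : Saddle k i t v) (hk : k ≠ 0) (hij : (i : ℕ) < j)
    (hsj : hs sg t.1 k j = true) (hb : ∀ m, (i : ℕ) < m → m < j → hs sg t.1 k m = false)
    (hc : ∀ m < (i : ℕ), hs sg t.1 k m = false) (x : Cpx (n 0) (n 1) (n 2)) :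
    edgeSum i t x = termk k t.1 (expo t) i x := by
  have hP := h.pattern_eq hk hij.ne' hsj
  have hv : hs sg v k j = true := by rw [h.hs_v_of_ne hk hij.ne', hsj]
  have hv' : ∀ l < j, hs sg v k l = false := fun l hl => by
    by_cases hli : l = i
    · rw [hli]
      exact h.hs_v_self hk
    · rw [h.hs_v_of_ne hk hli]
      rcases lt_or_gt_of_ne hli with h1 | h1
      · exact hc l h1
      · exact hb l h1 hl
  have ra : rep sg v (columnEdge n k true i) = botEdge n (pattern sg t.1) k := by
    rw [rep_columnEdge h.pos _ _ _ i.2.le,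
      levelRep_of_bot (fun l hl => hv' l (by omega)) ⟨j, hij.le, hv⟩, hP]
    rfl
  have rb : rep sg v (columnEdge n k false (i + 1)) = botEdge n (pattern sg t.1) k := by
    rw [rep_columnEdge h.pos _ _ _ i.2,
      levelRep_of_bot (fun l hl => hv' l (by omega)) ⟨j, hij, hv⟩, hP]
    exact botEdge_eq (h.pattern_t hk)
  have ta : rep sg t.1 (columnEdge n k true i) = botEdge n (pattern sg t.1) k := by
    rw [rep_columnEdge h.pos _ _ _ i.2.le, levelRep_of_bot hc ⟨j, hij.le, hsj⟩]
    rfl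
  have tb : rep sg t.1 (columnEdge n k false (i + 1)) = columnEdge n k false j := by
    rw [rep_columnEdge h.pos _ _ _ i.2]
    exact levelRep_of_upper hij hsj (fun l h1 h2 => hb l (by omega) h2)
      ⟨i, by omega, h.hs_i hk⟩ _
  rw [h.sum_of_split (end0 hk) (end2 hk) ra rb, h.expo_eq ta, h.expo_eq tb,
    h.termk_of_bottom hk _ hij hsj hb hc]
  rcases fin_two_eq_zero_or_one (expo t (columnEdge n k false j)) with h1 | h1
  · rw [h1, if_pos (show labs (expo t) k j = 0 from h1)]
    have p0 := h.pattern_t hk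
    rcases fin_two_eq_zero_or_one (expo t (botEdge n (pattern sg t.1) k)) with h2 | h2
    · rw [if_pos ⟨h2, rfl⟩, ev3_hs_eq_zero, hom_zero]
      rw [hP]
      unfold botEdge at h2
      obtain rfl | rfl := eq_one_or_two hk <;>
      constructor <;> intro e0 e1 e2 <;>
        simp_all [Outer.yAt, Outer.y1, Outer.y2, outer] <;> ext <;> simp [mulX]
    · have h3 : pattern sg t.1 0 = true ∧ pattern sg t.1 1 = true ∧ pattern sg t.1 2 = true := by
        by_contra h3
        rw [botEdge_base hk p0 h3, h.base] at h2
        cases h2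
      have h4 : botEdge n (pattern sg t.1) k = .bot 0 := by
        rw [botEdge, if_pos]
        simp [h3]
      rw [if_neg (by rw [h2]; simp)]
      refine congrArg (fun f => f x) (ev3_hs_congr (fun k' m hm => ?_) ?_)
      · refine if_neg ?_
        rw [rep_of_isUpper h.pos hm]
        exact columnEdge_ne_bot hm _ _
      · rw [hP]
        rw [h4] at h2
        have h5 : rep sg v (.bot 0) = .bot 0 := by simp [rep, hP, botEdge, h3]
        obtain rfl | rfl := eq_one_or_two hk <;>
        constructor <;> intro e0 e1 e2 <;>
          simp_all [Outer.yAt, Outer.y1, Outer.y2, outer] <;> ext <;> simp [mulX]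
  · rw [h1, if_neg (by simp), if_neg (show ¬ labs (expo t) k j = 0 by rw [labs, h1]; simp)]
    rw [stEv_congr h.pos fun e he he' => ?_]
    split_ifs with h2
    · rw [mul_one, ← h2, he]
    · rfl

theorem sum_of_middle (h : Saddle k i t v) (hk : k ≠ 0) (hij : (i : ℕ) < j)
    (hsj : hs sg t.1 k j = true) (hb : ∀ m, (i : ℕ) < m → m < j → hs sg t.1 k m = false)
    (hc : ∃ m < (i : ℕ), hs sg t.1 k m = true) (x : Cpx (n 0) (n 1) (n 2)) :
    edgeSum i t x = termk k t.1 (expo t) i x := by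
  have hP := h.pattern_eq hk hij.ne' hsj
  obtain ⟨m, hm, hm'⟩ := hc
  have hv : hs sg v k j = true := by rw [h.hs_v_of_ne hk hij.ne', hsj]
  have hvm : hs sg v k m = true := by rw [h.hs_v_of_ne hk hm.ne, hm']
  have hv' : ∀ l, (i : ℕ) ≤ l → l < j → hs sg v k l = false := fun l hl hl' => by
    rcases hl.eq_or_lt with rfl | hl
    · exact h.hs_v_self hk
    · rw [h.hs_v_of_ne hk hl.ne', hb l hl hl']
  have ra : rep sg v (columnEdge n k true i) = columnEdge n k false j := by
    rw [rep_columnEdge h.pos _ _ _ i.2.le]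
    exact levelRep_of_upper hij.le hv hv' ⟨m, hm, hvm⟩ _
  have rb : rep sg v (columnEdge n k false (i + 1)) = columnEdge n k false j := by
    rw [rep_columnEdge h.pos _ _ _ i.2]
    exact levelRep_of_upper hij hv (fun l h1 h2 => hv' l (by omega) h2) ⟨m, by omega, hvm⟩ _
  have ta : rep sg t.1 (columnEdge n k true i) = columnEdge n k false i := by
    rw [rep_columnEdge h.pos _ _ _ i.2.le]
    exact levelRep_of_upper le_rfl (h.hs_i hk) (fun l h1 h2 => by omega) ⟨m, hm, hm'⟩ _
  have tb : rep sg t.1 (columnEdge n k false (i + 1)) = columnEdge n k false j := by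
    rw [rep_columnEdge h.pos _ _ _ i.2]
    exact levelRep_of_upper hij hsj (fun l h1 h2 => hb l (by omega) h2) ⟨m, by omega, hm'⟩ _
  rw [h.sum_of_split (end0 hk) (end2 hk) ra rb, h.expo_eq ta, h.expo_eq tb,
    h.termk_of_middle hk _ hij hsj hb ⟨m, hm, hm'⟩]
  have hup : IsUpper (hs sg v k) j := ⟨hv, m, by omega, hvm⟩
  by_cases h1 : expo t (columnEdge n k false i) = 0 ∧ expo t (columnEdge n k false j) = 0
  · rw [if_pos h1, if_pos (show labs (expo t) k i = 0 ∧ labs (expo t) k j = 0 from h1)]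
    rfl
  · rw [if_neg h1, if_neg (show ¬ (labs (expo t) k i = 0 ∧ labs (expo t) k j = 0) from h1)]
    refine congrArg (fun f => f x) (ev3_hs_congr (fun k' m hm => ?_) ?_)
    · change (if rep sg v (columnEdge n k' false m) = _ then _ else
        expo t (columnEdge n k' false m)) = _
      rw [rep_of_isUpper h.pos hm]
      by_cases h2 : k = k'
      · subst h2
        rw [update_self]
        by_cases h3 : m = j
        · subst h3
          rw [if_pos rfl, update_self]
          rfl
        · rw [if_neg fun e => h3 (columnEdge_injective hm hup e).2, update_of_ne h3]
          rfl
      · rw [if_neg fun e => h2 (columnEdge_injective hm hup e).1.symm,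
          update_of_ne (Ne.symm h2)]
        rfl
    · have : outer (fun e => if rep sg v e = columnEdge n k false j then
          expo t (columnEdge n k false i) * expo t (columnEdge n k false j) else expo t e) =
          outer (expo t) := by
        refine outer_congr (if_neg ?_) (if_neg ?_) (if_neg ?_)
        · exact fun e => columnEdge_ne_top hup _ _ e.symm
        · exact fun e => columnEdge_ne_top hup _ _ e.symm
        · exact fun e => columnEdge_ne_bot hup _ _ e.symm
      rw [this]
      exact Outer.AgreeAt.refl _ _

theorem sum_of_no_other (h : Saddle k i t v) (hk : k ≠ 0)
    (ho : ∀ m, m ≠ (i : ℕ) → hs sg t.1 k m = false) (x : Cpx (n 0) (n 1) (n 2)) :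
    edgeSum i t x = termk k t.1 (expo t) i x := by
  have p1 := h.pattern_t hk
  have hv : ∀ l, hs sg v k l = false := fun l => by
    by_cases hl : l = i
    · rw [hl]
      exact h.hs_v_self hk
    · rw [h.hs_v_of_ne hk hl, ho l hl]
  have p2 : pattern sg v k = false := pattern_eq_false.2 hv
  have ra : rep sg v (columnEdge n k true i) = topEdge n (pattern sg v) k := by
    rw [rep_columnEdge h.pos _ _ _ i.2.le, levelRep_of_top fun l _ => hv l]
    rfl
  have rb : rep sg v (columnEdge n k false (i + 1)) = topEdge n (pattern sg v) (k - 1) := by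
    rw [rep_columnEdge h.pos _ _ _ i.2, levelRep_of_top fun l _ => hv l]
    rfl
  have ta : rep sg t.1 (columnEdge n k true i) = botEdge n (pattern sg t.1) k := by
    rw [rep_columnEdge h.pos _ _ _ i.2.le,
      levelRep_of_bot (fun l hl => ho l hl.ne) ⟨i, le_rfl, h.hs_i hk⟩]
    rfl
  have tb : rep sg t.1 (columnEdge n k false (i + 1)) = .top 1 := by
    rw [rep_columnEdge h.pos _ _ _ i.2, levelRep_of_top fun l hl => ho l (by omega)]
    refine (topEdge_eq (h.pattern_t hk)).trans (topEdge_base hk (h.pattern_t hk))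
  have o0 := h.pattern_other (k' := 0)
  have o1 := h.pattern_other (k' := 1)
  have o2 := h.pattern_other (k' := 2)
  rw [h.termk_of_no_other hk _ ho]
  by_cases h3 : pattern sg t.1 0 = true ∧ pattern sg t.1 1 = true ∧ pattern sg t.1 2 = true
  · have e1 : topEdge n (pattern sg v) k = .top 1 ∧ topEdge n (pattern sg v) (k - 1) = .top 1 := by
      obtain rfl | rfl := eq_one_or_two hk <;> simp_all [topEdge, topRep]
    have e2 : botEdge n (pattern sg t.1) k = .bot 0 := by
      rw [botEdge, if_pos]
      simp [h3]
    rw [e1.1] at ra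
    rw [e1.2] at rb
    rw [e2] at ta
    rw [h.sum_of_split (end0 hk) (end2 hk) ra rb, h.expo_eq ta, h.expo_eq tb, h.base]
    rcases fin_two_eq_zero_or_one (expo t (.bot 0)) with h4 | h4
    · rw [if_pos ⟨h4, rfl⟩, ev3_hs_eq_zero, hom_zero]
      obtain rfl | rfl := eq_one_or_two hk <;>
      constructor <;> intro e0 e1 e2 <;>
        simp_all [Outer.sAt, Outer.s1, Outer.s2, outer] <;> ext <;> simp [inX]
    · rw [if_neg (by simp [h4]), stEv_congr h.pos (z' := expo t)
        fun e he he' => if_neg (by rw [he]; exact he')]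
      refine congrArg (fun f => f x) (ev3_hs_congr (fun k' m hm => rfl) ?_)
      obtain rfl | rfl := eq_one_or_two hk <;>
      constructor <;> intro e0 e1 e2 <;>
        simp_all [Outer.sAt, Outer.s1, Outer.s2, outer] <;> ext <;> simp [inX]
  · rw [botEdge_base hk p1 h3] at ta
    have hr : topEdge n (pattern sg v) k ≠ topEdge n (pattern sg v) (k - 1) := by
      obtain rfl | rfl := eq_one_or_two hk <;> cases q0 : pattern sg t.1 0 <;>
        cases q1 : pattern sg t.1 1 <;> cases q2 : pattern sg t.1 2 <;>
        simp_all [topEdge, topRep]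
    rw [h.sum_of_merge (end0 hk) (end2 hk) ra rb hr ta tb, if_pos h.base]
    refine congrArg (fun f => f x) (ev3_hs_congr (fun k' m hm => rfl) ?_)
    have t0 := fun e => h.expo_eq (e := .top 0) (f := e)
    have t2 := fun e => h.expo_eq (e := .top 2) (f := e)
    have hbase := h.base
    simp only [rep, topEdge, topRep] at t0 t2
    obtain rfl | rfl := eq_one_or_two hk
    · have z0 : expo t (.top 0) = 0 := (t0 (.top 1) (by simp [p1])).trans hbase
      clear t0 t2 ta tb ra rb hr
      constructor <;> intro e0 e1 e2 <;> simp only [p2, Bool.false_eq_true] at e1 <;>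
        simp only [Outer.sAt, Outer.s1, outer, if_true, z0] <;> first | rfl | skip
      exact absurd ⟨(o0 (by decide)).symm.trans e0, p1, (o2 (by decide)).symm.trans e2⟩ h3
    · have z2 : expo t (.top 2) = 0 := by
        rw [t2 _ rfl, if_neg (by decide), if_neg (by decide), p1]
        exact hbase
      have z0 : pattern sg t.1 0 = true → expo t (.top 0) = 0 := fun q0 =>
        (t0 (.top 1) (by simp [p1, q0])).trans hbase
      clear t0 t2 ta tb ra rb hr
      rw [← o0 (by decide)] at z0
      constructor <;> intro e0 e1 e2 <;> simp only [p2, Bool.false_eq_true] at e2 <;>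
        simp only [Outer.sAt, Outer.s2, outer, z2, show ¬ (2 : Fin 3) = 1 by decide, if_false]
      · rcases fin_two_eq_zero_or_one (expo t (.top 0)) with e | e <;> rw [e] <;> rfl
      · rw [z0 e0]
        rfl
      · rfl
      · exact absurd ⟨(o0 (by decide)).symm.trans e0, (o1 (by decide)).symm.trans e1, p1⟩ h3

end

end Saddle

open PDCode

/-! ### The edge maps in coordinates: the column on the left -/

namespace Saddle

variable {n : Fin 3 → ℕ} {i : Fin (n 0)} {t : (PD n).State}
  {v : PretzelCrossing n → Bool} {j : ℕ}

theorem hs_v_of_ne_zero (h : Saddle 0 i t v) {m : ℕ} (hm : m ≠ i) :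
    hs sg v 0 m = hs sg t.1 0 m := by rw [h.hs_self_zero, update_of_ne hm]

theorem hs_v_self_zero (h : Saddle 0 i t v) : hs sg v 0 i = true := by
  rw [h.hs_self_zero, update_self]

theorem pattern_v (h : Saddle 0 i t v) : pattern sg v 0 = true :=
  pattern_eq_true.2 ⟨i, h.hs_v_self_zero⟩

theorem pattern_eq_zero (h : Saddle 0 i t v) {m : ℕ} (h' : hs sg t.1 0 m = true) :
    pattern sg v = pattern sg t.1 := by
  funext k'
  by_cases hk' : k' = 0
  · subst hk'
    rw [h.pattern_v, eq_comm, pattern_eq_true]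
    exact ⟨m, h'⟩
  · exact h.pattern_other hk'

/-- The coordinate of a state whose exponents are changed on an inner circle of column `0`. -/
theorem stEv_update (hn : ∀ k, 0 < n k) {z z' : PretzelEdge n → Fin 2} {l : ℕ} {a : Fin 2}
    (hl : IsUpper (hs sg v 0) l) (h1 : z' (columnEdge n 0 false l) = a)
    (h2 : ∀ e, rep sg v e = e → e ≠ .top 1 → e ≠ columnEdge n 0 false l → z' e = z e) :
    stEv v z' = ev3 (n 0) (n 1) (n 2) (hs sg v)
      (update (labs z) 0 (update (labs z 0) l a)) (outer z) := by
  rw [stEv_congr hn (z' := update z (columnEdge n 0 false l) a)]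
  · refine ev3_hs_congr (fun k' m hm => ?_) ?_
    · change update z (columnEdge n 0 false l) a (columnEdge n k' false m) = _
      by_cases hk : k' = 0
      · subst hk
        rw [update_self]
        by_cases h3 : m = l
        · subst h3
          rw [update_self, update_self]
        · rw [update_of_ne fun e => h3 (columnEdge_injective hm hl e).2,
            update_of_ne h3]
          rfl
      · rw [update_of_ne fun e => hk (columnEdge_injective hm hl e).1,
          update_of_ne hk]
        rfl
    · rw [outer_congr (z' := z)]
      · exact Outer.AgreeAt.refl _ _
      all_goals
        rw [update_of_ne]
        obtain ⟨_, _, e⟩ := columnEdge_of_isUpper hl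
        rw [e]
        simp
  · intro e he he'
    by_cases h3 : e = columnEdge n 0 false l
    · rw [h3, h1, update_self]
    · rw [h2 e he he' h3, update_of_ne h3]

theorem update_labs {z : PretzelEdge n → Fin 2} {l : ℕ} {a : Fin 2}
    (h : z (columnEdge n 0 false l) = a) : update (labs z) 0 (update (labs z 0) l a) = labs z := by
  rw [Function.update_eq_self_iff, Function.update_eq_self_iff]
  exact h.symm

open Classical in
theorem stEv_ite (hn : ∀ k, 0 < n k) (z : PretzelEdge n → Fin 2) {l : ℕ}
    (hl : IsUpper (hs sg v 0) l) :
    stEv v (fun e => if rep sg v e = columnEdge n 0 false l then 0 else z e) =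
      ev3 (n 0) (n 1) (n 2) (hs sg v)
        (update (labs z) 0 (update (labs z 0) l 0)) (outer z) :=
  stEv_update hn hl (if_pos (rep_of_isUpper hn hl)) fun e he _ h => if_neg (by rw [he]; exact h)

section

variable [Fintype (PD n).State]

open Classical in
theorem sum_of_no_other_zero (h : Saddle 0 i t v)
    (ho : ∀ m, m ≠ (i : ℕ) → hs sg t.1 0 m = false) (x : Cpx (n 0) (n 1) (n 2)) :
    edgeSum i t x = termk 0 t.1 (expo t) i x := by
  have p1 := h.pattern_v
  have ht : ∀ l, hs sg t.1 0 l = false := fun l => by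
    by_cases hl : l = i
    · rw [hl]
      exact h.hs_i_zero
    · exact ho l hl
  have p2 : pattern sg t.1 0 = false := pattern_eq_false.2 ht
  have ta : rep sg t.1 (columnEdge n 0 false i) = topEdge n (pattern sg t.1) 2 := by
    rw [rep_columnEdge h.pos _ _ _ i.2.le, levelRep_of_top fun l _ => ht l]
    rfl
  have tb : rep sg t.1 (columnEdge n 0 true (i + 1)) = topEdge n (pattern sg t.1) 0 := by
    rw [rep_columnEdge h.pos _ _ _ i.2, levelRep_of_top fun l _ => ht l]
    rfl
  have ra : rep sg v (columnEdge n 0 false i) = botEdge n (pattern sg v) 0 := by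
    rw [rep_columnEdge h.pos _ _ _ i.2.le, levelRep_of_bot (fun l hl => by
      rw [h.hs_v_of_ne_zero hl.ne, ht]) ⟨i, le_rfl, h.hs_v_self_zero⟩]
    exact botEdge_eq p1
  have rb : rep sg v (columnEdge n 0 true (i + 1)) = topEdge n (pattern sg v) 0 := by
    rw [rep_columnEdge h.pos _ _ _ i.2, levelRep_of_top fun l hl => by
      rw [h.hs_v_of_ne_zero (by omega), ht]]
    rfl
  have o1 : pattern sg v 1 = pattern sg t.1 1 := h.pattern_other (by decide)
  have o2 : pattern sg v 2 = pattern sg t.1 2 := h.pattern_other (by decide)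
  have e : termk 0 t.1 (expo t) i =
      ev3 (n 0) (n 1) (n 2) (hs sg v) (labs (expo t)) (outer (expo t)).s0 :=
    term0_of_no_other _ _ (h.hs_other (by decide)) (h.hs_other (by decide)) h.hs_self_zero i.2 ho
  have split : ∀ r a b, botEdge n (pattern sg v) 0 = r → topEdge n (pattern sg v) 0 = r →
      topEdge n (pattern sg t.1) 2 = a → topEdge n (pattern sg t.1) 0 = b → edgeSum i t x =
        if expo t a = 0 ∧ expo t b = 0 then 0 else
          stEv v (fun e => if rep sg v e = r then expo t a * expo t b else expo t e) x :=
    fun r a b h1 h2 h3 h4 => by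
      rw [h.sum_of_split end0_zero end2_zero (ra.trans h1) (rb.trans h2), h.expo_eq (ta.trans h3),
        h.expo_eq (tb.trans h4)]
  rw [e]
  have hbase := h.base
  cases q1 : pattern sg t.1 1 <;> cases q2 : pattern sg t.1 2 <;> rw [q1] at o1 <;> rw [q2] at o2
  · rw [split (.top 0) (.top 2) (.top 0) (by simp [botEdge, topRep, o1, o2])
      (by simp [topEdge, topRep, o1, o2]) (by simp [topEdge, topRep, p2, q1, q2])
      (by simp [topEdge, topRep, p2, q1, q2])]
    have r0 : rep sg v (.top 0) = .top 0 := by simp [rep, topEdge, topRep, p1, o1, o2]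
    by_cases h1 : expo t (.top 2) = 0 ∧ expo t (.top 0) = 0
    · rw [if_pos h1, ev3_hs_eq_zero, hom_zero]
      constructor <;> intro e0 e1 e2 <;> simp [p1, o1, o2] at e0 e1 e2
      simp only [Outer.s0, outer, h1]
      rfl
    · rw [if_neg h1]
      refine congrArg (fun f => f x) (ev3_hs_congr (fun k' m hm => ?_) ?_)
      · refine if_neg ?_
        rw [rep_of_isUpper h.pos hm]
        exact columnEdge_ne_top hm (fun _ => false) 0
      · constructor <;> intro e0 e1 e2 <;> simp [p1, o1, o2] at e0 e1 e2
        simp only [Outer.s0, outer, r0, if_true]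
        rcases fin_two_eq_zero_or_one (expo t (.top 2)) with h2 | h2 <;>
        rcases fin_two_eq_zero_or_one (expo t (.top 0)) with h3 | h3 <;> rw [h2, h3]
        · exact absurd ⟨h2, h3⟩ h1
        all_goals rfl
  · rw [split (.top 1) (.top 1) (.top 0) (by simp [botEdge, topRep, o1, o2, p1])
      (by simp [topEdge, topRep, o1, o2, p1]) (by simp [topEdge, topRep, p2, q1, q2])
      (by simp [topEdge, topRep, p2, q1, q2]), stEv_congr h.pos (z' := expo t)
        fun e he he' => if_neg (by rw [he]; exact he'), hbase]
    rcases fin_two_eq_zero_or_one (expo t (.top 0)) with h1 | h1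
    · rw [if_pos ⟨rfl, h1⟩, ev3_hs_eq_zero, hom_zero]
      constructor <;> intro e0 e1 e2 <;> simp [p1, o1, o2] at e0 e1 e2
      simp only [Outer.s0, outer, h1]
      rfl
    · rw [if_neg (by simp [h1])]
      refine congrArg (fun f => f x) (ev3_hs_congr (fun k' m hm => rfl) ?_)
      constructor <;> intro e0 e1 e2 <;> simp [p1, o1, o2] at e0 e1 e2
      simp only [Outer.s0, outer, h1]
      rfl
  · rw [split (.top 1) (.top 2) (.top 1) (by simp [botEdge, topRep, o1, o2, p1])
      (by simp [topEdge, topRep, o1, o2, p1]) (by simp [topEdge, topRep, p2, q1, q2])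
      (by simp [topEdge, topRep, p2, q1, q2]), stEv_congr h.pos (z' := expo t)
        fun e he he' => if_neg (by rw [he]; exact he'), hbase]
    rcases fin_two_eq_zero_or_one (expo t (.top 2)) with h1 | h1
    · rw [if_pos ⟨h1, rfl⟩, ev3_hs_eq_zero, hom_zero]
      constructor <;> intro e0 e1 e2 <;> simp [p1, o1, o2] at e0 e1 e2
      simp only [Outer.s0, outer, h1]
      rfl
    · rw [if_neg (by simp [h1])]
      refine congrArg (fun f => f x) (ev3_hs_congr (fun k' m hm => rfl) ?_)
      constructor <;> intro e0 e1 e2 <;> simp [p1, o1, o2] at e0 e1 e2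
      simp only [Outer.s0, outer, h1]
      rfl
  · rw [h.sum_of_merge end0_zero end2_zero
      (ra.trans (by simp [botEdge, o1, o2, p1] : _ = PretzelEdge.bot 0))
      (rb.trans (by simp [topEdge, topRep, o1, o2, p1] : _ = PretzelEdge.top 1)) (by simp)
      (ta.trans (by simp [topEdge, topRep, p2, q1, q2] : _ = PretzelEdge.top 1))
      (tb.trans (by simp [topEdge, topRep, p2, q1, q2])), if_pos hbase]
    refine congrArg (fun f => f x) (ev3_hs_congr (fun k' m hm => rfl) ?_)
    constructor <;> intro e0 e1 e2 <;> simp [p1, o1, o2] at e0 e1 e2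
    simp only [Outer.s0, outer]
    rw [(h.expo_eq (e := .bot 0) (f := .top 1)
      (by simp [rep, botEdge, topRep, p2, q1, q2])).trans hbase]
    rfl

theorem sum_of_top_zero (h : Saddle 0 i t v)
    (ha : ∀ m, (i : ℕ) < m → hs sg t.1 0 m = false) (hb : ∃ m < (i : ℕ), hs sg t.1 0 m = true)
    (x : Cpx (n 0) (n 1) (n 2)) :
    edgeSum i t x = termk 0 t.1 (expo t) i x := by
  have e : termk 0 t.1 (expo t) i = _ :=
    term0_of_top (sm := hs sg t.1) (sm' := hs sg v) (labs (expo t)) (outer (expo t))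
      (h.hs_other (by decide)) (h.hs_other (by decide)) h.hs_self_zero i.2 ha hb
  obtain ⟨m, hm, hm'⟩ := hb
  have hP := h.pattern_eq_zero hm'
  have p1 : pattern sg t.1 0 = true := pattern_eq_true.2 ⟨m, hm'⟩
  have ht : ∀ l, (i : ℕ) ≤ l → hs sg t.1 0 l = false := fun l hl => by
    rcases hl.eq_or_lt with rfl | hl
    · exact h.hs_i_zero
    · exact ha l hl
  have hup : IsUpper (hs sg v 0) i :=
    ⟨h.hs_v_self_zero, m, hm, by rw [h.hs_v_of_ne_zero hm.ne, hm']⟩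
  have ta : rep sg t.1 (columnEdge n 0 false i) = topEdge n (pattern sg t.1) 0 := by
    rw [rep_columnEdge h.pos _ _ _ i.2.le, levelRep_of_top ht]
    exact topEdge_eq p1
  have tb : rep sg t.1 (columnEdge n 0 true (i + 1)) = topEdge n (pattern sg t.1) 0 := by
    rw [rep_columnEdge h.pos _ _ _ i.2, levelRep_of_top fun l hl => ht l (by omega)]
    rfl
  have ra : rep sg v (columnEdge n 0 false i) = columnEdge n 0 false i := rep_of_isUpper h.pos hup
  have rb : rep sg v (columnEdge n 0 true (i + 1)) = topEdge n (pattern sg t.1) 0 := by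
    rw [rep_columnEdge h.pos _ _ _ i.2, levelRep_of_top fun l hl => by
      rw [h.hs_v_of_ne_zero (by omega), ht l (by omega)], hP]
    rfl
  have hne := columnEdge_ne_top hup (pattern sg t.1) 0
  have hbase := h.base
  have et := h.expo_eq ta
  have tt : expo t (topEdge n (pattern sg t.1) 0) = expo t (.top 0) :=
    (h.expo_eq (e := .top 0) rfl).symm
  rw [h.sum_of_merge end0_zero end2_zero ra rb hne ta tb, e, hom_add]
  by_cases h1 : expo t (topEdge n (pattern sg t.1) 0) = 0
  · rw [if_pos h1, ← stEv_update h.pos (z' := expo t) hup (et.trans h1) (fun _ _ _ _ => rfl),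
      ev3_hs_eq_zero (f := Outer.t0 _), hom_zero, add_zero]
    rw [tt] at h1
    constructor <;> intro e0 e1 e2 <;> simp only [Outer.t0, outer, hP, p1, Bool.true_eq_false, h1]
        at e0 ⊢
    rfl
  · rw [if_neg h1, stEv_ite h.pos _ hup]
    congr 1
    have h2 := (fin_two_eq_zero_or_one _).resolve_left h1
    refine congrArg (fun f => f x) (ev3_hs_congr (fun k' m hm => ?_) ?_)
    · change (if _ = _ then _ else labs (expo t) k' m) = _
      rw [rep_of_isUpper h.pos hm, if_neg (columnEdge_ne_top hm _ _), update_labs (et.trans h2)]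
    · have h3 : topEdge n (pattern sg t.1) 0 ≠ .top 1 := fun e => h1 (by rw [e, hbase])
      rw [hP]
      simp only [topEdge, topRep, if_true] at h3
      constructor <;> intro e0 e1 e2 <;> rw [p1] at e0 <;> cases e0 <;> simp [e1, e2, p1] at h3
      have r0 : rep sg v (.top 0) = topEdge n (pattern sg t.1) 0 := by rw [rep, hP]
      simp only [Outer.t0, outer, r0, if_true]
      rw [← tt, h2]
      rfl

theorem sum_of_bottom_zero (h : Saddle 0 i t v) (hij : (i : ℕ) < j)
    (hsj : hs sg t.1 0 j = true) (hb : ∀ m, (i : ℕ) < m → m < j → hs sg t.1 0 m = false)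
    (hc : ∀ m < (i : ℕ), hs sg t.1 0 m = false) (x : Cpx (n 0) (n 1) (n 2)) :
    edgeSum i t x = termk 0 t.1 (expo t) i x := by
  have e : termk 0 t.1 (expo t) i = _ :=
    term0_of_bottom (sm := hs sg t.1) (sm' := hs sg v) (labs (expo t)) (outer (expo t))
      (h.hs_other (by decide)) (h.hs_other (by decide)) h.hs_self_zero hij (lt_of_hs hsj) hsj hb hc
  have hP := h.pattern_eq_zero hsj
  have p1 : pattern sg t.1 0 = true := pattern_eq_true.2 ⟨j, hsj⟩
  have ht : ∀ l < j, hs sg t.1 0 l = false := fun l hl => by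
    rcases lt_trichotomy l i with h1 | rfl | h1
    · exact hc l h1
    · exact h.hs_i_zero
    · exact hb l h1 hl
  have hvj : hs sg v 0 j = true := by rw [h.hs_v_of_ne_zero hij.ne', hsj]
  have hup : IsUpper (hs sg v 0) j := ⟨hvj, i, hij, h.hs_v_self_zero⟩
  have ta : rep sg t.1 (columnEdge n 0 false i) = botEdge n (pattern sg t.1) 0 := by
    rw [rep_columnEdge h.pos _ _ _ i.2.le, levelRep_of_bot hc ⟨j, hij.le, hsj⟩]
    exact botEdge_eq p1
  have tb : rep sg t.1 (columnEdge n 0 true (i + 1)) = botEdge n (pattern sg t.1) 0 := by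
    rw [rep_columnEdge h.pos _ _ _ i.2, levelRep_of_bot (fun l hl => ht l (by omega)) ⟨j, hij, hsj⟩]
    rfl
  have tj : rep sg t.1 (columnEdge n 0 false j) = botEdge n (pattern sg t.1) 0 := by
    rw [rep_columnEdge h.pos _ _ _ (lt_of_hs hsj).le, levelRep_of_bot ht ⟨j, le_rfl, hsj⟩]
    exact botEdge_eq p1
  have ra : rep sg v (columnEdge n 0 false i) = botEdge n (pattern sg t.1) 0 := by
    rw [rep_columnEdge h.pos _ _ _ i.2.le, levelRep_of_bot (fun l hl => by
      rw [h.hs_v_of_ne_zero hl.ne, hc l hl]) ⟨j, hij.le, hvj⟩, hP]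
    exact botEdge_eq p1
  have rb : rep sg v (columnEdge n 0 true (i + 1)) = columnEdge n 0 false j := by
    rw [rep_columnEdge h.pos _ _ _ i.2]
    exact levelRep_of_upper hij hvj (fun l h1 h2 => by
      rw [h.hs_v_of_ne_zero (by omega), ht l h2]) ⟨i, by omega, h.hs_v_self_zero⟩ _
  have hne := columnEdge_ne_bot hup (pattern sg t.1) 0
  have hbase := h.base
  have et := h.expo_eq tj
  rw [h.sum_of_merge end0_zero end2_zero ra rb hne.symm ta tb, e, hom_add]
  by_cases h1 : expo t (botEdge n (pattern sg t.1) 0) = 0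
  · rw [if_pos h1, ← stEv_update h.pos (z' := expo t) hup (et.trans h1) (fun _ _ _ _ => rfl),
      ev3_hs_eq_zero (f := Outer.y0 _), hom_zero, add_zero]
    rw [hP]
    constructor <;> intro e0 e1 e2 <;> simp [botEdge, topRep, p1, e1, e2] at h1 <;>
      simp only [Outer.y0, outer, p1, Bool.true_eq_false, h1] at e0 ⊢ <;> rfl
  · rw [if_neg h1, add_comm, stEv_ite h.pos _ hup]
    congr 1
    have h2 := (fin_two_eq_zero_or_one _).resolve_left h1
    refine congrArg (fun f => f x) (ev3_hs_congr (fun k' m hm => ?_) ?_)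
    · change (if _ = _ then _ else labs (expo t) k' m) = _
      rw [rep_of_isUpper h.pos hm, if_neg (columnEdge_ne_bot hm _ _), update_labs (et.trans h2)]
    · have h3 : botEdge n (pattern sg t.1) 0 ≠ .top 1 := fun e => h1 (by rw [e, hbase])
      rw [hP]
      simp only [botEdge, topRep, if_true] at h3
      constructor <;> intro e0 e1 e2 <;> rw [p1] at e0 <;> cases e0 <;> simp [e1, e2, p1] at h3
      · have r0 : rep sg v (.top 0) = .top 0 := by simp [rep, hP, topEdge, topRep, e1, e2]
        have r1 : botEdge n (pattern sg t.1) 0 = .top 0 := by simp [botEdge, topRep, e1, e2]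
        rw [r1] at h2 ⊢
        simp only [Outer.y0, outer, r0, if_true, h2]
        rfl
      · have r0 : rep sg v (.bot 0) = .bot 0 := by simp [rep, hP, botEdge, e1, e2, p1]
        have r1 : botEdge n (pattern sg t.1) 0 = .bot 0 := by simp [botEdge, e1, e2, p1]
        rw [r1] at h2 ⊢
        simp only [Outer.y0, outer, r0, if_true, h2]
        rfl

theorem sum_of_middle_zero (h : Saddle 0 i t v) (hij : (i : ℕ) < j)
    (hsj : hs sg t.1 0 j = true) (hb : ∀ m, (i : ℕ) < m → m < j → hs sg t.1 0 m = false)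
    (hc : ∃ m < (i : ℕ), hs sg t.1 0 m = true) (x : Cpx (n 0) (n 1) (n 2)) :
    edgeSum i t x = termk 0 t.1 (expo t) i x := by
  have e : termk 0 t.1 (expo t) i = _ :=
    term0_of_middle (sm := hs sg t.1) (sm' := hs sg v) (labs (expo t)) (outer (expo t))
      (h.hs_other (by decide)) (h.hs_other (by decide)) h.hs_self_zero hij (lt_of_hs hsj) hsj hb hc
  obtain ⟨m, hm, hm'⟩ := hc
  have ht : ∀ l, (i : ℕ) ≤ l → l < j → hs sg t.1 0 l = false := fun l hl hl' => by
    rcases hl.eq_or_lt with rfl | hl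
    · exact h.hs_i_zero
    · exact hb l hl hl'
  have hvj : hs sg v 0 j = true := by rw [h.hs_v_of_ne_zero hij.ne', hsj]
  have hup : IsUpper (hs sg v 0) j := ⟨hvj, i, hij, h.hs_v_self_zero⟩
  have hup' : IsUpper (hs sg v 0) i :=
    ⟨h.hs_v_self_zero, m, hm, by rw [h.hs_v_of_ne_zero hm.ne, hm']⟩
  have ta : rep sg t.1 (columnEdge n 0 false i) = columnEdge n 0 false j := by
    rw [rep_columnEdge h.pos _ _ _ i.2.le]
    exact levelRep_of_upper hij.le hsj ht ⟨m, hm, hm'⟩ _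
  have tb : rep sg t.1 (columnEdge n 0 true (i + 1)) = columnEdge n 0 false j := by
    rw [rep_columnEdge h.pos _ _ _ i.2]
    exact levelRep_of_upper hij hsj (fun l h1 h2 => ht l (by omega) h2) ⟨m, by omega, hm'⟩ _
  have ra : rep sg v (columnEdge n 0 false i) = columnEdge n 0 false i := rep_of_isUpper h.pos hup'
  have rb : rep sg v (columnEdge n 0 true (i + 1)) = columnEdge n 0 false j := by
    rw [rep_columnEdge h.pos _ _ _ i.2]
    exact levelRep_of_upper hij hvj (fun l h1 h2 => by
      rw [h.hs_v_of_ne_zero (by omega), ht l (by omega) h2]) ⟨i, by omega, h.hs_v_self_zero⟩ _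
  have hne : columnEdge n 0 false i ≠ columnEdge n 0 false j := fun e =>
    hij.ne (columnEdge_injective hup' hup e).2
  have et := h.expo_eq ta
  rw [h.sum_of_merge end0_zero end2_zero ra rb hne ta tb, e, hom_add]
  by_cases h1 : expo t (columnEdge n 0 false j) = 0
  · rw [if_pos h1, if_pos (show labs (expo t) 0 j = 0 from h1),
      ← stEv_update h.pos (z' := expo t) hup' (et.trans h1) (fun _ _ _ _ => rfl),
      hom_zero, add_zero]
  · rw [if_neg h1, if_neg (show ¬ labs (expo t) 0 j = 0 from h1), stEv_ite h.pos _ hup']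
    congr 1
    have h2 := (fin_two_eq_zero_or_one _).resolve_left h1
    have h3 : update (labs (expo t) 0) i 1 = labs (expo t) 0 :=
      Function.update_eq_self_iff.2 (et.trans h2).symm
    rw [h3, stEv_ite h.pos _ hup]

end

end Saddle

open Classical in
/-- The edge map at a crossing, in coordinates. -/
theorem sum_incident_stEv {n : Fin 3 → ℕ} {k : Fin 3} {i : Fin (n k)}
    {t : (PD n).State} {v : PretzelCrossing n → Bool}
    [Fintype (PD n).State] (h : Saddle k i t v) (x : Cpx (n 0) (n 1) (n 2)) :
    (∑ s, if (PD n).Incident (toLex ⟨k, i⟩) s t then redEv s.1 (expo s) x else 0) =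
      termk k t.1 (expo t) i x := by
  have hfalse : ∀ b : Bool, b ≠ true → b = false := by simp
  by_cases ha : ∃ m, (i : ℕ) < m ∧ hs sg t.1 k m = true
  · have h1 := Nat.find_spec ha
    have h2 : ∀ m, (i : ℕ) < m → m < Nat.find ha → hs sg t.1 k m = false := fun m hm hm' =>
      hfalse _ fun e => Nat.find_min ha hm' ⟨hm, e⟩
    by_cases hb : ∃ m < (i : ℕ), hs sg t.1 k m = true
    · by_cases hk : k = 0
      · subst hk
        exact h.sum_of_middle_zero h1.1 h1.2 h2 hb x
      · exact h.sum_of_middle hk h1.1 h1.2 h2 hb x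
    · have hb : ∀ m < (i : ℕ), hs sg t.1 k m = false := fun m hm => hfalse _ fun e => hb ⟨m, hm, e⟩
      by_cases hk : k = 0
      · subst hk
        exact h.sum_of_bottom_zero h1.1 h1.2 h2 hb x
      · exact h.sum_of_bottom hk h1.1 h1.2 h2 hb x
  · have ha : ∀ m, (i : ℕ) < m → hs sg t.1 k m = false := fun m hm => hfalse _ fun e => ha ⟨m, hm,
        e⟩
    by_cases hb : ∃ m < (i : ℕ), hs sg t.1 k m = true
    · by_cases hk : k = 0
      · subst hk
        exact h.sum_of_top_zero ha hb x
      · exact h.sum_of_top hk ha hb x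
    · have ho : ∀ m, m ≠ (i : ℕ) → hs sg t.1 k m = false := fun m hm => by
        rcases lt_or_gt_of_ne hm with h1 | h1
        · exact hfalse _ fun e => hb ⟨m, h1, e⟩
        · exact ha m h1
      by_cases hk : k = 0
      · subst hk
        exact h.sum_of_no_other_zero ho x
      · exact h.sum_of_no_other hk ho x

open PDCode

/-! ### The differential in coordinates -/

section

variable {n : Fin 3 → ℕ}

/-- The number of crossings before a given one with the `1`-smoothing. -/
theorem ncard_before (v : PretzelCrossing n → Bool) (k : Fin 3) (i : Fin (n k)) :
    {c | c < toLex ⟨k, i⟩ ∧ v c = true}.ncard =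
      (∑ k' ∈ Finset.univ.filter (· < k), Nat.count (fun m => hs sg v k' m = sg k') (n k')) +
        Nat.count (fun m => hs sg v k m = sg k) i := by
  classical
  have hc : ∀ (k : Fin 3) (l : ℕ), l ≤ n k →
      Nat.count (fun m => hs sg v k m = sg k) l =
        (Finset.univ.filter fun m : Fin (n k) => (m : ℕ) < l ∧ v (toLex ⟨k, m⟩) = true).card := by
    intro k l hl
    rw [Nat.count_eq_card_filter_range]
    symm
    refine Finset.card_bij (fun m _ => (m : ℕ)) ?_ ?_ ?_
    · intro m hm
      simp only [Finset.mem_filter, Finset.mem_univ, true_and, Finset.mem_range] at hm ⊢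
      exact ⟨hm.1, by simp [hs, hm.2]⟩
    · intro a _ b _ h
      exact Fin.ext h
    · intro m hm
      simp only [Finset.mem_filter, Finset.mem_univ, true_and, Finset.mem_range] at hm ⊢
      refine ⟨⟨m, by omega⟩, ⟨hm.1, ?_⟩, rfl⟩
      have := hm.2
      rw [hs, dif_pos (by omega)] at this
      revert this
      cases v (toLex ⟨k, ⟨m, _⟩⟩) <;> cases sg k <;> simp
  have h1 : {c | c < toLex ⟨k, i⟩ ∧ v c = true}.ncard =
      ((Finset.univ.sigma fun k' : Fin 3 => Finset.univ.filter fun m : Fin (n k') =>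
        (k' < k ∨ k' = k ∧ (m : ℕ) < i) ∧ v (toLex ⟨k', m⟩) = true)).card := by
    rw [← Set.ncard_coe_finset]
    refine Set.ncard_congr (fun c _ => ofLex c) ?_ (fun _ _ _ _ h => ofLex.injective h) ?_
    · intro c hc
      obtain ⟨⟨k', m⟩, rfl⟩ := toLex.surjective c
      simp only [Set.mem_setOf_eq, Sigma.Lex.lt_def] at hc
      simp only [Finset.coe_sigma, Finset.coe_univ, Set.mem_sigma_iff, Set.mem_univ, true_and,
        Finset.coe_filter, Finset.mem_univ, Set.mem_setOf_eq, ofLex_toLex]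
      refine ⟨?_, hc.2⟩
      rcases hc.1 with h | ⟨h, h'⟩
      · exact Or.inl h
      · obtain rfl : k' = k := h
        exact Or.inr ⟨rfl, h'⟩
    · rintro ⟨k', m⟩ hc
      simp only [Finset.coe_sigma, Finset.coe_univ, Set.mem_sigma_iff, Set.mem_univ, true_and,
        Finset.coe_filter, Finset.mem_univ, Set.mem_setOf_eq] at hc
      refine ⟨toLex ⟨k', m⟩, ⟨?_, hc.2⟩, rfl⟩
      rw [Sigma.Lex.lt_def]
      rcases hc.1 with h | ⟨rfl, h⟩
      · exact Or.inl h
      · exact Or.inr ⟨rfl, h⟩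
  rw [h1, Finset.card_sigma, Finset.sum_filter, ← Finset.add_sum_erase _ _ (Finset.mem_univ k),
    ← Finset.add_sum_erase (Finset.univ : Finset (Fin 3)) (fun k' => if k' < k then _ else _)
      (Finset.mem_univ k), if_neg (lt_irrefl k), zero_add, add_comm]
  congr 1
  · refine Finset.sum_congr rfl fun k' hk' => ?_
    have hne := Finset.ne_of_mem_erase hk'
    split_ifs with h
    · rw [hc k' (n k') le_rfl]
      congr 1
      ext m
      simp [h]
    · rw [Finset.card_eq_zero]
      ext m
      simp [h, hne]
  · rw [hc k i i.2.le]
    congr 1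
    ext m
    simp

open Classical in
/-- The differential, in the coordinates of the states. -/
theorem stEv_colD [Fintype (PD n).State] (hn : ∀ k, 0 < n k)
    (t : (PD n).State) (ht : expo t (.top 1) = 0) (x : Cpx (n 0) (n 1) (n 2)) :
    stEv t.1 (expo t) (colD (n 2) (right (n 0) (n 1)) x) =
      ∑ s, (PD n).coeff s t * redEv s.1 (expo s) x := by
  have hsum : ∀ k (i : Fin (n k)),
      (∑ s, (if (PD n).Incident (toLex ⟨k, i⟩) s t then
        (-1 : ℤ) ^ {c' | c' < toLex ⟨k, i⟩ ∧ s.1 c' = true}.ncard else 0) * redEv s.1 (expo s) x) =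
      if hs sg t.1 k i = sg k then
        ((-1 : ℤ) ^ {c' | c' < toLex ⟨k, i⟩ ∧ t.1 c' = true}.ncard) * termk k t.1 (expo t) i x
      else 0 := by
    intro k i
    have hiff : hs sg t.1 k i = sg k ↔ t.1 (toLex ⟨k, i⟩) = true := by
      rw [hs, dif_pos i.2]
      cases t.1 (toLex ⟨k, ⟨i, i.2⟩⟩) <;> cases sg k <;> simp
    split_ifs with h
    · rw [← sum_incident_stEv ⟨hn, ht, hiff.1 h, rfl⟩, Finset.mul_sum]
      refine Finset.sum_congr rfl fun s _ => ?_
      split_ifs with hi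
      · congr 3
        ext c'
        simp only [Set.mem_setOf_eq]
        refine and_congr_right fun hlt => ?_
        rw [hi.2.2.1 c' hlt.ne]
      · simp
    · refine Finset.sum_eq_zero fun s _ => ?_
      rw [if_neg fun hi => h (hiff.2 hi.2.1), zero_mul]
  have h1 : ∑ s, (PD n).coeff s t * redEv s.1 (expo s) x =
      ∑ k : Fin 3, ∑ i : Fin (n k), if hs sg t.1 k i = sg k then
        ((-1 : ℤ) ^ {c' | c' < toLex ⟨k, i⟩ ∧ t.1 c' = true}.ncard) * termk k t.1 (expo t) i x
      else 0 := by
    simp only [coeff, Finset.sum_mul]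
    rw [Finset.sum_comm, ← (toLex (α := (k : Fin 3) × Fin (n k))).sum_comp, Fintype.sum_sigma]
    refine Finset.sum_congr rfl fun k _ => Finset.sum_congr rfl fun i _ => ?_
    rw [← hsum k i]
  have h2 := DFunLike.congr_fun (ev3_colD (n 0) (n 1) (n 2) (hs sg t.1) (labs (expo t))
    (outer (expo t))) x
  have h3 : stEv t.1 (expo t) (colD (n 2) (right (n 0) (n 1)) x) = _ := h2
  rw [h3, h1, Fin.sum_univ_three]
  simp only [hom_add, AddMonoidHom.finset_sum_apply]
  have f0 : Finset.univ.filter (· < (0 : Fin 3)) = ∅ := by decide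
  have f1 : Finset.univ.filter (· < (1 : Fin 3)) = {0} := by decide
  have f2 : Finset.univ.filter (· < (2 : Fin 3)) = {0, 1} := by decide
  congr 1
  · congr 1
    · rw [Finset.sum_range]
      refine Finset.sum_congr rfl fun i _ => ?_
      rw [ncard_before, f0, Finset.sum_empty, zero_add]
      change _ = if hs sg t.1 0 i = false then _ else _
      split_ifs <;> rfl
    · rw [Finset.sum_range]
      refine Finset.sum_congr rfl fun i _ => ?_
      rw [ncard_before, f1, Finset.sum_singleton, pow_add]
      change _ = if hs sg t.1 1 i = true then _ else _
      split_ifs <;> rfl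
  · rw [Finset.sum_range]
    refine Finset.sum_congr rfl fun i _ => ?_
    rw [ncard_before, f2, Finset.sum_pair (by decide), pow_add, pow_add,
      mul_comm ((-1 : ℤ) ^ Nat.count (fun m => hs sg t.1 0 m = sg 0) (n 0))]
    change _ = if hs sg t.1 2 i = true then _ else _
    split_ifs <;> rfl

end

/-! ### Coordinates on the groups of the outer circles -/

/-- The identity, as a coordinate of degree `k`. -/
def pureE (k i : ℤ) : Set (ℤ →+ ℤ) := {e | e = idHom ℤ ∧ i = k}

/-- The coordinates on `ℤ[X] / (X ^ 2)`. -/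
def circleE (k i : ℤ) : Set (ℤ × ℤ →+ ℤ) := prodCoords (pureE k) (pureE (k - 1)) i

theorem dual_pure (k : ℤ) : Dual (pureDeg k) (pureE k) where
  inj x hx := hx k (idHom ℤ) ⟨rfl, rfl⟩
  surj g := ⟨g (idHom ℤ), by rintro j _ ⟨rfl, rfl⟩; rfl⟩
  mem i x := ⟨by
    rintro h j hj _ ⟨rfl, rfl⟩
    exact h hj.symm, fun h hi => h k (Ne.symm hi) _ ⟨rfl, rfl⟩⟩
  disj := by
    rintro i j hij _ ⟨rfl, rfl⟩ ⟨_, rfl⟩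
    exact hij rfl

theorem dual_circle (k : ℤ) : Dual (circleDeg k) (circleE k) := (dual_pure k).prod (dual_pure (k -
    1))

theorem coef_mem_circleE (k : ℤ) (a : Fin 2) : coef a ∈ circleE k (k - (a : ℕ)) := by
  rcases fin_two_eq_zero_or_one a with rfl | rfl
  · exact Or.inl ⟨idHom ℤ, ⟨rfl, by simp⟩, rfl⟩
  · exact Or.inr ⟨idHom ℤ, ⟨rfl, by simp⟩, rfl⟩

theorem exists_coef {k i : ℤ} {e : ℤ × ℤ →+ ℤ} (h : e ∈ circleE k i) : ∃ a : Fin 2, e = coef a := by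
  rcases h with ⟨_, ⟨rfl, _⟩, rfl⟩ | ⟨_, ⟨rfl, _⟩, rfl⟩
  · exact ⟨0, rfl⟩
  · exact ⟨1, rfl⟩

/-- The coordinates on two circles. -/
def twoCircleE (i : ℤ) : Set ((ℤ × ℤ) × (ℤ × ℤ) →+ ℤ) := prodCoords (circleE 1) (circleE 0) i

theorem coef_comp_mem (a b : Fin 2) :
    (coef b).comp (coef a) ∈ twoCircleE (1 - (a : ℕ) - (b : ℕ)) := by
  rcases fin_two_eq_zero_or_one a with rfl | rfl
  · refine Or.inl ⟨coef b, ?_, rfl⟩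
    simpa using coef_mem_circleE 1 b
  · refine Or.inr ⟨coef b, ?_, rfl⟩
    simpa using coef_mem_circleE 0 b

theorem exists_coef_comp {i : ℤ} {e : (ℤ × ℤ) × (ℤ × ℤ) →+ ℤ} (h : e ∈ twoCircleE i) :
    ∃ a b : Fin 2, e = (coef b).comp (coef a) := by
  rcases h with ⟨f, hf, rfl⟩ | ⟨f, hf, rfl⟩ <;> obtain ⟨b, rfl⟩ := exists_coef hf
  · exact ⟨0, b, rfl⟩
  · exact ⟨1, b, rfl⟩

section

variable (p q r : ℕ)

/-- The coordinates on two columns, with the right one vertical. -/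
def coordsV : ℤ → Set (Col q (Col p ((ℤ × ℤ) × (ℤ × ℤ)) (ℤ × ℤ)) (Col p (ℤ × ℤ) ℤ) →+ ℤ) :=
  coords 0 1 q (coords (-1) 0 p twoCircleE (circleE 1)) (coords (-1) 0 p (circleE 0) (pureE 0))

/-- The coordinates on two columns, with the right one horizontal. -/
def coordsH : ℤ → Set (Col q (Col p (ℤ × ℤ) ℤ) (Col p ℤ (ℤ × ℤ)) →+ ℤ) :=
  coords 0 1 q (coords (-1) 0 p (circleE 0) (pureE 0)) (coords (-1) 0 p (pureE (-1)) (circleE 0))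

/-- The coordinates on the complex of the three columns. -/
def coords3 : ℤ → Set (Cpx p q r →+ ℤ) := coords 0 1 r (coordsV p q) (coordsH p q)

theorem dual_coords3 : Dual (colG r (right p q)) (coords3 p q r) := by
  have h1 : Dual (mcolG p opsVV) (coords (-1) 0 p twoCircleE (circleE 1)) := by
    rw [mcolG_eq]
    exact Dual.col _ _ p ((dual_circle 1).prod (dual_circle 0)) (dual_circle 1)
  have h2 : Dual (mcolG p opsHV) (coords (-1) 0 p (circleE 0) (pureE 0)) := by
    rw [mcolG_eq]
    exact Dual.col _ _ p (dual_circle 0) (dual_pure 0)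
  have h3 : Dual (mcolG p opsHH) (coords (-1) 0 p (pureE (-1)) (circleE 0)) := by
    rw [mcolG_eq]
    exact Dual.col _ _ p (dual_pure (-1)) (dual_circle 0)
  have hV : Dual (right p q).GV (coordsV p q) := by
    change Dual (colG q (midV p)) _
    rw [colG_eq]
    exact Dual.col _ _ q h1 h2
  have hH : Dual (right p q).GH (coordsH p q) := by
    change Dual (colG q (midH p)) _
    rw [colG_eq]
    exact Dual.col _ _ q h2 h3
  rw [colG_eq]
  exact Dual.col _ _ r hV hH

end

open PDCode

/-! ### States and coordinates -/

theorem ev_mem {a b : ℤ} {n : ℕ} {V H : Type} [Ab V] [Ab H] {EV : ℤ → Set (V →+ ℤ)}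
    {EH : ℤ → Set (H →+ ℤ)} {sm : ℕ → Bool} {lab : ℕ → Fin 2}
    {φV : V →+ ℤ} {φH : H →+ ℤ} {c d : ℤ} {P : Bool} (h0 : P = false → ∀ m < n, sm m = false)
    (h1 : P = true → ∃ m < n, sm m = true) (hV : P = false → φV ∈ EV c) (hH : P = true → φH ∈ EH c)
    (hd : d = c - weight a b n sm lab) : ev n sm lab φV φH ∈ coords a b n EV EH d := by
  cases P
  · rw [weight_of_vertical _ _ _ (h0 rfl), sub_zero] at hd
    exact ev_mem_of_vertical a b n φH (h0 rfl) (hd ▸ hV rfl)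
  · exact ev_mem_of_horizontal a b n φV (h1 rfl) (hH rfl) hd

section

variable {n : Fin 3 → ℕ}

/-- The contribution of the outer circles to the degree of a state. -/
def outerDeg (P : Fin 3 → Bool) (z : PretzelEdge n → Fin 2) : ℤ :=
  match P 0, P 1, P 2 with
  | false, false, false => 1 - (z (.top 0) : ℕ) - (z (.top 2) : ℕ)
  | true, false, false => 1 - (z (.top 0) : ℕ)
  | false, true, false => -(z (.top 2) : ℕ)
  | true, true, false => 0
  | false, false, true => -(z (.top 0) : ℕ)
  | true, false, true => 0
  | false, true, true => -1
  | true, true, true => -(z (.bot 0) : ℕ)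

/-- The degree of a state. -/
noncomputable def stDeg (v : PretzelCrossing n → Bool) (z : PretzelEdge n → Fin 2) : ℤ :=
  outerDeg (pattern sg v) z - weight (-1) 0 (n 0) (hs sg v 0) (labs z 0) -
    weight 0 1 (n 1) (hs sg v 1) (labs z 1) - weight 0 1 (n 2) (hs sg v 2) (labs z 2)

theorem stEv_mem (v : PretzelCrossing n → Bool) (z : PretzelEdge n → Fin 2) :
    stEv v z ∈ coords3 (n 0) (n 1) (n 2) (stDeg v z) := by
  have f : ∀ k, pattern sg v k = false → ∀ m < n k, hs sg v k m = false := fun k h m _ =>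
    pattern_eq_false.1 h m
  have t : ∀ k, pattern sg v k = true → ∃ m < n k, hs sg v k m = true := fun k h =>
    (pattern_eq_true.1 h).imp fun m hm => ⟨lt_of_hs hm, hm⟩
  have c : ∀ a : Fin 2, coef a ∈ circleE 0 (-(a : ℕ)) := fun a => by
    simpa using coef_mem_circleE 0 a
  refine ev_mem (f 2) (t 2) (c := stDeg v z + weight 0 1 (n 2) (hs sg v 2) (labs z 2))
    (fun p2 => ?_) (fun p2 => ?_) (by ring) <;>
  refine ev_mem (f 1) (t 1) (c := outerDeg (pattern sg v) z -
      weight (-1) 0 (n 0) (hs sg v 0) (labs z 0))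
    (fun p1 => ?_) (fun p1 => ?_) (by unfold stDeg; ring) <;>
  refine ev_mem (f 0) (t 0) (fun p0 => ?_) (fun p0 => ?_) rfl <;>
  rw [outerDeg, p0, p1, p2]
  · exact coef_comp_mem _ _
  · exact coef_mem_circleE 1 _
  · exact c _
  · exact ⟨rfl, rfl⟩
  · exact c _
  · exact ⟨rfl, rfl⟩
  · exact ⟨rfl, rfl⟩
  · exact c _

/-- Exponents on the outer circles. -/
def bits (a b c : Fin 2) : PretzelEdge n → Fin 2
  | .top k => if k = 0 then a else if k = 2 then b else 0
  | .bot k => if k = 0 then c else 0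
  | .inner _ _ _ => 0

theorem exists_ev3 {d : ℤ} {e : Cpx (n 0) (n 1) (n 2) →+ ℤ}
    (he : e ∈ coords3 (n 0) (n 1) (n 2) d) : ∃ (sm : Fin 3 → ℕ → Bool) (lab : Fin 3 → ℕ → Fin 2)
      (a b c : Fin 2), e = ev3 (n 0) (n 1) (n 2) sm lab (outer (n := n) (bits a b c)) := by
  obtain ⟨sm2, lab2, h⟩ := exists_ev 0 1 (n 2) he
  have key : ∀ {φ}, (∃ d, φ ∈ coordsV (n 0) (n 1) d) → ∃ sm0 sm1 lab0 lab1 a b c,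
      φ = ev2 (n 0) (n 1) ![sm0, sm1, sm2] ![lab0, lab1, lab2]
        (outer (n := n) (bits a b c)).f000 (outer (n := n) (bits a b c)).f100
        (outer (n := n) (bits a b c)).f010 (outer (n := n) (bits a b c)).f110 := by
    rintro φ ⟨d, hφ⟩
    obtain ⟨sm1, lab1, ⟨-, ψ, hψ, e1⟩ | ⟨-, ψ, hψ, e1⟩⟩ := exists_ev 0 1 (n 1) hφ <;>
    obtain ⟨sm0, lab0, ⟨-, ω, hω, e0⟩ | ⟨-, ω, hω, e0⟩⟩ := exists_ev (-1) 0 (n 0) hψ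
    · obtain ⟨a, b, rfl⟩ := exists_coef_comp hω
      exact ⟨sm0, sm1, lab0, lab1, a, b, 0, by rw [e1, e0]; rfl⟩
    · obtain ⟨a, rfl⟩ := exists_coef hω
      exact ⟨sm0, sm1, lab0, lab1, a, 0, 0, by rw [e1, e0]; rfl⟩
    · obtain ⟨b, rfl⟩ := exists_coef hω
      exact ⟨sm0, sm1, lab0, lab1, 0, b, 0, by rw [e1, e0]; rfl⟩
    · obtain ⟨rfl, -⟩ := hω
      exact ⟨sm0, sm1, lab0, lab1, 0, 0, 0, by rw [e1, e0]; rfl⟩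
  have key' : ∀ {φ}, (∃ d, φ ∈ coordsH (n 0) (n 1) d) → ∃ sm0 sm1 lab0 lab1 a b c,
      φ = ev2 (n 0) (n 1) ![sm0, sm1, sm2] ![lab0, lab1, lab2]
        (outer (n := n) (bits a b c)).f001 (outer (n := n) (bits a b c)).f101
        (outer (n := n) (bits a b c)).f011 (outer (n := n) (bits a b c)).f111 := by
    rintro φ ⟨d, hφ⟩
    obtain ⟨sm1, lab1, ⟨-, ψ, hψ, e1⟩ | ⟨-, ψ, hψ, e1⟩⟩ := exists_ev 0 1 (n 1) hφ <;>
    obtain ⟨sm0, lab0, ⟨-, ω, hω, e0⟩ | ⟨-, ω, hω, e0⟩⟩ := exists_ev (-1) 0 (n 0) hψ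
    · obtain ⟨a, rfl⟩ := exists_coef hω
      exact ⟨sm0, sm1, lab0, lab1, a, 0, 0, by rw [e1, e0]; rfl⟩
    · obtain ⟨rfl, -⟩ := hω
      exact ⟨sm0, sm1, lab0, lab1, 0, 0, 0, by rw [e1, e0]; rfl⟩
    · obtain ⟨rfl, -⟩ := hω
      exact ⟨sm0, sm1, lab0, lab1, 0, 0, 0, by rw [e1, e0]; rfl⟩
    · obtain ⟨c, rfl⟩ := exists_coef hω
      exact ⟨sm0, sm1, lab0, lab1, 0, 0, c, by rw [e1, e0]; rfl⟩
  rcases h with ⟨-, φ, hφ, e2⟩ | ⟨-, φ, hφ, e2⟩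
  · obtain ⟨sm0, sm1, lab0, lab1, a, b, c, rfl⟩ := key ⟨_, hφ⟩
    exact ⟨![sm0, sm1, sm2], ![lab0, lab1, lab2], a, b, c, e2 _⟩
  · obtain ⟨sm0, sm1, lab0, lab1, a, b, c, rfl⟩ := key' ⟨_, hφ⟩
    exact ⟨![sm0, sm1, sm2], ![lab0, lab1, lab2], a, b, c, e2 _⟩

theorem ev3_sm_congr {p q r : ℕ} {sm sm' : Fin 3 → ℕ → Bool} {lab : Fin 3 → ℕ → Fin 2} {f : Outer}
    (h0 : ∀ m < p, sm 0 m = sm' 0 m) (h1 : ∀ m < q, sm 1 m = sm' 1 m)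
    (h2 : ∀ m < r, sm 2 m = sm' 2 m) : ev3 p q r sm lab f = ev3 p q r sm' lab f := by
  have c0 : ∀ {A B : Type} [Ab A] [Ab B] {a : A →+ ℤ} {b : B →+ ℤ},
      ev p (sm 0) (lab 0) a b = ev p (sm' 0) (lab 0) a b :=
    ev_congr p h0 (fun _ _ _ _ => rfl) (fun _ => rfl) (fun _ => rfl)
  have c1 : ∀ {A B : Type} [Ab A] [Ab B] {a a' : A →+ ℤ} {b b' : B →+ ℤ},
      a = a' → b = b' → ev q (sm 1) (lab 1) a b = ev q (sm' 1) (lab 1) a' b' := fun ha hb =>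
    ev_congr q h1 (fun _ _ _ _ => rfl) (fun _ => ha) (fun _ => hb)
  exact ev_congr r h2 (fun _ _ _ _ => rfl) (fun _ => c1 c0 c0) (fun _ => c1 c0 c0)

/-- Every coordinate is the coordinate of a state. -/
theorem exists_state (hn : ∀ k, 0 < n k) {d : ℤ} {e : Cpx (n 0) (n 1) (n 2) →+ ℤ}
    (he : e ∈ coords3 (n 0) (n 1) (n 2) d) : ∃ t : (PD n).State,
      expo t (.top 1) = 0 ∧ e = stEv t.1 (expo t) := by
  obtain ⟨sm, lab, a, b, c, rfl⟩ := exists_ev3 he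
  let v : PretzelCrossing n → Bool := fun x => sm (ofLex x).1 (ofLex x).2 == sg (ofLex x).1
  let z : PretzelEdge n → Fin 2 := fun e => match e with
    | .inner k _ i => lab k (i + 1)
    | .top k => bits (n := n) a b c (.top k)
    | .bot k => bits (n := n) a b c (.bot k)
  have hsm : ∀ k, ∀ m < n k, sm k m = hs sg v k m := fun k m hm => by
    rw [hs, dif_pos hm]
    change sm k m = ((sm k m == sg k) == sg k)
    cases sm k m <;> cases sg k <;> rfl
  refine ⟨mkState v (fun e => z (rep sg v e)) fun e f h => by rw [(circle_eq_iff hn).1 h], rfl, ?_⟩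
  rw [ev3_sm_congr (hsm 0) (hsm 1) (hsm 2)]
  refine (Eq.trans ?_ (stEv_congr hn (z := z) fun e h _ => ?_))
  · refine ev3_hs_congr (fun k m hm => ?_) (Outer.AgreeAt.refl _ _)
    obtain ⟨h', h0, e⟩ := columnEdge_of_isUpper hm
    rw [labs, e]
    change _ = lab k (m - 1 + 1)
    rw [Nat.sub_add_cancel h0]
  · rw [expo_mkState]
    exact congrArg z h.symm

/-- The edges that represent circles. -/
theorem rep_inner_eq_self {v : PretzelCrossing n → Bool} {k : Fin 3} {b : Bool}
    {i : Fin (n k - 1)} : rep sg v (.inner k b i) = .inner k b i ↔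
      b = false ∧ IsUpper (hs sg v k) (i + 1) := by
  have hi := i.2
  have e : (PretzelEdge.inner k b i : PretzelEdge n) = columnEdge n k b (i + 1) :=
    (columnEdge_inner b (l := i + 1) ⟨by omega, by omega⟩).symm
  constructor
  · intro h
    rw [rep] at h
    unfold levelRep at h
    split_ifs at h with h1 h2
    · obtain ⟨h3, h4⟩ := Nat.sInf_mem (s := {m | (i : ℕ) + 1 ≤ m ∧ hs sg v k m = true}) h1
      set m := sInf {m | (i : ℕ) + 1 ≤ m ∧ hs sg v k m = true}
      obtain ⟨l, hl, hl'⟩ := h2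
      rw [columnEdge_inner false (l := m) ⟨by omega, lt_of_hs h4⟩] at h
      simp only [PretzelEdge.inner.injEq, true_and, heq_eq_eq] at h
      obtain ⟨h5, h6⟩ := h
      have h7 := congrArg Fin.val h6
      simp only at h7
      have h8 : m = i + 1 := by omega
      rw [h8] at h4
      exact ⟨h5.symm, h4, l, hl, hl'⟩
    · rw [botEdge] at h
      split_ifs at h
    · cases h
  · rintro ⟨rfl, h⟩
    rw [rep, levelRep_of_upper le_rfl h.1 (fun l h1 h2 => by omega) h.2, e]

/-- A state of the reduced complex is determined by its coordinate. -/
theorem stEv_injective (hn : ∀ k, 0 < n k) {s t : (PD n).State}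
    (hs0 : expo s (.top 1) = 0) (ht0 : expo t (.top 1) = 0)
    (h : stEv s.1 (expo s) = stEv t.1 (expo t)) : s = t := by
  have c : ∀ a : Fin 2, (coef a : ℤ × ℤ →+ ℤ) ≠ 0 := fun a =>
    (dual_circle 0).ne_zero (coef_mem_circleE 0 a)
  have cc : ∀ a b : Fin 2, ((coef b).comp (coef a) : (ℤ × ℤ) × (ℤ × ℤ) →+ ℤ) ≠ 0 := fun a b =>
    ((dual_circle 1).prod (dual_circle 0)).ne_zero (coef_comp_mem a b)
  have i : idHom ℤ ≠ 0 := (dual_pure 0).ne_zero ⟨rfl, rfl⟩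
  have cinj : ∀ {a b : Fin 2}, (coef a : ℤ × ℤ →+ ℤ) = coef b → a = b := by
    intro a b h
    rcases fin_two_eq_zero_or_one a with rfl | rfl <;>
    rcases fin_two_eq_zero_or_one b with rfl | rfl
    · rfl
    · simpa using DFunLike.congr_fun h (1, 0)
    · simpa using DFunLike.congr_fun h (1, 0)
    · rfl
  have ccinj : ∀ {a b a' b' : Fin 2}, ((coef b).comp (coef a) : (ℤ × ℤ) × (ℤ × ℤ) →+ ℤ) =
      (coef b').comp (coef a') → a = a' ∧ b = b' := by
    intro a b a' b' h
    rcases fin_two_eq_zero_or_one a with rfl | rfl <;>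
    rcases fin_two_eq_zero_or_one a' with rfl | rfl <;>
    rcases fin_two_eq_zero_or_one b with rfl | rfl <;>
    rcases fin_two_eq_zero_or_one b' with rfl | rfl <;>
    first
    | exact ⟨rfl, rfl⟩
    | (exfalso; simpa using DFunLike.congr_fun h ((1, 0), (0, 0)))
    | (exfalso; simpa using DFunLike.congr_fun h ((0, 1), (0, 0)))
    | (exfalso; simpa using DFunLike.congr_fun h ((0, 0), (1, 0)))
    | (exfalso; simpa using DFunLike.congr_fun h ((0, 0), (0, 1)))
  have hv : ∀ k, (∀ m < n k, hs sg s.1 k m = hs sg t.1 k m) → hs sg s.1 k = hs sg t.1 k := by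
    intro k h
    funext m
    by_cases hm : m < n k
    · exact h m hm
    · simp [hs, hm]
  have hF : ∀ k, pattern sg s.1 k = false → ∀ m < n k, hs sg s.1 k m = false := fun k h m _ =>
    pattern_eq_false.1 h m
  have hT : ∀ k, pattern sg s.1 k = true → ∃ m < n k, hs sg s.1 k m = true := fun k h =>
    (pattern_eq_true.1 h).imp fun m hm => ⟨lt_of_hs hm, hm⟩
  have nz : ∀ {A B : Type} [Ab A] [Ab B] {φ : A →+ ℤ} {ψ : B →+ ℤ}
      {sm : ℕ → Bool} {lab : ℕ → Fin 2} {m : ℕ}, φ ≠ 0 → ψ ≠ 0 → ev m sm lab φ ψ ≠ 0 := fun h h' =>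
    ev_ne_zero _ h h'
  obtain ⟨a2, l2, f2, t2⟩ := ev_injective (n 2)
    (nz (nz (cc _ _) (c _)) (nz (c _) i)) (nz (nz (c _) i) (nz i (c _)))
    (nz (nz (cc _ _) (c _)) (nz (c _) i)) (nz (nz (c _) i) (nz i (c _))) h
  have rest : (∀ m < n 1, hs sg s.1 1 m = hs sg t.1 1 m) ∧
      (∀ m < n 1, IsUpper (hs sg s.1 1) m → labs (expo s) 1 m = labs (expo t) 1 m) ∧
      (∀ m < n 0, hs sg s.1 0 m = hs sg t.1 0 m) ∧
      (∀ m < n 0, IsUpper (hs sg s.1 0) m → labs (expo s) 0 m = labs (expo t) 0 m) ∧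
      (rep sg s.1 (.top 0) = .top 0 → expo s (.top 0) = expo t (.top 0)) ∧
      (rep sg s.1 (.top 2) = .top 2 → expo s (.top 2) = expo t (.top 2)) ∧
      (rep sg s.1 (.bot 0) = .bot 0 → expo s (.bot 0) = expo t (.bot 0)) := by
    cases p2 : pattern sg s.1 2
    · obtain ⟨a1, l1, f1, t1⟩ := ev_injective (n 1) (nz (cc _ _) (c _)) (nz (c _) i)
        (nz (cc _ _) (c _)) (nz (c _) i) (f2 (hF 2 p2))
      refine ⟨a1, l1, ?_⟩
      cases p1 : pattern sg s.1 1
      · obtain ⟨a0, l0, f0, t0⟩ := ev_injective (n 0) (cc _ _) (c _) (cc _ _) (c _) (f1 (hF 1 p1))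
        refine ⟨a0, l0, ?_⟩
        cases p0 : pattern sg s.1 0
        · have := ccinj (f0 (hF 0 p0))
          exact ⟨fun _ => this.1, fun _ => this.2, by simp [rep, botEdge, p0, p1, p2]⟩
        · have := cinj (t0 (hT 0 p0))
          exact ⟨fun _ => this, by simp [rep, topEdge, topRep, p0, p1, p2],
            by simp [rep, botEdge, p0, p1, p2]⟩
      · obtain ⟨a0, l0, f0, t0⟩ := ev_injective (n 0) (c _) i (c _) i (t1 (hT 1 p1))
        refine ⟨a0, l0, ?_⟩
        cases p0 : pattern sg s.1 0
        · have := cinj (f0 (hF 0 p0))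
          exact ⟨by simp [rep, topEdge, topRep, p0, p1, p2], fun _ => this,
            by simp [rep, botEdge, p0, p1, p2]⟩
        · exact ⟨by simp [rep, topEdge, topRep, p0, p1, p2],
            by simp [rep, topEdge, topRep, p0, p1, p2], by simp [rep, botEdge, p0, p1, p2]⟩
    · obtain ⟨a1, l1, f1, t1⟩ := ev_injective (n 1) (nz (c _) i) (nz i (c _))
        (nz (c _) i) (nz i (c _)) (t2 (hT 2 p2))
      refine ⟨a1, l1, ?_⟩
      cases p1 : pattern sg s.1 1
      · obtain ⟨a0, l0, f0, t0⟩ := ev_injective (n 0) (c _) i (c _) i (f1 (hF 1 p1))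
        refine ⟨a0, l0, ?_⟩
        cases p0 : pattern sg s.1 0
        · have := cinj (f0 (hF 0 p0))
          exact ⟨fun _ => this, by simp [rep, topEdge, topRep, p0, p1, p2],
            by simp [rep, botEdge, p0, p1, p2]⟩
        · exact ⟨by simp [rep, topEdge, topRep, p0, p1, p2],
            by simp [rep, topEdge, topRep, p0, p1, p2], by simp [rep, botEdge, p0, p1, p2]⟩
      · obtain ⟨a0, l0, f0, t0⟩ := ev_injective (n 0) i (c _) i (c _) (t1 (hT 1 p1))
        refine ⟨a0, l0, ?_⟩
        cases p0 : pattern sg s.1 0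
        · exact ⟨by simp [rep, topEdge, topRep, p0, p1, p2],
            by simp [rep, topEdge, topRep, p0, p1, p2], by simp [rep, botEdge, p0, p1, p2]⟩
        · have := cinj (t0 (hT 0 p0))
          exact ⟨by simp [rep, topEdge, topRep, p0, p1, p2],
            by simp [rep, topEdge, topRep, p0, p1, p2], fun _ => this⟩
  obtain ⟨a1, l1, a0, l0, e0, e2, eb⟩ := rest
  have hhs : ∀ k, hs sg s.1 k = hs sg t.1 k := by
    intro k
    fin_cases k
    · exact hv 0 a0
    · exact hv 1 a1
    · exact hv 2 a2
  have hst : s.1 = t.1 := by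
    funext x
    obtain ⟨⟨k, m⟩, rfl⟩ := toLex.surjective x
    have := congrFun (hhs k) m
    rw [hs, hs, dif_pos m.2, dif_pos m.2] at this
    revert this
    cases s.1 (toLex ⟨k, m⟩) <;> cases t.1 (toLex ⟨k, m⟩) <;> cases sg k <;> simp
  have hl : ∀ k m, IsUpper (hs sg s.1 k) m → expo s (columnEdge n k false m) =
      expo t (columnEdge n k false m) := by
    intro k m hm
    have hm' := lt_of_hs hm.1
    fin_cases k
    · exact l0 m hm' hm
    · exact l1 m hm' hm
    · exact l2 m hm' hm
  have hfix : ∀ e, rep sg s.1 e = e → expo s e = expo t e := by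
    rintro (k | k | ⟨k, b, m⟩) he
    · obtain rfl | rfl | rfl : k = 0 ∨ k = 1 ∨ k = 2 := by omega
      · exact e0 he
      · rw [hs0, ht0]
      · exact e2 he
    · have hk : k = 0 := by
        rw [rep, botEdge] at he
        split_ifs at he
        cases he
        rfl
      subst hk
      exact eb he
    · obtain ⟨rfl, hm⟩ := rep_inner_eq_self.1 he
      obtain ⟨_, -, e⟩ := columnEdge_of_isUpper hm
      have := hl k _ hm
      rw [e] at this
      exact this
  refine state_ext hst fun e => ?_
  rw [← expo_rep hn s e, ← expo_rep hn t e, ← hst]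
  refine hfix _ ?_
  exact (circle_eq_iff hn).1 (circle_rep hn s.1 e)

end

open PDCode

/-! ### The grading of a state -/

section

variable {n : Fin 3 → ℕ}

/-- The arcs, and the edges inside the columns. -/
def edgeEquiv (n : Fin 3 → ℕ) :
    Fin 3 ⊕ Fin 3 ⊕ ((k : Fin 3) × (Bool × Fin (n k - 1))) ≃ PretzelEdge n where
  toFun
    | .inl k => .top k
    | .inr (.inl k) => .bot k
    | .inr (.inr ⟨k, b, i⟩) => .inner k b i
  invFun
    | .top k => .inl k
    | .bot k => .inr (.inl k)
    | .inner k b i => .inr (.inr ⟨k, b, i⟩)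
  left_inv := by rintro (k | k | ⟨k, b, i⟩) <;> rfl
  right_inv := by rintro (k | k | ⟨k, b, i⟩) <;> rfl

theorem sum_edge (f : PretzelEdge n → ℤ) : ∑ e, f e = (∑ k, f (.top k)) + (∑ k, f (.bot k)) +
    ∑ k, ∑ i, (f (.inner k true i) + f (.inner k false i)) := by
  rw [← (edgeEquiv n).sum_comp, Fintype.sum_sum_type, Fintype.sum_sum_type, Fintype.sum_sigma,
    add_assoc]
  congr 2
  refine Finset.sum_congr rfl fun k _ => ?_
  rw [Fintype.sum_prod_type, Fintype.sum_bool, ← Finset.sum_add_distrib]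
  rfl

open Classical in
theorem finsum_circle (hn : ∀ k, 0 < n k) (t : (PD n).State) :
    (∑ᶠ C, (1 - 2 * ((t.2 C : ℕ) : ℤ))) =
      ∑ e, if rep sg t.1 e = e then (1 - 2 * ((expo t e : ℕ) : ℤ)) else 0 := by
  have h1 : (∑ᶠ e : {e // rep sg t.1 e = e}, (1 - 2 * ((expo t e.1 : ℕ) : ℤ))) =
      ∑ᶠ C, (1 - 2 * ((t.2 C : ℕ) : ℤ)) := by
    refine finsum_eq_of_bijective (fun e => (PD n).circle t.1 e.1) ⟨?_, ?_⟩
      fun e => rfl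
    · rintro ⟨e, he⟩ ⟨f, hf⟩ h
      have := (circle_eq_iff hn).1 h
      rw [he, hf] at this
      exact Subtype.ext this
    · intro C
      obtain ⟨e, rfl⟩ := Quotient.exists_rep C
      exact ⟨⟨rep sg t.1 e, (circle_eq_iff hn).1 (circle_rep hn t.1 e)⟩, circle_rep hn t.1 e⟩
  rw [← h1, finsum_eq_sum_of_fintype, ← Finset.sum_filter]
  exact (Finset.sum_subtype (Finset.univ.filter fun e => rep sg t.1 e = e) (fun e => by simp)
    (fun e => 1 - 2 * ((expo t e : ℕ) : ℤ))).symm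

open Classical in
/-- The number of inner circles of column `k`. -/
noncomputable def upperCount (sm : ℕ → Bool) (N : ℕ) : ℤ :=
  ∑ m ∈ Finset.range N, if IsUpper sm m then 1 else 0

open Classical in
/-- The number of inner circles of column `k` with exponent `1`. -/
noncomputable def upperSum (sm : ℕ → Bool) (lab : ℕ → Fin 2) (N : ℕ) : ℤ :=
  ∑ m ∈ Finset.range N, if IsUpper sm m then ((lab m : ℕ) : ℤ) else 0

theorem weight_pos (sm : ℕ → Bool) (lab : ℕ → Fin 2) (N : ℕ) :
    weight 0 1 N sm lab = upperSum sm lab N := by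
  refine Finset.sum_congr rfl fun m _ => ?_
  rcases fin_two_eq_zero_or_one (lab m) with h | h <;> simp [h]

theorem weight_neg (sm : ℕ → Bool) (lab : ℕ → Fin 2) (N : ℕ) :
    weight (-1) 0 N sm lab = upperSum sm lab N - upperCount sm N := by
  rw [upperSum, upperCount, ← Finset.sum_sub_distrib]
  refine Finset.sum_congr rfl fun m _ => ?_
  rcases fin_two_eq_zero_or_one (lab m) with h | h <;> split_ifs <;> simp_all

theorem count_eq_upperCount (sm : ℕ → Bool) (N : ℕ) :
    (Nat.count (fun m => sm m = true) N : ℤ) =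
      upperCount sm N + if ∃ m < N, sm m = true then 1 else 0 := by
  induction N with
  | zero => simp [upperCount]
  | succ N ih =>
    rw [Nat.count_succ, upperCount, Finset.sum_range_succ, ← upperCount]
    push_cast
    rw [ih]
    by_cases h1 : ∃ m < N, sm m = true
    · have h2 : ∃ m < N + 1, sm m = true := h1.imp fun m hm => ⟨by omega, hm.2⟩
      rw [if_pos h1, if_pos h2]
      by_cases h3 : sm N = true
      · rw [if_pos h3, if_pos ⟨h3, h1⟩]
      · rw [if_neg h3, if_neg fun h => h3 h.1]
        ring
    · rw [if_neg h1]
      have h4 : ¬ IsUpper sm N := fun h => h1 h.2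
      rw [if_neg h4]
      by_cases h3 : sm N = true
      · rw [if_pos h3, if_pos ⟨N, N.lt_succ_self, h3⟩]
      · rw [if_neg h3, if_neg]
        rintro ⟨m, hm, e⟩
        rcases (Nat.lt_succ_iff.1 hm).eq_or_lt with rfl | h
        · exact h3 e
        · exact h1 ⟨m, h, e⟩

theorem count_false (sm : ℕ → Bool) (N : ℕ) :
    (Nat.count (fun m => sm m = false) N : ℤ) = N - Nat.count (fun m => sm m = true) N := by
  induction N with
  | zero => simp
  | succ N ih =>
    rw [Nat.count_succ, Nat.count_succ]
    push_cast
    rw [ih]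
    cases sm N <;> simp
    ring

theorem ncard_one (v : PretzelCrossing n → Bool) : {c | v c = true}.ncard =
    ∑ k, Nat.count (fun m => hs sg v k m = sg k) (n k) := by
  classical
  have hc : ∀ (k : Fin 3), Nat.count (fun m => hs sg v k m = sg k) (n k) =
      (Finset.univ.filter fun m : Fin (n k) => v (toLex ⟨k, m⟩) = true).card := by
    intro k
    rw [Nat.count_eq_card_filter_range]
    symm
    refine Finset.card_bij (fun m _ => (m : ℕ)) ?_ ?_ ?_
    · intro m hm
      simp only [Finset.mem_filter, Finset.mem_univ, true_and, Finset.mem_range] at hm ⊢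
      exact ⟨m.2, by simp [hs, hm]⟩
    · intro a _ b _ h
      exact Fin.ext h
    · intro m hm
      simp only [Finset.mem_filter, Finset.mem_univ, true_and, Finset.mem_range] at hm ⊢
      refine ⟨⟨m, hm.1⟩, ?_, rfl⟩
      have := hm.2
      rw [hs, dif_pos hm.1] at this
      revert this
      cases v (toLex ⟨k, ⟨m, _⟩⟩) <;> cases sg k <;> simp
  simp only [hc]
  rw [← Finset.card_sigma, ← Set.ncard_coe_finset]
  refine Set.ncard_congr (fun c _ => ofLex c) ?_ (fun _ _ _ _ h => ofLex.injective h) ?_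
  · intro c hc
    simpa using hc
  · rintro ⟨k', m⟩ hc
    exact ⟨toLex ⟨k', m⟩, by simpa using hc, rfl⟩

theorem two_mul_stDeg (hn : ∀ k, 0 < n k) (t : (PD n).State)
    (ht : expo t (.top 1) = 0) : 2 * stDeg t.1 (expo t) =
      (∑ᶠ C, (1 - 2 * ((t.2 C : ℕ) : ℤ))) - 1 - {c | t.1 c = true}.ncard + n 0 := by
  classical
  rw [finsum_circle hn, sum_edge, ncard_one, Fin.sum_univ_three, Fin.sum_univ_three,
    Fin.sum_univ_three, Fin.sum_univ_three]
  have hin : ∀ k, (∑ i : Fin (n k - 1),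
      ((if rep sg t.1 (.inner k true i) = .inner k true i then
          (1 - 2 * ((expo t (.inner k true i) : ℕ) : ℤ)) else 0) +
        (if rep sg t.1 (.inner k false i) = .inner k false i then
          (1 - 2 * ((expo t (.inner k false i) : ℕ) : ℤ)) else 0))) =
      upperCount (hs sg t.1 k) (n k) - 2 * upperSum (hs sg t.1 k) (labs (expo t) k) (n k) := by
    intro k
    obtain ⟨N, hN⟩ : ∃ N, n k = N + 1 := ⟨n k - 1, by have := hn k; omega⟩
    have hR : Finset.range (n k) = Finset.range (N + 1) := by rw [hN]
    have h0 : ¬ IsUpper (hs sg t.1 k) 0 := fun h => by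
      obtain ⟨l, hl, _⟩ := h.2
      omega
    rw [upperCount, upperSum, Finset.mul_sum, ← Finset.sum_sub_distrib, hR, Finset.sum_range_succ',
      if_neg h0, if_neg h0, mul_zero, sub_zero, add_zero, Finset.sum_range]
    have hN' : n k - 1 = N := by omega
    refine Fintype.sum_equiv (finCongr hN') _ _ fun i => ?_
    simp only [rep_inner_eq_self, Bool.true_eq_false, false_and, if_false, true_and, zero_add,
      finCongr_apply, Fin.val_cast]
    split_ifs with h
    · have h' := i.2
      rw [labs, columnEdge_inner false ⟨by omega, by omega⟩]
      simp
    · simp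
  have P : ∀ k, (∃ m < n k, hs sg t.1 k m = true) ↔ pattern sg t.1 k = true := fun k => by
    rw [pattern_eq_true]
    exact exists_congr fun m => ⟨fun h => h.2, fun h => ⟨lt_of_hs h, h⟩⟩
  have c0 : (Nat.count (fun m => hs sg t.1 0 m = sg 0) (n 0) : ℤ) = _ := count_false _ _
  have c1 : (Nat.count (fun m => hs sg t.1 1 m = sg 1) (n 1) : ℤ) = _ := count_eq_upperCount _ _
  have c2 : (Nat.count (fun m => hs sg t.1 2 m = sg 2) (n 2) : ℤ) = _ := count_eq_upperCount _ _
  rw [count_eq_upperCount, if_congr (P 0) rfl rfl] at c0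
  rw [if_congr (P 1) rfl rfl] at c1
  rw [if_congr (P 2) rfl rfl] at c2
  rw [hin, hin, hin]
  rw [Nat.cast_add, Nat.cast_add, c0, c1, c2, stDeg, weight_pos, weight_pos, weight_neg, outerDeg]
  rcases Bool.eq_false_or_eq_true (pattern sg t.1 0) with p0 | p0 <;>
  rcases Bool.eq_false_or_eq_true (pattern sg t.1 1) with p1 | p1 <;>
  rcases Bool.eq_false_or_eq_true (pattern sg t.1 2) with p2 | p2 <;>
    simp [rep, topEdge, topRep, botEdge, p0, p1, p2, ht] <;> ring

/-- The `δ`-grading of a state of the reduced complex. -/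
theorem deltaGrading_eq (hn : ∀ k, 0 < n k) (o : (PD n).Orientation)
    (t : (PD n).State) (ht : expo t (.top 1) = 0) :
    deltaGrading o t = (-(n 0 : ℚ) + o.nPlus) / 2 + stDeg t.1 (expo t) := by
  have h := two_mul_stDeg hn t ht
  have h' : (2 : ℚ) * stDeg t.1 (expo t) = (((∑ᶠ C, (1 - 2 * ((t.2 C : ℕ) : ℤ))) : ℤ) : ℚ) - 1 -
      {c | t.1 c = true}.ncard + n 0 := by exact_mod_cast h
  rw [deltaGrading, qGrading, hGrading]
  push_cast at h' ⊢
  linarith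

end

open PDCode

/-! ### The reduced complex and the complex of the columns -/

section

variable {n : Fin 3 → ℕ} (o : (PD n).Orientation) (δ : ℚ)

/-- The coefficients of an element of the complex of the three columns. -/
noncomputable def stCoords : Cpx (n 0) (n 1) (n 2) →+ (ReducedState o (.top 1) δ → ℤ) :=
  AddMonoidHom.mk' (fun x s => stEv s.1.1 (expo s.1) x) fun x y => by
    funext s
    exact map_add _ x y

variable {o δ}

theorem stDeg_eq (hn : ∀ k, 0 < n k) {i : ℤ} (hδ : δ = (-(n 0 : ℚ) + o.nPlus) / 2 + i) (s :
    ReducedState o (.top 1) δ) :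
    stDeg s.1.1 (expo s.1) = i := by
  have h1 := (deltaGrading_eq hn o s.1 s.2.1).symm.trans (s.2.2.trans hδ)
  have h2 : (stDeg s.1.1 (expo s.1) : ℚ) = i := by linarith
  exact_mod_cast h2

theorem stCoords_injective (hn : ∀ k, 0 < n k) {i : ℤ} (hδ : δ = (-(n 0 : ℚ) + o.nPlus) / 2 + i)
    {x : Cpx (n 0) (n 1) (n 2)} (hx : x ∈ colG (n 2) (right (n 0) (n 1)) i)
    (h : stCoords o δ x = 0) : x = 0 := by
  have hd := dual_coords3 (n 0) (n 1) (n 2)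
  refine hd.inj x fun j e he => ?_
  by_cases hj : j = i
  · subst hj
    obtain ⟨t, ht, rfl⟩ := exists_state hn he
    by_cases hdeg : stDeg t.1 (expo t) = j
    · exact congrFun h ⟨t, ht, by rw [deltaGrading_eq hn o t ht, hdeg, hδ]⟩
    · exact absurd he (hd.disj _ _ hdeg _ (stEv_mem _ _))
  · exact (hd.mem i x).1 hx j hj e he

theorem stCoords_surjective (hn : ∀ k, 0 < n k) {i : ℤ} (hδ : δ = (-(n 0 : ℚ) + o.nPlus) / 2 + i)
    (g : ReducedState o (.top 1) δ → ℤ) :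
    ∃ x ∈ colG (n 2) (right (n 0) (n 1)) i, stCoords o δ x = g := by
  classical
  have hd := dual_coords3 (n 0) (n 1) (n 2)
  obtain ⟨x, hx⟩ := hd.surj fun e => if h : ∃ s : ReducedState o (.top 1) δ,
    e = stEv s.1.1 (expo s.1) then g h.choose else 0
  refine ⟨x, (hd.mem i x).2 fun j hj e he => ?_, ?_⟩
  · rw [hx j e he, dif_neg]
    rintro ⟨s, rfl⟩
    have := stEv_mem s.1.1 (expo s.1)
    rw [stDeg_eq hn hδ s] at this
    exact hd.disj _ _ hj _ he this
  · funext s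
    have h : ∃ s' : ReducedState o (.top 1) δ, stEv s.1.1 (expo s.1) = stEv s'.1.1 (expo s'.1) :=
      ⟨s, rfl⟩
    refine (hx _ _ (stEv_mem s.1.1 (expo s.1))).trans ?_
    rw [dif_pos h]
    congr 1
    exact Subtype.ext (stEv_injective hn h.choose.2.1 s.2.1 h.choose_spec.symm)

theorem stCoords_colD (hn : ∀ k, 0 < n k) {i : ℤ} (hδ : δ = (-(n 0 : ℚ) + o.nPlus) / 2 + i)
    {x : Cpx (n 0) (n 1) (n 2)} (hx : x ∈ colG (n 2) (right (n 0) (n 1)) i) (δ' : ℚ) :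
    stCoords o δ' (colD (n 2) (right (n 0) (n 1)) x) =
      differential o (.top 1) δ δ' (stCoords o δ x) := by
  classical
  let _ : Fintype (PD n).State := Fintype.ofFinite _
  have hd := dual_coords3 (n 0) (n 1) (n 2)
  funext t
  refine (stEv_colD hn t.1 t.2.1 x).trans ?_
  change _ = ∑ s : ReducedState o (.top 1) δ,
    (PD n).coeff s.1 t.1 * stEv s.1.1 (expo s.1) x
  have h0 : ∀ s : (PD n).State,
      ¬ (s.2 ((PD n).circle s.1 (.top 1)) = 0 ∧ deltaGrading o s = δ) →
      redEv s.1 (expo s) x = 0 := fun s hs => by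
    rw [redEv]
    split_ifs with h1
    · refine (hd.mem i x).1 hx _ (fun h2 => hs ⟨h1, ?_⟩) _ (stEv_mem s.1 (expo s))
      rw [deltaGrading_eq hn o s h1, h2, hδ]
    · rfl
  rw [← Finset.sum_filter_of_ne (p := fun s : (PD n).State =>
    s.2 ((PD n).circle s.1 (.top 1)) = 0 ∧ deltaGrading o s = δ)]
  · refine (Finset.sum_subtype (p := fun s : (PD n).State =>
      s.2 ((PD n).circle s.1 (.top 1)) = 0 ∧ deltaGrading o s = δ)
      (F := instFintypeReducedStateOfFinite o (.top 1) δ) _ (by simp) _).trans ?_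
    refine Finset.sum_congr rfl fun s _ => ?_
    congr 1
    exact if_pos s.2.1
  · intro s _ hs
    by_contra h
    exact hs (by rw [h0 s h, mul_zero])

/-- The reduced Khovanov homology is the homology of the complex of the columns. -/
theorem reducedKh_equiv (hn : ∀ k, 0 < n k) {i : ℤ} (hδ : δ = (-(n 0 : ℚ) + o.nPlus) / 2 + i) :
    Nonempty (ReducedKh o (.top 1) δ ≃ₗ[ℤ]
      Homology (colD (n 2) (right (n 0) (n 1))) (colG (n 2) (right (n 0) (n 1))) i) := by
  set d := colD (n 2) (right (n 0) (n 1)) with hd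
  set G := colG (n 2) (right (n 0) (n 1)) with hG
  have hδ' : δ - 1 = (-(n 0 : ℚ) + o.nPlus) / 2 + ((i - 1 : ℤ) : ℚ) := by rw [hδ]; push_cast; ring
  have hδ'' : δ + 1 = (-(n 0 : ℚ) + o.nPlus) / 2 + ((i + 1 : ℤ) : ℚ) := by rw [hδ]; push_cast; ring
  have hmem : ∀ x ∈ G i, d x ∈ G (i - 1) := fun x hx =>
    colD_mem (n 2) ((step_mid (n 0)).col_good (n 1)) (i - 1) x (by rw [sub_add_cancel]; exact hx)
  let Φ : G i ≃+ (ReducedState o (.top 1) δ → ℤ) :=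
    AddEquiv.ofBijective ((stCoords o δ).comp (G i).subtype) ⟨by
      rw [injective_iff_map_eq_zero]
      rintro ⟨x, hx⟩ h
      exact Subtype.ext (stCoords_injective hn hδ hx h), fun g => by
      obtain ⟨x, hx, h⟩ := stCoords_surjective hn hδ g
      exact ⟨⟨x, hx⟩, h⟩⟩
  have hΦ : ∀ y, stCoords o δ (Φ.symm y).1 = y := fun y => Φ.apply_symm_apply y
  have hker : ∀ y, differential o (.top 1) δ (δ - 1) y = 0 ↔ d (Φ.symm y).1 = 0 := by
    intro y
    have h := stCoords_colD hn hδ (Φ.symm y).2 (δ - 1)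
    rw [hΦ] at h
    rw [← h]
    exact ⟨fun h1 => stCoords_injective hn hδ' (hmem _ (Φ.symm y).2) h1, fun h1 => by
      rw [← hd, h1, map_zero]⟩
  let f : LinearMap.ker (differential o (.top 1) δ (δ - 1)) →+ Homology d G i :=
    (QuotientAddGroup.mk' _).comp
      ((((G i).subtype.comp Φ.symm.toAddMonoidHom).comp
        (Submodule.subtype _).toAddMonoidHom).codRestrict (cycles d G i)
          fun y => ⟨(hker y.1).1 y.2, (Φ.symm y.1).2⟩)
  have fsurj : Function.Surjective f := by
    intro z
    obtain ⟨⟨x, hx⟩, rfl⟩ := QuotientAddGroup.mk'_surjective _ z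
    refine ⟨⟨Φ ⟨x, hx.2⟩, ?_⟩, ?_⟩
    · rw [LinearMap.mem_ker, hker, Φ.symm_apply_apply]
      exact hx.1
    · refine congrArg (QuotientAddGroup.mk' _) (Subtype.ext ?_)
      change (Φ.symm (Φ ⟨x, hx.2⟩)).1 = x
      rw [Φ.symm_apply_apply]
  have fker : LinearMap.ker f.toIntLinearMap =
      (LinearMap.range (differential o (.top 1) (δ + 1) δ)).submoduleOf
        (LinearMap.ker (differential o (.top 1) δ (δ - 1))) := by
    ext y
    rw [LinearMap.mem_ker, Submodule.submoduleOf, Submodule.mem_comap, LinearMap.mem_range]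
    change (QuotientAddGroup.mk _ : Homology d G i) = 0 ↔ _
    rw [QuotientAddGroup.eq_zero_iff]
    constructor
    · rintro ⟨x, hx, h⟩
      replace h : d x = (Φ.symm y.1).1 := h
      refine ⟨stCoords o (δ + 1) x, ?_⟩
      rw [← stCoords_colD hn hδ'' hx, ← hd, h, hΦ]
      rfl
    · rintro ⟨g, hg⟩
      obtain ⟨x, hx, rfl⟩ := stCoords_surjective hn hδ'' g
      rw [← stCoords_colD hn hδ'' hx] at hg
      refine ⟨x, hx, ?_⟩
      change d x = (Φ.symm y.1).1
      have h1 : d x ∈ G i := colD_mem (n 2) ((step_mid (n 0)).col_good (n 1)) i x hx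
      have h2 : Φ ⟨d x, h1⟩ = y.1 := hg
      rw [← h2, Φ.symm_apply_apply]
  exact ⟨(Submodule.quotEquivOfEq _ _ fker.symm).trans
    (f.toIntLinearMap.quotKerEquivOfSurjective fsurj)⟩

/-- There is no homology outside of the gradings of the states. -/
theorem subsingleton_reducedKh (hn : ∀ k, 0 < n k) (h : ∀ i : ℤ, δ ≠ (-(n 0 : ℚ) + o.nPlus) / 2 +
    i) :
    Subsingleton (ReducedKh o (.top 1) δ) := by
  have : IsEmpty (ReducedState o (.top 1) δ) := ⟨fun s => by
    have h1 := s.2.2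
    rw [deltaGrading_eq hn o s.1 s.2.1] at h1
    exact h _ h1.symm⟩
  infer_instance

end

/-! ### Homomorphisms on simplified columns -/

/-- The homomorphism on a simplified column with the given values on the summands. -/
def Sm.lift : (n : ℕ) → {V H A : Type} → [Ab V] → [Ab H] → [Ab A] →
    (V →+ A) → (ℕ → H →+ A) → (Sm n V H →+ A)
  | 0, _, _, _, _, _, _, f₀, _ => f₀
  | n + 1, _, _, _, _, _, _, f₀, f =>
    f₀.comp Sm.head + (Sm.lift n (f 0) fun k => f (k + 1)).comp Sm.tail

section

variable {V H V' H' A : Type} [Ab V] [Ab H] [Ab V'] [Ab H']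
  [Ab A]

theorem Sm.lift_congr (n : ℕ) {f₀ g₀ : V →+ A} {f g : ℕ → H →+ A} (h₀ : f₀ = g₀)
    (h : ∀ k, f k = g k) (x : Sm n V H) : Sm.lift n f₀ f x = Sm.lift n g₀ g x := by
  rw [h₀, funext h]

theorem Sm.lift_zero_add (n : ℕ) (f₀ : V →+ A) (f : ℕ → H →+ A) (x : Sm n V H) :
    Sm.lift n 0 f x + f₀ (Sm.proj n x) = Sm.lift n f₀ f x := by
  cases n with
  | zero => exact zero_add _
  | succ n =>
    change 0 + Sm.lift n _ _ (Sm.tail x) + f₀ (Sm.head x) = f₀ (Sm.head x) + _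
    rw [zero_add, add_comm]
    rfl

theorem Sm.lift_incl (n : ℕ) (f₀ : V →+ A) (f : ℕ → H →+ A) (v : V) :
    Sm.lift n f₀ f (Sm.incl n v) = f₀ v := by
  cases n with
  | zero => rfl
  | succ n =>
    change f₀ v + Sm.lift n _ _ (0 : Sm n H H) = _
    rw [_root_.map_zero, add_zero]

end

theorem Sm.lift_map : ∀ (n : ℕ) {V H V' H' A : Type} [Ab V] [Ab H] [Ab V'] [Ab H'] [Ab A]
    (f₀ : V' →+ A) (f : ℕ → H' →+ A)
    (g : V →+ V') (h : H →+ H') (x : Sm n V H),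
    Sm.lift n f₀ f (Sm.map n g h x) = Sm.lift n (f₀.comp g) (fun k => (f k).comp h) x
  | 0, _, _, _, _, _, _, _, _, _, _, _, _, _, _, _ => rfl
  | n + 1, _, _, _, _, _, _, _, _, _, _, f₀, f, g, h, x =>
    congrArg (f₀ (g (Sm.head x)) + ·) (Sm.lift_map n (f 0) _ h h (Sm.tail x))

theorem Sm.lift_add : ∀ (n : ℕ) {V H A : Type} [Ab V] [Ab H] [Ab A] (f₀ g₀ : V →+ A)
    (f g : ℕ → H →+ A) (x : Sm n V H),
    Sm.lift n f₀ f x + Sm.lift n g₀ g x = Sm.lift n (f₀ + g₀) (fun k => f k + g k) x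
  | 0, _, _, _, _, _, _, _, _, _, _, _ => rfl
  | n + 1, _, _, _, _, _, _, f₀, g₀, f, g, x => by
    have := Sm.lift_add n (f 0) (g 0) (fun k => f (k + 1)) (fun k => g (k + 1)) (Sm.tail x)
    simp only [Sm.lift, hom_add, hom_comp, ← this]
    abel

theorem Sm.lift_zsmul (m : ℤ) : ∀ (n : ℕ) {V H A : Type} [Ab V] [Ab H] [Ab A] (f₀ : V →+ A)
    (f : ℕ → H →+ A) (x : Sm n V H),
    m • Sm.lift n f₀ f x = Sm.lift n (m • f₀) (fun k => m • f k) x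
  | 0, _, _, _, _, _, _, _, _, _ => rfl
  | n + 1, _, _, _, _, _, _, f₀, f, x =>
    (smul_add m _ _).trans
      (congrArg (m • f₀ (Sm.head x) + ·) (Sm.lift_zsmul m n (f 0) _ (Sm.tail x)))

theorem Sm.lift_zero (n : ℕ) {V H A : Type} [Ab V] [Ab H] [Ab A] :
    Sm.lift n (0 : V →+ A) (fun _ => (0 : H →+ A)) = 0 :=
  hom_ext fun x => by
    have := Sm.lift_zsmul 0 n (0 : V →+ A) (fun _ => (0 : H →+ A)) x
    simpa using this.symm

theorem Sm.exists_lift : ∀ (n : ℕ) {V H A : Type} [Ab V] [Ab H] [Ab A]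
    (F : Sm n V H →+ A),
    ∃ (f₀ : V →+ A) (f : ℕ → H →+ A), F = Sm.lift n f₀ f ∧ ∀ k, n ≤ k → f k = 0
  | 0, _, _, _, _, _, _, F => ⟨F, 0, rfl, fun _ _ => rfl⟩
  | n + 1, V, H, A, _, _, _, F => by
    obtain ⟨g₀, g, hg, h0⟩ := Sm.exists_lift n (F.comp (AddMonoidHom.inr V (Sm n H H)))
    refine ⟨F.comp (AddMonoidHom.inl V (Sm n H H)), fun k => Nat.casesOn k g₀ g,
      hom_ext fun x => ?_, fun k hk => ?_⟩
    · change F x = F (Sm.head x, 0) + Sm.lift n g₀ g (Sm.tail x)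
      rw [← hg]
      change F x = F (Sm.head x, 0) + F (0, Sm.tail x)
      refine Eq.trans ?_ (map_add F (Sm.pair (idHom V) 0 (Sm.head x))
        (Sm.pair (n := n) 0 (idHom _) (Sm.tail x)))
      exact congrArg F (Sm.ext (add_zero _).symm (zero_add _).symm)
    · obtain ⟨k, rfl⟩ := Nat.exists_eq_add_of_le' (Nat.le_of_add_left_le hk)
      exact h0 _ (by omega)

theorem Sm.lift_smE : ∀ (n : ℕ) {V H A : Type} [Ab V] [Ab H] [Ab A] (O : Ops V H) (f₀ : V →+ A)
    (f : ℕ → H →+ A) (x : Sm n V H),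
    Sm.lift n f₀ f (smE n O x) =
      Sm.lift n (f₀.comp O.eV) (fun k => (-1 : ℤ) ^ (k + 1) • (f k).comp O.eH) x
  | 0, _, _, _, _, _, _, _, _, _, _ => rfl
  | n + 1, V, H, A, _, _, _, O, f₀, f, x => by
    have h1 := Sm.lift_smE n O.peel (f 0) (fun k => f (k + 1)) (Sm.tail x)
    have h3 := Sm.lift_zsmul (-1) n ((f 0).comp O.eH)
      (fun k => (-1 : ℤ) ^ (k + 1) • (f (k + 1)).comp O.eH) (Sm.tail x)
    simp only [Sm.lift, smE, hom_add, hom_comp, Sm.head_pair,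
      Sm.tail_pair, hom_neg, map_neg]
    rw [h1]
    refine congrArg _ (((neg_one_zsmul _).symm.trans h3).trans (Sm.lift_congr _ ?_ (fun k => ?_) _))
    · simp
    · rw [smul_smul, ← pow_succ']

theorem Sm.lift_smD : ∀ (n : ℕ) {V H A : Type} [Ab V] [Ab H] [Ab A] (O : Ops V H) (_ : O.T = 0)
    (f₀ : V →+ A) (f : ℕ → H →+ A) (_ : ∀ k, n ≤ k → f k = 0)
    (x : Sm n V H), Sm.lift n f₀ f (smD n O x) =
      Sm.lift n (f₀.comp O.dV + (f 0).comp (O.eH.comp O.s))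
        (fun k => (f k).comp O.dH + (f (k + 1)).comp (O.eH.comp O.Y)) x
  | 0, _, _, _, _, _, _, O, _, f₀, f, hf, x => by
    rw [hf 0 le_rfl, zero_comp, add_zero]
    rfl
  | n + 1, V, H, A, _, _, _, O, hT, f₀, f, hf, x => by
    have h1 := Sm.lift_smD n O.peel (by simp [Ops.peel, hT]) (f 0) (fun k => f (k + 1))
      (fun k hk => hf _ (by omega)) (Sm.tail x)
    simp only [Sm.lift, smD, hom_add, hom_comp, Sm.head_pair,
      Sm.tail_pair, map_add, Sm.lift_incl, h1]
    simp only [Ops.peel, hT, sub_zero]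
    abel

theorem Sm.lift_msmE : ∀ (n : ℕ) {V H A : Type} [Ab V] [Ab H] [Ab A] (O : MOps V H) (f₀ : V →+ A)
    (f : ℕ → H →+ A) (x : Sm n V H),
    Sm.lift n f₀ f (msmE n O x) = Sm.lift n ((-1 : ℤ) ^ n • f₀.comp O.eV)
      (fun k => (-1 : ℤ) ^ (n + k + 1) • (f k).comp O.eH) x
  | 0, _, _, _, _, _, _, O, f₀, f, x => by
    rw [pow_zero, one_smul]
    rfl
  | n + 1, V, H, A, _, _, _, O, f₀, f, x => by
    have h1 := Sm.lift_msmE n O.peel (f 0) (fun k => f (k + 1)) (Sm.tail x)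
    have h2 : ∀ k, (-1 : ℤ) ^ (n + 1 + k + 1) = (-1) ^ (n + k) := fun k => by
      rw [show n + 1 + k + 1 = n + k + 2 by ring, pow_add, neg_one_sq, mul_one]
    simp only [Sm.lift, msmE, hom_add, hom_comp, Sm.head_pair,
      Sm.tail_pair, h1, hom_smul, map_zsmul]
    refine congrArg _ (Sm.lift_congr _ ?_ (fun k => ?_) _)
    · rw [h2 0]
      rfl
    · rw [h2]
      rfl

theorem Sm.lift_msmD : ∀ (n : ℕ) {V H A : Type} [Ab V] [Ab H] [Ab A] (O : MOps V H) (_ : O.dV = 0)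
    (_ : O.dH = 0) (f₀ : V →+ A) (f : ℕ → H →+ A)
    (_ : ∀ k, (f k).comp (O.eH.comp O.T) = 0) (x : Sm n V H),
    Sm.lift n f₀ f (msmD n O x) = Sm.lift n 0 (fun k => (-1 : ℤ) ^ (n + k + 1) •
      (Nat.casesOn k (f₀.comp (O.eV.comp O.s)) fun k => (f k).comp (O.eH.comp O.Y) : H →+ A)) x
  | 0, _, _, _, _, _, _, O, hV, hH, f₀, f, hf, x => by
    change f₀ (O.dV x) = 0
    rw [hV]
    exact _root_.map_zero f₀
  | n + 1, V, H, A, _, _, _, O, hV, hH, f₀, f, hf, x => by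
    have h1 := Sm.lift_msmD n O.peel hH hH (f 0) (fun k => f (k + 1))
      (fun k => by
        change (f (k + 1)).comp (O.eH.comp (-O.T)) = 0
        rw [AddMonoidHom.comp_neg, AddMonoidHom.comp_neg, hf, neg_zero]) (Sm.tail x)
    have h2 : ∀ k, (-1 : ℤ) ^ (n + 1 + k + 1) = (-1) ^ (n + k) := fun k => by
      rw [show n + 1 + k + 1 = n + k + 2 by ring, pow_add, neg_one_sq, mul_one]
    have h3 : (f 0).comp (O.eH.comp (O.Y - O.T)) = (f 0).comp (O.eH.comp O.Y) := by
      rw [AddMonoidHom.comp_sub, AddMonoidHom.comp_sub, hf, sub_zero]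
    simp only [Sm.lift, msmD, hom_add, hom_comp, Sm.head_pair,
      Sm.tail_pair, h1, hom_smul, map_zsmul, hV, _root_.map_zero,
      hom_zero, zero_add]
    rw [add_comm]
    refine (Sm.lift_zero_add n ((-1 : ℤ) ^ n • f₀.comp (O.eV.comp O.s)) _ _).trans
      (Sm.lift_congr _ ?_ (fun k => ?_) _)
    · rw [h2 0]
      rfl
    · rw [h2]
      cases k with
      | zero => exact congrArg _ h3
      | succ k => rfl

theorem Sm.lift_eq_zero_on_smG_iff : ∀ (n : ℕ) {V H A : Type} [Ab V] [Ab H] [Ab A] (O : Ops V H)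
    (f₀ : V →+ A) (f : ℕ → H →+ A) (i : ℤ),
    (∀ x ∈ smG n O i, Sm.lift n f₀ f x = 0) ↔
      (∀ x ∈ O.GV i, f₀ x = 0) ∧ ∀ k < n, ∀ x ∈ O.GH i, f k x = 0
  | 0, _, _, _, _, _, _, O, f₀, f, i => by
    simp only [Nat.not_lt_zero, false_implies, implies_true, and_true]
    rfl
  | n + 1, V, H, A, _, _, _, O, f₀, f, i => by
    have ih := Sm.lift_eq_zero_on_smG_iff n O.peel (f 0) (fun k => f (k + 1)) i
    constructor
    · intro h
      have h1 : ∀ x ∈ O.GV i, f₀ x = 0 := fun x hx => by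
        have := h (Sm.incl (n + 1) x) (incl_mem_smG _ O i x hx)
        rwa [Sm.lift_incl] at this
      obtain ⟨h2, h3⟩ := ih.1 fun x hx => by
        have : f₀ 0 + Sm.lift n (f 0) (fun k => f (k + 1)) x = 0 :=
          h (0, x) ⟨zero_mem (O.GV i), hx⟩
        rwa [_root_.map_zero, zero_add] at this
      refine ⟨h1, fun k hk => ?_⟩
      cases k with
      | zero => exact h2
      | succ k => exact h3 k (by omega)
    · rintro ⟨h1, h2⟩ x hx
      change f₀ (Sm.head x) + Sm.lift n (f 0) (fun k => f (k + 1)) (Sm.tail x) = 0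
      rw [h1 _ hx.1, zero_add]
      exact ih.2 ⟨h2 0 (by omega), fun k hk => h2 (k + 1) (by omega)⟩ _ hx.2

theorem Sm.lift_eq_zero_on_msmG_iff (n : ℕ) {V H A : Type} [Ab V] [Ab H] [Ab A] (O : MOps V H)
    (f₀ : V →+ A) (f : ℕ → H →+ A) (i : ℤ) : (∀ x ∈ msmG n O i, Sm.lift n f₀ f x = 0) ↔
      (∀ x ∈ O.GV i, f₀ x = 0) ∧ ∀ k < n, ∀ x ∈ O.GH i, f k x = 0 := by
  rw [msmG_eq]
  exact Sm.lift_eq_zero_on_smG_iff n O.toOps f₀ f i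

/-! ### Homomorphisms on the lowest degree -/

/-- The group of the simplified complex of the three columns. -/
abbrev Simple (p q r : ℕ) : Type :=
  Sm r (Sm q (Sm p ((ℤ × ℤ) × (ℤ × ℤ)) (ℤ × ℤ)) (Sm p (ℤ × ℤ) ℤ))
    (Sm q (Sm p (ℤ × ℤ) ℤ) (Sm p ℤ (ℤ × ℤ)))

section

variable {A : Type} [Ab A]

/-- The homomorphism to `A` with the value `u` at `1`. -/
def scal (u : A) : ℤ →+ A := zmultiplesHom A u

@[simp] theorem scal_apply (u : A) (x : ℤ) : scal u x = x • u := rfl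

@[simp] theorem scal_zero : scal (0 : A) = 0 := by
  ext
  simp

/-- The homomorphism to `A` with the value `u` at `X` and `0` at the unit. -/
def coefX (u : A) : ℤ × ℤ →+ A := (scal u).comp (AddMonoidHom.snd ℤ ℤ)

@[simp] theorem coefX_apply (u : A) (x : ℤ × ℤ) : coefX u x = x.2 • u := rfl

@[simp] theorem coefX_zero : coefX (0 : A) = 0 := by
  ext <;> simp

/-- The homomorphism that vanishes in the degrees `0` and `1`, with the given values on the
generators of degree `-1`. -/
def lowest (p q r : ℕ) (w : A) (xa xb : ℕ → A) (y : ℕ → ℕ → ℕ → A) :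
    Simple p q r →+ A :=
  Sm.lift r
    (Sm.lift q (Sm.lift p ((coefX w).comp (AddMonoidHom.snd (ℤ × ℤ) (ℤ × ℤ))) 0)
      fun a => Sm.lift p (coefX (xa a)) 0)
    fun b => Sm.lift q (Sm.lift p (coefX (xb b)) 0)
      fun a => Sm.lift p (scal (y a b 0)) fun c => coefX (y a b (c + 1))

/-- The relations between the values on the generators of degree `-1` of a homomorphism that
vanishes on boundaries. -/
structure Relations (p q r : ℕ) (w : A) (xa xb : ℕ → A) (y : ℕ → ℕ → ℕ → A) : Prop where
  w : w = 0
  xa_zero : xa 0 = 0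
  xb_zero : xb 0 = 0
  xa : ∀ a < q, xa a = (-1 : ℤ) ^ a • y a 0 1
  xb : ∀ b < r, xb b = -y 0 b 1
  ya : ∀ a < q, ∀ c ≤ p, c ≠ 1 → y a 0 c = 0
  yb : ∀ b < r, ∀ c ≤ p, c ≠ 1 → y 0 b c = 0
  y : ∀ a < q, ∀ b < r, ∀ c < p, y a b c = -y (a + 1) b (c + 1) + (-1 : ℤ) ^ a • y a (b + 1) (c + 1)

theorem grading_eq (p q : ℕ) : (sright p q).GV = smG q (smidV p) ∧
    (sright p q).GH = smG q (smidH p) ∧ (smidV p).GV = msmG p opsVV ∧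
    (smidV p).GH = msmG p opsHV ∧ (smidH p).GV = msmG p opsHV ∧ (smidH p).GH = msmG p opsHH :=
  ⟨rfl, rfl, rfl, rfl, rfl, rfl⟩

theorem neg_one_pow_smul_eq_zero {n : ℕ} {u : A} : (-1 : ℤ) ^ n • u = 0 ↔ u = 0 :=
  (isUnit_neg_one.pow n).smul_eq_zero

theorem smul_fst_eq_zero_on_circleDeg {u : A} :
    (∀ x ∈ circleDeg 0 0, x.1 • u = 0) ↔ u = 0 :=
  ⟨fun h => by simpa using h (1, 0) ⟨fun h => absurd rfl h, fun _ => rfl⟩,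
    fun h x _ => by rw [h, smul_zero]⟩

theorem smul_snd_eq_zero_on_circleDeg {u : A} :
    (∀ x ∈ circleDeg 1 0, x.2 • u = 0) ↔ u = 0 :=
  ⟨fun h => by simpa using h (0, 1) ⟨fun _ => rfl, fun h => absurd rfl h⟩,
    fun h x _ => by rw [h, smul_zero]⟩

theorem lowest_smD {p q r : ℕ} {w : A} {xa xb : ℕ → A} {y : ℕ → ℕ → ℕ → A}
    (hxa : ∀ a, q ≤ a → xa a = 0) (hxb : ∀ b, r ≤ b → xb b = 0)
    (hya : ∀ a b c, q ≤ a → y a b c = 0) (hyb : ∀ a b c, r ≤ b → y a b c = 0) (hp : 0 < p) :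
    (∀ x ∈ smG r (sright p q) 0, lowest p q r w xa xb y (smD r (sright p q) x) = 0) ↔
      Relations p q r w xa xb y := by
  have e : ∀ x, lowest p q r w xa xb y (smD r (sright p q) x) = Sm.lift r (Sm.lift q
      (Sm.lift p (((-1 : ℤ) ^ p • coefX (xa 0)).comp cstOuter + ((-1 : ℤ) ^ p • coefX (xb 0)).comp
          cstInner)
        fun c => if c = 0 then (-1 : ℤ) ^ (p + 1) • coefX w else 0)
      fun a => Sm.lift p ((-1 : ℤ) ^ (a + 1 + p) • (scal (y a 0 0)).comp cst)
        fun c => if c = 0 then (-1 : ℤ) ^ (p + 1) • (scal (xa a) +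
            (-1 : ℤ) ^ (a + 1) • scal (y a 0 1))
          else (-1 : ℤ) ^ (a + p + c) • scal (y a 0 (c + 1)))
      (fun b => Sm.lift q (Sm.lift p ((-1 : ℤ) ^ p • (scal (y 0 b 0)).comp cst)
        fun c => if c = 0 then (-1 : ℤ) ^ (p + 1) • (scal (xb b) +
            scal (y 0 b 1))
          else (-1 : ℤ) ^ (p + c + 1) • scal (y 0 b (c + 1)))
      fun a => Sm.lift p 0 fun c => (-1 : ℤ) ^ (p + c + 1) • ((scal (y a b c)).comp cst
        + (scal (y (a + 1) b (c + 1))).comp cst + (-1 : ℤ) ^ (a + 1) •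
          (scal (y a (b + 1) (c + 1))).comp cst)) x := by
    intro x
    unfold lowest
    rw [Sm.lift_smD r _ rfl _ _ fun b hb => by simp only [hxb b hb, hyb _ b _ hb, coefX_zero,
      scal_zero, Pi.zero_def, Sm.lift_zero]]
    refine Sm.lift_congr r ?_ (fun b => ?_) x
    · refine hom_ext fun x => ?_
      simp only [sright, smOps, hom_add, hom_comp]
      rw [Sm.lift_smD q _ rfl _ _ fun a ha => by simp only [hxa a ha, coefX_zero, Pi.zero_def,
        Sm.lift_zero], Sm.lift_smE, Sm.lift_map, Sm.lift_add]
      refine Sm.lift_congr q ?_ (fun a => ?_) x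
      · refine hom_ext fun x => ?_
        simp only [smidV, smidH, msmOps, hom_add, hom_comp]
        rw [Sm.lift_msmD p _ rfl rfl _ _ (fun _ => rfl), Sm.lift_msmE, Sm.lift_map, Sm.lift_msmE,
          Sm.lift_map, Sm.lift_add, Sm.lift_add]
        refine Sm.lift_congr p ?_ (fun c => ?_) x
        · rw [zero_add]
          rfl
        · rcases c with _ | c
          · refine hom_ext fun x => ?_
            simp [opsVV, coprodX]
          · simp
      · refine hom_ext fun x => ?_
        simp only [smidV, smidH, msmOps, hom_add, hom_comp, hom_smul]
        rw [Sm.lift_msmD p _ rfl rfl _ _ (fun _ => rfl), Sm.lift_msmE, Sm.lift_map, Sm.lift_msmE,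
          Sm.lift_map, Sm.lift_zsmul, Sm.lift_add, Sm.lift_add]
        refine Sm.lift_congr p ?_ (fun c => ?_) x
        · refine hom_ext fun x => ?_
          simp [opsHH, pow_add, smul_smul, mul_assoc]
        · rcases c with _ | c <;> refine hom_ext fun x => ?_ <;>
            simp [opsHV, opsHH, inX, smul_smul, pow_add, mul_comm, mul_left_comm, mul_assoc]
    · refine hom_ext fun x => ?_
      simp only [sright, smOps, hom_add, hom_comp]
      rw [Sm.lift_smD q _ rfl _ _ fun a ha => by simp only [hya a _ _ ha, coefX_zero, scal_zero,
        Sm.lift_zero], Sm.lift_smE, Sm.lift_map, Sm.lift_add]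
      refine Sm.lift_congr q ?_ (fun a => ?_) x
      · refine hom_ext fun x => ?_
        simp only [smidV, smidH, msmOps, hom_add, hom_comp]
        rw [Sm.lift_msmD p _ rfl rfl _ _ (fun _ => rfl), Sm.lift_msmE, Sm.lift_map, Sm.lift_msmE,
          Sm.lift_map, Sm.lift_add, Sm.lift_add]
        refine Sm.lift_congr p ?_ (fun c => ?_) x
        · refine hom_ext fun x => ?_
          simp [opsHH]
        · rcases c with _ | c <;> refine hom_ext fun x => ?_ <;>
            simp [opsHV, opsHH, inX, smul_smul, pow_add, mul_comm, mul_left_comm, mul_assoc]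
      · refine hom_ext fun x => ?_
        simp only [smidV, smidH, msmOps, hom_add, hom_comp, hom_smul]
        rw [Sm.lift_msmD p _ rfl rfl _ _ (fun _ => hom_ext fun x => by simp [opsHH]), Sm.lift_msmE,
            Sm.lift_map, Sm.lift_msmE,
          Sm.lift_map, Sm.lift_zsmul, Sm.lift_add, Sm.lift_add]
        refine Sm.lift_congr p ?_ (fun c => ?_) x
        · refine hom_ext fun x => ?_
          simp [opsHH]
        · rcases c with _ | c <;> refine hom_ext fun x => ?_ <;>
            simp [opsHV, opsHH, mulX, cst, smul_smul, pow_add, mul_comm, mul_left_comm, mul_assoc]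
  have gVV : (smidV p).GV = msmG p opsVV := rfl
  have gVH : (smidV p).GH = msmG p opsHV := rfl
  have gHV : (smidH p).GV = msmG p opsHV := rfl
  have gHH : (smidH p).GH = msmG p opsHH := rfl
  have h1 : (∀ x ∈ opsVV.GV 0, (((-1 : ℤ) ^ p • coefX (xa 0)).comp cstOuter +
      ((-1 : ℤ) ^ p • coefX (xb 0)).comp cstInner) x = 0) ↔ xa 0 = 0 ∧ xb 0 = 0 := by
    constructor
    · intro h
      have h1 := h ((0, 1), (0, 0)) ⟨⟨fun _ => rfl, fun h => absurd rfl h⟩, fun _ => rfl, fun _ =>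
          rfl⟩
      have h2 := h ((0, 0), (1, 0)) ⟨⟨fun _ => rfl, fun _ => rfl⟩, fun h => absurd rfl h, fun _ =>
          rfl⟩
      simp [cstOuter, cstInner, cst, neg_one_pow_smul_eq_zero] at h1 h2
      exact ⟨h1, h2⟩
    · rintro ⟨h1, h2⟩ x -
      simp [h1, h2]
  have h2 : ∀ c, (∀ x ∈ opsVV.GH 0, (if c = 0 then (-1 : ℤ) ^ (p + 1) • coefX w else 0) x = 0) ↔
      (c = 0 → w = 0) := by
    intro c
    split_ifs with hc
    · simp only [hom_smul, neg_one_pow_smul_eq_zero, hc, forall_const]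
      exact smul_snd_eq_zero_on_circleDeg
    · simp [hc]
  have h3 : ∀ (n : ℕ) (u : A), (∀ x ∈ opsHV.GV 0, ((-1 : ℤ) ^ n • (scal u).comp cst) x = 0) ↔
      u = 0 := by
    intro n u
    simp only [hom_smul, neg_one_pow_smul_eq_zero]
    exact smul_fst_eq_zero_on_circleDeg
  have h4 : ∀ f : ℤ →+ A, (∀ x ∈ opsHV.GH 0, f x = 0) ↔ f 1 = 0 := fun f =>
    ⟨fun h => h 1 fun h => absurd rfl h, fun h x _ => by
      rw [← mul_one x, ← smul_eq_mul, map_zsmul, h, smul_zero]⟩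
  have h5 : ∀ (n m : ℕ) (u v w : A), (∀ x ∈ opsHH.GH 0, ((-1 : ℤ) ^ n • ((scal u).comp cst
      + (scal v).comp cst + (-1 : ℤ) ^ (m + 1) • (scal w).comp cst)) x = 0) ↔
      u = -v + (-1 : ℤ) ^ m • w := by
    intro n m u v w
    have : u = -v + (-1 : ℤ) ^ m • w ↔ u + v + (-1 : ℤ) ^ (m + 1) • w = 0 := by
      rw [pow_succ, mul_neg_one, neg_smul, ← sub_eq_zero]
      exact ⟨fun h => by rw [← h]; abel, fun h => by rw [← h]; abel⟩
    rw [this, ← smul_fst_eq_zero_on_circleDeg]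
    simp only [hom_smul, neg_one_pow_smul_eq_zero]
    refine forall₂_congr fun x _ => ?_
    simp [cst, smul_comm _ x.1]
  simp only [e, Sm.lift_eq_zero_on_smG_iff, grading_eq p q,
    Sm.lift_eq_zero_on_msmG_iff, h1, h2, h3, h4, h5, hom_zero, implies_true,
    true_and]
  constructor
  · rintro ⟨⟨⟨⟨hx, hx'⟩, hw⟩, ha⟩, hb⟩
    refine ⟨hw 0 hp rfl, hx, hx', fun a h => ?_, fun b h => ?_, fun a h c hc h1 => ?_,
      fun b h c hc h1 => ?_, fun a ha b h c hc => (hb b h).2 a ha c hc⟩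
    · have := (ha a h).2 0 hp
      simp only [if_true, hom_smul, neg_one_pow_smul_eq_zero,
        hom_add, scal_apply, one_smul] at this
      rw [pow_succ, mul_neg_one, neg_smul, ← sub_eq_add_neg] at this
      exact sub_eq_zero.1 this
    · have := (hb b h).1.2 0 hp
      simp only [if_true, hom_smul, neg_one_pow_smul_eq_zero,
        hom_add, scal_apply, one_smul] at this
      exact eq_neg_of_add_eq_zero_left this
    · rcases c with _ | _ | c
      · exact (ha a h).1
      · exact absurd rfl h1
      · have := (ha a h).2 (c + 1) (by omega)
        simpa only [Nat.add_one_ne_zero, if_false, hom_smul,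
          neg_one_pow_smul_eq_zero, scal_apply, one_smul] using this
    · rcases c with _ | _ | c
      · exact (hb b h).1.1
      · exact absurd rfl h1
      · have := (hb b h).1.2 (c + 1) (by omega)
        simpa only [Nat.add_one_ne_zero, if_false, hom_smul,
          neg_one_pow_smul_eq_zero, scal_apply, one_smul] using this
  · intro h
    refine ⟨⟨⟨⟨h.xa_zero, h.xb_zero⟩, fun _ _ _ => h.w⟩, fun a ha => ⟨h.ya a ha 0 (by omega)
      (by omega), fun c hc => ?_⟩⟩, fun b hb => ⟨⟨h.yb b hb 0 (by omega) (by omega),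
      fun c hc => ?_⟩, fun a ha c hc => h.y a ha b hb c hc⟩⟩
    · split_ifs with h0
      · simp [h.xa a ha, pow_succ]
      · simp [h.ya a ha (c + 1) (by omega) (by omega)]
    · split_ifs with h0
      · simp [h.xb b hb]
      · simp [h.yb b hb (c + 1) (by omega) (by omega)]

/-- On the lowest degree, every homomorphism is of the form `lowest`. -/
theorem exists_lowest (p q r : ℕ) (F : Simple p q r →+ A) :
    ∃ (w : A) (xa xb : ℕ → A) (y : ℕ → ℕ → ℕ → A),
      (∀ a, q ≤ a → xa a = 0) ∧ (∀ b, r ≤ b → xb b = 0) ∧ (∀ a b c, q ≤ a → y a b c = 0) ∧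
      (∀ a b c, r ≤ b → y a b c = 0) ∧ (∀ a b c, p < c → y a b c = 0) ∧
      ∀ x ∈ smG r (sright p q) (-1), F x = lowest p q r w xa xb y x := by
  obtain ⟨F0, Fb, rfl, hFb⟩ := Sm.exists_lift r F
  obtain ⟨F00, Fa0, rfl, hFa0⟩ := Sm.exists_lift q F0
  choose F0b Fab hF hFab using fun b => Sm.exists_lift q (Fb b)
  obtain ⟨α, γ, rfl, hγ⟩ := Sm.exists_lift p F00
  choose βa κa hβa hκa using fun a => Sm.exists_lift p (Fa0 a)
  choose βb κb hβb hκb using fun b => Sm.exists_lift p (F0b b)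
  choose ε η hε hη using fun b a => Sm.exists_lift p (Fab b a)
  refine ⟨α (0, (0, 1)), fun a => if a < q then βa a (0, 1) else 0,
    fun b => if b < r then βb b (0, 1) else 0,
    fun a b c => if a < q ∧ b < r ∧ c ≤ p then (Nat.casesOn c (ε b a 1) fun c => η b a c (0, 1))
        else 0,
    fun a h => if_neg (by omega), fun a h => if_neg (by omega), fun a b c h => if_neg (by omega),
    fun a b c h => if_neg (by omega), fun a b c h => if_neg (by omega), fun x hx => ?_⟩
  rw [← sub_eq_zero]
  unfold lowest
  have hsub : ∀ (n : ℕ) {V H : Type} [Ab V] [Ab H] (f₀ g₀ : V →+ A)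
      (f g : ℕ → H →+ A), Sm.lift n f₀ f - Sm.lift n g₀ g =
        Sm.lift n (f₀ - g₀) fun k => f k - g k := by
    intro n V H _ _ f₀ g₀ f g
    rw [sub_eq_iff_eq_add]
    ext x
    rw [hom_add, Sm.lift_add]
    simp
  have gVV : (smidV p).GV = msmG p opsVV := rfl
  have gVH : (smidV p).GH = msmG p opsHV := rfl
  have gHV : (smidH p).GV = msmG p opsHV := rfl
  have gHH : (smidH p).GH = msmG p opsHH := rfl
  have hX : ∀ (f : ℤ × ℤ →+ A), ∀ x ∈ circleDeg 0 (-1), f x = coefX (f (0, 1)) x := by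
    intro f x hx
    rw [coefX_apply, ← map_zsmul]
    exact congrArg f (Prod.ext (by simp [hx.1 (by decide)]) (by simp))
  rw [← hom_sub, hsub]
  revert x
  simp only [hF, hβa, hβb, hε, hsub, Sm.lift_eq_zero_on_smG_iff, grading_eq p q,
    Sm.lift_eq_zero_on_msmG_iff]
  refine ⟨⟨⟨fun x hx => ?_, fun c hc x hx => ?_⟩, fun a ha => ⟨fun x hx => ?_, fun c hc x hx =>
      ?_⟩⟩,
    fun b hb => ⟨⟨fun x hx => ?_, fun c hc x hx => ?_⟩, fun a ha => ⟨fun x hx => ?_, fun c hc x hx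
        => ?_⟩⟩⟩
  · have h1 : x = x.2.2 • ((0, 0), (0, 1)) := Prod.ext (Prod.ext (by simp [hx.1.1 (by decide)])
      (by simp [hx.1.2 (by decide)])) (Prod.ext (by simp [hx.2.1 (by decide)]) (by simp))
    have h2 := map_zsmul α x.2.2 ((0, 0), (0, 1))
    rw [← h1] at h2
    rw [hom_sub, h2]
    exact sub_self _
  · rw [show x = 0 from Prod.ext (hx.1 (by decide)) (hx.2 (by decide)), map_zero]
  · rw [hom_sub, hX _ _ hx, if_pos ha, sub_self]
  · rw [show x = 0 from hx (by decide), map_zero]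
  · rw [hom_sub, hX _ _ hx, if_pos hb, sub_self]
  · rw [show x = 0 from hx (by decide), map_zero]
  · rw [if_pos ⟨ha, hb, Nat.zero_le _⟩, hom_sub, scal_apply]
    change ε b a x - x • ε b a 1 = 0
    rw [← map_zsmul, smul_eq_mul, mul_one, sub_self]
  · rw [if_pos ⟨ha, hb, hc⟩, hom_sub, hX _ _ hx, sub_self]

end

/-! ### The relations as a difference equation -/

section

variable {A : Type} [Ab A]

/-- The difference operator that expresses the values for `c` crossings of the left column by those
for `c + 1`. -/
def diff (v : ℕ → ℕ → A) : ℕ → ℕ → A := fun a b => -v (a + 1) b + (-1 : ℤ) ^ a • v a (b + 1)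

/-- The square of `diff`. -/
def diffSq (v : ℕ → ℕ → A) : ℕ → ℕ → A := fun a b => v (a + 2) b + v a (b + 2)

theorem diff_diff (v : ℕ → ℕ → A) : diff (diff v) = diffSq v := by
  funext a b
  simp only [diff, diffSq, smul_add, smul_smul, ← pow_add, smul_neg, ← two_mul, pow_mul]
  simp [pow_succ]
  abel

theorem iterate_diff_two_mul (k : ℕ) (v : ℕ → ℕ → A) : diff^[2 * k] v = diffSq^[k] v := by
  rw [Function.iterate_mul]
  congr 1
  funext v
  exact diff_diff v

theorem iterate_diff_apply_zero (k : ℕ) : ∀ (v : ℕ → ℕ → A) (_ : ∀ a b, b < k → v a b = 0) (a : ℕ),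
    diff^[k] v a 0 = ((-1 : ℤ) ^ a) ^ k • v a k := by
  induction k with
  | zero => intro v _ a; simp
  | succ k ih =>
    intro v hv a
    rw [Function.iterate_succ_apply, ih]
    · simp [diff, hv (a + 1) k (by omega), smul_smul, pow_succ]
    · intro a b hb
      simp [diff, hv _ b (by omega), hv _ (b + 1) (by omega)]

theorem iterate_diff_zero_apply (k : ℕ) : ∀ (v : ℕ → ℕ → A) (_ : ∀ a b, a < k → v a b = 0) (b : ℕ),
    diff^[k] v 0 b = (-1 : ℤ) ^ k • v k b := by
  induction k with
  | zero => intro v _ b; simp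
  | succ k ih =>
    intro v hv b
    rw [Function.iterate_succ_apply, ih]
    · simp [diff, hv k _ (by omega), pow_succ]
    · intro a b hb
      simp [diff, hv a _ (by omega), hv (a + 1) _ (by omega)]

theorem iterate_diffSq_apply (k j : ℕ) : ∀ (v : ℕ → ℕ → A)
    (_ : ∀ a b, b + 1 < 2 * k + j → v a b = 0) (a : ℕ), diffSq^[k] v a j = v a (2 * k + j) := by
  induction k with
  | zero => intro v _ a; simp
  | succ k ih =>
    intro v hv a
    rw [Function.iterate_succ_apply, ih]
    · simp only [diffSq, hv (a + 2) (2 * k + j) (by omega), zero_add]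
      congr 1
      ring
    · intro a b hb
      simp [diffSq, hv _ b (by omega), hv _ (b + 2) (by omega)]

theorem iterate_diffSq_swap (k : ℕ) : ∀ (v : ℕ → ℕ → A) (a b : ℕ),
    diffSq^[k] v a b = diffSq^[k] (fun a b => v b a) b a := by
  induction k with
  | zero => intro v a b; rfl
  | succ k ih =>
    intro v a b
    rw [Function.iterate_succ_apply, ih, Function.iterate_succ_apply]
    have : (fun a b => diffSq v b a) = diffSq fun a b => v b a := by
      funext a b
      exact add_comm _ _
    rw [this]

theorem iterate_diff_eq_zero {q r : ℕ} (k : ℕ) : ∀ (v : ℕ → ℕ → A)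
    (_ : ∀ a b, q ≤ a ∨ r ≤ b → v a b = 0) (a b : ℕ) (_ : q ≤ a ∨ r ≤ b), diff^[k] v a b = 0 := by
  induction k with
  | zero => exact fun v hv => hv
  | succ k ih =>
    intro v hv
    rw [Function.iterate_succ_apply]
    refine ih _ fun a b h => ?_
    simp [diff, hv (a + 1) b (by omega), hv a (b + 1) (by omega)]

/-- The relations between the values for all `p` crossings of the left column. -/
structure Reduced (p q r : ℕ) (v : ℕ → ℕ → A) : Prop where
  supp : ∀ a b, q ≤ a ∨ r ≤ b → v a b = 0
  low : ∀ a b, a + 1 < p ∨ b + 1 < p → v a b = 0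
  even : Even p → (∀ a, v a p = 0) ∧ ∀ b, v p b = 0
  odd : Odd p → v (p - 1) (p - 1) = 0 ∧ (∀ b, v p b = v (p - 1) (b + 1)) ∧
    ∀ a, v (a + 1) (p - 1) = (-1 : ℤ) ^ a • v a p

theorem iterate_diff_even {k : ℕ} {v : ℕ → ℕ → A}
    (low : ∀ a b, a + 1 < 2 * k ∨ b + 1 < 2 * k → v a b = 0) :
    (∀ a, diff^[2 * k] v a 0 = v a (2 * k)) ∧ ∀ b, diff^[2 * k] v 0 b = v (2 * k) b := by
  rw [iterate_diff_two_mul]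
  exact ⟨iterate_diffSq_apply k 0 v fun a b h => low a b (.inr h), fun b => by
    rw [iterate_diffSq_swap]
    exact iterate_diffSq_apply k 0 (fun a b => v b a) (fun a b h => low b a (.inl h)) b⟩

theorem iterate_diff_odd {k : ℕ} {v : ℕ → ℕ → A}
    (low : ∀ a b, a + 1 < 2 * k + 1 ∨ b + 1 < 2 * k + 1 → v a b = 0) :
    (∀ a, diff^[2 * k + 1] v a 0 = -v (a + 1) (2 * k) + (-1 : ℤ) ^ a • v a (2 * k + 1)) ∧
      ∀ b, diff^[2 * k + 1] v 0 b = -v (2 * k + 1) b + v (2 * k) (b + 1) := by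
  rw [Function.iterate_succ_apply', iterate_diff_two_mul]
  have h0 := iterate_diffSq_apply k 0 v fun a b h => low a b (.inr (by omega))
  have h1 := iterate_diffSq_apply k 1 v fun a b h => low a b (.inr (by omega))
  have h2 := iterate_diffSq_apply k 0 (fun a b => v b a) fun a b h => low b a (.inl (by omega))
  have h3 := iterate_diffSq_apply k 1 (fun a b => v b a) fun a b h => low b a (.inl (by omega))
  refine ⟨fun a => ?_, fun b => ?_⟩
  · rw [diff, h0, h1]
    rfl
  · rw [diff, iterate_diffSq_swap, h3, iterate_diffSq_swap k v, h2, pow_zero, one_smul]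
    rfl

theorem Relations.eq_iterate {p q r : ℕ} {w : A} {xa xb : ℕ → A} {y : ℕ → ℕ → ℕ → A}
    (h : Relations p q r w xa xb y) (hy : ∀ a b c, q ≤ a ∨ r ≤ b → y a b c = 0) :
    ∀ k, k ≤ p → ∀ a b, y a b (p - k) = diff^[k] (fun a b => y a b p) a b := by
  intro k
  induction k with
  | zero => intro _ a b; rfl
  | succ k ih =>
    intro hk a b
    by_cases hab : q ≤ a ∨ r ≤ b
    · rw [hy _ _ _ hab, iterate_diff_eq_zero _ _ (fun a b => hy a b p) a b hab]
    · push Not at hab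
      rw [Function.iterate_succ_apply', diff, ← ih (by omega), ← ih (by omega),
        h.y a hab.1 b hab.2 _ (by omega), show p - (k + 1) + 1 = p - k by omega]

theorem Relations.reduced {p q r : ℕ} {w : A} {xa xb : ℕ → A} {y : ℕ → ℕ → ℕ → A}
    (h : Relations p q r w xa xb y) (hy : ∀ a b c, q ≤ a ∨ r ≤ b → y a b c = 0) (hp : 0 < p)
    (hpq : p ≤ q) (hqr : q ≤ r) : Reduced p q r fun a b => y a b p := by
  have e := h.eq_iterate hy
  have hb : ∀ k ≤ p, k + 1 ≠ p → ∀ a, diff^[k] (fun a b => y a b p) a 0 = 0 := by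
    intro k hk hk' a
    rw [← e k hk]
    by_cases ha : a < q
    · exact h.ya a ha _ (by omega) (by omega)
    · exact hy _ _ _ (by omega)
  have ha : ∀ k ≤ p, k + 1 ≠ p → ∀ b, diff^[k] (fun a b => y a b p) 0 b = 0 := by
    intro k hk hk' b
    rw [← e k hk]
    by_cases ha : b < r
    · exact h.yb b ha _ (by omega) (by omega)
    · exact hy _ _ _ (by omega)
  have lowb : ∀ b, b + 1 < p → ∀ a, y a b p = 0 := by
    intro b
    induction b using Nat.strong_induction_on with
    | _ b ih =>
      intro hbp a
      have := hb b (by omega) (by omega) a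
      rwa [iterate_diff_apply_zero b _ fun a k hk => ih k hk (by omega) a, ← pow_mul,
        neg_one_pow_smul_eq_zero] at this
  have lowa : ∀ a, a + 1 < p → ∀ b, y a b p = 0 := by
    intro a
    induction a using Nat.strong_induction_on with
    | _ a ih =>
      intro hbp b
      have := ha a (by omega) (by omega) b
      rwa [iterate_diff_zero_apply a _ fun k b hk => ih k hk (by omega) b,
        neg_one_pow_smul_eq_zero] at this
  have low : ∀ a b, a + 1 < p ∨ b + 1 < p → y a b p = 0 := by
    rintro a b (h | h)
    · exact lowa a h b
    · exact lowb b h a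
  refine ⟨fun a b => hy a b p, low, ?_, ?_⟩
  · rintro ⟨k, hk⟩
    rw [← two_mul] at hk
    obtain ⟨h1, h2⟩ := iterate_diff_even (k := k) (v := fun a b => y a b p) (by rwa [← hk])
    rw [← hk] at h1 h2
    exact ⟨fun a => (h1 a).symm.trans (hb p le_rfl (by omega) a),
      fun b => (h2 b).symm.trans (ha p le_rfl (by omega) b)⟩
  · rintro ⟨k, hk⟩
    obtain ⟨h1, h2⟩ := iterate_diff_odd (k := k) (v := fun a b => y a b p) (by rwa [← hk])
    rw [← hk] at h1 h2
    have h3 : ∀ a, y (a + 1) (p - 1) p = (-1 : ℤ) ^ a • y a p p := fun a => by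
      have := (h1 a).symm.trans (hb p le_rfl (by omega) a)
      rw [show p - 1 = 2 * k by omega]
      exact neg_add_eq_zero.1 this
    refine ⟨?_, fun b => ?_, h3⟩
    · rcases Nat.eq_zero_or_pos k with rfl | hk0
      · obtain rfl : p = 1 := by omega
        have := h.xa 0 (by omega)
        rw [h.xa_zero, pow_zero, one_smul] at this
        exact this.symm
      · have := h3 (p - 2)
        rw [low (p - 2) p (by omega), smul_zero, show p - 2 + 1 = p - 1 by omega] at this
        exact this
    · have := (h2 b).symm.trans (ha p le_rfl (by omega) b)
      rw [show p - 1 = 2 * k by omega]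
      exact neg_add_eq_zero.1 this

theorem Reduced.relations {p q r : ℕ} {v : ℕ → ℕ → A} (h : Reduced p q r v) (hp : 0 < p) :
    Relations p q r 0 (fun a => (-1 : ℤ) ^ a • diff^[p - 1] v a 0) (fun b => -diff^[p - 1] v 0 b)
      fun a b c => diff^[p - c] v a b := by
  have hb : ∀ k, k < p → ∀ a, diff^[k] v a 0 = ((-1 : ℤ) ^ a) ^ k • v a k := fun k hk a =>
    iterate_diff_apply_zero k v (fun a b hb => h.low a b (by omega)) a
  have ha : ∀ k, k < p → ∀ b, diff^[k] v 0 b = (-1 : ℤ) ^ k • v k b := fun k hk b =>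
    iterate_diff_zero_apply k v (fun a b hb => h.low a b (by omega)) b
  have h0 : v 0 (p - 1) = 0 := by
    rcases Nat.lt_or_ge 1 p with h1 | h1
    · exact h.low _ _ (by omega)
    · obtain rfl : p = 1 := by omega
      exact (h.odd odd_one).1
  have hp0 : (∀ a, diff^[p] v a 0 = 0) ∧ ∀ b, diff^[p] v 0 b = 0 := by
    rcases Nat.even_or_odd' p with ⟨k, hk | hk⟩
    · obtain ⟨h1, h2⟩ := iterate_diff_even (k := k) (v := v) (by rw [← hk]; exact h.low)
      obtain ⟨h3, h4⟩ := h.even (by rw [hk]; exact even_two_mul k)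
      rw [← hk] at h1 h2
      exact ⟨fun a => by rw [h1, h3], fun a => by rw [h2, h4]⟩
    · obtain ⟨h1, h2⟩ := iterate_diff_odd (k := k) (v := v) (by rw [← hk]; exact h.low)
      obtain ⟨-, h3, h4⟩ := h.odd (by rw [hk]; exact odd_two_mul_add_one k)
      rw [← hk, show 2 * k = p - 1 by omega] at h1 h2
      exact ⟨fun a => by rw [h1, h4, neg_add_cancel], fun a => by rw [h2, h3, neg_add_cancel]⟩
  refine ⟨rfl, ?_, ?_, fun a _ => rfl, fun b _ => rfl, fun a _ c hc h1 => ?_,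
    fun b _ c hc h1 => ?_, fun a _ b _ c hc => ?_⟩
  · rw [hb _ (by omega), h0, smul_zero, smul_zero]
  · rw [hb _ (by omega), h0, smul_zero, neg_zero]
  · rcases Nat.eq_zero_or_pos c with rfl | hc0
    · exact hp0.1 a
    · rw [hb _ (by omega), h.low _ _ (by omega), smul_zero]
  · rcases Nat.eq_zero_or_pos c with rfl | hc0
    · exact hp0.2 b
    · rw [ha _ (by omega), h.low _ _ (by omega), smul_zero]
  · rw [show p - c = p - (c + 1) + 1 by omega, Function.iterate_succ_apply']
    rfl

end

section

variable {A : Type} [Ab A]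

open Classical in
/-- The positions `(a, b)` such that the generators for `a`, `b` and `p` crossings in the columns
form a basis of the homology in the lowest degree. -/
noncomputable def freeIndex (p q r : ℕ) : Finset (ℕ × ℕ) :=
  if Even p then (Finset.Ico (p - 1) q).erase p ×ˢ (Finset.Ico (p - 1) r).erase p
  else ((Finset.Ico p q ×ˢ Finset.Ico p r).erase (p, r - 1)).erase (q - 1, p) ∪
    if p < q then {(p - 1, p)} else ∅

theorem mem_freeIndex_even {p q r a b : ℕ} (hp : Even p) : (a, b) ∈ freeIndex p q r ↔
    a ≠ p ∧ b ≠ p ∧ p - 1 ≤ a ∧ p - 1 ≤ b ∧ a < q ∧ b < r := by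
  simp only [freeIndex, if_pos hp, Finset.mem_product, Finset.mem_erase, Finset.mem_Ico]
  tauto

theorem mem_freeIndex_odd {p q r a b : ℕ} (hp : ¬ Even p) : (a, b) ∈ freeIndex p q r ↔
    (¬ (a = q - 1 ∧ b = p) ∧ ¬ (a = p ∧ b = r - 1) ∧ p ≤ a ∧ p ≤ b ∧ a < q ∧ b < r) ∨
      (p < q ∧ a = p - 1 ∧ b = p) := by
  simp only [freeIndex, if_neg hp, Finset.mem_union, Finset.mem_product, Finset.mem_erase,
    Finset.mem_Ico, ne_eq, Prod.mk.injEq]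
  refine or_congr (by tauto) ?_
  split_ifs with h
  · simp [h]
  · simp [h]

theorem mem_range_of_mem_freeIndex {p q r a b : ℕ} (hqr : q ≤ r) (h : (a, b) ∈ freeIndex p q r) :
    a < q ∧ b < r := by
  by_cases hp : Even p
  · rw [mem_freeIndex_even hp] at h
    omega
  · rw [mem_freeIndex_odd hp] at h
    omega

theorem Reduced.eq_zero {p q r : ℕ} {v : ℕ → ℕ → A} (h : Reduced p q r v) (hp : 0 < p)
    (hpq : p ≤ q) (hqr : q ≤ r) (h0 : ∀ a b, (a, b) ∈ freeIndex p q r → v a b = 0) (a b : ℕ) :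
    v a b = 0 := by
  by_cases hab : q ≤ a ∨ r ≤ b
  · exact h.supp a b hab
  by_cases hlow : a + 1 < p ∨ b + 1 < p
  · exact h.low a b hlow
  by_cases hpe : Even p
  · obtain ⟨h1, h2⟩ := h.even hpe
    by_cases ha : a = p
    · rw [ha, h2]
    by_cases hb : b = p
    · rw [hb, h1]
    exact h0 a b ((mem_freeIndex_even hpe).2 (by omega))
  · obtain ⟨h1, h2, h3⟩ := h.odd (Nat.not_even_iff_odd.1 hpe)
    have hge : ∀ a b, p ≤ a → p ≤ b → v a b = 0 := by
      intro a b ha hb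
      by_cases hab : q ≤ a ∨ r ≤ b
      · exact h.supp a b hab
      by_cases hc : a = p ∧ b = r - 1
      · rw [hc.1, h2, h.supp _ _ (by omega)]
      by_cases hc' : a = q - 1 ∧ b = p
      · have := h3 a
        rw [h.supp (a + 1) _ (by omega)] at this
        rw [hc'.2]
        exact neg_one_pow_smul_eq_zero.1 this.symm
      exact h0 a b ((mem_freeIndex_odd hpe).2 (by omega))
    have hpp : v (p - 1) p = 0 := by
      by_cases hq : p < q
      · exact h0 _ _ ((mem_freeIndex_odd hpe).2 (by omega))
      · have := h2 (p - 1)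
        rw [h.supp _ _ (by omega), show p - 1 + 1 = p by omega] at this
        exact this.symm
    rcases Nat.lt_or_ge a p with ha | ha
    · obtain rfl : a = p - 1 := by omega
      rcases Nat.lt_or_ge b p with hb | hb
      · obtain rfl : b = p - 1 := by omega
        exact h1
      · rcases hb.eq_or_lt with rfl | hb
        · exact hpp
        · have := h2 (b - 1)
          rw [hge _ _ le_rfl (by omega), show b - 1 + 1 = b by omega] at this
          exact this.symm
    · rcases Nat.lt_or_ge b p with hb | hb
      · obtain rfl : b = p - 1 := by omega
        have := h3 (a - 1)
        rw [show a - 1 + 1 = a by omega] at this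
        rw [this, neg_one_pow_smul_eq_zero]
        rcases ha.eq_or_lt with rfl | ha
        · exact hpp
        · exact hge _ _ (by omega) le_rfl
      · exact hge a b ha hb

theorem exists_reduced {p q r : ℕ} (hp : 0 < p) (hpq : p ≤ q) (hqr : q ≤ r) (w : ℕ → ℕ → A) :
    ∃ v, Reduced p q r v ∧ ∀ a b, (a, b) ∈ freeIndex p q r → v a b = w a b := by
  classical
  by_cases hpe : Even p
  · refine ⟨fun a b => if (a, b) ∈ freeIndex p q r then w a b else 0, ⟨fun a b h => ?_,
      fun a b h => ?_, fun _ => ⟨fun a => ?_, fun b => ?_⟩, fun h => absurd hpe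
      (Nat.not_even_iff_odd.2 h)⟩, fun a b h => if_pos h⟩
    all_goals exact if_neg fun h' => by rw [mem_freeIndex_even hpe] at h'; omega
  · have hodd := Nat.not_even_iff_odd.1 hpe
    obtain ⟨w', hw', h0⟩ : ∃ w' : ℕ → ℕ → A, (∀ a b, (a, b) ∈ freeIndex p q r → w' a b = w a b) ∧
        ∀ a b, (a, b) ∉ freeIndex p q r → w' a b = 0 :=
      ⟨fun a b => if (a, b) ∈ freeIndex p q r then w a b else 0, fun a b h => if_pos h,
        fun a b h => if_neg h⟩
    simp only [mem_freeIndex_odd hpe] at h0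
    refine ⟨fun a b => if a + 1 < p ∨ b + 1 < p then 0 else if a + 1 = p then
      (if b + 1 = p then 0 else if b = p then w' (p - 1) p else w' p (b - 1)) else
      if b + 1 = p then (if a = p then w' (p - 1) p else (-1 : ℤ) ^ (a - 1) • w' (a - 1) p)
      else w' a b, ⟨fun a b h => ?_, fun a b h => if_pos h, fun h => absurd h hpe,
        fun _ => ⟨?_, fun b => ?_, fun a => ?_⟩⟩, fun a b h => ?_⟩
    · split_ifs with h1 h2 h3 h4 h5 h6
      · rfl
      · rfl
      · exact h0 _ _ (by omega)
      · exact h0 _ _ (by omega)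
      · exact h0 _ _ (by omega)
      · rw [h0 _ _ (by omega), smul_zero]
      · exact h0 _ _ (by omega)
    · rw [if_neg (by omega), if_pos (by omega), if_pos (by omega)]
    · rcases lt_trichotomy (b + 1) p with h | h | h
      · rw [if_pos (by omega)]
        split_ifs <;> first | rfl | omega
      · rw [if_neg (by omega), if_neg (by omega), if_pos h, if_pos rfl, if_neg (by omega),
          if_pos (by omega), if_neg (by omega), if_pos h]
      · rw [if_neg (by omega), if_neg (by omega), if_neg (by omega), if_neg (by omega),
          if_pos (by omega), if_neg (by omega), if_neg (by omega), Nat.add_sub_cancel]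
    · rcases lt_trichotomy (a + 1) p with h | h | h
      · rw [if_pos (c := a + 1 < p ∨ p + 1 < p) (by omega), smul_zero]
        split_ifs <;> first | rfl | omega
      · rw [if_neg (by omega), if_neg (by omega), if_pos (by omega), if_pos h, if_neg (by omega),
          if_pos h, if_neg (by omega), if_pos rfl, Even.neg_one_pow, one_smul]
        rw [← h] at hpe
        simpa [Nat.even_add_one] using hpe
      · rw [if_neg (by omega), if_neg (by omega), if_pos (by omega), if_neg (by omega),
          if_neg (by omega), if_neg (by omega), if_neg (by omega), Nat.add_sub_cancel]
    · dsimp only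
      rw [← hw' a b h]
      rw [mem_freeIndex_odd hpe] at h
      rcases h with h | ⟨h, rfl, rfl⟩
      · rw [if_neg (by omega), if_neg (by omega), if_neg (by omega)]
      · rw [if_neg (by omega), if_pos (by omega), if_neg (by omega), if_pos rfl]

end

/-! ### The homology in the lowest degree -/

/-- The inclusion of a horizontal summand. -/
def Sm.single : (n k : ℕ) → {V H : Type} → [Ab V] → [Ab H] → (H →+ Sm n V H)
  | 0, _, _, _, _, _ => 0
  | n + 1, 0, _, _, _, _ => Sm.pair 0 (Sm.incl n)
  | n + 1, k + 1, _, _, _, _ => Sm.pair 0 (Sm.single n k)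

theorem Sm.lift_single : ∀ (n k : ℕ) (_ : k < n) {V H A : Type} [Ab V] [Ab H] [Ab A] (f₀ : V →+ A)
    (f : ℕ → H →+ A) (x : H),
    Sm.lift n f₀ f (Sm.single n k x) = f k x
  | n + 1, 0, _, _, _, _, _, _, _, f₀, f, x => by
    change f₀ 0 + Sm.lift n _ _ (Sm.incl n x) = _
    rw [_root_.map_zero, zero_add, Sm.lift_incl]
  | n + 1, k + 1, h, _, _, _, _, _, _, f₀, f, x => by
    change f₀ 0 + Sm.lift n _ _ (Sm.single n k x) = _
    rw [_root_.map_zero, zero_add, Sm.lift_single n k (by omega)]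

theorem Sm.single_mem_smG : ∀ (n k : ℕ) {V H : Type} [Ab V] [Ab H] (O : Ops V H) (i : ℤ)
    (x : H), x ∈ O.GH i → Sm.single n k x ∈ smG n O i
  | 0, _, _, _, _, _, O, i, x, hx => zero_mem (O.GV i)
  | n + 1, 0, _, _, _, _, O, i, x, hx => ⟨zero_mem (O.GV i), incl_mem_smG n O.peel i x hx⟩
  | n + 1, k + 1, _, _, _, _, O, i, x, hx =>
    ⟨zero_mem (O.GV i), Sm.single_mem_smG n k O.peel i x hx⟩

theorem Sm.single_mem_msmG (n k : ℕ) {V H : Type} [Ab V] [Ab H] (O : MOps V H) (i : ℤ) (x : H)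
    (hx : x ∈ O.GH i) : Sm.single n k x ∈ msmG n O i := by
  rw [msmG_eq]
  exact Sm.single_mem_smG n k O.toOps i x hx

theorem eq_zero_of_mem_smG : ∀ (n : ℕ) {V H : Type} [Ab V] [Ab H] {O : Ops V H} {i : ℤ}
    (_ : ∀ x ∈ O.GV i, x = 0) (_ : ∀ x ∈ O.GH i, x = 0) (x : Sm n V H),
    x ∈ smG n O i → x = 0
  | 0, _, _, _, _, _, _, hV, _, x, hx => hV x hx
  | n + 1, _, _, _, _, O, i, hV, hH, x, hx =>
    Sm.ext (hV _ hx.1) (eq_zero_of_mem_smG n (O := O.peel) hH hH _ hx.2)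

theorem eq_zero_of_mem_msmG (n : ℕ) {V H : Type} [Ab V] [Ab H] {O : MOps V H} {i : ℤ}
    (hV : ∀ x ∈ O.GV i, x = 0) (hH : ∀ x ∈ O.GH i, x = 0) : ∀ x ∈ msmG n O i, x = 0 := by
  rw [msmG_eq]
  exact eq_zero_of_mem_smG n (O := O.toOps) hV hH

theorem eq_zero_of_mem_smG_sright {p q r : ℕ} {i : ℤ} (h1 : i ≠ 1) (h0 : i ≠ 0) (hm : i ≠ -1) :
    ∀ x ∈ smG r (sright p q) i, x = 0 := by
  have hpure : ∀ k : ℤ, i ≠ k → ∀ x ∈ pureDeg k i, x = 0 := fun k hk x hx => hx hk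
  have hcirc : ∀ k : ℤ, i ≠ k → i ≠ k - 1 → ∀ x ∈ circleDeg k i, x = 0 := fun k hk hk' x hx =>
    Prod.ext (hx.1 hk) (hx.2 hk')
  refine eq_zero_of_mem_smG r ?_ ?_
  · refine eq_zero_of_mem_smG q ?_ ?_
    · exact eq_zero_of_mem_msmG p (fun x hx => Prod.ext (hcirc 1 h1 (by omega) _ hx.1)
        (hcirc 0 h0 (by omega) _ hx.2)) (hcirc 1 h1 (by omega))
    · exact eq_zero_of_mem_msmG p (hcirc 0 h0 (by omega)) (hpure 0 h0)
  · refine eq_zero_of_mem_smG q ?_ ?_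
    · exact eq_zero_of_mem_msmG p (hcirc 0 h0 (by omega)) (hpure 0 h0)
    · exact eq_zero_of_mem_msmG p (hpure (-1) hm) (hcirc 0 h0 (by omega))

/-- The generator of the lowest degree at the position `(a, b)`. -/
def generator (p q r : ℕ) (s : ℕ × ℕ) : Simple p q r :=
  Sm.single r s.2 (Sm.single q s.1 (Sm.single p (p - 1) (0, 1)))

theorem generator_mem (p q r : ℕ) (s : ℕ × ℕ) : generator p q r s ∈ smG r (sright p q) (-1) :=
  Sm.single_mem_smG r _ _ _ _ (Sm.single_mem_smG q _ _ _ _ (Sm.single_mem_msmG p _ _ _ _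
    ⟨fun _ => rfl, fun h => absurd rfl h⟩))

section

variable {A : Type} [Ab A]

theorem lowest_generator {p q r : ℕ} {w : A} {xa xb : ℕ → A} {y : ℕ → ℕ → ℕ → A} {a b : ℕ}
    (hp : 0 < p) (ha : a < q) (hb : b < r) :
    lowest p q r w xa xb y (generator p q r (a, b)) = y a b p := by
  unfold lowest generator
  rw [Sm.lift_single r _ hb, Sm.lift_single q _ ha, Sm.lift_single p _ (by omega), coefX_apply,
    one_smul, show p - 1 + 1 = p by omega]

theorem lowest_zero (p q r : ℕ) : lowest p q r (0 : A) 0 0 0 = 0 := by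
  simp only [lowest, Pi.zero_apply, coefX_zero, zero_comp, Pi.zero_def, Sm.lift_zero,
    scal_zero]

variable {p q r : ℕ}

theorem eq_zero_on_lowest (hp : 0 < p) (hpq : p ≤ q) (hqr : q ≤ r) (F : Simple p q r →+ A)
    (hF : ∀ x ∈ smG r (sright p q) 0, F (smD r (sright p q) x) = 0)
    (h0 : ∀ s ∈ freeIndex p q r, F (generator p q r s) = 0) :
    ∀ x ∈ smG r (sright p q) (-1), F x = 0 := by
  obtain ⟨w, xa, xb, y, hxa, hxb, hya, hyb, hyc, h⟩ := exists_lowest p q r F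
  have hg : (sright p q).Good := (step_smid p).sm_good q
  have hrel : Relations p q r w xa xb y := (lowest_smD hxa hxb hya hyb hp).1 fun x hx => by
    rw [← h _ (smD_mem r hg (-1) x hx), hF x hx]
  have hy : ∀ a b c, q ≤ a ∨ r ≤ b → y a b c = 0 := by
    rintro a b c (h | h)
    exacts [hya a b c h, hyb a b c h]
  have hv := (hrel.reduced hy hp hpq hqr).eq_zero hp hpq hqr fun a b hab => by
    obtain ⟨ha, hb⟩ := mem_range_of_mem_freeIndex hqr hab
    rw [← lowest_generator (y := y) (w := w) (xa := xa) (xb := xb) hp ha hb, ← h _ (generator_mem p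
        q r _),
      h0 _ hab]
  have hy0 : ∀ a b c, y a b c = 0 := by
    intro a b c
    by_cases hc : p < c
    · exact hyc a b c hc
    · have := hrel.eq_iterate hy (p - c) (by omega) a b
      rw [iterate_diff_eq_zero (q := 0) (r := 0) _ _ (fun a b _ => hv a b) a b (by omega),
        show p - (p - c) = c by omega] at this
      exact this
  intro x hx
  have e1 : xa = 0 := funext fun a => by
    by_cases ha : a < q
    · rw [hrel.xa a ha, hy0, smul_zero]
      rfl
    · exact hxa a (by omega)
  have e2 : xb = 0 := funext fun b => by
    by_cases hb : b < r
    · rw [hrel.xb b hb, hy0, neg_zero]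
      rfl
    · exact hxb b (by omega)
  have e3 : y = 0 := funext fun a => funext fun b => funext fun c => hy0 a b c
  rw [h x hx, hrel.w, e1, e2, e3, lowest_zero, hom_zero]

theorem exists_hom_lowest (hp : 0 < p) (hpq : p ≤ q) (hqr : q ≤ r) (f : ℕ × ℕ → A) : ∃ F : Simple p
    q r →+ A,
    (∀ x ∈ smG r (sright p q) 0, F (smD r (sright p q) x) = 0) ∧
      ∀ s ∈ freeIndex p q r, F (generator p q r s) = f s := by
  obtain ⟨v, hv, hvw⟩ := exists_reduced hp hpq hqr fun a b => f (a, b)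
  have hz := fun k => iterate_diff_eq_zero k v hv.supp
  refine ⟨_, (lowest_smD (fun a ha => ?_) (fun b hb => ?_) (fun a b c ha => ?_)
    (fun a b c hb => ?_) hp).2 (hv.relations hp), fun s hs => ?_⟩
  · rw [hz _ _ _ (.inl ha), smul_zero]
  · rw [hz _ _ _ (.inr hb), neg_zero]
  · exact hz _ _ _ (.inl ha)
  · exact hz _ _ _ (.inr hb)
  · obtain ⟨ha, hb⟩ := mem_range_of_mem_freeIndex hqr hs
    rw [lowest_generator hp ha hb, Nat.sub_self]
    exact hvw _ _ hs

theorem homology_lowest (hp : 0 < p) (hpq : p ≤ q) (hqr : q ≤ r) : Nonempty (Homology (smD r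
    (sright p q)) (smG r (sright p q)) (-1) ≃+
    (freeIndex p q r → ℤ)) := by
  classical
  obtain ⟨φ, hφ, hφg⟩ := exists_hom_lowest (A := freeIndex p q r → ℤ) hp hpq hqr
    fun s => if hs : s ∈ freeIndex p q r then Pi.single ⟨s, hs⟩ 1 else 0
  have hφg' : ∀ s : freeIndex p q r, φ (generator p q r s) = Pi.single s 1 := fun s => by
    rw [hφg s s.2, dif_pos s.2]
  have hg : (sright p q).Good := (step_smid p).sm_good q
  let d := smD r (sright p q)
  let G := smG r (sright p q)
  have hcyc : ∀ x ∈ G (-1), x ∈ cycles d G (-1) := fun x hx =>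
    ⟨eq_zero_of_mem_smG_sright (i := -2) (by decide) (by decide) (by decide) _
      (smD_mem r hg (-2) x hx), hx⟩
  let Φ : cycles d G (-1) →+ (freeIndex p q r → ℤ) := φ.comp (cycles d G (-1)).subtype
  let ψ : (freeIndex p q r → ℤ) →+ Simple p q r :=
    { toFun := fun f => ∑ s, f s • generator p q r s
      map_zero' := by simp
      map_add' := fun f g => by simp [add_smul, Finset.sum_add_distrib] }
  have hψ : ∀ f, ψ f ∈ G (-1) := fun f => sum_mem fun s _ => zsmul_mem (generator_mem p q r s) _
  have hφψ : ∀ f, φ (ψ f) = f := fun f => by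
    change φ (∑ s, f s • generator p q r s) = f
    rw [map_sum]
    simp only [map_zsmul, hφg']
    funext t
    simp [Finset.sum_apply, Pi.single_apply]
  have hsurj : Function.Surjective Φ := fun f => ⟨⟨ψ f, hcyc _ (hψ f)⟩, hφψ f⟩
  have hker : (boundaries d G (-1)).addSubgroupOf (cycles d G (-1)) = Φ.ker := by
    ext x
    constructor
    · rintro ⟨z, hz, e⟩
      change φ x = 0
      rw [show (x : Simple p q r) = d z from e.symm]
      exact hφ z hz
    · intro hx
      have hx' : φ x = 0 := hx
      let B := (G 0).map d
      have := eq_zero_on_lowest hp hpq hqr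
        (QuotientAddGroup.mk' B - (QuotientAddGroup.mk' B).comp (ψ.comp φ)) (fun z hz => by
          rw [hom_sub, hom_comp, hom_comp, hφ z hz,
            map_zero, map_zero, sub_zero]
          exact (QuotientAddGroup.eq_zero_iff _).2 ⟨z, hz, rfl⟩)
        (fun s hs => by
          have : ψ (φ (generator p q r s)) = generator p q r s := by
            rw [hφg' ⟨s, hs⟩]
            change ∑ t, (Pi.single (⟨s, hs⟩ : freeIndex p q r) (1 : ℤ) : freeIndex p q r → ℤ) t •
              generator p q r t = _
            rw [Finset.sum_eq_single ⟨s, hs⟩]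
            · simp
            · intro t _ ht
              simp [ht]
            · intro h
              exact absurd (Finset.mem_univ _) h
          rw [hom_sub, hom_comp, hom_comp, this,
            sub_self]) x x.2.2
      rw [hom_sub, hom_comp, hom_comp, hx', map_zero,
        map_zero, sub_zero] at this
      exact (QuotientAddGroup.eq_zero_iff (N := B) (x : Simple p q r)).1 this
  exact ⟨(QuotientAddGroup.quotientAddEquivOfEq hker).trans
    (QuotientAddGroup.quotientKerEquivOfSurjective Φ hsurj)⟩

end

/-! ### Ranks -/

/-- A subgroup that is free of rank `m`. -/
def HasRank {C : Type} [Ab C] (S : AddSubgroup C) (m : ℕ) : Prop :=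
  Nonempty (S ≃+ (Fin m → ℤ))

theorem HasRank.prod {C D E : Type} [Ab C] [Ab D] [Ab E] {S : AddSubgroup C} {T : AddSubgroup D}
    {m n : ℕ} (hS : HasRank S m) (hT : HasRank T n)
    (R : AddSubgroup E) (e : E ≃+ C × D) (hR : ∀ x, x ∈ R ↔ (e x).1 ∈ S ∧ (e x).2 ∈ T) :
    HasRank R (m + n) := by
  obtain ⟨f⟩ := hS
  obtain ⟨g⟩ := hT
  have hRm : R.map (e : E →+ C × D) = S.prod T := by
    ext x
    constructor
    · rintro ⟨y, hy, rfl⟩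
      exact (hR y).1 hy
    · intro hx
      exact ⟨e.symm x, (hR _).2 (by rw [e.apply_symm_apply]; exact hx), e.apply_symm_apply x⟩
  exact ⟨((e.addSubgroupMap R).trans (AddEquiv.addSubgroupCongr hRm)).trans
    ((AddSubgroup.prodEquiv S T).trans ((f.prodCongr g).trans
      ((LinearEquiv.sumArrowLequivProdArrow (Fin m) (Fin n) ℤ ℤ).symm.trans
        (LinearEquiv.funCongrLeft ℤ ℤ finSumFinEquiv.symm)).toAddEquiv))⟩

theorem hasRank_smG : ∀ (n : ℕ) {V H : Type} [Ab V] [Ab H] (O : Ops V H)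
    (i : ℤ) {k l : ℕ} (_ : HasRank (O.GV i) k) (_ : HasRank (O.GH i) l),
    HasRank (smG n O i) (k + n * l)
  | 0, _, _, _, _, O, i, k, l, hV, _ => by rw [Nat.zero_mul]; exact hV
  | n + 1, V, H, _, _, O, i, k, l, hV, hH => by
    rw [show k + (n + 1) * l = k + (l + n * l) by ring]
    exact hV.prod (hasRank_smG n O.peel i hH hH) _ (AddEquiv.refl (V × Sm n H H)) fun x => Iff.rfl

theorem hasRank_msmG (n : ℕ) {V H : Type} [Ab V] [Ab H] (O : MOps V H) (i : ℤ) {k l : ℕ}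
    (hV : HasRank (O.GV i) k) (hH : HasRank (O.GH i) l) : HasRank (msmG n O i) (k + n * l) := by
  rw [msmG_eq]
  exact hasRank_smG n O.toOps i hV hH

theorem hasRank_pureDeg (k i : ℤ) : HasRank (pureDeg k i) (if i = k then 1 else 0) := by
  split_ifs with h
  · have : pureDeg k i = ⊤ := eq_top_iff.2 fun x _ h' => absurd h h'
    exact ⟨((AddEquiv.addSubgroupCongr this).trans AddSubgroup.topEquiv).trans
      (LinearEquiv.funUnique (Fin 1) ℤ ℤ).symm.toAddEquiv⟩
  · have : pureDeg k i = ⊥ := eq_bot_iff.2 fun x hx => hx h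
    have : Subsingleton (pureDeg k i) := by rw [this]; infer_instance
    exact ⟨⟨⟨fun _ => 0, fun _ => 0, fun _ => Subsingleton.elim _ _, fun _ => Subsingleton.elim _
        _⟩,
      fun _ _ => Subsingleton.elim _ _⟩⟩

theorem hasRank_circleDeg (k i : ℤ) :
    HasRank (circleDeg k i) ((if i = k then 1 else 0) + if i = k - 1 then 1 else 0) :=
  (hasRank_pureDeg k i).prod (hasRank_pureDeg (k - 1) i) _ (AddEquiv.refl _) fun _ => Iff.rfl

theorem hasRank_sright (p q r : ℕ) (i : ℤ) {d₁ d₀ d : ℕ} (h₁ : d₁ = if i = 1 then 1 else 0)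
    (h₀ : d₀ = if i = 0 then 1 else 0) (h : d = if i = -1 then 1 else 0) :
    HasRank (smG r (sright p q) i) (d₁ + 2 * d₀ + d + p * (d₁ + d₀) + q * (d₀ + d + p * d₀) +
      r * (d₀ + d + p * d₀ + q * (d + p * (d₀ + d)))) := by
  have hHV := hasRank_msmG p opsHV i (hasRank_circleDeg 0 i) (hasRank_pureDeg 0 i)
  have hHH := hasRank_msmG p opsHH i (hasRank_pureDeg (-1) i) (hasRank_circleDeg 0 i)
  have hVV := hasRank_msmG p opsVV i ((hasRank_circleDeg 1 i).prod (hasRank_circleDeg 0 i) _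
    (AddEquiv.refl _) fun _ => Iff.rfl) (hasRank_circleDeg 1 i)
  subst h₁ h₀ h
  convert hasRank_smG r (sright p q) i (hasRank_smG q (smidV p) i hVV hHV)
    (hasRank_smG q (smidH p) i hHV hHH) using 1
  split_ifs <;> omega

/-! ### The homology in the middle degree -/

theorem finrank_range_add_finrank_ker {C D : Type} [Ab C] [Ab D] [Module.Finite ℤ C] (f : C →+ D)
    :
    Module.finrank ℤ f.range + Module.finrank ℤ f.ker = Module.finrank ℤ C := by
  have h := LinearMap.rank_range_add_rank_ker f.toIntLinearMap
  rw [← Module.finrank_eq_rank, ← Module.finrank_eq_rank, ← Module.finrank_eq_rank] at h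
  exact_mod_cast h

theorem addSubgroup_free {C : Type} [Ab C] [Module.Free ℤ C]
    [Module.Finite ℤ C] (S : AddSubgroup C) :
    Module.Free ℤ S :=
  inferInstanceAs (Module.Free ℤ (AddSubgroup.toIntSubmodule S))

theorem addSubgroup_finite {C : Type} [Ab C] [Module.Finite ℤ C] (S : AddSubgroup C) :
    Module.Finite ℤ S :=
  inferInstanceAs (Module.Finite ℤ (AddSubgroup.toIntSubmodule S))

theorem int_finrank_eq {C D : Type} [Ab C] [Ab D] (e : C ≃+ D) :
    Module.finrank ℤ C = Module.finrank ℤ D := e.toIntLinearEquiv.finrank_eq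

/-- The homology of a complex in the degrees `1`, `0`, `-1` whose first differential has a
retraction. -/
theorem homology_zero {C : Type} [Ab C] {d : C →+ C} {G : ℤ → AddSubgroup C}
    (ρ : C →+ C) {n₁ n₀ n m k : ℕ} (hd : ∀ x, d (d x) = 0)
    (hG : ∀ i, ∀ x ∈ G (i + 1), d x ∈ G i) (hρ : ∀ x ∈ G 1, ρ (d x) = x)
    (hρG : ∀ x ∈ G 0, ρ x ∈ G 1) (hbot : ∀ x ∈ G (-2), x = 0) (r₁ : HasRank (G 1) n₁)
    (r₀ : HasRank (G 0) n₀) (r : HasRank (G (-1)) n)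
    (hH : Nonempty (Homology d G (-1) ≃+ (Fin m → ℤ))) (hk : k + n₁ + n = n₀ + m) :
    Nonempty (Homology d G 0 ≃+ (Fin k → ℤ)) := by
  obtain ⟨e₁⟩ := r₁
  obtain ⟨e₀⟩ := r₀
  obtain ⟨e⟩ := r
  obtain ⟨eH⟩ := hH
  have : Module.Finite ℤ (G 0) := Module.Finite.equiv e₀.symm.toIntLinearEquiv
  have : Module.Free ℤ (G 0) := Module.Free.of_equiv e₀.symm.toIntLinearEquiv
  have : Module.Finite ℤ (G 1) := Module.Finite.equiv e₁.symm.toIntLinearEquiv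
  have : Module.Free ℤ (G 1) := Module.Free.of_equiv e₁.symm.toIntLinearEquiv
  have : Module.Finite ℤ (G (-1)) := Module.Finite.equiv e.symm.toIntLinearEquiv
  have hB : ∀ y ∈ G 1, d y ∈ cycles d G 0 := fun y hy => ⟨hd y, hG 0 y hy⟩
  let f : G 0 →+ C := d.comp (G 0).subtype
  have := addSubgroup_free f.ker
  have := addSubgroup_finite f.ker
  let τ : f.ker →+ G 1 := (ρ.comp ((G 0).subtype.comp f.ker.subtype)).codRestrict _
    fun x => hρG _ x.1.2
  have := addSubgroup_free τ.ker
  have := addSubgroup_finite τ.ker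
  have hτ : Function.Surjective τ := fun y =>
    ⟨⟨⟨d y, hG 0 y y.2⟩, hd y⟩, Subtype.ext (hρ y y.2)⟩
  let κ : cycles d G 0 →+ τ.ker := AddMonoidHom.mk'
    (fun x => ⟨⟨⟨x - d (ρ x), sub_mem x.2.2 (hB _ (hρG _ x.2.2)).2⟩,
      show d (x - d (ρ x)) = 0 by rw [map_sub, hd, sub_zero]; exact x.2.1⟩, Subtype.ext (by
        change ρ (x - d (ρ x)) = 0
        rw [map_sub, hρ _ (hρG _ x.2.2), sub_self])⟩)
    fun x y => Subtype.ext (Subtype.ext (Subtype.ext (by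
      change (x + y : C) - d (ρ (x + y)) = (x - d (ρ x)) + (y - d (ρ y))
      rw [map_add, map_add]
      abel)))
  have hκ : Function.Surjective κ := fun x => by
    have hx : ρ (x : f.ker) = 0 := congrArg Subtype.val x.2
    refine ⟨⟨x.1.1.1, x.1.2, x.1.1.2⟩, Subtype.ext (Subtype.ext (Subtype.ext ?_))⟩
    change (x.1.1.1 : C) - d (ρ x.1.1.1) = x.1.1.1
    rw [hx, map_zero, sub_zero]
  have hker : (boundaries d G 0).addSubgroupOf (cycles d G 0) = κ.ker := by
    ext x
    constructor
    · rintro ⟨y, hy, e⟩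
      refine Subtype.ext (Subtype.ext (Subtype.ext ?_))
      change (x : C) - d (ρ x) = 0
      rw [← show d y = x from e, hρ y hy, sub_self]
    · intro hx
      have hx' : (x : C) - d (ρ x) = 0 := congrArg (fun z : τ.ker => (z.1.1.1 : C)) hx
      exact ⟨ρ x, hρG _ x.2.2, (sub_eq_zero.1 hx').symm⟩
  have hcyc : ∀ x : G (-1), (x : C) ∈ cycles d G (-1) := fun x =>
    ⟨hbot _ (hG (-2) x x.2), x.2⟩
  let π : G (-1) →+ (Fin m → ℤ) := eH.toAddMonoidHom.comp ((QuotientAddGroup.mk' _).comp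
    ((G (-1)).subtype.codRestrict _ hcyc))
  have hπ : Function.Surjective π := fun y => by
    obtain ⟨x, rfl⟩ := eH.surjective y
    obtain ⟨x, rfl⟩ := QuotientAddGroup.mk_surjective x
    exact ⟨⟨x, x.2.2⟩, rfl⟩
  have hπ0 : ∀ x, π x = 0 ↔ (x : C) ∈ f.range := fun x => by
    refine (map_eq_zero_iff eH eH.injective).trans ((QuotientAddGroup.eq_zero_iff _).trans ?_)
    exact ⟨fun ⟨y, hy, e⟩ => ⟨⟨y, hy⟩, e⟩, fun ⟨y, e⟩ => ⟨y, y.2, e⟩⟩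
  let ι : π.ker →+ f.range := ((G (-1)).subtype.comp π.ker.subtype).codRestrict _
    fun x => (hπ0 _).1 x.2
  have hι : Function.Bijective ι := by
    refine ⟨fun x y h => Subtype.ext (Subtype.ext
      (congrArg (fun z : f.range => (z : C)) h)), ?_⟩
    rintro ⟨_, ⟨y, rfl⟩⟩
    exact ⟨⟨⟨d y, hG (-1) y y.2⟩, (hπ0 _).2 ⟨y, rfl⟩⟩, rfl⟩
  have h1 := finrank_range_add_finrank_ker f
  have h2 := finrank_range_add_finrank_ker τ
  have h3 := finrank_range_add_finrank_ker π
  have h4 := int_finrank_eq (AddEquiv.ofBijective ι hι)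
  have h5 := int_finrank_eq e₀
  have h6 := int_finrank_eq e₁
  have h7 := int_finrank_eq e
  rw [AddMonoidHom.range_eq_top.2 hτ, int_finrank_eq AddSubgroup.topEquiv] at h2
  rw [AddMonoidHom.range_eq_top.2 hπ, int_finrank_eq AddSubgroup.topEquiv] at h3
  simp only [Module.finrank_fin_fun] at h3 h5 h6 h7
  have hk' : Module.finrank ℤ τ.ker = k := by omega
  exact ⟨((QuotientAddGroup.quotientAddEquivOfEq hker).trans
    (QuotientAddGroup.quotientKerEquivOfSurjective κ hκ)).trans
      (Module.finBasisOfFinrankEq ℤ τ.ker hk').equivFun.toAddEquiv⟩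

theorem proj_mem_smG : ∀ (n : ℕ) {V H : Type} [Ab V] [Ab H] (O : Ops V H)
    (i : ℤ) (x : Sm n V H), x ∈ smG n O i → Sm.proj n x ∈ O.GV i
  | 0, _, _, _, _, _, _, _, h => h
  | n + 1, _, _, _, _, O, i, x, h => h.1

theorem Sm.proj_incl : ∀ (n : ℕ) {V H : Type} [Ab V] [Ab H] (v : V),
    Sm.proj n (Sm.incl n v : Sm n V H) = v
  | 0, _, _, _, _, _ => rfl
  | n + 1, _, _, _, _, v => rfl

theorem map_eq_self_of_mem_msmG : ∀ (n : ℕ) {V H : Type} [Ab V] [Ab H] {O : MOps V H} {i : ℤ}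
    {f : V →+ V} {g : H →+ H} (_ : ∀ x ∈ O.GV i, f x = x)
    (_ : ∀ x ∈ O.GH i, g x = x) (x : Sm n V H), x ∈ msmG n O i → Sm.map n f g x = x
  | 0, _, _, _, _, _, _, _, _, hV, _, x, hx => hV x hx
  | n + 1, _, _, _, _, O, i, f, g, hV, hH, x, hx =>
    Sm.ext (hV _ hx.1) (map_eq_self_of_mem_msmG n (O := O.peel) hH hH _ hx.2)

/-- The unit of the circle in the first factor. -/
def inOne : ℤ →+ ℤ × ℤ := AddMonoidHom.inl ℤ ℤ

/-- The retraction of the first differential: it reads off the part of a boundary with a single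
crossing of the middle column. -/
def retract (p q r : ℕ) : Simple p (q + 1) (r + 1) →+ Simple p (q + 1) (r + 1) :=
  (Sm.incl (r + 1)).comp ((Sm.incl (q + 1)).comp
    ((Sm.map p ((AddMonoidHom.inl (ℤ × ℤ) (ℤ × ℤ)).comp (inOne.comp cst)) inOne).comp
      ((msmE p opsHV).comp ((Sm.proj q).comp (Sm.tail.comp Sm.head)))))

theorem retract_smD (p q r : ℕ) (x : Simple p (q + 1) (r + 1))
    (hx : x ∈ smG (r + 1) (sright p (q + 1)) 1) :
    retract p q r (smD (r + 1) (sright p (q + 1)) x) = x := by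
  have hHV : ∀ y ∈ msmG p opsHV 1, y = 0 := eq_zero_of_mem_msmG p
    (fun x hx => Prod.ext (hx.1 (by decide)) (hx.2 (by decide))) fun x hx => hx (by decide)
  have hHH : ∀ y ∈ msmG p opsHH 1, y = 0 := eq_zero_of_mem_msmG p
    (fun x hx => hx (by decide)) fun x hx => Prod.ext (hx.1 (by decide)) (hx.2 (by decide))
  have h1 : Sm.tail x = 0 := eq_zero_of_mem_smG r (O := (sright p (q + 1)).peel)
    (eq_zero_of_mem_smG (q + 1) hHV hHH) (eq_zero_of_mem_smG (q + 1) hHV hHH) _ hx.2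
  have h2 : Sm.tail (Sm.head x) = 0 := eq_zero_of_mem_smG q (O := (smidV p).peel) hHV hHV _ hx.1.2
  have h3 : Sm.tail (Sm.head (smD (r + 1) (sright p (q + 1)) x)) =
      Sm.incl q (msmE p opsHV (Sm.map p cstOuter cst (Sm.head (Sm.head x)))) := by
    change smD q (smidV p).peel (Sm.tail (Sm.head x)) + _ = _
    rw [h2, map_zero, zero_add]
    rfl
  have h4 : retract p q r (smD (r + 1) (sright p (q + 1)) x) =
      Sm.incl (r + 1) (Sm.incl (q + 1) (Sm.head (Sm.head x))) := by
    simp only [retract, hom_comp, h3, Sm.proj_incl]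
    rw [msmE_msmE p opsHV_good, Sm.map_map]
    congr 2
    refine map_eq_self_of_mem_msmG p (O := opsVV) ?_ ?_ _ hx.1.1
    · intro y hy
      exact Prod.ext (Prod.ext rfl (hy.1.2 (by decide)).symm)
        (Prod.ext (hy.2.1 (by decide)).symm (hy.2.2 (by decide)).symm)
    · intro y hy
      exact Prod.ext rfl (hy.2 (by decide)).symm
  rw [h4]
  exact Sm.ext (Sm.ext rfl h2.symm) h1.symm

theorem retract_mem (p q r : ℕ) (x : Simple p (q + 1) (r + 1))
    (hx : x ∈ smG (r + 1) (sright p (q + 1)) 0) :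
    retract p q r x ∈ smG (r + 1) (sright p (q + 1)) 1 := by
  refine incl_mem_smG _ _ _ _ (incl_mem_smG _ _ _ _ ?_)
  refine map_mem_msmG (-1) p (O := opsHV) (O' := opsVV) ?_ ?_ 1 _ ?_
  · intro i y hy
    exact ⟨⟨fun h => hy.1 (by omega), fun _ => rfl⟩, fun _ => rfl, fun _ => rfl⟩
  · intro i y hy
    exact ⟨fun h => hy (by omega), fun _ => rfl⟩
  · exact msmE_mem p opsHV_good _ _ (proj_mem_smG q (smidV p).peel _ _ hx.1.2)

theorem subsingleton_homology {C : Type} [Ab C] {d : C →+ C} {G : ℤ → AddSubgroup C}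
    {i : ℤ} (h : ∀ x ∈ G i, d x = 0 → x = 0) : Subsingleton (Homology d G i) := by
  have : Subsingleton (cycles d G i) :=
    ⟨fun x y => Subtype.ext ((h x x.2.2 x.2.1).trans (h y y.2.2 y.2.1).symm)⟩
  exact Quotient.instSubsingletonQuotient _

section

variable {p q r : ℕ}

theorem subsingleton_homology_sright (hp : 0 < p) (hpq : p ≤ q) (hqr : q ≤ r) {i : ℤ} (h0 : i ≠ 0)
    (hm : i ≠ -1) :
    Subsingleton (Homology (smD r (sright p q)) (smG r (sright p q)) i) := by
  refine subsingleton_homology fun x hx hd => ?_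
  by_cases h1 : i = 1
  · subst h1
    obtain ⟨q, rfl⟩ := Nat.exists_eq_add_of_le' (hp.trans_le hpq)
    obtain ⟨r, rfl⟩ := Nat.exists_eq_add_of_le' (hp.trans_le (hpq.trans hqr))
    rw [← retract_smD p q r x hx, hd, map_zero]
  · exact eq_zero_of_mem_smG_sright h1 h0 hm x hx

theorem homology_lowest_sright (hp : 0 < p) (hpq : p ≤ q) (hqr : q ≤ r) {m : ℕ} (hm : (freeIndex p
    q r).card = m) :
    Nonempty (Homology (smD r (sright p q)) (smG r (sright p q)) (-1) ≃+ (Fin m → ℤ)) := by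
  obtain ⟨e⟩ := homology_lowest hp hpq hqr
  exact ⟨e.trans (LinearEquiv.funCongrLeft ℤ ℤ
    ((freeIndex p q r).equivFinOfCardEq hm).symm).toAddEquiv⟩

theorem homology_zero_sright (hp : 0 < p) (hpq : p ≤ q) (hqr : q ≤ r) {m k : ℕ} (hm : (freeIndex p
    q r).card = m)
    (hk : k + q * r = p * q + p * r + m) :
    Nonempty (Homology (smD r (sright p q)) (smG r (sright p q)) 0 ≃+ (Fin k → ℤ)) := by
  have hH := homology_lowest_sright hp hpq hqr hm
  have r₁ := hasRank_sright p q r 1 rfl rfl rfl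
  have r₀ := hasRank_sright p q r 0 rfl rfl rfl
  have rm := hasRank_sright p q r (-1) rfl rfl rfl
  obtain ⟨q, rfl⟩ := Nat.exists_eq_add_of_le' (hp.trans_le hpq)
  obtain ⟨r, rfl⟩ := Nat.exists_eq_add_of_le' (hp.trans_le (hpq.trans hqr))
  have hg : (sright p (q + 1)).Good := (step_smid p).sm_good _
  refine homology_zero (retract p q r) (smD_smD _ hg) (smD_mem _ hg) (retract_smD p q r)
    (retract_mem p q r) (eq_zero_of_mem_smG_sright (by decide) (by decide) (by decide)) r₁ r₀ rm hH
        ?_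
  norm_num
  linarith

end

theorem card_freeIndex_even {p q r : ℕ} (hp : 0 < p) (h : Even p) : (freeIndex p q r).card =
    ((Finset.Ico (p - 1) q).erase p).card * ((Finset.Ico (p - 1) r).erase p).card := by
  rw [freeIndex, if_pos h, Finset.card_product]

theorem card_erase_Ico {p n : ℕ} (hp : 0 < p) (hpn : p ≤ n) :
    ((Finset.Ico (p - 1) n).erase p).card = if p = n then 1 else n - p := by
  split_ifs with h
  · rw [Finset.erase_eq_of_notMem (by simp; omega), Nat.card_Ico]
    omega
  · rw [Finset.card_erase_of_mem (by simp; omega), Nat.card_Ico]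
    omega

theorem card_freeIndex_odd {p q r : ℕ} (hp : 0 < p) (h : Odd p) (hpq : p < q) (hqr : q ≤ r) :
    (freeIndex p q r).card = if r = p + 1 then 1 else (q - p) * (r - p) - 1 := by
  classical
  have hne : ¬ Even p := Nat.not_even_iff_odd.2 h
  rw [freeIndex, if_neg hne, if_pos hpq, Finset.card_union_of_disjoint, Finset.card_singleton]
  · split_ifs with hr
    · obtain rfl : q = p + 1 := by omega
      subst hr
      simp
    · rw [Finset.card_erase_of_mem, Finset.card_erase_of_mem, Finset.card_product, Nat.card_Ico,
        Nat.card_Ico]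
      · have : 1 * 2 ≤ (q - p) * (r - p) := Nat.mul_le_mul (by omega) (by omega)
        omega
      · simp
        omega
      · simp
        omega
  · simp
    omega

theorem card_freeIndex_odd_self {p r : ℕ} (hp : 0 < p) (h : Odd p) :
    (freeIndex p p r).card = 0 := by
  classical
  rw [freeIndex, if_neg (Nat.not_even_iff_odd.2 h)]
  simp

open PDCode

/-! ### The signs of the crossings -/

section

variable {n : Fin 3 → ℕ} {pos : Fin 3 → Bool}

/-- The end of a crossing on the left or right, at the bottom or top. -/
def corner (b right up : Bool) : Fin 4 :=
  if b then (if up then (if right then 1 else 2) else if right then 0 else 3)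
  else if up then (if right then 2 else 3) else if right then 1 else 0

theorem pretzelDiagram_corner (k : Fin 3) (i : Fin (n k)) (right up : Bool) :
    pretzelDiagram n pos (toLex ⟨k, i⟩) (corner (pos k) right up) =
      columnEdge n k right (i + if up then 1 else 0) := by
  change (if pos k = true then (![columnEdge n k true i, columnEdge n k true (i + 1),
    columnEdge n k false (i + 1), columnEdge n k false i] : Fin 4 → PretzelEdge n) else
    ![columnEdge n k false i, columnEdge n k true i, columnEdge n k true (i + 1),
      columnEdge n k false (i + 1)]) _ = _
  cases pos k <;> cases up <;> cases right <;> rfl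

variable (o : (pretzelDiagram n pos).Orientation)

/-- Whether the strand points inward at the given end of a crossing. -/
def inAt (k : Fin 3) (i : Fin (n k)) (right up : Bool) : Bool :=
  o.inward (toLex ⟨k, i⟩) (corner (pos k) right up)

theorem inAt_up (k : Fin 3) (i : Fin (n k)) (right : Bool) :
    inAt o k i right true = !inAt o k i (!right) false := by
  have h1 := o.lower (toLex ⟨k, i⟩)
  have h2 := o.upper (toLex ⟨k, i⟩)
  unfold inAt corner
  cases pos k <;> cases right <;> simp only [if_true, if_false, Bool.not_true, Bool.not_false,
    Bool.false_eq_true]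
  · exact Bool.eq_not_of_ne h2.symm
  · exact Bool.eq_not_of_ne h1.symm
  · exact Bool.eq_not_of_ne h1.symm
  · exact Bool.eq_not_of_ne h2

theorem inAt_ne {k l : Fin 3} {i : Fin (n k)} {j : Fin (n l)} {right up right' up' : Bool}
    (h : columnEdge n k right (i + if up then 1 else 0) =
      columnEdge n l right' (j + if up' then 1 else 0))
    (hne : (⟨k, i⟩ : Σ k, Fin (n k)) ≠ ⟨l, j⟩) : inAt o k i right up = !inAt o l j right' up' := by
  refine Bool.eq_not_of_ne (o.edge _ _ _ _ ?_ fun e => hne (congrArg ofLex (Prod.ext_iff.1 e).1))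
  rw [pretzelDiagram_corner, pretzelDiagram_corner, h]

theorem inAt_parallel (k : Fin 3) : ∀ (m : ℕ) (hm : m < n k),
    (inAt o k ⟨m, hm⟩ false false == inAt o k ⟨m, hm⟩ true false) =
      (inAt o k ⟨n k - 1, by omega⟩ false true == inAt o k ⟨n k - 1, by omega⟩ true true) := by
  intro m hm
  obtain ⟨j, hj⟩ := Nat.exists_eq_add_of_lt hm
  induction j generalizing m with
  | zero =>
    have : (⟨n k - 1, by omega⟩ : Fin (n k)) = ⟨m, hm⟩ := Fin.ext (by simp; omega)
    rw [this, inAt_up, inAt_up, Bool.not_false, Bool.not_true]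
    cases inAt o k ⟨m, hm⟩ false false <;> cases inAt o k ⟨m, hm⟩ true false <;> rfl
  | succ j ih =>
    rw [← ih (m + 1) (by omega) (by omega)]
    have h := fun right => inAt_ne o (k := k) (l := k) (i := ⟨m + 1, by omega⟩) (j := ⟨m, hm⟩)
      (right := right) (up := false) (right' := right) (up' := true) (by simp)
      (by simp [Sigma.mk.injEq])
    rw [h, h, inAt_up, inAt_up, Bool.not_false, Bool.not_true]
    cases inAt o k ⟨m, hm⟩ false false <;> cases inAt o k ⟨m, hm⟩ true false <;> rfl

theorem topArcRunsRight_iff (hn : ∀ k, 0 < n k) (k : Fin 3) : TopArcRunsRight o k ↔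
    inAt o k ⟨n k - 1, Nat.sub_one_lt (hn k).ne'⟩ true true = false := by
  have hc : (if pos k = true then (1 : Fin 4) else 2) = corner (pos k) true true := by
    cases pos k <;> rfl
  rw [TopArcRunsRight, hc]
  constructor
  · exact fun h => h _ (Nat.succ_pred_eq_of_pos (hn k))
  · intro h i hi
    obtain rfl : i = ⟨n k - 1, Nat.sub_one_lt (hn k).ne'⟩ := Fin.ext (by simp; omega)
    exact h

theorem isPositive_iff (hn : ∀ k, 0 < n k) (k : Fin 3) (i : Fin (n k)) :
    o.IsPositive (toLex ⟨k, i⟩) ↔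
      ((TopArcRunsRight o (k - 1) ↔ ¬ TopArcRunsRight o k) ↔ pos k = true) := by
  have hpar := inAt_parallel o k i i.2
  have hup := inAt_up o k i false
  have htop := inAt_ne o (k := k) (l := k - 1) (i := ⟨n k - 1, Nat.sub_one_lt (hn k).ne'⟩)
    (j := ⟨n (k - 1) - 1, Nat.sub_one_lt (hn (k - 1)).ne'⟩)
    (right := false) (up := true) (right' := true) (up' := true) (by
      simp only [if_true, Nat.sub_add_cancel (hn _)]
      rw [columnEdge_last hn, columnEdge_last hn]
      rfl) fun h =>
      (by decide : ∀ k : Fin 3, k ≠ k - 1) k (congrArg Sigma.fst h)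
  rw [htop] at hpar
  rw [topArcRunsRight_iff o hn, topArcRunsRight_iff o hn]
  have hP : o.IsPositive (toLex ⟨k, i⟩) ↔
      (inAt o k i false false = if pos k then inAt o k i true false else inAt o k i false true) :=
          by
    unfold Orientation.IsPositive inAt corner
    cases pos k
    · rfl
    · exact eq_comm
  rw [hP, hup, Bool.not_false]
  generalize inAt o (k - 1) _ true true = x at *
  generalize inAt o k ⟨n k - 1, _⟩ true true = y at *
  revert hpar
  cases pos k <;> cases inAt o k i false false <;> cases inAt o k i true false <;> cases x <;>
    cases y <;> decide

theorem ncard_column (P : Fin 3 → Prop) [DecidablePred P] :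
    {c : PretzelCrossing n | P (ofLex c).1}.ncard = ∑ k, if P k then n k else 0 := by
  rw [← Finset.sum_filter]
  have h : ∀ k, n k = (Finset.univ : Finset (Fin (n k))).card := fun k => by simp
  rw [Finset.sum_congr rfl fun k _ => h k, ← Finset.card_sigma, ← Set.ncard_coe_finset]
  refine Set.ncard_congr (fun c _ => ofLex c) ?_ (fun _ _ _ _ h => ofLex.injective h) ?_
  · intro c hc
    simpa using hc
  · rintro ⟨k', m⟩ hc
    exact ⟨toLex ⟨k', m⟩, by simpa using hc, rfl⟩

open Classical in
theorem nPlus_eq (hn : ∀ k, 0 < n k) : o.nPlus = ∑ k, if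
    ((TopArcRunsRight o (k - 1) ↔ ¬ TopArcRunsRight o k) ↔ pos k = true) then n k else 0 := by
  rw [← ncard_column]
  exact congrArg Set.ncard (Set.ext fun c => isPositive_iff o hn (ofLex c).1 (ofLex c).2)

open Classical in
theorem nMinus_eq (hn : ∀ k, 0 < n k) : o.nMinus = ∑ k, if
    ¬ ((TopArcRunsRight o (k - 1) ↔ ¬ TopArcRunsRight o k) ↔ pos k = true) then n k else 0 := by
  rw [← ncard_column]
  exact congrArg Set.ncard (Set.ext fun c => (isPositive_iff o hn (ofLex c).1 (ofLex c).2).not)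

end

theorem vec_pos {p q r : ℕ} (hp : 0 < p) (hpq : p ≤ q) (hqr : q ≤ r) (k : Fin 3) :
    0 < (![p, q, r] : Fin 3 → ℕ) k := by
  fin_cases k
  · exact hp
  · exact hp.trans_le hpq
  · exact hp.trans_le (hpq.trans hqr)

/-- The reduced Khovanov homology of the pretzel link `P(-p, q, r)` in terms of the number of free
positions. -/
theorem reducedKhIs_pretzel {p q r : ℕ} (hp : 0 < p) (hpq : p ≤ q) (hqr : q ≤ r)
    (o : (pretzelNegPosPos p q r).Orientation) {δ₁ δ₀ : ℚ} (hδ₁ : δ₁ = (-(p : ℚ) + o.nPlus) / 2)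
    (hδ₀ : δ₀ = (-2 - (p : ℚ) + o.nPlus) / 2) {m₁ m₀ : ℕ} (hm₀ : (freeIndex p q r).card = m₀)
    (hm₁ : m₁ + q * r = p * q + p * r + m₀) : PDCode.ReducedKhIs o (.top 1) δ₁ m₁ δ₀ m₀ := by
  have hn := vec_pos hp hpq hqr
  have key : ∀ (i : ℤ) {δ : ℚ}, δ = (-(p : ℚ) + o.nPlus) / 2 + i →
      Nonempty (ReducedKh o (.top 1) δ ≃+
        Homology (smD r (sright p q)) (smG r (sright p q)) i) := by
    intro i δ hδ
    obtain ⟨e⟩ := reducedKh_equiv (n := ![p, q, r]) hn hδ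
    obtain ⟨e'⟩ := homology_simplify p q r i
    exact ⟨e.toAddEquiv.trans e'⟩
  refine ⟨?_, ?_, fun δ h1 h0 => ?_⟩
  · obtain ⟨e⟩ := key 0 (δ := δ₁) (by rw [hδ₁]; simp)
    obtain ⟨e'⟩ := homology_zero_sright hp hpq hqr hm₀ hm₁
    exact ⟨(e.trans e').toIntLinearEquiv⟩
  · obtain ⟨e⟩ := key (-1) (δ := δ₀) (by rw [hδ₀]; push_cast; ring)
    obtain ⟨e'⟩ := homology_lowest_sright hp hpq hqr hm₀
    exact ⟨(e.trans e').toIntLinearEquiv⟩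
  · by_cases h : ∃ i : ℤ, δ = (-(p : ℚ) + o.nPlus) / 2 + i
    · obtain ⟨i, hi⟩ := h
      obtain ⟨e⟩ := key i hi
      have := subsingleton_homology_sright hp hpq hqr (i := i)
        (fun h => h1 (by rw [hi, h, hδ₁]; simp)) fun h => h0 (by rw [hi, h, hδ₀]; push_cast; ring)
      exact e.toEquiv.subsingleton
    · exact subsingleton_reducedKh (n := ![p, q, r]) hn fun i hi => h ⟨i, hi⟩

end PretzelKh

/-- The basepoint is on the top arc between the columns of `q` and of `r`. -/
theorem theorem2 (p q r : ℕ) (hp : 0 < p) (hpq : p ≤ q) (hqr : q ≤ r)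
    (o : (pretzelNegPosPos p q r).Orientation)
    (δ₁ δ₀ : ℚ) (hδ₁ : δ₁ = (-(p : ℚ) + o.nPlus) / 2) (hδ₀ : δ₀ = (-2 - (p : ℚ) + o.nPlus) / 2) :
    -- the numbers of positive and negative crossings
    ((FirstArrowAgrees o → SecondArrowAgrees o → o.nPlus = r ∧ o.nMinus = p + q) ∧
      (FirstArrowAgrees o → ¬ SecondArrowAgrees o → o.nPlus = p + q + r ∧ o.nMinus = 0) ∧
      (¬ FirstArrowAgrees o → SecondArrowAgrees o → o.nPlus = p ∧ o.nMinus = q + r) ∧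
      (¬ FirstArrowAgrees o → ¬ SecondArrowAgrees o → o.nPlus = q ∧ o.nMinus = p + r)) ∧
    -- the generic cases
    (Even p → p + 2 ≤ q →
      PDCode.ReducedKhIs o (.top 1) δ₁ (p ^ 2) δ₀ ((q - p) * (r - p))) ∧
    (Odd p → p + 2 ≤ q →
      PDCode.ReducedKhIs o (.top 1) δ₁ (p ^ 2 - 1) δ₀ ((q - p) * (r - p) - 1)) ∧
    -- the cases with `q = p + 1`
    (Even p → q = p + 1 →
      PDCode.ReducedKhIs o (.top 1) δ₁ (p ^ 2) δ₀ ((q - p) * (r - p))) ∧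
    (Odd p → q = p + 1 → p + 2 ≤ r →
      PDCode.ReducedKhIs o (.top 1) δ₁ (p ^ 2 - 1) δ₀ ((q - p) * (r - p) - 1)) ∧
    (Odd p → q = p + 1 → r = p + 1 →
      PDCode.ReducedKhIs o (.top 1) δ₁ (p ^ 2) δ₀ 1) ∧
    -- the cases with `q = p`
    (Even p → q = p → p < r →
      PDCode.ReducedKhIs o (.top 1) δ₁ (p ^ 2 + (r - p)) δ₀ (r - p)) ∧
    (Even p → q = p → r = p →
      PDCode.ReducedKhIs o (.top 1) δ₁ (p ^ 2 + 1) δ₀ 1) ∧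
    (Odd p → q = p →
      PDCode.ReducedKhIs o (.top 1) δ₁ (p ^ 2) δ₀ 0) := by
  have H {m₁ m₀ : ℕ} (hm₀ : (PretzelKh.freeIndex p q r).card = m₀)
      (hm₁ : m₁ + q * r = p * q + p * r + m₀) : PDCode.ReducedKhIs o (.top 1) δ₁ m₁ δ₀ m₀ :=
    PretzelKh.reducedKhIs_pretzel hp hpq hqr o hδ₁ hδ₀ hm₀ hm₁
  have hodd {m₁ m₀ : ℕ} (hm₀ : m₀ + 1 = (q - p) * (r - p)) (hm₁ : m₁ + 1 = p ^ 2) :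
      m₁ + q * r = p * q + p * r + m₀ := by
    zify [hpq, hpq.trans hqr] at *
    linarith
  have heven : p ^ 2 + q * r = p * q + p * r + (q - p) * (r - p) := by
    zify [hpq, hpq.trans hqr]
    ring
  have hsq : 1 ≤ p ^ 2 := Nat.one_le_pow _ _ hp
  have hcard_even (h : Even p) (hq : p < q) :
      (PretzelKh.freeIndex p q r).card = (q - p) * (r - p) := by
    rw [PretzelKh.card_freeIndex_even hp h, PretzelKh.card_erase_Ico hp hpq,
      PretzelKh.card_erase_Ico hp (hpq.trans hqr), if_neg (by omega), if_neg (by omega)]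
  have hcard_odd (h : Odd p) (hq : p < q) (hr : p + 2 ≤ r) :
      (PretzelKh.freeIndex p q r).card = (q - p) * (r - p) - 1 := by
    rw [PretzelKh.card_freeIndex_odd hp h hq hqr, if_neg (by omega)]
  have hmul (hq : p < q) : 1 ≤ (q - p) * (r - p) :=
    Nat.mul_pos (by omega) (by omega)
  refine ⟨?_, fun h hq => H (hcard_even h (by omega)) heven,
    fun h hq => H (hcard_odd h (by omega) (by omega)) (hodd (Nat.sub_add_cancel (hmul (by omega)))
      (Nat.sub_add_cancel hsq)),
    fun h hq => H (hcard_even h (by omega)) heven,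
    fun h hq hr => H (hcard_odd h (by omega) hr) (hodd (Nat.sub_add_cancel (hmul (by omega)))
      (Nat.sub_add_cancel hsq)), fun h hq hr => ?_, fun h hq hr => ?_, fun h hq hr => ?_,
    fun h hq => ?_⟩
  · have hn := PretzelKh.vec_pos hp hpq hqr
    have h1 := PretzelKh.nPlus_eq o hn
    have h2 := PretzelKh.nMinus_eq o hn
    rw [Fin.sum_univ_three, show (0 - 1 : Fin 3) = 2 from rfl, show (1 - 1 : Fin 3) = 0 from rfl,
      show (2 - 1 : Fin 3) = 1 from rfl] at h1 h2
    rw [h1, h2]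
    unfold FirstArrowAgrees SecondArrowAgrees
    by_cases t0 : TopArcRunsRight o 0 <;> by_cases t1 : TopArcRunsRight o 1 <;>
      by_cases t2 : TopArcRunsRight o 2 <;> simp [t0, t1, t2]
  · refine H (by rw [PretzelKh.card_freeIndex_odd hp h (by omega) hqr, if_pos hr]) ?_
    subst hq hr
    ring
  · subst hq
    refine H (by rw [PretzelKh.card_freeIndex_even hp h, PretzelKh.card_erase_Ico hp le_rfl,
      PretzelKh.card_erase_Ico hp hqr, if_pos rfl, if_neg (by omega), one_mul]) (by ring)
  · subst hq hr
    exact H (by rw [PretzelKh.card_freeIndex_even hp h, PretzelKh.card_erase_Ico hp le_rfl,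
      if_pos rfl]) (by ring)
  · subst hq
    exact H (PretzelKh.card_freeIndex_odd_self hp h) (by ring)
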